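/- **Setting.** Let $p,q\ge 0$, let $t_1,\dots,t_{p+1}\in\mathbb C$ be distinct, no three of them on a straight line, and let $T=\mathrm{diag}(t_1I_{n_1},\dots,t_pI_{n_p})$, $n=n_1+\dots+n_p$. Let $A=(A_{ij})\in \mathrm M(n;\mathbb C)$, partitioned as $T$, have diagonal blocks $A_{ii}=\mathrm{diag}(\lambda_{i,1}I_{\ell_{i,1}},\dots,\lambda_{i,r_i}I_{\ell_{i,r_i}})$, and let $P\in \mathrm{GL}(n;\mathbb C)$ be such that $A'=P^{-1}AP=\mathrm{diag}(\mu_1I_{m_1},\dots,\mu_qI_{m_q})$. Let $\rho_1,\rho_2,\eta_0\in\mathbb C$, and let $j'$ be the complement of $j$ in $\{1,2\}$. Consider the rank $2n$ system $$\Bigl(xI_{2n}-\begin{pmatrix}T&\\&t_{p+1}I_n\end{pmatrix}\Bigr)\frac{dU}{dx}=\begin{pmatrix}A&P\\-(A'-\rho_1I_n)(A'-\rho_2I_n)P^{-1}&(\rho_1+\rho_2)I_n-A'\end{pmatrix}U .\qquad(\ast)$$ Assume that none of the following is an integer: $\lambda_{i,k}$; $\lambda_{i,k}-\lambda_{i,h}$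 ($k\ne h$); $\mu_k$; $\mu_k-\mu_h$ ($k\neq h$); $\rho_j$; $\rho_1-\rho_2$; $\rho_j-\lambda_{i,k}$; $\rho_j-\mu_k$; $\lambda_{i,k}-\mu_j$. (In particular neither $\rho_j$ is an eigenvalue of $A$.) Fix arguments $\theta_i=\arg(t_i-t_{p+1})$ ($1\le i\le p$) and a real $\theta_{p+1}$ with $\theta_1<\dots<\theta_p<\theta_{p+1}<\theta_1+2\pi$; put $\theta_0=\theta_{p+1}-2\pi$. Fix $\delta>0$ with $\delta<\theta_{i+1}-\theta_i$ for $0\le i\le p$, and for $1\le i\le p$ let $$\mathcal S_i^+=\{x:\theta_i<\arg(x-t_{p+1})<\min(\theta_{i+1}-\delta,\theta_i+\pi)\},\quad \mathcal S_i^-=\{x:\max(\theta_{i-1}+\delta,\theta_i-\pi)<\arg(x-t_{p+1})<\theta_i\}.$$ On these sectors $\arg(x-t_{p+1})$ is as in their definition, $\arg(x-t_i)\in(\theta_i,\theta_i+\pi)$ on $\mathcal S_i^+$ and $\arg(x-t_i)\in(\theta_i-\pi,\theta_i)$ on $\mathcal S_i^-$. Let $\varepsilon_N(a)$ be the $a$-th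 unit $N$-vector. The following solutions of $(\ast)$ are continued analytically to the whole sector: * $U_{t_i,k,h}(x)=(x-t_i)^{\lambda_{i,k}}\{\varepsilon_{2n}(n_1+\dots+n_{i-1}+\ell_{i,1}+\dots+\ell_{i,k-1}+h)+\sum_{m\ge1}G(m)(x-t_i)^m\}$ near $t_i$ ($1\le k\le r_i$, $1\le h\le \ell_{i,k}$); * $U_{t_{p+1},k,h}(x)=(x-t_{p+1})^{\rho_1+\rho_2-\mu_k}\{\varepsilon_{2n}(n+m_1+\dots+m_{k-1}+h)+\sum_{m\ge1}G(m)(x-t_{p+1})^m\}$ near $t_{p+1}$ ($1\le k\le q$, $1\le h\le m_k$), for those $k$ with $\rho_1+\rho_2-\mu_k\notin\mathbb Z_{<0}$; * $U_{\infty,j,\tilde h}(x)=\bigl(\tfrac1{x-t_{p+1}}\bigr)^{-\rho_j}\Bigl\{\begin{pmatrix}P\\\rho_jI_n-A'\end{pmatrix}\varepsilon_n(\tilde h)+\sum_{m\ge1}G(m)(x-t_{p+1})^{-m}\Bigr\}$ near $\infty$ ($j=1,2$, $1\le\tilde h\le n$). Put $t'_i=\eta_0+\frac1{t_i-t_{p+1}}$,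 $\theta'_i=-\theta_i$ ($0\le i\le p+1$), $T'=\mathrm{diag}(t'_1I_{n_1},\dots,t'_pI_{n_p})$, and consider the underlying rank $n$ system $(\zeta I_n-T')\frac{dw}{d\zeta}=(\rho I_n+A)w$. Let $w_{t'_i,k,h}(\rho;\zeta)$ be its solution, holomorphic in $\mathbb C\setminus\bigcup_{\nu=1}^p\{\eta_0+(t'_\nu-\eta_0)s: s\ge1\}$, of the form $$(\zeta-t'_i)^{\rho+\lambda_{i,k}}\{\varepsilon_n(n_1+\dots+n_{i-1}+\ell_{i,1}+\dots+\ell_{i,k-1}+h)+\textstyle\sum_{m\ge1}g(m)(\zeta-t'_i)^m\}$$ near $t'_i$, with $\arg(\zeta-t'_i)\in(\theta'_i-2\pi,\theta'_i)$. Let $$\mathcal S_i'^{-}=\{\zeta:\max(\theta'_{i+1}+\delta,\theta'_i-\pi)<\arg(\zeta-\eta_0)<\theta'_i\},\quad \mathcal S_i'^{+}=\{\zeta:\theta'_i<\arg(\zeta-\eta_0)<\min(\theta'_{i-1}-\delta,\theta'_i+\pi)\},$$ and let $w_{\infty,k,h}|_{\mathcal S_i'^{\pm}}(\rho;\zeta)$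 be the analytic continuation into a neighbourhood of $\eta_0$ through $\mathcal S_i'^{\pm}$ of the solution of the form $\bigl(\tfrac1{\zeta-\eta_0}\bigr)^{-\rho-\mu_k}\{P\varepsilon_n(m_1+\dots+m_{k-1}+h)+\sum_{m\ge1}g(m)(\zeta-\eta_0)^{-m}\}$ near $\infty$ in $\mathcal S_i'^{\pm}$. Writing $[P^{-1}]_{\tilde h}$ for the $\tilde h$-th row of $P^{-1}$, set $$\gamma_{\tilde h;t'_i,k,h}(\rho)=[P^{-1}]_{\tilde h}(\eta_0I_n-T')\,w_{t'_i,k,h}(\rho;\eta_0),\qquad \gamma^{\langle\mathcal S_i'^{\pm}\rangle}_{\tilde h;\infty,k,h}(\rho)=[P^{-1}]_{\tilde h}(\eta_0I_n-T')\,w_{\infty,k,h}|_{\mathcal S_i'^{\pm}}(\rho;\eta_0).$$ **Theorem.** All the solutions above exist (those of the underlying system for $\rho=-\rho_1-1$ and $\rho=-\rho_2-1$). For $1\le i\le p$ and for either sign, there are unique coefficients with $$U_{t_i,k,h}(x)=\sum_{j=1}^2\sum_{\tilde h=1}^nC_{\infty,j,\tilde h;t_i,k,h}\,U_{\infty,j,\tilde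 h}(x)\qquad(x\in\mathcal S_i^{\pm}),$$ and they are $$C_{\infty,j,\tilde h;t_i,k,h}=e^{\pi\sqrt{-1}(\lambda_{i,k}-\rho_{j'})}(t_i-t_{p+1})^{2\lambda_{i,k}-\rho_1-\rho_2}\frac{\Gamma(\rho_j-\rho_{j'})\Gamma(\lambda_{i,k}+1)}{\Gamma(\rho_j+1)\Gamma(\lambda_{i,k}-\rho_{j'})}\,\gamma_{\tilde h;t'_i,k,h}(-\rho_{j'}-1),$$ where $\arg(t_i-t_{p+1})=\theta_i$. Moreover, for every $k$ with $\rho_1+\rho_2-\mu_k\notin\mathbb Z_{<0}$, there are unique coefficients with $$U_{t_{p+1},k,h}(x)=\sum_{j=1}^2\sum_{\tilde h=1}^nC^{\langle\mathcal S_i^{\pm}\rangle}_{\infty,j,\tilde h;t_{p+1},k,h}\,U_{\infty,j,\tilde h}(x)\qquad(x\in\mathcal S_i^{\pm}),$$ and they are $$C^{\langle\mathcal S_i^{\pm}\rangle}_{\infty,j,\tilde h;t_{p+1},k,h}=\frac{\Gamma(\rho_j-\rho_{j'})\Gamma(\rho_1+\rho_2-\mu_k+1)}{\Gamma(\rho_j+1)\Gamma(\rho_j-\mu_k+1)}\,\gamma^{\langle\mathcal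 S_i'^{\mp}\rangle}_{\tilde h;\infty,k,h}(-\rho_{j'}-1).$$ -/

import Mathlib

open Complex Matrix

noncomputable section

namespace Okubo

/-! ### Powers with a prescribed argument -/

/-- The logarithm of `z ≠ 0` whose imaginary part, i.e. the chosen value of `arg z`, lies in
`(φ - π, φ + π]`. -/
def argLog (φ : ℝ) (z : ℂ) : ℂ := Complex.log (z * Complex.exp (-(φ * I))) + φ * I

/-- The value of `arg z` in `(φ - π, φ + π]` (for `z ≠ 0`). -/
def argNear (φ : ℝ) (z : ℂ) : ℝ := (argLog φ z).im

/-- The power `z ^ a` (for `z ≠ 0`) formed with the argument of `z` in `(φ - π, φ + π]`. -/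
def argPow (φ : ℝ) (z a : ℂ) : ℂ := Complex.exp (a * argLog φ z)

/-! ### Systems of Okubo normal form and local expansions -/

/-- `U` is a holomorphic solution of `(x I - T) dU/dx = B U` at all points of `S`. -/
def IsSolutionOn {J : Type} [Fintype J] [DecidableEq J] (T B : Matrix J J ℂ) (S : Set ℂ)
    (U : ℂ → J → ℂ) : Prop :=
  ∀ x ∈ S, ∃ U' : J → ℂ, HasDerivAt U U' x ∧
    (x • (1 : Matrix J J ℂ) - T) *ᵥ U' = B *ᵥ U x

/-- Near `c`, on `S`, one has `U(x) = (x - c)^a ∑_{m ≥ 0} G(m) (x - c)^m` with `G(0) = v`,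
where `arg (x - c) ∈ (φ - π, φ + π]`. -/
def HasExpansionAt {J : Type} [Fintype J] (c : ℂ) (φ : ℝ) (a : ℂ) (v : J → ℂ) (S : Set ℂ)
    (U : ℂ → J → ℂ) : Prop :=
  ∃ G : ℕ → J → ℂ, G 0 = v ∧ ∃ R : ℝ, 0 < R ∧ ∀ x ∈ S, ‖x - c‖ < R →
    HasSum (fun m : ℕ => (argPow φ (x - c) a * (x - c) ^ m) • G m) (U x)

/-- Near infinity, on `S`, one has
`U(x) = (1 / (x - c))^(-a) ∑_{m ≥ 0} G(m) (1 / (x - c))^m` with `G(0) = v`,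
where `arg (x - c) = - arg (1 / (x - c)) ∈ (φ - π, φ + π]`. -/
def HasExpansionAtInfinity {J : Type} [Fintype J] (c : ℂ) (φ : ℝ) (a : ℂ) (v : J → ℂ)
    (S : Set ℂ) (U : ℂ → J → ℂ) : Prop :=
  ∃ G : ℕ → J → ℂ, G 0 = v ∧ ∃ R : ℝ, 0 < R ∧ ∀ x ∈ S, R < ‖x - c‖ →
    HasSum (fun m : ℕ => (argPow φ (x - c) a * ((x - c)⁻¹) ^ m) • G m) (U x)

/-! ### The data of the rank `2n` system -/

/-- The data of the system. The rows of `A` are indexed by triples `(i, k, h)` with `1 ≤ i ≤ p`,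
`1 ≤ k ≤ r_i`, `1 ≤ h ≤ ℓ_{i,k}`, and the columns of `P` by pairs `(k, h)` with `1 ≤ k ≤ q`,
`1 ≤ h ≤ m_k` (all counted from `0` here); both index sets stand for `{1, …, n}` in its
lexicographic enumeration. The last entries of `t` and `θ` are `t_{p+1}` and `θ_{p+1}`. -/
structure Data where
  p : ℕ
  q : ℕ
  r : Fin p → ℕ
  l : (i : Fin p) → Fin (r i) → ℕ
  m : Fin q → ℕ
  t : Fin (p + 1) → ℂ
  θ : Fin (p + 1) → ℝ
  lam : (i : Fin p) → Fin (r i) → ℂ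
  mu : Fin q → ℂ
  ρ : Fin 2 → ℂ
  η₀ : ℂ
  A : Matrix ((i : Fin p) × (k : Fin (r i)) × Fin (l i k))
    ((i : Fin p) × (k : Fin (r i)) × Fin (l i k)) ℂ
  P : Matrix ((i : Fin p) × (k : Fin (r i)) × Fin (l i k)) ((k : Fin q) × Fin (m k)) ℂ
  /-- The inverse of `P`. -/
  Pinv : Matrix ((k : Fin q) × Fin (m k)) ((i : Fin p) × (k : Fin (r i)) × Fin (l i k)) ℂ
  P_mul_Pinv : P * Pinv = 1
  Pinv_mul_P : Pinv * P = 1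

/-- The complex number `a` is not an integer. -/
def NotInt (a : ℂ) : Prop := ∀ z : ℤ, a ≠ (z : ℂ)

/-- The two sides of a ray: `plus` for `S_i^+`, `S'_i^+` and `minus` for `S_i^-`, `S'_i^-`. -/
inductive Side where
  | plus
  | minus

/-- The opposite side. -/
def Side.opp : Side → Side
  | .plus => .minus
  | .minus => .plus

namespace Data

variable (d : Data)

/-- Index set of the upper half of a `2n`-vector: triples `(i, k, h)`. -/
abbrev Row : Type := (i : Fin d.p) × (k : Fin (d.r i)) × Fin (d.l i k)

/-- Index set of the lower half of a `2n`-vector: pairs `(k, h)`. -/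
abbrev Col : Type := (k : Fin d.q) × Fin (d.m k)

/-- `t_{p+1}`. -/
def tLast : ℂ := d.t (Fin.last d.p)

/-- `T = diag(t_1 I_{n_1}, …, t_p I_{n_p})`. -/
def T : Matrix d.Row d.Row ℂ := Matrix.diagonal fun a => d.t a.1.castSucc

/-- `A' = P⁻¹ A P`. -/
def A' : Matrix d.Col d.Col ℂ := d.Pinv * d.A * d.P

/-- The matrix `diag(T, t_{p+1} I_n)`. -/
def bigT : Matrix (d.Row ⊕ d.Col) (d.Row ⊕ d.Col) ℂ :=
  Matrix.fromBlocks d.T 0 0 (d.tLast • (1 : Matrix d.Col d.Col ℂ))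

/-- The coefficient matrix of the rank `2n` system. -/
def bigA : Matrix (d.Row ⊕ d.Col) (d.Row ⊕ d.Col) ℂ :=
  Matrix.fromBlocks d.A d.P
    (-((d.A' - d.ρ 0 • (1 : Matrix d.Col d.Col ℂ)) *
      (d.A' - d.ρ 1 • (1 : Matrix d.Col d.Col ℂ)) * d.Pinv))
    ((d.ρ 0 + d.ρ 1) • (1 : Matrix d.Col d.Col ℂ) - d.A')

/-- `t'_i = η₀ + 1 / (t_i - t_{p+1})`. -/
def t' (i : Fin d.p) : ℂ := d.η₀ + 1 / (d.t i.castSucc - d.tLast)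

/-- `T' = diag(t'_1 I_{n_1}, …, t'_p I_{n_p})`. -/
def T' : Matrix d.Row d.Row ℂ := Matrix.diagonal fun a => d.t' a.1

/-- `θ_i` for `1 ≤ i ≤ p`. -/
def ang (i : Fin d.p) : ℝ := d.θ i.castSucc

/-- `θ_{i+1}` for `1 ≤ i ≤ p`. -/
def angNext (i : Fin d.p) : ℝ := d.θ i.succ

/-- `θ_{i-1}` for `1 ≤ i ≤ p`, where `θ_0 = θ_{p+1} - 2π`. -/
def angPrev (i : Fin d.p) : ℝ :=
  if i.val = 0 then d.θ (Fin.last d.p) - 2 * Real.pi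
  else d.θ ⟨i.val - 1, by omega⟩

/-- `θ'_i = -θ_i`, the chosen argument of `t'_i - η₀`. -/
def ang' (i : Fin d.p) : ℝ := -d.ang i

/-- `θ'_{i+1} = -θ_{i+1}`; for `i = p` this is `θ'_∞ = -θ_{p+1}`. -/
def angNext' (i : Fin d.p) : ℝ := -d.angNext i

/-- `θ'_{i-1} = -θ_{i-1}`; for `i = 1` this is `θ'_∞ + 2π`. -/
def angPrev' (i : Fin d.p) : ℝ := -d.angPrev i

/-- The standing assumptions on the data in the generic case. -/
structure Generic : Prop where
  t_injective : Function.Injective d.t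
  no_three_collinear : ∀ a b c : Fin (d.p + 1), a ≠ b → b ≠ c → a ≠ c →
    ¬ Collinear ℝ ({d.t a, d.t b, d.t c} : Set ℂ)
  θ_arg : ∀ i : Fin d.p,
    d.t i.castSucc - d.tLast
      = (‖d.t i.castSucc - d.tLast‖ : ℂ) * Complex.exp (d.θ i.castSucc * I)
  θ_strictMono : StrictMono d.θ
  θ_last_lt : d.θ (Fin.last d.p) < d.θ 0 + 2 * Real.pi
  A_diagonal_blocks : ∀ (i : Fin d.p) (a b : (k : Fin (d.r i)) × Fin (d.l i k)),
    d.A ⟨i, a⟩ ⟨i, b⟩ = if a = b then d.lam i a.1 else 0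
  A'_diagonal : d.A' = Matrix.diagonal fun c => d.mu c.1
  lam_notInt : ∀ i k, NotInt (d.lam i k)
  lam_sub_lam : ∀ i k h, k ≠ h → NotInt (d.lam i k - d.lam i h)
  mu_sub_mu : ∀ k h, k ≠ h → NotInt (d.mu k - d.mu h)
  rho_notInt : ∀ j, NotInt (d.ρ j)
  rho_sub_rho : NotInt (d.ρ 0 - d.ρ 1)
  rho_sub_lam : ∀ j i k, NotInt (d.ρ j - d.lam i k)
  rho_sub_mu : ∀ j k, NotInt (d.ρ j - d.mu k)
  mu_notInt : ∀ k, NotInt (d.mu k)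
  lam_sub_mu : ∀ i k j, NotInt (d.lam i k - d.mu j)

/-- `δ` is positive, and so small that none of the sectors below is empty. -/
def SmallAngle (δ : ℝ) : Prop :=
  0 < δ ∧ ∀ i : Fin d.p, d.angPrev i + δ < d.ang i ∧ d.ang i + δ < d.angNext i

/-- The sectors `S_i^+` and `S_i^-` with vertex `t_{p+1}`. The angles that occur lie in
`(θ_i - π, θ_i + π)`. -/
def sector (δ : ℝ) (i : Fin d.p) : Side → Set ℂ
  | .plus => {x | x ≠ d.tLast ∧ argNear (d.ang i) (x - d.tLast) ∈
      Set.Ioo (d.ang i) (min (d.angNext i - δ) (d.ang i + Real.pi))}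
  | .minus => {x | x ≠ d.tLast ∧ argNear (d.ang i) (x - d.tLast) ∈
      Set.Ioo (max (d.angPrev i + δ) (d.ang i - Real.pi)) (d.ang i)}

/-- The sectors `S'_i^+` and `S'_i^-` with vertex `η₀`. The angles that occur lie in
`(θ'_i - π, θ'_i + π)`. -/
def sector' (δ : ℝ) (i : Fin d.p) : Side → Set ℂ
  | .plus => {z | z ≠ d.η₀ ∧ argNear (d.ang' i) (z - d.η₀) ∈
      Set.Ioo (d.ang' i) (min (d.angPrev' i - δ) (d.ang' i + Real.pi))}
  | .minus => {z | z ≠ d.η₀ ∧ argNear (d.ang' i) (z - d.η₀) ∈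
      Set.Ioo (max (d.angNext' i + δ) (d.ang' i - Real.pi)) (d.ang' i)}

/-- The plane cut along the rays from `t'_k` to infinity in the direction of `t'_k - η₀`. -/
def cutPlane : Set ℂ :=
  {z | ∀ (k : Fin d.p) (s : ℝ), 1 ≤ s → z ≠ d.η₀ + (s : ℂ) * (d.t' k - d.η₀)}

/-- The largest disc with centre `η₀` that contains none of the `t'_k`. -/
def regularDisc : Set ℂ := {z | ∀ k : Fin d.p, ‖z - d.η₀‖ < ‖d.t' k - d.η₀‖}

/-- `U` is, on the sector, the (analytic continuation of the) solution `U_{t_i,k,h}`,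
where `arg (x - t_i)` is in `(θ_i, θ_i + π)` on `S_i^+` and in `(θ_i - π, θ_i)` on `S_i^-`. -/
def IsUFin (δ : ℝ) (i : Fin d.p) (σ : Side) (k : Fin (d.r i)) (h : Fin (d.l i k))
    (U : ℂ → d.Row ⊕ d.Col → ℂ) : Prop :=
  IsSolutionOn d.bigT d.bigA (d.sector δ i σ) U ∧
  HasExpansionAt (d.t i.castSucc) (d.ang i) (d.lam i k) (Pi.single (Sum.inl ⟨i, k, h⟩) 1)
    (d.sector δ i σ) U

/-- `U` is, on the sector, the (analytic continuation of the) solution `U_{t_{p+1},k,h}`. -/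
def IsULast (δ : ℝ) (i : Fin d.p) (σ : Side) (k : Fin d.q) (h : Fin (d.m k))
    (U : ℂ → d.Row ⊕ d.Col → ℂ) : Prop :=
  IsSolutionOn d.bigT d.bigA (d.sector δ i σ) U ∧
  HasExpansionAt d.tLast (d.ang i) (d.ρ 0 + d.ρ 1 - d.mu k) (Pi.single (Sum.inr ⟨k, h⟩) 1)
    (d.sector δ i σ) U

/-- `U` is, on the sector, the (analytic continuation of the) solution `U_{∞,j,c}`, whose
leading coefficient is the `c`-th column of the block matrix `(P ; ρ_j I - A')`. -/
def IsUInf (δ : ℝ) (i : Fin d.p) (σ : Side) (j : Fin 2) (c : d.Col)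
    (U : ℂ → d.Row ⊕ d.Col → ℂ) : Prop :=
  IsSolutionOn d.bigT d.bigA (d.sector δ i σ) U ∧
  HasExpansionAtInfinity d.tLast (d.ang i) (d.ρ j)
    (Sum.elim (fun a => d.P a c)
      (fun b => (d.ρ j • (1 : Matrix d.Col d.Col ℂ) - d.A') b c))
    (d.sector δ i σ) U

/-- `w` is, on the cut plane, the solution `w_{t'_i,k,h}(s; ·)` of the underlying system
`(ζ I - T') dw/dζ = (s I + A) w`, where `arg (ζ - t'_i) ∈ (θ'_i - 2π, θ'_i)` near `t'_i`. -/
def IsWFin (s : ℂ) (i : Fin d.p) (k : Fin (d.r i)) (h : Fin (d.l i k))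
    (w : ℂ → d.Row → ℂ) : Prop :=
  IsSolutionOn d.T' (s • (1 : Matrix d.Row d.Row ℂ) + d.A) d.cutPlane w ∧
  HasExpansionAt (d.t' i) (d.ang' i - Real.pi) (s + d.lam i k) (Pi.single ⟨i, k, h⟩ 1)
    d.cutPlane w

/-- `w` is the analytic continuation of the solution `w_{∞,k,h}(s; ·)` of the underlying system
into a neighbourhood of `η₀` through the sector `S'_i^±`; here `arg (ζ - η₀)` is the one used
to define the sector. -/
def IsWInf (s : ℂ) (δ : ℝ) (i : Fin d.p) (σ : Side) (k : Fin d.q) (h : Fin (d.m k))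
    (w : ℂ → d.Row → ℂ) : Prop :=
  IsSolutionOn d.T' (s • (1 : Matrix d.Row d.Row ℂ) + d.A)
    (d.sector' δ i σ ∪ d.regularDisc) w ∧
  HasExpansionAtInfinity d.η₀ (d.ang' i) (s + d.mu k) (fun a => d.P a ⟨k, h⟩)
    (d.sector' δ i σ) w

/-- The vector `P⁻¹ (η₀ I - T') w(η₀)`; its components are the quantities `γ`. -/
def gam (w : ℂ → d.Row → ℂ) : d.Col → ℂ :=
  d.Pinv *ᵥ ((d.η₀ • (1 : Matrix d.Row d.Row ℂ) - d.T') *ᵥ w d.η₀)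

end Data

end Okubo

end

/-!
# Connection coefficients of a rank `2n` system of Okubo normal form

The rank `2n` system is a fractional integral (middle convolution) of the underlying rank `n`
system in the coordinate `z = 1 / (x - t_{p+1}) = ζ - η₀`, and the point at infinity of the first
is the regular point `η₀` of the second. So the leading term at infinity of a fractional integral
is the value of the integrand's solution at `η₀`, up to a Beta integral. This is why the
connection coefficients are Gamma quotients times the quantities `γ`.

**The relation along a ray.** Put `x = t_{p+1} + ω X` with `X` real: `ω = t_i - t_{p+1}` and `X > 1`
for the singular point `t_i`, and `ω` in the direction of the sector and `X > 0` for `t_{p+1}`. Let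
`τ` be the diagonal matrix of the `(t_i - t_{p+1}) / ω`. If `g` solves the underlying system on the
ray, then `u(X) = ∫ (X - ξ) ^ ρ₂ ξ ^ (ρ₁ - ρ₂ - 1) τ⁻¹ g(ξ) dξ`, taken from the starting point of
the ray, is the upper half of a solution of the rank `2n` system, provided that the integral
converges well (`RaySys.raySol_rl`, by integration by parts; `RaySys.exists_raySol_of_gSol`). At
the starting point, `u` has an expansion with a single exponent, so that the solution is a multiple
of the one that is to be connected (`RaySol.eventually_eq_zero`, uniqueness in Frobenius' method).
At infinity, `u` is asymptotic to `X ^ ρ₁ B(ρ₁ - ρ₂, ρ₂ + 1) τ⁻¹ g(∞)`, which dominates `X ^ ρ₂`.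
Comparison gives the part of the connection relation that belongs to the exponent `ρ₁`; this
relation is `RaySys.Connects`, and `RaySys.connects_of_large` proves it when `Re ρ₂`,
`Re (ρ₁ - ρ₂)` and the real part of the exponent of the integrand are large.

**General parameters.** The real parts are made large by contiguity relations, which map solutions
to solutions of a system with shifted parameters: `up` shifts `A`, `ρ₁`, `ρ₂` by `1` (a primitive
of the solution), `down` shifts `A`, `ρ₂` by `-1`, and `lower` shifts `ρ₂` alone by `-1`. Each of
them changes the leading coefficients by explicit factors, which are those in the functional
equation of the Gamma function (`RaySys.FinCase.connects`, `RaySys.LastCase.connects`). No analytic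
continuation in the parameters is needed.

**From the ray to the sector.** The exponent `ρ₁` is either of the two exponents at infinity, since
the coefficient matrix is symmetric in them; this gives all coefficients
(`Data.Generic.coeff_of_ray`, `Data.Generic.coeff_fin`, `Data.Generic.coeff_last`). For `t_i` the
ray lies on the boundary of the sector. Since no three singular points are collinear, it contains
no further singular point, and the solution continues across it. That the coefficients so found
do represent the solution follows from the solutions at infinity being a basis: their leading
coefficients are linearly independent, and linear independence is an open condition
(`Data.Generic.linearIndependent_lead`, `Data.Generic.exists_coeff`,
`Data.Generic.combination_iff`).

**Existence.** Power series give the solutions locally (`exists_eulerFin`, `exists_eulerInf`). They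
are continued to star-shaped domains, where a linear differential equation is solved by its Dyson
series (`exists_linear_ode`): planes that are cut along rays directed away from a centre
(`exists_okSol_starCut`), or the union of a sector and a disc around its vertex.
-/

noncomputable section

namespace Okubo

open Set Filter Topology Metric MeasureTheory

/-! ### Linear differential equations on star-shaped domains -/

section StarShaped

variable {E : Type*} [NormedAddCommGroup E] [NormedSpace ℂ E] [CompleteSpace E]

/-- The segments from `x₀` to the points of a small disc around `z` fill a compact subset of `Ω`;
on it everything holomorphic on `Ω` is bounded. -/
lemma exists_compact_star {Ω : Set ℂ} (hΩ : IsOpen Ω) {x₀ : ℂ} (hs : StarConvex ℝ x₀ Ω) {z : ℂ}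
    (hz : z ∈ Ω) : ∃ ε > 0, ball z ε ⊆ Ω ∧ ∃ C : Set ℂ, IsCompact C ∧ C ⊆ Ω ∧
      ∀ w ∈ ball z ε, ∀ t ∈ Icc (0 : ℝ) 1, x₀ + t * (w - x₀) ∈ C := by
  obtain ⟨ε, hε, hb⟩ := Metric.isOpen_iff.1 hΩ z hz
  have hb2 : closedBall z (ε / 2) ⊆ Ω := (closedBall_subset_ball (by linarith)).trans hb
  refine ⟨ε / 2, by positivity, ball_subset_closedBall.trans hb2,
    (fun p : ℝ × ℂ => x₀ + p.1 * (p.2 - x₀)) '' (Icc 0 1 ×ˢ closedBall z (ε / 2)), ?_, ?_, ?_⟩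
  · exact (isCompact_Icc.prod (isCompact_closedBall _ _)).image (by fun_prop)
  · rintro _ ⟨⟨t, w⟩, ⟨ht, hw⟩, rfl⟩
    have := hs (hb2 hw) (a := 1 - t) (b := t) (by linarith [ht.2]) ht.1 (by ring)
    convert this using 1
    simp only [Complex.real_smul]; push_cast; ring
  · intro w hw t ht
    exact ⟨(t, w), ⟨ht, ball_subset_closedBall hw⟩, rfl⟩

/-- On a star-shaped domain, integration along segments from the centre produces a primitive. -/
lemma hasDerivAt_integral_segment {Ω : Set ℂ} (hΩ : IsOpen Ω) {x₀ : ℂ} (hs : StarConvex ℝ x₀ Ω)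
    {f : ℂ → E} (hf : DifferentiableOn ℂ f Ω) {z : ℂ} (hz : z ∈ Ω) :
    HasDerivAt (fun w => ∫ t in (0 : ℝ)..1, (w - x₀) • f (x₀ + t * (w - x₀))) (f z) z := by
  obtain ⟨ε, hε, hb, C, hC, hCΩ, hseg⟩ := exists_compact_star hΩ hs hz
  have hf' : ContinuousOn (deriv f) Ω := (hf.deriv hΩ).continuousOn
  obtain ⟨K, hK⟩ := hC.exists_bound_of_continuousOn (hf.continuousOn.mono hCΩ)
  obtain ⟨K', hK'⟩ := hC.exists_bound_of_continuousOn (hf'.mono hCΩ)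
  have hcl : ∀ w ∈ ball z ε, ContinuousOn (fun t : ℝ => x₀ + t * (w - x₀)) (Icc 0 1) :=
    fun w _ => by fun_prop
  have hmap : ∀ w ∈ ball z ε, MapsTo (fun t : ℝ => x₀ + t * (w - x₀)) (Icc 0 1) Ω :=
    fun w hw t ht => hCΩ (hseg w hw t ht)
  have hc1 : ∀ w ∈ ball z ε, ContinuousOn (fun t : ℝ => f (x₀ + t * (w - x₀))) (Icc 0 1) :=
    fun w hw => hf.continuousOn.comp (hcl w hw) (hmap w hw)
  have hc2 : ∀ w ∈ ball z ε, ContinuousOn (fun t : ℝ => deriv f (x₀ + t * (w - x₀))) (Icc 0 1) :=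
    fun w hw => hf'.comp (hcl w hw) (hmap w hw)
  have hzb : z ∈ ball z ε := mem_ball_self hε
  have hIoc : uIoc (0 : ℝ) 1 ⊆ Icc 0 1 := by
    rw [uIoc_of_le zero_le_one]; exact Ioc_subset_Icc_self
  have hmeasI : MeasurableSet (uIoc (0 : ℝ) 1) := measurableSet_uIoc
  have hF'c : ContinuousOn (fun t : ℝ => f (x₀ + t * (z - x₀)) +
      (z - x₀) • ((t : ℂ) • deriv f (x₀ + t * (z - x₀)))) (Icc 0 1) :=
    (hc1 z hzb).add (continuousOn_const.smul
      ((Complex.continuous_ofReal.continuousOn).smul (hc2 z hzb)))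
  have key := intervalIntegral.hasDerivAt_integral_of_dominated_loc_of_deriv_le
    (μ := MeasureTheory.volume) (a := 0) (b := 1)
    (F := fun w (t : ℝ) => (w - x₀) • f (x₀ + t * (w - x₀)))
    (F' := fun w (t : ℝ) => f (x₀ + t * (w - x₀)) +
      (w - x₀) • ((t : ℂ) • deriv f (x₀ + t * (w - x₀))))
    (x₀ := z) (s := ball z ε) (bound := fun _ => K + (‖z‖ + ε + ‖x₀‖) * (1 * K'))
    (ball_mem_nhds z hε) ?_ ?_ ?_ ?_ ?_ ?_
  -- the integrand of the derivative is the derivative of `t • f (x₀ + t (z - x₀))`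
  · have h2 := key.2
    have hint : ∫ t in (0 : ℝ)..1, (f (x₀ + t * (z - x₀)) +
        (z - x₀) • ((t : ℂ) • deriv f (x₀ + t * (z - x₀)))) = f z := by
      have := intervalIntegral.integral_eq_sub_of_hasDerivAt (a := 0) (b := 1)
        (f := fun t : ℝ => (t : ℂ) • f (x₀ + t * (z - x₀)))
        (f' := fun t : ℝ => f (x₀ + t * (z - x₀)) +
          (z - x₀) • ((t : ℂ) • deriv f (x₀ + t * (z - x₀)))) ?_ ?_
      · rw [this]; simp
      · intro t ht
        rw [uIcc_of_le zero_le_one] at ht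
        have hd : HasDerivAt f (deriv f (x₀ + t * (z - x₀))) (x₀ + t * (z - x₀)) :=
          ((hf _ (hmap z hzb ht)).differentiableAt (hΩ.mem_nhds (hmap z hzb ht))).hasDerivAt
        have hl : HasDerivAt (fun t : ℝ => x₀ + (t : ℂ) * (z - x₀)) (z - x₀) t := by
          simpa using ((Complex.ofRealCLM.hasDerivAt (x := t)).mul_const (z - x₀)).const_add x₀
        have h3 := HasDerivAt.scomp t hd hl
        have h4 := (Complex.ofRealCLM.hasDerivAt (x := t)).smul h3
        refine h4.congr_deriv ?_
        simp only [Function.comp, Complex.ofRealCLM_apply, Complex.ofReal_one, one_smul]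
        rw [smul_comm, add_comm]
      · exact (hF'c.mono (by rw [uIcc_of_le zero_le_one])).intervalIntegrable
    rw [hint] at h2
    exact h2
  · filter_upwards [ball_mem_nhds z hε] with w hw
    exact (continuousOn_const.smul ((hc1 w hw).mono hIoc)).aestronglyMeasurable hmeasI
  · exact (continuousOn_const.smul ((hc1 z hzb).mono
      (by rw [uIcc_of_le zero_le_one]))).intervalIntegrable
  · exact (hF'c.mono hIoc).aestronglyMeasurable hmeasI
  · refine .of_forall fun t ht w hw => ?_
    have h1 := hK _ (hseg w hw t (hIoc ht))
    have h2 := hK' _ (hseg w hw t (hIoc ht))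
    have hw' : ‖w - x₀‖ ≤ ‖z‖ + ε + ‖x₀‖ := by
      have : ‖w - z‖ < ε := by simpa [dist_eq_norm] using hw
      calc ‖w - x₀‖ = ‖z + (w - z) - x₀‖ := by ring_nf
        _ ≤ ‖z‖ + ‖w - z‖ + ‖x₀‖ := (norm_sub_le _ _).trans (by gcongr; exact norm_add_le _ _)
        _ ≤ _ := by gcongr
    have ht' : ‖(t : ℂ)‖ ≤ 1 := by
      rw [Complex.norm_real, Real.norm_of_nonneg (hIoc ht).1]; exact (hIoc ht).2
    refine (norm_add_le _ _).trans ?_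
    rw [norm_smul, norm_smul]
    gcongr
  · exact intervalIntegrable_const
  · refine .of_forall fun t ht w hw => ?_
    have hd : HasDerivAt f (deriv f (x₀ + t * (w - x₀))) (x₀ + t * (w - x₀)) :=
      ((hf _ (hmap w hw (hIoc ht))).differentiableAt (hΩ.mem_nhds (hmap w hw (hIoc ht)))).hasDerivAt
    have hl : HasDerivAt (fun w : ℂ => x₀ + (t : ℂ) * (w - x₀)) (t : ℂ) w := by
      simpa using (((hasDerivAt_id w).sub_const x₀).const_mul (t : ℂ)).const_add x₀
    have h3 := HasDerivAt.scomp w hd hl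
    have h4 := ((hasDerivAt_id w).sub_const x₀).smul h3
    refine h4.congr_deriv ?_
    simp only [Function.comp, one_smul, id]
    rw [add_comm]

end StarShaped

section Dyson
variable {E : Type*} [NormedAddCommGroup E] [NormedSpace ℂ E] [CompleteSpace E]

/-- The terms of the Dyson series of the equation `U' = M U` with initial value `v` at `x₀`. -/
def dysonTerm (M : ℂ → E →L[ℂ] E) (x₀ : ℂ) (v : E) : ℕ → ℂ → E
  | 0 => fun _ => v
  | n + 1 => fun z => ∫ t in (0 : ℝ)..1, (z - x₀) •
      M (x₀ + t * (z - x₀)) (dysonTerm M x₀ v n (x₀ + t * (z - x₀)))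

lemma dysonTerm_differentiableOn {Ω : Set ℂ} (hΩ : IsOpen Ω) {x₀ : ℂ} (hs : StarConvex ℝ x₀ Ω)
    {M : ℂ → E →L[ℂ] E} (hM : DifferentiableOn ℂ M Ω) (v : E) (n : ℕ) :
    DifferentiableOn ℂ (dysonTerm M x₀ v n) Ω := by
  induction n with
  | zero => exact differentiableOn_const v
  | succ n ih =>
    intro z hz
    exact (hasDerivAt_integral_segment hΩ hs
      (hM.clm_apply ih) hz).differentiableAt.differentiableWithinAt

lemma dysonTerm_hasDerivAt {Ω : Set ℂ} (hΩ : IsOpen Ω) {x₀ : ℂ} (hs : StarConvex ℝ x₀ Ω)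
    {M : ℂ → E →L[ℂ] E} (hM : DifferentiableOn ℂ M Ω) (v : E) (n : ℕ) {z : ℂ} (hz : z ∈ Ω) :
    HasDerivAt (dysonTerm M x₀ v (n + 1)) (M z (dysonTerm M x₀ v n z)) z :=
  hasDerivAt_integral_segment hΩ hs
    (hM.clm_apply (dysonTerm_differentiableOn hΩ hs hM v n)) hz

omit [CompleteSpace E] in
/-- The factorial in the bound, which makes the Dyson series converge on all of `Ω`, comes from
integrating `t ^ n` along the segment. -/
lemma dysonTerm_norm_le {x₀ : ℂ} {M : ℂ → E →L[ℂ] E} (v : E) {K : ℝ} (hK : 0 ≤ K) (n : ℕ) :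
    ∀ z : ℂ, (∀ t ∈ Icc (0 : ℝ) 1, ‖M (x₀ + t * (z - x₀))‖ ≤ K) →
      ‖dysonTerm M x₀ v n z‖ ≤ (K * ‖z - x₀‖) ^ n / n.factorial * ‖v‖ := by
  induction n with
  | zero => intro z _; simp [dysonTerm]
  | succ n ih =>
    intro z hz
    have hb : ∀ t ∈ Ioc (0 : ℝ) 1, ‖(z - x₀) • M (x₀ + t * (z - x₀))
        (dysonTerm M x₀ v n (x₀ + t * (z - x₀)))‖ ≤
        ‖z - x₀‖ * (K * ((K * ‖z - x₀‖) ^ n / n.factorial * ‖v‖)) * t ^ n := by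
      intro t ht
      have h1 := ih (x₀ + t * (z - x₀)) (fun u hu => by
        have := hz (u * t) ⟨mul_nonneg hu.1 ht.1.le, mul_le_one₀ hu.2 ht.1.le ht.2⟩
        convert this using 3
        push_cast; ring)
      have h2 : ‖x₀ + t * (z - x₀) - x₀‖ = t * ‖z - x₀‖ := by
        rw [add_sub_cancel_left, norm_mul, Complex.norm_real, Real.norm_of_nonneg ht.1.le]
      rw [h2] at h1
      rw [norm_smul]
      calc _ ≤ ‖z - x₀‖ * (K * ((K * (t * ‖z - x₀‖)) ^ n / n.factorial * ‖v‖)) := by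
            gcongr
            refine (ContinuousLinearMap.le_opNorm _ _).trans ?_
            gcongr
            exact hz t (Ioc_subset_Icc_self ht)
        _ = _ := by rw [show K * (t * ‖z - x₀‖) = (K * ‖z - x₀‖) * t by ring, mul_pow]; ring
    have := intervalIntegral.norm_integral_le_of_norm_le (μ := MeasureTheory.volume)
      (a := (0 : ℝ)) (b := 1) zero_le_one
      (f := fun t : ℝ => (z - x₀) • M (x₀ + t * (z - x₀))
        (dysonTerm M x₀ v n (x₀ + t * (z - x₀))))
      (g := fun t => ‖z - x₀‖ * (K * ((K * ‖z - x₀‖) ^ n / n.factorial * ‖v‖)) * t ^ n)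
      (.of_forall hb) ((by fun_prop : Continuous _).intervalIntegrable _ _)
    refine this.trans (le_of_eq ?_)
    rw [intervalIntegral.integral_const_mul, integral_pow, Nat.factorial_succ]
    push_cast
    have : (n.factorial : ℝ) ≠ 0 := by positivity
    have : (n : ℝ) + 1 ≠ 0 := by positivity
    field_simp
    ring

/-- A linear holomorphic differential equation on a star-shaped open set has a global solution
with prescribed value at the centre. -/
lemma exists_linear_ode {Ω : Set ℂ} (hΩ : IsOpen Ω) {x₀ : ℂ} (hs : StarConvex ℝ x₀ Ω)
    {M : ℂ → E →L[ℂ] E} (hM : DifferentiableOn ℂ M Ω) (v : E) :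
    ∃ U : ℂ → E, U x₀ = v ∧ ∀ z ∈ Ω, HasDerivAt U (M z (U z)) z := by
  set D := dysonTerm M x₀ v with hD
  refine ⟨fun z => ∑' n, D n z, ?_, ?_⟩
  · have : ∀ n, n ≠ 0 → D n x₀ = 0 := by
      intro n hn
      obtain ⟨k, rfl⟩ := Nat.exists_eq_succ_of_ne_zero hn
      simp [hD, dysonTerm]
    simp only
    rw [tsum_eq_single 0 this]
    rfl
  · intro z hz
    obtain ⟨ε, hε, hb, C, hC, hCΩ, hseg⟩ := exists_compact_star hΩ hs hz
    obtain ⟨K, hK⟩ := hC.exists_bound_of_continuousOn (hM.continuousOn.mono hCΩ)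
    have hK0 : 0 ≤ K := (norm_nonneg _).trans (hK _ (hseg z (mem_ball_self hε) 0 (by simp)))
    set L := K * (‖z - x₀‖ + ε)
    have hle : ∀ n w, w ∈ ball z ε → ‖D n w‖ ≤ L ^ n / n.factorial * ‖v‖ := by
      intro n w hw
      refine (dysonTerm_norm_le v hK0 n w (fun t ht => hK _ (hseg w hw t ht))).trans ?_
      have : ‖w - x₀‖ ≤ ‖z - x₀‖ + ε := by
        have : ‖w - z‖ < ε := by simpa [dist_eq_norm] using hw
        calc ‖w - x₀‖ = ‖(z - x₀) + (w - z)‖ := by ring_nf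
          _ ≤ _ := (norm_add_le _ _).trans (by gcongr)
      change _ ≤ (K * (‖z - x₀‖ + ε)) ^ n / n.factorial * ‖v‖
      gcongr
    have hsum : Summable fun n : ℕ => L ^ n / n.factorial * ‖v‖ :=
      (Real.summable_pow_div_factorial L).mul_right _
    have hdiff : ∀ n, DifferentiableOn ℂ (D n) (ball z ε) := fun n =>
      (dysonTerm_differentiableOn hΩ hs hM v n).mono hb
    have hzb := mem_ball_self (x := z) hε
    -- locally uniform convergence, hence termwise differentiation
    have h1 := Complex.hasSum_deriv_of_summable_norm hsum hdiff isOpen_ball hle hzb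
    have h2 : DifferentiableAt ℂ (fun w => ∑' n, D n w) z :=
      (Complex.differentiableOn_tsum_of_summable_norm hsum hdiff isOpen_ball hle).differentiableAt
        (isOpen_ball.mem_nhds hzb)
    have h3 : Summable fun n => D n z := .of_norm_bounded hsum (fun n => hle n z hzb)
    have h4 : HasSum (fun n => deriv (D (n + 1)) z) (M z (∑' n, D n z)) := by
      have : (fun n => deriv (D (n + 1)) z) = fun n => M z (D n z) :=
        funext fun n => (dysonTerm_hasDerivAt hΩ hs hM v n hz).deriv
      rw [this]
      exact h3.hasSum.mapL (M z)
    have h5 : deriv (D 0) z = 0 := by simp [hD, dysonTerm]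
    have h6 := h1.unique ((hasSum_nat_add_iff' (f := fun n => deriv (D n) z) 1).1
      (by simpa [h5] using h4))
    have := h2.hasDerivAt
    rwa [h6] at this

end Dyson

/-! ### Solutions of systems of Okubo normal form -/

section Solutions

variable {J : Type} [Fintype J]

/-- `U` solves `(x - t_j) U_j' = (B U)_j` at all points of the set `S` of complex numbers. -/
def OkSol (t : J → ℂ) (B : Matrix J J ℂ) (S : Set ℂ) (U : ℂ → J → ℂ) : Prop :=
  ∀ x ∈ S, ∃ U' : J → ℂ, HasDerivAt U U' x ∧ ∀ j, (x - t j) * U' j = (B *ᵥ U x) j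

/-- `f` solves `(x - t_j) f_j' = (B f)_j` at all points of the set `I` of real numbers. -/
def RaySol (t : J → ℂ) (B : Matrix J J ℂ) (I : Set ℝ) (f : ℝ → J → ℂ) : Prop :=
  ∀ x ∈ I, ∃ f' : J → ℂ, HasDerivAt f f' x ∧ ∀ j, ((x : ℂ) - t j) * f' j = (B *ᵥ f x) j

/-- For a diagonal `T` the system is read off row by row. -/
lemma isSolutionOn_diagonal [DecidableEq J] {t : J → ℂ} {B : Matrix J J ℂ} {S : Set ℂ}
    {U : ℂ → J → ℂ} : IsSolutionOn (diagonal t) B S U ↔ OkSol t B S U := by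
  refine forall₂_congr fun x _ => exists_congr fun U' => and_congr Iff.rfl ?_
  rw [funext_iff]
  refine forall_congr' fun j => ?_
  rw [sub_mulVec, smul_mulVec, one_mulVec, Pi.sub_apply, mulVec_diagonal, Pi.smul_apply,
    smul_eq_mul, sub_mul]

variable {t : J → ℂ} {B : Matrix J J ℂ} {S : Set ℂ} {I : Set ℝ}

lemma OkSol.mono {S' : Set ℂ} {U : ℂ → J → ℂ} (h : OkSol t B S U) (hS : S' ⊆ S) :
    OkSol t B S' U := fun x hx => h x (hS hx)

lemma RaySol.mono {I' : Set ℝ} {f : ℝ → J → ℂ} (h : RaySol t B I f) (hS : I' ⊆ I) :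
    RaySol t B I' f := fun x hx => h x (hS hx)

lemma OkSol.sub {U V : ℂ → J → ℂ} (hU : OkSol t B S U) (hV : OkSol t B S V) :
    OkSol t B S (U - V) := by
  intro x hx
  obtain ⟨U', h1, h2⟩ := hU x hx
  obtain ⟨V', h3, h4⟩ := hV x hx
  refine ⟨U' - V', h1.sub h3, fun j => ?_⟩
  rw [Pi.sub_apply, Pi.sub_apply, mulVec_sub, Pi.sub_apply, mul_sub, h2, h4]

lemma RaySol.sub {U V : ℝ → J → ℂ} (hU : RaySol t B I U) (hV : RaySol t B I V) :
    RaySol t B I (U - V) := by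
  intro x hx
  obtain ⟨U', h1, h2⟩ := hU x hx
  obtain ⟨V', h3, h4⟩ := hV x hx
  refine ⟨U' - V', h1.sub h3, fun j => ?_⟩
  rw [Pi.sub_apply, Pi.sub_apply, mulVec_sub, Pi.sub_apply, mul_sub, h2, h4]

lemma OkSol.smul {U : ℂ → J → ℂ} (hU : OkSol t B S U) (c : ℂ) :
    OkSol t B S (c • U) := by
  intro x hx
  obtain ⟨U', h1, h2⟩ := hU x hx
  refine ⟨c • U', h1.const_smul c, fun j => ?_⟩
  rw [Pi.smul_apply, Pi.smul_apply, mulVec_smul, Pi.smul_apply, smul_eq_mul, smul_eq_mul, ← h2]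
  ring

lemma RaySol.smul {U : ℝ → J → ℂ} (hU : RaySol t B I U) (c : ℂ) :
    RaySol t B I (c • U) := by
  intro x hx
  obtain ⟨U', h1, h2⟩ := hU x hx
  refine ⟨c • U', h1.const_smul c, fun j => ?_⟩
  rw [Pi.smul_apply, Pi.smul_apply, mulVec_smul, Pi.smul_apply, smul_eq_mul, smul_eq_mul, ← h2]
  ring

lemma OkSol.sum {ι : Type*} (s : Finset ι) {U : ι → ℂ → J → ℂ}
    (hU : ∀ i ∈ s, OkSol t B S (U i)) : OkSol t B S (∑ i ∈ s, U i) := by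
  intro x hx
  choose! U' h1 h2 using fun i hi => hU i hi x hx
  refine ⟨∑ i ∈ s, U' i, HasDerivAt.sum h1, fun j => ?_⟩
  rw [Finset.sum_apply, Finset.sum_apply, Finset.mul_sum, mulVec_sum, Finset.sum_apply]
  exact Finset.sum_congr rfl fun i hi => h2 i hi j

lemma OkSol.differentiableAt {U : ℂ → J → ℂ} (h : OkSol t B S U) {x : ℂ} (hx : x ∈ S) :
    DifferentiableAt ℂ U x :=
  let ⟨_, h, _⟩ := h x hx
  h.differentiableAt

variable [DecidableEq J]

/-- The right-hand side of the system in explicit form. -/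
def okRhs (t : J → ℂ) (B : Matrix J J ℂ) (x : ℂ) : (J → ℂ) →L[ℂ] (J → ℂ) :=
  ∑ j, (x - t j)⁻¹ • ((ContinuousLinearMap.proj j).smulRight (Pi.single j (1 : ℂ))).comp
    (Matrix.mulVecLin B).toContinuousLinearMap

lemma okRhs_apply (x : ℂ) (u : J → ℂ) (j : J) :
    okRhs t B x u j = (x - t j)⁻¹ * (B *ᵥ u) j := by
  simp [okRhs, Finset.sum_apply, Pi.single_apply]

lemma okRhs_differentiableOn (hS : ∀ x ∈ S, ∀ j, x ≠ t j) :
    DifferentiableOn ℂ (okRhs t B) S := by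
  unfold okRhs
  refine DifferentiableOn.fun_sum fun j _ => DifferentiableOn.smul_const ?_ _
  exact (differentiableOn_id.sub_const _).inv fun x hx => sub_ne_zero.2 (hS x hx j)

lemma okSol_iff (hS : ∀ x ∈ S, ∀ j, x ≠ t j) {U : ℂ → J → ℂ} :
    OkSol t B S U ↔ ∀ x ∈ S, HasDerivAt U (okRhs t B x (U x)) x := by
  refine forall₂_congr fun x hx => ⟨?_, fun h => ⟨_, h, fun j => ?_⟩⟩
  · rintro ⟨U', h1, h2⟩
    refine h1.congr_deriv (funext fun j => ?_)
    rw [okRhs_apply, ← h2, inv_mul_cancel_left₀ (sub_ne_zero.2 (hS x hx j))]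
  · rw [okRhs_apply, mul_inv_cancel_left₀ (sub_ne_zero.2 (hS x hx j))]

lemma raySol_iff (hI : ∀ x ∈ I, ∀ j, (x : ℂ) ≠ t j) {U : ℝ → J → ℂ} :
    RaySol t B I U ↔ ∀ x ∈ I, HasDerivAt U (okRhs t B x (U x)) x := by
  refine forall₂_congr fun x hx => ⟨?_, fun h => ⟨_, h, fun j => ?_⟩⟩
  · rintro ⟨U', h1, h2⟩
    refine h1.congr_deriv (funext fun j => ?_)
    rw [okRhs_apply, ← h2, inv_mul_cancel_left₀ (sub_ne_zero.2 (hI x hx j))]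
  · rw [okRhs_apply, mul_inv_cancel_left₀ (sub_ne_zero.2 (hI x hx j))]

/-- A solution on a star-shaped domain without singular points can be prescribed at the centre. -/
lemma exists_okSol (B : Matrix J J ℂ) (hSo : IsOpen S) {x₀ : ℂ} (hs : StarConvex ℝ x₀ S)
    (hS : ∀ x ∈ S, ∀ j, x ≠ t j) (v : J → ℂ) : ∃ U, U x₀ = v ∧ OkSol t B S U := by
  obtain ⟨U, h1, h2⟩ := exists_linear_ode hSo hs (okRhs_differentiableOn (B := B) hS) v
  exact ⟨U, h1, (okSol_iff hS).2 h2⟩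

end Solutions

section Uniqueness

/-- A solution of a linear differential equation on a real interval that vanishes at one point
vanishes identically. -/
lemma eq_zero_of_linear_ode {E : Type*} [NormedAddCommGroup E] [NormedSpace ℂ E]
    {I : Set ℝ} (hI : I.OrdConnected) {N : ℝ → E →L[ℂ] E} (hN : ContinuousOn N I) {f : ℝ → E}
    (hf : ∀ x ∈ I, HasDerivAt f (N x (f x)) x) {x₀ : ℝ} (hx₀ : x₀ ∈ I) (h0 : f x₀ = 0) :
    ∀ x ∈ I, f x = 0 := by
  have hlip : ∀ a b, Icc a b ⊆ I → ∃ K : NNReal, ∀ x ∈ Icc a b,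
      LipschitzOnWith K (fun y => N x y) (univ : Set E) := by
    intro a b hab
    obtain ⟨K, hK⟩ := isCompact_Icc.exists_bound_of_continuousOn (hN.mono hab)
    refine ⟨K.toNNReal, fun x hx => LipschitzWith.lipschitzOnWith ?_⟩
    refine ContinuousLinearMap.lipschitzWith_of_opNorm_le ?_
    exact (hK x hx).trans (Real.le_coe_toNNReal K)
  intro x hx
  rcases le_total x₀ x with h | h
  · have hss : Icc x₀ x ⊆ I := hI.out hx₀ hx
    obtain ⟨K, hK⟩ := hlip _ _ hss
    exact ODE_solution_unique_of_mem_Icc_right (v := fun x y => N x y) (s := fun _ => univ)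
      (g := fun _ => 0)
      (fun y hy => hK y (Ico_subset_Icc_self hy))
      (HasDerivAt.continuousOn fun y hy => hf y (hss hy))
      (fun y hy => (hf y (hss (Ico_subset_Icc_self hy))).hasDerivWithinAt)
      (fun _ _ => mem_univ _) continuousOn_const
      (fun y _ => by simpa using (hasDerivWithinAt_const y (Ici y) (0 : E)))
      (fun _ _ => mem_univ _) h0 ⟨h, le_rfl⟩
  · have hss : Icc x x₀ ⊆ I := hI.out hx hx₀
    obtain ⟨K, hK⟩ := hlip _ _ hss
    exact ODE_solution_unique_of_mem_Icc_left (v := fun x y => N x y) (s := fun _ => univ)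
      (g := fun _ => 0)
      (fun y hy => hK y (Ioc_subset_Icc_self hy))
      (HasDerivAt.continuousOn fun y hy => hf y (hss hy))
      (fun y hy => (hf y (hss (Ioc_subset_Icc_self hy))).hasDerivWithinAt)
      (fun _ _ => mem_univ _) continuousOn_const
      (fun y _ => by simpa using (hasDerivWithinAt_const y (Iic y) (0 : E)))
      (fun _ _ => mem_univ _) h0 ⟨le_rfl, h⟩

variable {J : Type} [Fintype J] [DecidableEq J] {t : J → ℂ} {B : Matrix J J ℂ}

/-- Uniqueness along a ray that contains no singular point. -/
lemma RaySol.eq_zero {I : Set ℝ} (hI : I.OrdConnected) (hIt : ∀ x ∈ I, ∀ j, (x : ℂ) ≠ t j)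
    {f : ℝ → J → ℂ} (hf : RaySol t B I f) {x₀ : ℝ} (hx₀ : x₀ ∈ I) (h0 : f x₀ = 0) :
    ∀ x ∈ I, f x = 0 := by
  refine eq_zero_of_linear_ode hI (N := fun x : ℝ => okRhs t B x) ?_ ((raySol_iff hIt).1 hf) hx₀ h0
  have := (okRhs_differentiableOn (t := t) (B := B) (S := (fun x : ℝ => (x : ℂ)) '' I)
    (by rintro _ ⟨x, hx, rfl⟩; exact hIt x hx)).continuousOn
  exact this.comp Complex.continuous_ofReal.continuousOn (mapsTo_image _ _)

/-- Analytic continuation on a domain preserves the vanishing of a solution. -/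
lemma OkSol.eq_zero {S : Set ℂ} (hSo : IsOpen S) (hSc : IsPreconnected S)
    (hS : ∀ x ∈ S, ∀ j, x ≠ t j) {U : ℂ → J → ℂ} (hU : OkSol t B S U) {x₀ : ℂ} (hx₀ : x₀ ∈ S)
    (h0 : U x₀ = 0) : ∀ x ∈ S, U x = 0 := by
  have hd : DifferentiableOn ℂ U S := fun x hx => (hU.differentiableAt hx).differentiableWithinAt
  have han : AnalyticOnNhd ℂ U S := hd.analyticOnNhd hSo
  refine han.eqOn_zero_of_preconnected_of_eventuallyEq_zero hSc hx₀ ?_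
  -- near `x₀`, the uniqueness theorem on real intervals applies along each segment
  obtain ⟨ε, hε, hb⟩ := Metric.isOpen_iff.1 hSo x₀ hx₀
  filter_upwards [ball_mem_nhds x₀ hε] with z hz
  have hmem : ∀ s ∈ Icc (0 : ℝ) 1, x₀ + s * (z - x₀) ∈ S := by
    intro s hs
    apply hb
    rw [mem_ball, dist_eq_norm, add_sub_cancel_left, norm_mul, Complex.norm_real,
      Real.norm_of_nonneg hs.1]
    have : ‖z - x₀‖ < ε := by simpa [dist_eq_norm] using hz
    nlinarith [norm_nonneg (z - x₀), hs.2, hs.1]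
  have hc : ContinuousOn (fun s : ℝ => x₀ + s * (z - x₀)) (Icc 0 1) := by fun_prop
  have := eq_zero_of_linear_ode (I := Icc 0 1) ordConnected_Icc
    (N := fun s : ℝ => (z - x₀) • okRhs t B (x₀ + s * (z - x₀)))
    (f := fun s : ℝ => U (x₀ + s * (z - x₀))) ?_ ?_ (x₀ := 0) (by simp) (by simpa using h0) 1
    (by simp)
  · simpa using this
  · have hcr := (okRhs_differentiableOn (B := B) hS).continuousOn
    exact (hcr.comp hc fun s hs => hmem s hs).const_smul (z - x₀)
  · intro s hs
    have hl : HasDerivAt (fun s : ℝ => x₀ + (s : ℂ) * (z - x₀)) (z - x₀) s := by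
      simpa using ((Complex.ofRealCLM.hasDerivAt (x := s)).mul_const (z - x₀)).const_add x₀
    exact HasDerivAt.scomp s ((okSol_iff hS).1 hU _ (hmem s hs)) hl

lemma OkSol.eqOn {S : Set ℂ} (hSo : IsOpen S) (hSc : IsPreconnected S)
    (hS : ∀ x ∈ S, ∀ j, x ≠ t j) {U V : ℂ → J → ℂ} (hU : OkSol t B S U) (hV : OkSol t B S V)
    {x₀ : ℂ} (hx₀ : x₀ ∈ S) (h0 : U x₀ = V x₀) : ∀ x ∈ S, U x = V x := fun x hx =>
  sub_eq_zero.1 ((hU.sub hV).eq_zero hSo hSc hS hx₀ (by simp [h0]) x hx)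

end Uniqueness

/-! ### Local solutions by power series -/

section PowerSeries

variable {E : Type*} [NormedAddCommGroup E] [NormedSpace ℂ E] [CompleteSpace E]

/-- A power series with geometrically bounded coefficients, and its Euler derivative `y d/dy`,
inside the disc of convergence. -/
lemma powerSeries_facts {G : ℕ → E} {C K : ℝ} (hK : 0 < K) (hG : ∀ m, ‖G m‖ ≤ C * K ^ m) {y : ℂ}
    (hy : ‖y‖ < K⁻¹) :
    HasSum (fun m => y ^ m • G m) (∑' m, y ^ m • G m) ∧
    DifferentiableAt ℂ (fun y => ∑' m, y ^ m • G m) y ∧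
    HasSum (fun m : ℕ => (m * y ^ m) • G m) (y • deriv (fun y => ∑' m, y ^ m • G m) y) := by
  obtain ⟨r, hr1, hr2⟩ := exists_between hy
  have hr0 : 0 < r := (norm_nonneg y).trans_lt hr1
  have hrK : r * K < 1 := by
    have := mul_lt_mul_of_pos_right hr2 hK
    rwa [inv_mul_cancel₀ hK.ne'] at this
  have hle : ∀ m (w : ℂ), w ∈ ball (0 : ℂ) r → ‖w ^ m • G m‖ ≤ C * (r * K) ^ m := by
    intro m w hw
    have hw' : ‖w‖ ≤ r := by simpa using (mem_ball_zero_iff.1 hw).le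
    have hC : 0 ≤ C * K ^ m := (norm_nonneg _).trans (hG m)
    rw [norm_smul, norm_pow]
    calc ‖w‖ ^ m * ‖G m‖ ≤ r ^ m * (C * K ^ m) := by
          gcongr
          exact hG m
      _ = _ := by rw [mul_pow]; ring
  have hsum : Summable fun m => C * (r * K) ^ m :=
    (summable_geometric_of_lt_one (by positivity) hrK).mul_left C
  have hd : ∀ m, DifferentiableOn ℂ (fun w : ℂ => w ^ m • G m) (ball 0 r) := fun m =>
    ((differentiable_id.pow m).smul_const (G m)).differentiableOn
  have hyb : y ∈ ball (0 : ℂ) r := mem_ball_zero_iff.2 hr1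
  refine ⟨(Summable.of_norm_bounded hsum fun m => hle m y hyb).hasSum,
    (Complex.differentiableOn_tsum_of_summable_norm hsum hd isOpen_ball hle).differentiableAt
      (isOpen_ball.mem_nhds hyb), ?_⟩
  have := (Complex.hasSum_deriv_of_summable_norm hsum hd isOpen_ball hle hyb).const_smul y
  convert this using 2 with m
  have h1 : HasDerivAt (fun w : ℂ => w ^ m • G m) (((m : ℂ) * y ^ (m - 1)) • G m) y :=
    (hasDerivAt_pow m y).smul_const (G m)
  rw [h1.deriv, smul_smul]
  rcases m with _ | m
  · simp
  · congr 1
    rw [Nat.add_sub_cancel]; ring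

lemma powerSeries_analyticAt {G : ℕ → E} {C K : ℝ} (hK : 0 < K) (hG : ∀ m, ‖G m‖ ≤ C * K ^ m) :
    AnalyticAt ℂ (fun y : ℂ => ∑' m, y ^ m • G m) 0 := by
  have : DifferentiableOn ℂ (fun y : ℂ => ∑' m, y ^ m • G m) (ball 0 K⁻¹) := fun y hy =>
    (powerSeries_facts hK hG (mem_ball_zero_iff.1 hy)).2.1.differentiableWithinAt
  exact this.analyticAt (isOpen_ball.mem_nhds (mem_ball_self (by positivity)))

/-- The non-vanishing quantities `z + m + 1` grow like `m`; this controls the denominators of the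
Frobenius recursions, which then lead to geometrically bounded coefficients. -/
lemma exists_nat_le_mul_norm {z : ℂ} (h : ∀ m : ℕ, z + m + 1 ≠ 0) :
    ∃ K : ℝ, 0 < K ∧ ∀ m : ℕ, (m : ℝ) + 1 ≤ K * ‖z + m + 1‖ := by
  have hlim : Tendsto (fun m : ℕ => ((m : ℝ) + 1) / ‖z + m + 1‖) atTop (𝓝 1) := by
    have h1 : Tendsto (fun m : ℕ => z * ((m : ℂ) + 1)⁻¹ + 1) atTop (𝓝 (z * 0 + 1)) := by
      refine Tendsto.add_const _ (Tendsto.const_mul _ ?_)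
      have := (tendsto_inv_atTop_nhds_zero_nat (𝕜 := ℂ)).comp (tendsto_add_atTop_nat 1)
      simpa [Function.comp_def] using this
    have h2 := (h1.norm).inv₀ (by simp)
    simp only [mul_zero, zero_add, norm_one, inv_one] at h2
    refine h2.congr fun m => ?_
    have hm : ((m : ℂ) + 1) ≠ 0 := by exact_mod_cast Nat.succ_ne_zero m
    rw [show z * ((m : ℂ) + 1)⁻¹ + 1 = (z + m + 1) / ((m : ℂ) + 1) by field_simp; ring,
      norm_div, inv_div]
    congr 1
    have : ((m : ℂ) + 1) = ((m + 1 : ℝ) : ℂ) := by push_cast; ring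
    rw [this, Complex.norm_real, Real.norm_of_nonneg (by positivity)]
  obtain ⟨K, hK⟩ := hlim.bddAbove_range
  refine ⟨max K 1, by positivity, fun m => ?_⟩
  have h1 : ((m : ℝ) + 1) / ‖z + m + 1‖ ≤ K := hK ⟨m, rfl⟩
  have h2 : 0 < ‖z + m + 1‖ := norm_pos_iff.2 (h m)
  rw [div_le_iff₀ h2] at h1
  exact h1.trans (by gcongr; exact le_max_left _ _)

lemma exists_norm_mulVec_le {J L : Type} [Fintype J] [Fintype L] (B : Matrix J L ℂ) :
    ∃ K : ℝ, 0 ≤ K ∧ ∀ g : L → ℂ, ‖B *ᵥ g‖ ≤ K * ‖g‖ := by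
  classical
  exact ⟨‖(Matrix.mulVecLin B).toContinuousLinearMap‖, norm_nonneg _, fun g =>
    (Matrix.mulVecLin B).toContinuousLinearMap.le_opNorm g⟩

omit [NormedSpace ℂ E] [CompleteSpace E] in
lemma exists_geometric_bound {G : ℕ → E} {K : ℝ} (hK : 0 ≤ K)
    (h : ∀ m, ‖G (m + 1)‖ ≤ K * ‖G m‖) : ∃ K' : ℝ, 0 < K' ∧ ∀ m, ‖G m‖ ≤ ‖G 0‖ * K' ^ m := by
  refine ⟨K + 1, by positivity, fun m => ?_⟩
  induction m with
  | zero => simp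
  | succ m ih =>
    calc ‖G (m + 1)‖ ≤ K * ‖G m‖ := h m
      _ ≤ (K + 1) * (‖G 0‖ * (K + 1) ^ m) := by gcongr; linarith
      _ = _ := by ring

end PowerSeries

section Frobenius

variable {J : Type} [Fintype J]

/-- The equation that makes `(x - c) ^ e • Ψ (x - c)` a solution near `c`. -/
def EulerFin (t : J → ℂ) (B : Matrix J J ℂ) (c e : ℂ) (Ψ : ℂ → J → ℂ) : Prop :=
  ∀ᶠ y in 𝓝 (0 : ℂ), ∀ j, (y + c - t j) * (e * Ψ y j + y * deriv Ψ y j) = y * (B *ᵥ Ψ y) j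

/-- The equation that makes `(x - c) ^ e • Φ (1 / (x - c))` a solution near infinity. -/
def EulerInf (t : J → ℂ) (B : Matrix J J ℂ) (c e : ℂ) (Φ : ℂ → J → ℂ) : Prop :=
  ∀ᶠ y in 𝓝 (0 : ℂ), ∀ j, (1 - (t j - c) * y) * (e * Φ y j - y * deriv Φ y j) = (B *ᵥ Φ y) j

/-- Existence of the local solution with exponent `e` at the singular point `c`, provided that the
block of `B` belonging to `c` is diagonal with entries `β` and `e` is not resonant. -/
lemma exists_eulerFin [DecidableEq J] {t : J → ℂ} {B : Matrix J J ℂ} {c e : ℂ} {β : J → ℂ} {a₀ : J}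
    (ha₀ : t a₀ = c) (hβ₀ : β a₀ = e)
    (hB : ∀ a b, t a = c → t b = c → B a b = if a = b then β a else 0)
    (he : ∀ m : ℕ, e + m + 1 ≠ 0) (hres : ∀ a, t a = c → ∀ m : ℕ, e + m + 1 ≠ β a) :
    ∃ Ψ : ℂ → J → ℂ, AnalyticAt ℂ Ψ 0 ∧ Ψ 0 = Pi.single a₀ 1 ∧ EulerFin t B c e Ψ := by
  classical
  -- the components of the next coefficient away from the block of `c`
  let reg : ℕ → (J → ℂ) → J → ℂ := fun m g a =>
    if t a = c then 0 else (c - t a)⁻¹ * (((B *ᵥ g) a - (e + m) * g a) / (e + m + 1))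
  -- its components in the block of `c`; these need the components just defined
  let sing : ℕ → (J → ℂ) → J → ℂ := fun m g a =>
    if t a = c then (B *ᵥ reg m g) a / (e + m + 1 - β a) else 0
  let G : ℕ → J → ℂ := fun m => Nat.rec (Pi.single a₀ 1) (fun m g => reg m g + sing m g) m
  have hG0 : G 0 = Pi.single a₀ 1 := rfl
  have hGs : ∀ m, G (m + 1) = reg m (G m) + sing m (G m) := fun m => rfl
  obtain ⟨Kb, hKb0, hKb⟩ := exists_norm_mulVec_le B
  obtain ⟨K₁, hK₁0, hK₁⟩ := exists_nat_le_mul_norm he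
  have hK₂ : ∀ a, ∃ K : ℝ, 0 < K ∧ (t a = c → ∀ m : ℕ, (m : ℝ) + 1 ≤ K * ‖e - β a + m + 1‖) := by
    intro a
    by_cases h : t a = c
    · obtain ⟨K, h1, h2⟩ := exists_nat_le_mul_norm (z := e - β a) (fun m hm =>
        hres a h m (by linear_combination hm))
      exact ⟨K, h1, fun _ => h2⟩
    · exact ⟨1, one_pos, fun h' => absurd h' h⟩
  choose K₂ hK₂0 hK₂ using hK₂
  set D := ∑ a, ‖(c - t a)⁻¹‖ with hD
  set K₃ := ∑ a, K₂ a with hK₃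
  have hD0 : 0 ≤ D := Finset.sum_nonneg fun _ _ => norm_nonneg _
  have hK₃0 : 0 ≤ K₃ := Finset.sum_nonneg fun a _ => (hK₂0 a).le
  have hinv : ∀ {K x : ℝ} {m : ℕ}, (m : ℝ) + 1 ≤ K * x → 0 ≤ x → 0 ≤ K → x⁻¹ ≤ K := by
    intro K x m h hx hK
    have h1 : 1 ≤ K * x := by
      have : (0 : ℝ) ≤ m := Nat.cast_nonneg m
      linarith
    have hx' : 0 < x := lt_of_le_of_ne hx (by rintro rfl; norm_num at h1)
    rw [inv_le_iff_one_le_mul₀ hx']; exact h1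
  have hreg : ∀ m g, ‖reg m g‖ ≤ D * (Kb * K₁ + 1 + K₁) * ‖g‖ := by
    intro m g
    refine (pi_norm_le_iff_of_nonneg (by positivity)).2 fun a => ?_
    by_cases h : t a = c
    · simp only [reg, h, if_true, norm_zero]; positivity
    · simp only [reg, h, if_false, norm_mul, norm_div]
      have h1 : ‖(c - t a)⁻¹‖ ≤ D :=
        Finset.single_le_sum (f := fun a => ‖(c - t a)⁻¹‖) (fun _ _ => norm_nonneg _)
          (Finset.mem_univ a)
      have hpos : 0 < ‖e + m + 1‖ := norm_pos_iff.2 (he m)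
      have h2 : ‖e + m + 1‖⁻¹ ≤ K₁ := hinv (hK₁ m) hpos.le hK₁0.le
      have h3 : ‖(B *ᵥ g) a - (e + m) * g a‖ ≤ (Kb + (‖e + m + 1‖ + 1)) * ‖g‖ := by
        refine (norm_sub_le _ _).trans ?_
        rw [add_mul Kb, norm_mul]
        gcongr
        · exact (norm_le_pi_norm _ a).trans (hKb g)
        · calc ‖e + m‖ = ‖(e + m + 1) - 1‖ := by ring_nf
            _ ≤ _ := (norm_sub_le _ _).trans (by simp)
        · exact norm_le_pi_norm g a
      rw [mul_assoc]
      refine mul_le_mul h1 ?_ (by positivity) hD0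
      rw [div_eq_mul_inv]
      calc _ ≤ (Kb + (‖e + m + 1‖ + 1)) * ‖g‖ * ‖e + m + 1‖⁻¹ := by gcongr
        _ = (Kb * ‖e + m + 1‖⁻¹ + 1 + ‖e + m + 1‖⁻¹) * ‖g‖ := by field_simp; ring
        _ ≤ _ := by gcongr
  have hsing : ∀ m g, ‖sing m g‖ ≤ Kb * K₃ * ‖reg m g‖ := by
    intro m g
    refine (pi_norm_le_iff_of_nonneg (by positivity)).2 fun a => ?_
    by_cases h : t a = c
    · simp only [sing, h, if_true, norm_div]
      have h2 : ‖e + m + 1 - β a‖⁻¹ ≤ K₂ a := by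
        have := hK₂ a h m
        rw [show e - β a + m + 1 = e + m + 1 - β a by ring] at this
        exact hinv this (norm_nonneg _) (hK₂0 a).le
      have h3 : K₂ a ≤ K₃ := Finset.single_le_sum (f := K₂) (fun a _ => (hK₂0 a).le)
        (Finset.mem_univ a)
      rw [div_eq_mul_inv]
      calc _ ≤ (Kb * ‖reg m g‖) * K₃ := by
            gcongr
            · exact (norm_le_pi_norm _ a).trans (hKb _)
            · exact h2.trans h3
        _ = _ := by ring
    · simp only [sing, h, if_false, norm_zero]; positivity
  have hstep : ∀ m, ‖G (m + 1)‖ ≤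
      ((1 + Kb * K₃) * (D * (Kb * K₁ + 1 + K₁))) * ‖G m‖ := by
    intro m
    rw [hGs]
    calc _ ≤ ‖reg m (G m)‖ + Kb * K₃ * ‖reg m (G m)‖ :=
          (norm_add_le _ _).trans (by gcongr; exact hsing _ _)
      _ = (1 + Kb * K₃) * ‖reg m (G m)‖ := by ring
      _ ≤ (1 + Kb * K₃) * (D * (Kb * K₁ + 1 + K₁) * ‖G m‖) := by gcongr; exact hreg _ _
      _ = _ := by ring
  obtain ⟨K, hK0, hK⟩ := exists_geometric_bound (by positivity) hstep
  -- the recursion satisfied by the coefficients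
  have hBsing : ∀ m g a, t a = c → (B *ᵥ sing m g) a = β a * sing m g a := by
    intro m g a ha
    rw [mulVec, dotProduct, Finset.sum_eq_single a]
    · rw [hB a a ha ha, if_pos rfl]
    · intro b _ hb
      by_cases h : t b = c
      · rw [hB a b ha h, if_neg hb.symm, zero_mul]
      · simp [sing, h]
    · simp
  have hrec₁ : ∀ m a, t a = c → (e + m) * G m a = (B *ᵥ G m) a := by
    intro m a ha
    rcases m with _ | m
    · rw [hG0, mulVec_single_one, col_apply, hB a a₀ ha ha₀]
      by_cases h : a = a₀
      · subst h; simp [hβ₀]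
      · simp [h]
    · have hne : e + m + 1 - β a ≠ 0 := sub_ne_zero.2 (hres a ha m)
      have h0 : reg m (G m) a = 0 := by simp [reg, ha]
      have h1 : sing m (G m) a = (B *ᵥ reg m (G m)) a / (e + m + 1 - β a) := by simp [sing, ha]
      rw [hGs, mulVec_add, Pi.add_apply, Pi.add_apply, hBsing m _ a ha, h0, zero_add]
      rw [eq_div_iff hne] at h1
      rw [← h1]; push_cast; ring
  have hrec₂ : ∀ m a, (c - t a) * ((e + m + 1) * G (m + 1) a) + (e + m) * G m a =
      (B *ᵥ G m) a := by
    intro m a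
    by_cases h : t a = c
    · rw [h, sub_self, zero_mul, zero_add, hrec₁ m a h]
    · rw [hGs, Pi.add_apply]
      simp only [reg, sing, h, if_false, add_zero]
      have h1 : c - t a ≠ 0 := sub_ne_zero.2 (Ne.symm h)
      have h2 := he m
      field_simp
      ring
  refine ⟨fun y => ∑' m, y ^ m • G m, powerSeries_analyticAt hK0 hK, ?_, ?_⟩
  · simp only
    rw [tsum_eq_single 0 (fun m hm => by simp [hm])]
    simp [hG0]
  · filter_upwards [ball_mem_nhds (0 : ℂ) (inv_pos.2 hK0)] with y hy j
    obtain ⟨h1, -, h3⟩ := powerSeries_facts hK0 hK (mem_ball_zero_iff.1 hy)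
    set Ψ : ℂ → J → ℂ := fun y => ∑' m, y ^ m • G m with hΨ
    have h1j := Pi.hasSum.1 h1 j
    have h3j := Pi.hasSum.1 h3 j
    simp only [Pi.smul_apply, smul_eq_mul] at h1j h3j
    have hBs : HasSum (fun m => y ^ m * (B *ᵥ G m) j) ((B *ᵥ Ψ y) j) := by
      have := h1.mapL ((ContinuousLinearMap.proj (R := ℂ) (φ := fun _ : J => ℂ) j).comp
        (Matrix.mulVecLin B).toContinuousLinearMap)
      simpa [mulVec_smul] using this
    have h4 : HasSum (fun m : ℕ => (e + m) * y ^ m * G m j) (e * Ψ y j + y * deriv Ψ y j) := by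
      have := (h1j.mul_left e).add h3j
      refine this.congr_fun ?_ |> fun h => h
      intro m; ring
    have h5 := (hasSum_nat_add_iff' (f := fun m : ℕ => (e + m) * y ^ m * G m j) 1).2 h4
    simp only [Finset.range_one, Finset.sum_singleton, Nat.cast_zero, add_zero, pow_zero,
      mul_one] at h5
    have h0 : (c - t j) * (e * G 0 j) = 0 := by
      by_cases h : j = a₀
      · subst h; simp [ha₀]
      · simp [hG0, h]
    have h6 := (h5.mul_left (c - t j)).add (h4.mul_left y)
    have h7 := hBs.mul_left y
    have h8 := h6.unique (h7.congr_fun fun m => by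
      rw [← hrec₂ m j]; push_cast; ring)
    linear_combination h8 + h0

/-- Existence of the local solution with exponent `e` at infinity, for a diagonalizable matrix `B`
with eigenvalues `b`. -/
lemma exists_eulerInf [DecidableEq J] {L : Type} [Fintype L] [DecidableEq L] {t : J → ℂ}
    {B : Matrix J J ℂ} {c e : ℂ} {Q : Matrix J L ℂ} {Qi : Matrix L J ℂ} {b : L → ℂ}
    (hQ : Q * Qi = 1) (hBQ : B * Q = Q * diagonal b)
    (hres : ∀ l, ∀ m : ℕ, e - m - 1 ≠ b l) {v : J → ℂ} (hv : B *ᵥ v = e • v) :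
    ∃ Φ : ℂ → J → ℂ, AnalyticAt ℂ Φ 0 ∧ Φ 0 = v ∧ EulerInf t B c e Φ := by
  let R : ℕ → Matrix J J ℂ := fun m => Q * diagonal (fun l => (e - m) / (e - m - 1 - b l)) * Qi
  let G : ℕ → J → ℂ := fun m => Nat.rec v (fun m g => R m *ᵥ fun a => (t a - c) * g a) m
  have hG0 : G 0 = v := rfl
  have hGs : ∀ m, G (m + 1) = R m *ᵥ fun a => (t a - c) * G m a := fun m => rfl
  obtain ⟨Kq, hKq0, hKq⟩ := exists_norm_mulVec_le Q
  obtain ⟨Ki, hKi0, hKi⟩ := exists_norm_mulVec_le Qi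
  have hK₂ : ∀ l, ∃ K : ℝ, 0 < K ∧ (∀ m : ℕ, (m : ℝ) + 1 ≤ K * ‖b l - e + m + 1‖) := by
    intro l
    exact exists_nat_le_mul_norm (z := b l - e) (fun m hm =>
        hres l m (by linear_combination -hm))
  choose K₂ hK₂0 hK₂ using hK₂
  set D := ∑ a, ‖t a - c‖ with hD
  set K₃ := ∑ l, K₂ l * (‖e‖ + 1) with hK₃
  have hD0 : 0 ≤ D := Finset.sum_nonneg fun _ _ => norm_nonneg _
  have hK₃0 : 0 ≤ K₃ := Finset.sum_nonneg fun a _ => mul_nonneg (hK₂0 a).le (by positivity)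
  have hstep : ∀ m, ‖G (m + 1)‖ ≤ (Kq * (K₃ * (Ki * D))) * ‖G m‖ := by
    intro m
    rw [hGs]
    simp only [R]
    rw [← mulVec_mulVec, ← mulVec_mulVec]
    have h1 : ‖fun a => (t a - c) * G m a‖ ≤ D * ‖G m‖ := by
      refine (pi_norm_le_iff_of_nonneg (by positivity)).2 fun a => ?_
      rw [norm_mul]
      gcongr
      · exact Finset.single_le_sum (f := fun a => ‖t a - c‖) (fun _ _ => norm_nonneg _)
          (Finset.mem_univ a)
      · exact norm_le_pi_norm _ a
    have h2 : ∀ g : L → ℂ, ‖diagonal (fun l => (e - m) / (e - m - 1 - b l)) *ᵥ g‖ ≤ K₃ * ‖g‖ := by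
      intro g
      refine (pi_norm_le_iff_of_nonneg (by positivity)).2 fun l => ?_
      rw [mulVec_diagonal, norm_mul]
      gcongr
      · refine le_trans ?_ (Finset.single_le_sum (f := fun l => K₂ l * (‖e‖ + 1))
          (fun l _ => mul_nonneg (hK₂0 l).le (by positivity)) (Finset.mem_univ l))
        have hpos : 0 < ‖e - m - 1 - b l‖ :=
          norm_pos_iff.2 (sub_ne_zero.2 (hres l m))
        rw [norm_div, div_le_iff₀ hpos]
        have h3 := hK₂ l m
        rw [show b l - e + m + 1 = -(e - m - 1 - b l) by ring, norm_neg] at h3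
        calc ‖e - m‖ ≤ ‖e‖ + m := (norm_sub_le _ _).trans (by simp)
          _ ≤ (‖e‖ + 1) * ((m : ℝ) + 1) := by
              have : (0 : ℝ) ≤ m := Nat.cast_nonneg m
              nlinarith [norm_nonneg e]
          _ ≤ (‖e‖ + 1) * (K₂ l * ‖e - m - 1 - b l‖) := by gcongr
          _ = _ := by ring
      · exact norm_le_pi_norm _ l
    calc _ ≤ Kq * (K₃ * (Ki * (D * ‖G m‖))) := by
          refine (hKq _).trans ?_
          gcongr
          refine (h2 _).trans ?_
          gcongr
          refine (hKi _).trans ?_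
          gcongr
      _ = _ := by ring
  obtain ⟨K, hK0, hK⟩ := exists_geometric_bound (by positivity) hstep
  have hrec : ∀ m a, (e - m - 1) * G (m + 1) a - (t a - c) * ((e - m) * G m a) =
      (B *ᵥ G (m + 1)) a := by
    intro m a
    have h1 : (e - m - 1) • G (m + 1) - B *ᵥ G (m + 1) =
        (e - m) • fun a => (t a - c) * G m a := by
      have hne : ∀ l, e - m - 1 - b l ≠ 0 := fun l => sub_ne_zero.2 (hres l m)
      have h2 : (e - m - 1) • R m - B * R m = (e - m) • (1 : Matrix J J ℂ) := by
        have h3 : B * R m = Q * (diagonal b *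
            diagonal (fun l => (e - m) / (e - m - 1 - b l))) * Qi := by
          simp only [R]
          rw [← Matrix.mul_assoc, ← Matrix.mul_assoc, hBQ, Matrix.mul_assoc Q]
        have h4 : (e - m - 1) • diagonal (fun l => (e - m) / (e - m - 1 - b l)) -
            diagonal b * diagonal (fun l => (e - m) / (e - m - 1 - b l)) =
            (e - m) • (1 : Matrix L L ℂ) := by
          rw [diagonal_mul_diagonal]
          ext l k
          have := hne l
          by_cases hlk : l = k
          · subst hlk
            simp only [Matrix.sub_apply, Matrix.smul_apply, diagonal_apply_eq, smul_eq_mul,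
              one_apply_eq, mul_one]
            field_simp
          · simp [hlk]
        calc _ = Q * ((e - m - 1) • diagonal (fun l => (e - m) / (e - m - 1 - b l)) -
              diagonal b * diagonal (fun l => (e - m) / (e - m - 1 - b l))) * Qi := by
              rw [h3, Matrix.mul_sub, Matrix.sub_mul, Matrix.mul_smul, Matrix.smul_mul]
          _ = _ := by rw [h4, Matrix.mul_smul, Matrix.smul_mul, Matrix.mul_one, hQ]
      rw [hGs, mulVec_mulVec, ← smul_mulVec, ← sub_mulVec, h2, smul_mulVec, one_mulVec]
    have h5 := congrFun h1 a
    simp only [Pi.sub_apply, Pi.smul_apply, smul_eq_mul] at h5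
    linear_combination h5
  refine ⟨fun y => ∑' m, y ^ m • G m, powerSeries_analyticAt hK0 hK, ?_, ?_⟩
  · simp only
    rw [tsum_eq_single 0 (fun m hm => by simp [hm])]
    simp [hG0]
  · filter_upwards [ball_mem_nhds (0 : ℂ) (inv_pos.2 hK0)] with y hy j
    obtain ⟨h1, -, h3⟩ := powerSeries_facts hK0 hK (mem_ball_zero_iff.1 hy)
    set Ψ : ℂ → J → ℂ := fun y => ∑' m, y ^ m • G m with hΨ
    have h1j := Pi.hasSum.1 h1 j
    have h3j := Pi.hasSum.1 h3 j
    simp only [Pi.smul_apply, smul_eq_mul] at h1j h3j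
    have hBs : HasSum (fun m => y ^ m * (B *ᵥ G m) j) ((B *ᵥ Ψ y) j) := by
      have := h1.mapL ((ContinuousLinearMap.proj (R := ℂ) (φ := fun _ : J => ℂ) j).comp
        (Matrix.mulVecLin B).toContinuousLinearMap)
      simpa [mulVec_smul] using this
    have h4 : HasSum (fun m : ℕ => (e - m) * y ^ m * G m j) (e * Ψ y j - y * deriv Ψ y j) := by
      have := (h1j.mul_left e).sub h3j
      refine this.congr_fun ?_ |> fun h => h
      intro m; ring
    have h5 := (hasSum_nat_add_iff' (f := fun m : ℕ => (e - m) * y ^ m * G m j) 1).2 h4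
    have h7 := (hasSum_nat_add_iff' (f := fun m => y ^ m * (B *ᵥ G m) j) 1).2 hBs
    simp only [Finset.range_one, Finset.sum_singleton, Nat.cast_zero, sub_zero, pow_zero,
      mul_one, one_mul] at h5 h7
    have h0 : e * G 0 j = (B *ᵥ G 0) j := by
      rw [hG0, hv]; rfl
    have h6 := h5.sub (h4.mul_left ((t j - c) * y))
    have h8 := h6.unique (h7.congr_fun fun m => by
      rw [← hrec m j]; push_cast; ring)
    linear_combination h8 + h0

end Frobenius

/-! ### Expansions along a real ray -/

section RayExpansions

variable {E : Type*} [NormedAddCommGroup E] [NormedSpace ℂ E]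

/-- `f X = (X - a) ^ e • Ψ (X - a)` for real `X > a` close to `a`, with `Ψ` analytic at `0`. -/
def RayExpFin (a : ℝ) (e : ℂ) (Ψ : ℂ → E) (f : ℝ → E) : Prop :=
  AnalyticAt ℂ Ψ 0 ∧ ∀ᶠ X : ℝ in 𝓝[>] a, f X = ((X - a : ℝ) : ℂ) ^ e • Ψ ((X - a : ℝ) : ℂ)

/-- `f X = X ^ e • Φ (1 / X)` for large real `X`, with `Φ` analytic at `0`. -/
def RayExpInf (e : ℂ) (Φ : ℂ → E) (f : ℝ → E) : Prop :=
  AnalyticAt ℂ Φ 0 ∧ ∀ᶠ X : ℝ in atTop, f X = (X : ℂ) ^ e • Φ ((X : ℂ)⁻¹)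

lemma cpow_ne_zero_of_ne {z : ℂ} (e : ℂ) (hz : z ≠ 0) : z ^ e ≠ 0 := by
  rw [Ne, cpow_eq_zero_iff]
  tauto

lemma hasDerivAt_ofReal_cpow {X : ℝ} (hX : 0 < X) (e : ℂ) :
    HasDerivAt (fun X : ℝ => (X : ℂ) ^ e) (e * (X : ℂ) ^ (e - 1)) X := by
  have h := (hasDerivAt_id (X : ℂ)).cpow_const (c := e) (Or.inl (by simpa using hX))
  have := h.comp_ofReal
  simpa using this

lemma tendsto_sub_nhdsGT (a : ℝ) :
    Tendsto (fun X : ℝ => ((X - a : ℝ) : ℂ)) (𝓝[>] a) (𝓝 0) := by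
  have : ContinuousAt (fun X : ℝ => ((X - a : ℝ) : ℂ)) a := by fun_prop
  have h := this.tendsto
  simp only [sub_self, ofReal_zero] at h
  exact h.mono_left nhdsWithin_le_nhds

lemma tendsto_inv_atTop_complex : Tendsto (fun X : ℝ => (X : ℂ)⁻¹) atTop (𝓝 0) := by
  have : Tendsto (fun X : ℝ => ((X⁻¹ : ℝ) : ℂ)) atTop (𝓝 ((0 : ℝ) : ℂ)) :=
    (Complex.continuous_ofReal.tendsto _).comp tendsto_inv_atTop_zero
  simpa using this

lemma eventually_nhds_of_nhdsGT {a : ℝ} {p : ℝ → Prop} (h : ∀ᶠ X in 𝓝[>] a, p X) :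
    ∀ᶠ X in 𝓝[>] a, ∀ᶠ Y in 𝓝 X, p Y := by
  filter_upwards [eventually_eventually_nhdsWithin.2 h, self_mem_nhdsWithin] with X hX ha
  rwa [(isOpen_Ioi).nhdsWithin_eq ha] at hX

lemma eventually_nhds_of_atTop {p : ℝ → Prop} (h : ∀ᶠ X in atTop, p X) :
    ∀ᶠ X : ℝ in atTop, ∀ᶠ Y in 𝓝 X, p Y := by
  obtain ⟨R, hR⟩ := eventually_atTop.1 h
  filter_upwards [eventually_gt_atTop R] with X hX
  filter_upwards [Ioi_mem_nhds hX] with Y hY using hR Y (le_of_lt hY)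

lemma exists_smul_of_analyticAt_zero {Ψ : ℂ → E} (h : AnalyticAt ℂ Ψ 0) (h0 : Ψ 0 = 0) :
    ∃ Ψ' : ℂ → E, AnalyticAt ℂ Ψ' 0 ∧ ∀ᶠ y in 𝓝 0, Ψ y = y • Ψ' y := by
  have h1 : ((1 : ℕ) : ℕ∞) ≤ analyticOrderAt Ψ 0 := by
    rw [Nat.cast_one, Order.one_le_iff_ne_zero]
    exact fun h' => (h.analyticOrderAt_eq_zero.1 h') h0
  obtain ⟨g, hg, hg'⟩ := (natCast_le_analyticOrderAt h).1 h1
  exact ⟨g, hg, by simpa using hg'⟩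

/-- If the leading coefficient vanishes, the expansion starts one order later. -/
lemma RayExpFin.raise {a : ℝ} {e : ℂ} {Ψ : ℂ → E} {f : ℝ → E} (h : RayExpFin a e Ψ f)
    (h0 : Ψ 0 = 0) : ∃ Ψ', RayExpFin a (e + 1) Ψ' f := by
  obtain ⟨Ψ', h1, h2⟩ := exists_smul_of_analyticAt_zero h.1 h0
  refine ⟨Ψ', h1, ?_⟩
  filter_upwards [h.2, (tendsto_sub_nhdsGT a).eventually h2, self_mem_nhdsWithin] with X h3 h4 h5
  have hX : ((X - a : ℝ) : ℂ) ≠ 0 := by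
    exact_mod_cast (sub_pos.2 h5).ne'
  rw [h3, h4, smul_smul, cpow_add _ _ hX, cpow_one]

/-- If the leading coefficient vanishes, the expansion starts one order later. -/
lemma RayExpInf.lower {e : ℂ} {Φ : ℂ → E} {f : ℝ → E} (h : RayExpInf e Φ f)
    (h0 : Φ 0 = 0) : ∃ Φ', RayExpInf (e - 1) Φ' f := by
  obtain ⟨Ψ', h1, h2⟩ := exists_smul_of_analyticAt_zero h.1 h0
  refine ⟨Ψ', h1, ?_⟩
  filter_upwards [h.2, tendsto_inv_atTop_complex.eventually h2, eventually_gt_atTop 0]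
    with X h3 h4 h5
  have hX : (X : ℂ) ≠ 0 := by exact_mod_cast h5.ne'
  rw [h3, h4, smul_smul, cpow_sub _ _ hX, cpow_one, div_eq_mul_inv]

lemma RayExpFin.deriv {a : ℝ} {e : ℂ} {Ψ : ℂ → E} {f f' : ℝ → E} [CompleteSpace E]
    (h : RayExpFin a e Ψ f)
    (hf : ∀ᶠ X in 𝓝[>] a, HasDerivAt f (f' X) X) :
    RayExpFin a (e - 1) (fun y => e • Ψ y + y • _root_.deriv Ψ y) f' := by
  refine ⟨(h.1.const_smul).add (analyticAt_id.smul h.1.deriv), ?_⟩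
  filter_upwards [hf, eventually_nhds_of_nhdsGT h.2, self_mem_nhdsWithin,
    (tendsto_sub_nhdsGT a).eventually h.1.eventually_analyticAt] with X h1 h2 h3 h4
  have hX : 0 < X - a := sub_pos.2 h3
  have hX' : ((X - a : ℝ) : ℂ) ≠ 0 := by exact_mod_cast hX.ne'
  have hs : HasDerivAt (fun X : ℝ => X - a) 1 X := (hasDerivAt_id X).sub_const a
  have d1 : HasDerivAt (fun X : ℝ => ((X - a : ℝ) : ℂ) ^ e)
      (e * ((X - a : ℝ) : ℂ) ^ (e - 1)) X := by
    have := HasDerivAt.scomp X (hasDerivAt_ofReal_cpow hX e) hs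
    simpa [Function.comp_def] using this
  have d2 : HasDerivAt (fun X : ℝ => Ψ ((X - a : ℝ) : ℂ))
      (_root_.deriv Ψ ((X - a : ℝ) : ℂ)) X := by
    have := HasDerivAt.scomp X h4.differentiableAt.hasDerivAt hs.ofReal_comp
    simpa [Function.comp_def] using this
  have d3 := d1.smul d2
  rw [h1.unique (d3.congr_of_eventuallyEq h2)]
  have : ((X - a : ℝ) : ℂ) ^ e = ((X - a : ℝ) : ℂ) ^ (e - 1) * ((X - a : ℝ) : ℂ) := by
    rw [cpow_sub _ _ hX', cpow_one, div_mul_cancel₀ _ hX']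
  rw [this, smul_add, smul_smul, smul_smul, add_comm, mul_comm e]

lemma RayExpInf.deriv {e : ℂ} {Φ : ℂ → E} {f f' : ℝ → E} [CompleteSpace E]
    (h : RayExpInf e Φ f) (hf : ∀ᶠ X in atTop, HasDerivAt f (f' X) X) :
    RayExpInf (e - 1) (fun y => e • Φ y - y • _root_.deriv Φ y) f' := by
  refine ⟨(h.1.const_smul).sub (analyticAt_id.smul h.1.deriv), ?_⟩
  filter_upwards [hf, eventually_nhds_of_atTop h.2, eventually_gt_atTop 0,
    tendsto_inv_atTop_complex.eventually h.1.eventually_analyticAt] with X h1 h2 hX h4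
  have hX' : (X : ℂ) ≠ 0 := by exact_mod_cast hX.ne'
  have d1 := hasDerivAt_ofReal_cpow hX e
  have d2 : HasDerivAt (fun X : ℝ => Φ ((X : ℂ)⁻¹))
      ((-((X : ℂ) ^ 2)⁻¹) • _root_.deriv Φ ((X : ℂ)⁻¹)) X :=
    HasDerivAt.scomp X h4.differentiableAt.hasDerivAt (hasDerivAt_inv hX').comp_ofReal
  have d3 := d1.smul d2
  rw [h1.unique (d3.congr_of_eventuallyEq h2)]
  have : (X : ℂ) ^ e = (X : ℂ) ^ (e - 1) * X := by
    rw [cpow_sub _ _ hX', cpow_one, div_mul_cancel₀ _ hX']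
  have h5 : (X : ℂ) ^ (e - 1) * X * -((X : ℂ) ^ 2)⁻¹ = -((X : ℂ) ^ (e - 1) * (X : ℂ)⁻¹) := by
    field_simp
  rw [this, smul_sub, smul_smul, smul_smul, smul_smul, h5, neg_smul, mul_comm e]
  abel

lemma RayExpFin.congr {a : ℝ} {e : ℂ} {Ψ : ℂ → E} {f g : ℝ → E} (h : RayExpFin a e Ψ f)
    (hfg : ∀ᶠ X in 𝓝[>] a, g X = f X) : RayExpFin a e Ψ g :=
  ⟨h.1, by filter_upwards [h.2, hfg] with X h1 h2 using h2.trans h1⟩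

end RayExpansions

section RayFrobenius

variable {J : Type} [Fintype J] {t : J → ℂ} {B : Matrix J J ℂ}

/-- The differential equation, in terms of the analytic factor of the solution. -/
lemma RaySol.euler {a : ℝ} {e : ℂ} {Ψ : ℂ → J → ℂ} {f : ℝ → J → ℂ} (hf : RaySol t B (Ioi a) f)
    (h : RayExpFin a e Ψ f) : ∀ᶠ X : ℝ in 𝓝[>] a, ∀ j, ((X : ℂ) - t j) *
      (e * Ψ ((X - a : ℝ) : ℂ) j + ((X - a : ℝ) : ℂ) * deriv Ψ ((X - a : ℝ) : ℂ) j) =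
      ((X - a : ℝ) : ℂ) * (B *ᵥ Ψ ((X - a : ℝ) : ℂ)) j := by
  choose! f' h1 h2 using hf
  have hd := h.deriv (f' := f') (by filter_upwards [self_mem_nhdsWithin] with X hX using h1 X hX)
  filter_upwards [h.2, hd.2, self_mem_nhdsWithin] with X h3 h4 h5 j
  have hX' : ((X - a : ℝ) : ℂ) ≠ 0 := by exact_mod_cast (sub_pos.2 h5).ne'
  have hp := cpow_ne_zero_of_ne (e - 1) hX'
  have h6 := h2 X h5 j
  have : ((X - a : ℝ) : ℂ) ^ e = ((X - a : ℝ) : ℂ) ^ (e - 1) * ((X - a : ℝ) : ℂ) := by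
    rw [cpow_sub _ _ hX', cpow_one, div_mul_cancel₀ _ hX']
  rw [h4, h3, this, mulVec_smul] at h6
  simp only [Pi.smul_apply, Pi.add_apply, smul_eq_mul] at h6
  refine mul_left_cancel₀ hp ?_
  linear_combination h6

/-- The leading coefficient of a solution at infinity is an eigenvector of `B`. -/
lemma RaySol.mulVec_leading_inf {R : ℝ} {e : ℂ} {Φ : ℂ → J → ℂ} {f : ℝ → J → ℂ}
    (hf : RaySol t B (Ioi R) f) (h : RayExpInf e Φ f) : B *ᵥ Φ 0 = e • Φ 0 := by
  choose! f' h1 h2 using hf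
  have hd := h.deriv (f' := f') (by filter_upwards [Ioi_mem_atTop R] with X hX using h1 X hX)
  funext j
  have hev : ∀ᶠ X : ℝ in atTop, (1 - t j * (X : ℂ)⁻¹) *
      (e * Φ ((X : ℂ)⁻¹) j - (X : ℂ)⁻¹ * deriv Φ ((X : ℂ)⁻¹) j) = (B *ᵥ Φ ((X : ℂ)⁻¹)) j := by
    filter_upwards [h.2, hd.2, Ioi_mem_atTop R, eventually_gt_atTop 0] with X h3 h4 h5 hX
    have hX' : (X : ℂ) ≠ 0 := by exact_mod_cast hX.ne'
    have hp := cpow_ne_zero_of_ne (e - 1) hX'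
    have h6 := h2 X h5 j
    have : (X : ℂ) ^ e = (X : ℂ) ^ (e - 1) * X := by
      rw [cpow_sub _ _ hX', cpow_one, div_mul_cancel₀ _ hX']
    rw [h4, h3, this, mulVec_smul] at h6
    simp only [Pi.smul_apply, Pi.sub_apply, smul_eq_mul] at h6
    refine mul_left_cancel₀ (mul_ne_zero hp hX') ?_
    rw [← h6]
    field_simp
  have hc : ContinuousAt (fun y : ℂ => (1 - t j * y) * (e * Φ y j - y * deriv Φ y j) -
      (B *ᵥ Φ y) j) 0 := by
    have c1 : ContinuousAt Φ 0 := h.1.continuousAt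
    have c2 : ContinuousAt (deriv Φ) 0 := h.1.deriv.continuousAt
    have c3 : ContinuousAt (fun y => (B *ᵥ Φ y) j) 0 := by
      have : Continuous fun v : J → ℂ => (B *ᵥ v) j := by
        unfold mulVec dotProduct; fun_prop
      exact this.continuousAt.comp c1
    have c4 : ContinuousAt (fun y => Φ y j) 0 := (continuous_apply j).continuousAt.comp c1
    have c5 : ContinuousAt (fun y => deriv Φ y j) 0 := (continuous_apply j).continuousAt.comp c2
    fun_prop
  have hl := hc.tendsto.comp tendsto_inv_atTop_complex
  have h0 := tendsto_nhds_unique_of_eventuallyEq hl tendsto_const_nhds (by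
    filter_upwards [hev] with X hX
    simp only [Function.comp]
    exact sub_eq_zero.2 hX)
  simp at h0
  rw [Pi.smul_apply, smul_eq_mul]
  exact (sub_eq_zero.1 h0).symm

/-- The leading coefficient of a solution at `a` is supported on the block of `a`, where it is
an eigenvector of the diagonal block. -/
lemma RaySol.leading_fin {a : ℝ} {e : ℂ} {Ψ : ℂ → J → ℂ} {f : ℝ → J → ℂ}
    (hf : RaySol t B (Ioi a) f) (h : RayExpFin a e Ψ f) :
    (∀ j, (a - t j) * (e * Ψ 0 j) = 0) ∧ ∀ j, t j = a → e * Ψ 0 j = (B *ᵥ Ψ 0) j := by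
  have hE := hf.euler h
  have c1 : ContinuousAt Ψ 0 := h.1.continuousAt
  have c2 : ContinuousAt (deriv Ψ) 0 := h.1.deriv.continuousAt
  have c3 : ∀ j, ContinuousAt (fun y => (B *ᵥ Ψ y) j) 0 := fun j => by
    have : Continuous fun v : J → ℂ => (B *ᵥ v) j := by
      unfold mulVec dotProduct; fun_prop
    exact this.continuousAt.comp c1
  have c4 : ∀ j, ContinuousAt (fun y => Ψ y j) 0 := fun j =>
    (continuous_apply j).continuousAt.comp c1
  have c5 : ∀ j, ContinuousAt (fun y => deriv Ψ y j) 0 := fun j =>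
    (continuous_apply j).continuousAt.comp c2
  constructor
  · intro j
    have c3 := c3 j
    have c4 := c4 j
    have c5 := c5 j
    have hc : ContinuousAt (fun y : ℂ => (y + a - t j) * (e * Ψ y j + y * deriv Ψ y j) -
      y * (B *ᵥ Ψ y) j) 0 := by fun_prop
    have hl := hc.tendsto.comp (tendsto_sub_nhdsGT a)
    have h0 := tendsto_nhds_unique_of_eventuallyEq hl tendsto_const_nhds (by
      filter_upwards [hE] with X hX
      simp only [Function.comp]
      have := hX j
      rw [sub_eq_zero, ← this]; push_cast; ring)
    simpa using h0
  · intro j hj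
    have c3 := c3 j
    have c4 := c4 j
    have c5 := c5 j
    have hc : ContinuousAt (fun y : ℂ => (e * Ψ y j + y * deriv Ψ y j) - (B *ᵥ Ψ y) j) 0 := by
      fun_prop
    have hl := hc.tendsto.comp (tendsto_sub_nhdsGT a)
    have h0 := tendsto_nhds_unique_of_eventuallyEq hl tendsto_const_nhds (by
      filter_upwards [hE, self_mem_nhdsWithin] with X hX h5
      simp only [Function.comp]
      have hX' : ((X - a : ℝ) : ℂ) ≠ 0 := by exact_mod_cast (sub_pos.2 h5).ne'
      have := hX j
      rw [hj, ← ofReal_sub] at this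
      rw [sub_eq_zero]
      exact mul_left_cancel₀ hX' this)
    simp at h0
    exact sub_eq_zero.1 h0

/-- A solution with expansion at a singular point is determined by its leading coefficient, if no
`e + m + 1` is an exponent at this point. -/
lemma RaySol.eventually_eq_zero [DecidableEq J] {a : ℝ} {e : ℂ} {Ψ : ℂ → J → ℂ} {f : ℝ → J → ℂ}
    {β : J → ℂ}
    (hB : ∀ i j, t i = a → t j = a → B i j = if i = j then β i else 0)
    (he : ∀ m : ℕ, e + m + 1 ≠ 0) (hres : ∀ j, t j = a → ∀ m : ℕ, e + m + 1 ≠ β j)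
    (hf : RaySol t B (Ioi a) f) (h : RayExpFin a e Ψ f) (h0 : Ψ 0 = 0) :
    ∀ᶠ X in 𝓝[>] a, f X = 0 := by
  by_cases hΨ : ∀ᶠ y in 𝓝 (0 : ℂ), Ψ y = 0
  · filter_upwards [h.2, (tendsto_sub_nhdsGT a).eventually hΨ] with X h1 h2
    rw [h1, h2, smul_zero]
  exfalso
  -- after division by the power of the order of vanishing `k + 1`, the leading coefficient would
  -- be a non-zero eigenvector with eigenvalue `e + k + 1`, which is excluded
  obtain ⟨k, Ψ₁, h1, h2, h3⟩ := h.1.exists_eventuallyEq_pow_smul_nonzero_iff.2 hΨ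
  simp only [sub_zero] at h3
  obtain ⟨k, rfl⟩ : ∃ m, k = m + 1 := by
    refine Nat.exists_eq_succ_of_ne_zero ?_
    rintro rfl
    apply h2
    have := h3.self_of_nhds
    simpa [h0] using this.symm
  have hE : RayExpFin a (e + k + 1) Ψ₁ f := by
    refine ⟨h1, ?_⟩
    filter_upwards [h.2, (tendsto_sub_nhdsGT a).eventually h3, self_mem_nhdsWithin] with X h4 h5 h6
    have hX : ((X - a : ℝ) : ℂ) ≠ 0 := by exact_mod_cast (sub_pos.2 h6).ne'
    rw [h4, h5, smul_smul, add_assoc, cpow_add _ _ hX]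
    congr 2
    exact_mod_cast (cpow_natCast ((X - a : ℝ) : ℂ) (k + 1)).symm
  obtain ⟨h4, h5⟩ := hf.leading_fin hE
  have h6 : ∀ j, t j ≠ a → Ψ₁ 0 j = 0 := by
    intro j hj
    have := h4 j
    simpa [sub_ne_zero.2 (Ne.symm hj), he k] using this
  apply h2
  funext j
  by_cases hj : t j = a
  · have h7 := h5 j hj
    have h8 : (B *ᵥ Ψ₁ 0) j = β j * Ψ₁ 0 j := by
      rw [mulVec, dotProduct, Finset.sum_eq_single j]
      · rw [hB j j hj hj, if_pos rfl]
      · intro i _ hi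
        by_cases h : t i = a
        · rw [hB j i hj h, if_neg hi.symm, zero_mul]
        · rw [h6 i h, mul_zero]
      · simp
    rw [h8] at h7
    have : (e + k + 1 - β j) * Ψ₁ 0 j = 0 := by linear_combination h7
    exact (mul_eq_zero.1 this).resolve_left (sub_ne_zero.2 (hres j hj k))
  · exact h6 j hj

end RayFrobenius

/-! ### Fractional integrals -/

section RiemannLiouville

/-- The (unnormalized) Riemann-Liouville integral `∫_a^X (X - ξ) ^ ν φ(ξ) dξ`. -/
def rl (a : ℝ) (ν : ℂ) (φ : ℝ → ℂ) (X : ℝ) : ℂ :=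
  ∫ ξ in a..X, ((X - ξ : ℝ) : ℂ) ^ ν * φ ξ

lemma continuous_max_cpow {ν : ℂ} (hν : 0 < ν.re) :
    Continuous fun x : ℝ => ((max x 0 : ℝ) : ℂ) ^ ν :=
  (Complex.continuous_ofReal_cpow_const hν).comp (continuous_id.max continuous_const)

lemma hasDerivAt_max_cpow {ν : ℂ} (hν : 1 < ν.re) (x : ℝ) :
    HasDerivAt (fun x : ℝ => ((max x 0 : ℝ) : ℂ) ^ ν) (ν * ((max x 0 : ℝ) : ℂ) ^ (ν - 1)) x := by
  have h0 : ν ≠ 0 := by rintro rfl; norm_num at hν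
  have h1 : ν - 1 ≠ 0 := by
    intro h; rw [sub_eq_zero] at h; rw [h] at hν; norm_num at hν
  have hν' : 0 < (ν - 1).re := by simpa using hν
  refine hasDerivAt_of_hasDerivAt_of_ne' (x := 0)
    (g := fun x : ℝ => ν * ((max x 0 : ℝ) : ℂ) ^ (ν - 1)) (fun y hy => ?_)
    (continuous_max_cpow (by linarith)).continuousAt
    (continuous_const.mul (continuous_max_cpow hν')).continuousAt x
  rcases lt_or_gt_of_ne hy with h | h
  · have : (fun x : ℝ => ((max x 0 : ℝ) : ℂ) ^ ν) =ᶠ[𝓝 y] fun _ => 0 := by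
      filter_upwards [Iio_mem_nhds h] with z hz
      rw [max_eq_right (le_of_lt hz), ofReal_zero, zero_cpow h0]
    simp only [max_eq_right h.le, ofReal_zero, zero_cpow h1, mul_zero]
    exact (hasDerivAt_const y (0 : ℂ)).congr_of_eventuallyEq this
  · have : (fun x : ℝ => ((max x 0 : ℝ) : ℂ) ^ ν) =ᶠ[𝓝 y] fun x : ℝ => (x : ℂ) ^ ν := by
      filter_upwards [Ioi_mem_nhds h] with z hz
      rw [max_eq_left (le_of_lt hz)]
    simp only [max_eq_left h.le]
    exact (hasDerivAt_ofReal_cpow h ν).congr_of_eventuallyEq this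

variable {a : ℝ} {ν : ℂ} {φ : ℝ → ℂ}

lemma continuous_sub_cpow (hν : 0 < ν.re) (X : ℝ) :
    Continuous fun ξ : ℝ => ((X - ξ : ℝ) : ℂ) ^ ν :=
  (Complex.continuous_ofReal_cpow_const hν).comp (continuous_const.sub continuous_id)

lemma rl_intervalIntegrable (hν : 0 < ν.re) (hφ : Continuous φ) (X b c : ℝ) :
    IntervalIntegrable (fun ξ : ℝ => ((X - ξ : ℝ) : ℂ) ^ ν * φ ξ) volume b c :=
  ((continuous_sub_cpow hν X).mul hφ).intervalIntegrable _ _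

/-- The kernel, extended by zero, allows a domain of integration that does not depend on `X`; then
the integral is differentiated under the integral sign. -/
lemma rl_eq_max (hν : 0 < ν.re) (hφ : Continuous φ) {X b : ℝ} (hX : a ≤ X) (hb : X ≤ b) :
    rl a ν φ X = ∫ ξ in a..b, ((max (X - ξ) 0 : ℝ) : ℂ) ^ ν * φ ξ := by
  have h0 : ν ≠ 0 := by rintro rfl; norm_num at hν
  have hc : Continuous fun ξ : ℝ => ((max (X - ξ) 0 : ℝ) : ℂ) ^ ν * φ ξ :=
    ((continuous_max_cpow hν).comp (continuous_const.sub continuous_id)).mul hφ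
  rw [← intervalIntegral.integral_add_adjacent_intervals (b := X)
    (hc.intervalIntegrable _ _) (hc.intervalIntegrable _ _)]
  have h2 : ∫ ξ in X..b, ((max (X - ξ) 0 : ℝ) : ℂ) ^ ν * φ ξ = 0 := by
    rw [intervalIntegral.integral_congr (g := fun _ => 0)]
    · simp
    · intro ξ hξ
      rw [uIcc_of_le hb] at hξ
      simp only
      rw [max_eq_right (by linarith [hξ.1]), ofReal_zero, zero_cpow h0, zero_mul]
  rw [h2, add_zero]
  refine intervalIntegral.integral_congr fun ξ hξ => ?_
  rw [uIcc_of_le hX] at hξ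
  rw [max_eq_left (by linarith [hξ.2])]

lemma hasDerivAt_rl (hν : 1 < ν.re) (hφ : Continuous φ) {X : ℝ} (hX : a < X) :
    HasDerivAt (rl a ν φ) (ν * rl a (ν - 1) φ X) X := by
  have hν0 : 0 < ν.re := by linarith
  have hν' : 0 < (ν - 1).re := by simpa using hν
  set b := X + 1
  obtain ⟨K, hK⟩ := (isCompact_Icc (a := a) (b := b)).exists_bound_of_continuousOn hφ.continuousOn
  have hIoc : uIoc a b ⊆ Icc a b := by
    rw [uIoc_of_le (by simp only [b]; linarith)]; exact Ioc_subset_Icc_self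
  have hnhds : Ioo a b ∈ 𝓝 X := Ioo_mem_nhds hX (by simp [b])
  have hc : ∀ Y : ℝ, ∀ {μ : ℂ}, 0 < μ.re →
      Continuous fun ξ : ℝ => ((max (Y - ξ) 0 : ℝ) : ℂ) ^ μ * φ ξ := fun Y μ h =>
    ((continuous_max_cpow h).comp (continuous_const.sub continuous_id)).mul hφ
  have key := intervalIntegral.hasDerivAt_integral_of_dominated_loc_of_deriv_le
    (μ := volume) (a := a) (b := b)
    (F := fun Y ξ => ((max (Y - ξ) 0 : ℝ) : ℂ) ^ ν * φ ξ)
    (F' := fun Y ξ => ν * ((max (Y - ξ) 0 : ℝ) : ℂ) ^ (ν - 1) * φ ξ)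
    (x₀ := X) (s := Ioo a b) (bound := fun _ => ‖ν‖ * (b - a) ^ (ν - 1).re * K)
    hnhds (.of_forall fun Y => (hc Y hν0).aestronglyMeasurable)
    ((hc X hν0).intervalIntegrable _ _) ?_ ?_ intervalIntegrable_const ?_
  · have h2 := key.2
    have h3 : rl a ν φ =ᶠ[𝓝 X] fun Y => ∫ ξ in a..b, ((max (Y - ξ) 0 : ℝ) : ℂ) ^ ν * φ ξ := by
      filter_upwards [hnhds] with Y hY using rl_eq_max hν0 hφ hY.1.le hY.2.le
    refine (h2.congr_of_eventuallyEq h3).congr_deriv ?_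
    rw [rl_eq_max hν' hφ hX.le (b := b) (by simp [b]), ← intervalIntegral.integral_const_mul]
    exact intervalIntegral.integral_congr fun ξ _ => by ring
  · have := (hc X hν').const_mul ν
    exact (this.congr fun ξ => (mul_assoc _ _ _).symm).aestronglyMeasurable
  · refine .of_forall fun ξ hξ Y hY => ?_
    have hξ' := hIoc hξ
    rw [norm_mul, norm_mul]
    have hba : 0 ≤ b - a := by linarith [hY.1, hY.2]
    have hpow : ‖((max (Y - ξ) 0 : ℝ) : ℂ) ^ (ν - 1)‖ ≤ (b - a) ^ (ν - 1).re := by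
      rcases le_or_gt (Y - ξ) 0 with h | h
      · rw [max_eq_right h, ofReal_zero, zero_cpow (by
          intro h; rw [sub_eq_zero] at h; rw [h] at hν; norm_num at hν), norm_zero]
        exact Real.rpow_nonneg hba _
      · rw [max_eq_left h.le, norm_cpow_eq_rpow_re_of_pos h]
        exact Real.rpow_le_rpow h.le (by linarith [hY.2, hξ'.1]) hν'.le
    gcongr
    exact hK ξ hξ'
  · refine .of_forall fun ξ _ Y _ => ?_
    have h1 := hasDerivAt_max_cpow hν (Y - ξ)
    have h2 := HasDerivAt.scomp Y h1 ((hasDerivAt_id Y).sub_const ξ)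
    simpa [Function.comp_def] using h2.mul_const (φ ξ)

/-- Splitting off one factor `X - ξ` of the kernel. -/
lemma rl_mul_id (hν : 1 < ν.re) (hφ : Continuous φ) (X : ℝ) :
    rl a ν φ X = X * rl a (ν - 1) φ X - rl a (ν - 1) (fun ξ => ξ * φ ξ) X := by
  have hν' : 0 < (ν - 1).re := by simpa using hν
  have h0 : ν ≠ 0 := by rintro rfl; norm_num at hν
  have h1 : ν - 1 ≠ 0 := by
    intro h; rw [sub_eq_zero] at h; rw [h] at hν; norm_num at hν
  unfold rl
  rw [← intervalIntegral.integral_const_mul, ← intervalIntegral.integral_sub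
    ((rl_intervalIntegrable hν' hφ X a X).const_mul _)
    (rl_intervalIntegrable hν' (by fun_prop) X a X)]
  refine intervalIntegral.integral_congr fun ξ _ => ?_
  rcases eq_or_ne ((X - ξ : ℝ) : ℂ) 0 with h | h
  · rw [h, zero_cpow h0, zero_cpow h1]; ring
  · have : ((X - ξ : ℝ) : ℂ) ^ ν = ((X - ξ : ℝ) : ℂ) ^ (ν - 1) * ((X - ξ : ℝ) : ℂ) := by
      rw [cpow_sub _ _ h, cpow_one, div_mul_cancel₀ _ h]
    rw [this]; push_cast; ring

/-- Integration by parts. -/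
lemma rl_deriv {φ' : ℝ → ℂ} (hν : 1 < ν.re) (hφ : Continuous φ) (hφ' : Continuous φ')
    (h0 : φ a = 0) (hd : ∀ ξ, a < ξ → HasDerivAt φ (φ' ξ) ξ) {X : ℝ} (hX : a ≤ X) :
    ν * rl a (ν - 1) φ X = rl a ν φ' X := by
  have hν0 : 0 < ν.re := by linarith
  have hν' : 0 < (ν - 1).re := by simpa using hν
  have hne : ν ≠ 0 := by rintro rfl; norm_num at hν
  have key := intervalIntegral.integral_eq_sub_of_hasDerivAt_of_le hX
    (f := fun ξ => ((X - ξ : ℝ) : ℂ) ^ ν * φ ξ)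
    (f' := fun ξ => ((X - ξ : ℝ) : ℂ) ^ ν * φ' ξ - ν * (((X - ξ : ℝ) : ℂ) ^ (ν - 1) * φ ξ))
    ((continuous_sub_cpow hν0 X).mul hφ).continuousOn ?_
    ((rl_intervalIntegrable hν0 hφ' X a X).sub ((rl_intervalIntegrable hν' hφ X a X).const_mul _))
  · rw [intervalIntegral.integral_sub (rl_intervalIntegrable hν0 hφ' X a X)
      ((rl_intervalIntegrable hν' hφ X a X).const_mul _), intervalIntegral.integral_const_mul] at key
    simp only [sub_self, ofReal_zero, zero_cpow hne, zero_mul, h0, mul_zero] at key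
    exact (sub_eq_zero.1 key).symm
  · intro ξ hξ
    have h1 := hasDerivAt_ofReal_cpow (X := X - ξ) (by linarith [hξ.2]) ν
    have h2 := HasDerivAt.scomp ξ h1 ((hasDerivAt_id ξ).const_sub X)
    have h3 := h2.mul (hd ξ hξ.1)
    refine h3.congr_deriv ?_
    simp only [Function.comp, neg_smul, one_smul]
    ring

lemma rl_add (hν : 0 < ν.re) {ψ : ℝ → ℂ} (hφ : Continuous φ) (hψ : Continuous ψ) (X : ℝ) :
    rl a ν (fun ξ => φ ξ + ψ ξ) X = rl a ν φ X + rl a ν ψ X := by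
  unfold rl
  rw [← intervalIntegral.integral_add (rl_intervalIntegrable hν hφ X a X)
    (rl_intervalIntegrable hν hψ X a X)]
  exact intervalIntegral.integral_congr fun ξ _ => by simp only; ring

lemma rl_const_mul (c : ℂ) (X : ℝ) :
    rl a ν (fun ξ => c * φ ξ) X = c * rl a ν φ X := by
  unfold rl
  rw [← intervalIntegral.integral_const_mul]
  exact intervalIntegral.integral_congr fun ξ _ => by simp only; ring

lemma rl_sum (hν : 0 < ν.re) {ι : Type*} (s : Finset ι) {φ : ι → ℝ → ℂ}
    (hφ : ∀ i, Continuous (φ i)) (X : ℝ) :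
    rl a ν (fun ξ => ∑ i ∈ s, φ i ξ) X = ∑ i ∈ s, rl a ν (φ i) X := by
  unfold rl
  rw [← intervalIntegral.integral_finsetSum fun i _ => rl_intervalIntegrable hν (hφ i) X a X]
  exact intervalIntegral.integral_congr fun ξ _ => by simp only [Finset.mul_sum]

/-- Asymptotics of the fractional integral of a function with `φ(X) ∼ g X ^ κ`. -/
lemma tendsto_rl (hν : 0 < ν.re) {κ g : ℂ} (hκ : 0 < κ.re) (ha : 0 ≤ a) (hφ : Continuous φ)
    (hφ0 : ∀ ξ ≤ a, φ ξ = 0)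
    (hlim : Tendsto (fun X : ℝ => (X : ℂ) ^ (-κ) * φ X) atTop (𝓝 g)) :
    Tendsto (fun X : ℝ => (X : ℂ) ^ (-(ν + κ + 1)) * rl a ν φ X) atTop
      (𝓝 (betaIntegral (κ + 1) (ν + 1) * g)) := by
  -- a bound for `φ`
  obtain ⟨K, hK0, hK⟩ : ∃ K : ℝ, 0 ≤ K ∧ ∀ ξ : ℝ, 0 ≤ ξ → ‖φ ξ‖ ≤ K * (1 + ξ) ^ κ.re := by
    have h1 := (hlim.norm.eventually (eventually_le_nhds (lt_add_one ‖g‖)))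
    obtain ⟨R, hR⟩ := eventually_atTop.1 (h1.and (eventually_gt_atTop 0))
    obtain ⟨K₀, hK₀⟩ := (isCompact_Icc (a := 0) (b := R)).exists_bound_of_continuousOn
      hφ.continuousOn
    refine ⟨max K₀ (‖g‖ + 1), le_max_of_le_right (by positivity), fun ξ hξ => ?_⟩
    have hone : 1 ≤ (1 + ξ) ^ κ.re := Real.one_le_rpow (by linarith) hκ.le
    rcases le_or_gt ξ R with h | h
    · calc ‖φ ξ‖ ≤ K₀ := hK₀ ξ ⟨hξ, h⟩
        _ ≤ max K₀ (‖g‖ + 1) * 1 := by rw [mul_one]; exact le_max_left _ _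
        _ ≤ _ := by gcongr
    · obtain ⟨h2, h3⟩ := hR ξ h.le
      have h4 : ‖(ξ : ℂ) ^ (-κ)‖ = (ξ ^ κ.re)⁻¹ := by
        rw [norm_cpow_eq_rpow_re_of_pos h3, neg_re, Real.rpow_neg h3.le]
      rw [norm_mul, h4] at h2
      have h5 : 0 < ξ ^ κ.re := Real.rpow_pos_of_pos h3 _
      rw [inv_mul_le_iff₀ h5] at h2
      calc ‖φ ξ‖ ≤ ξ ^ κ.re * (‖g‖ + 1) := h2
        _ ≤ (1 + ξ) ^ κ.re * max K₀ (‖g‖ + 1) := by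
            gcongr
            · linarith
            · exact le_max_right _ _
        _ = _ := mul_comm _ _
  -- after the substitution `ξ = X y`, dominated convergence applies
  have hI : Tendsto (fun X : ℝ => ∫ y in (0 : ℝ)..1,
      ((1 - y : ℝ) : ℂ) ^ ν * ((X : ℂ) ^ (-κ) * φ (X * y))) atTop
      (𝓝 (∫ y in (0 : ℝ)..1, ((1 - y : ℝ) : ℂ) ^ ν * ((y : ℂ) ^ κ * g))) := by
    refine intervalIntegral.tendsto_integral_filter_of_dominated_convergence
      (fun _ => 1 * (K * 2 ^ κ.re)) (.of_forall fun X => ?_) ?_ intervalIntegrable_const ?_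
    · have : Continuous fun y : ℝ => ((1 - y : ℝ) : ℂ) ^ ν * ((X : ℂ) ^ (-κ) * φ (X * y)) :=
        (continuous_sub_cpow hν 1).mul
          (continuous_const.mul (hφ.comp (continuous_const.mul continuous_id)))
      exact this.aestronglyMeasurable
    · filter_upwards [eventually_ge_atTop 1] with X hX
      refine .of_forall fun y hy => ?_
      rw [uIoc_of_le zero_le_one] at hy
      have hX0 : 0 < X := by linarith
      have hXy : 0 ≤ X * y := mul_nonneg hX0.le hy.1.le
      rw [norm_mul]
      refine mul_le_mul ?_ ?_ (norm_nonneg _) zero_le_one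
      · rcases eq_or_lt_of_le hy.2 with h | h
        · have : ν ≠ 0 := by rintro rfl; norm_num at hν
          rw [h, sub_self, ofReal_zero, zero_cpow this, norm_zero]; exact zero_le_one
        · rw [norm_cpow_eq_rpow_re_of_pos (by linarith)]
          exact Real.rpow_le_one (by linarith) (by linarith [hy.1]) hν.le
      · rw [norm_mul, norm_cpow_eq_rpow_re_of_pos hX0, neg_re, Real.rpow_neg hX0.le]
        have h5 : 0 < X ^ κ.re := Real.rpow_pos_of_pos hX0 _
        rw [inv_mul_le_iff₀ h5]
        calc ‖φ (X * y)‖ ≤ K * (1 + X * y) ^ κ.re := hK _ hXy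
          _ ≤ K * (X * 2) ^ κ.re := by
              gcongr
              nlinarith [hy.2]
          _ = _ := by rw [Real.mul_rpow hX0.le (by norm_num)]; ring
    · refine .of_forall fun y hy => ?_
      rw [uIoc_of_le zero_le_one] at hy
      refine Tendsto.const_mul _ ?_
      have h1 := (hlim.comp (tendsto_id.atTop_mul_const hy.1)).const_mul ((y : ℂ) ^ κ)
      refine h1.congr' ?_
      filter_upwards [eventually_gt_atTop 0] with X hX
      have hy0 : (y : ℂ) ≠ 0 := by exact_mod_cast hy.1.ne'
      simp only [Function.comp, id]
      rw [ofReal_mul, mul_cpow_ofReal_nonneg hX.le hy.1.le, cpow_neg (y : ℂ)]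
      have := cpow_ne_zero_of_ne κ hy0
      field_simp
  have hb : ∫ y in (0 : ℝ)..1, ((1 - y : ℝ) : ℂ) ^ ν * ((y : ℂ) ^ κ * g) =
      betaIntegral (κ + 1) (ν + 1) * g := by
    rw [betaIntegral, ← intervalIntegral.integral_mul_const]
    refine intervalIntegral.integral_congr fun y _ => ?_
    simp only [add_sub_cancel_right]
    push_cast; ring
  rw [hb] at hI
  refine hI.congr' ?_
  filter_upwards [eventually_gt_atTop 0, eventually_ge_atTop a] with X hX hXa
  have hX' : (X : ℂ) ≠ 0 := by exact_mod_cast hX.ne'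
  have h0 : rl a ν φ X = ∫ ξ in (0 : ℝ)..X, ((X - ξ : ℝ) : ℂ) ^ ν * φ ξ := by
    rw [← intervalIntegral.integral_add_adjacent_intervals (b := a)
      (rl_intervalIntegrable hν hφ X 0 a) (rl_intervalIntegrable hν hφ X a X)]
    rw [intervalIntegral.integral_congr (a := 0) (b := a) (g := fun _ => 0)]
    · simp [rl]
    · intro ξ hξ
      rw [uIcc_of_le ha] at hξ
      simp [hφ0 ξ hξ.2]
  have h1 := intervalIntegral.smul_integral_comp_mul_left (a := 0) (b := 1)
    (fun ξ : ℝ => ((X - ξ : ℝ) : ℂ) ^ ν * φ ξ) X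
  rw [mul_zero, mul_one] at h1
  rw [h0, ← h1, Complex.real_smul, ← intervalIntegral.integral_const_mul,
    ← intervalIntegral.integral_const_mul]
  refine intervalIntegral.integral_congr fun y hy => ?_
  rw [uIcc_of_le zero_le_one] at hy
  rw [show X - X * y = X * (1 - y) by ring, ofReal_mul X,
    mul_cpow_ofReal_nonneg hX.le (by linarith [hy.2]), neg_add, neg_add, cpow_add _ _ hX',
    cpow_add _ _ hX', cpow_neg (X : ℂ) ν, cpow_neg (X : ℂ) 1, cpow_one]
  have := cpow_ne_zero_of_ne ν hX'
  field_simp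

/-- The fractional integral of `(ξ - a) ^ α N(ξ - a)` is `(X - a) ^ (α + ν + 1)` times an analytic
function. -/
lemma rl_rayExpFin (hν : 0 < ν.re) {α : ℂ} (hα : 0 < α.re) {N : ℂ → ℂ} (hφ : Continuous φ)
    (h : RayExpFin a α N φ) : ∃ N' : ℂ → ℂ, RayExpFin a (α + ν + 1) N' (rl a ν φ) ∧
      N' 0 = betaIntegral (α + 1) (ν + 1) * N 0 := by
  obtain ⟨ε, hε, hεN⟩ := Metric.eventually_nhds_iff_ball.1 h.1.eventually_analyticAt
  have hdN : DifferentiableOn ℂ N (ball 0 ε) := fun y hy =>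
    (hεN y hy).differentiableAt.differentiableWithinAt
  have hdN' : ContinuousOn (deriv N) (ball 0 ε) := (hdN.deriv isOpen_ball).continuousOn
  have hsub : closedBall (0 : ℂ) (ε / 2) ⊆ ball 0 ε := closedBall_subset_ball (by linarith)
  obtain ⟨K, hK⟩ := (isCompact_closedBall (0 : ℂ) (ε / 2)).exists_bound_of_continuousOn
    (hdN'.mono hsub)
  have hmem : ∀ q ∈ ball (0 : ℂ) (ε / 2), ∀ y ∈ Icc (0 : ℝ) 1,
      q * y ∈ closedBall (0 : ℂ) (ε / 2) := by
    intro q hq y hy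
    rw [mem_closedBall_zero_iff, norm_mul, Complex.norm_real, Real.norm_of_nonneg hy.1]
    have := mem_ball_zero_iff.1 hq
    nlinarith [norm_nonneg q, hy.2]
  have hc1 : Continuous fun y : ℝ => ((y : ℝ) : ℂ) ^ α := Complex.continuous_ofReal_cpow_const hα
  have hc2 : Continuous fun y : ℝ => ((1 - y : ℝ) : ℂ) ^ ν := continuous_sub_cpow hν 1
  obtain ⟨K', hK'⟩ := (isCompact_Icc (a := (0 : ℝ)) (b := 1)).exists_bound_of_continuousOn
    (hc1.mul hc2).continuousOn
  have hIoc : uIoc (0 : ℝ) 1 ⊆ Icc 0 1 := by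
    rw [uIoc_of_le zero_le_one]; exact Ioc_subset_Icc_self
  have hcN : ∀ q ∈ ball (0 : ℂ) (ε / 2), ContinuousOn (fun y : ℝ => N (q * y)) (Icc 0 1) :=
    fun q hq => hdN.continuousOn.comp (by fun_prop) fun y hy => hsub (hmem q hq y hy)
  have hcN' : ∀ q ∈ ball (0 : ℂ) (ε / 2), ContinuousOn (fun y : ℝ => deriv N (q * y)) (Icc 0 1) :=
    fun q hq => hdN'.comp (by fun_prop) fun y hy => hsub (hmem q hq y hy)
  let N' : ℂ → ℂ := fun q => ∫ y in (0 : ℝ)..1, (y : ℂ) ^ α * ((1 - y : ℝ) : ℂ) ^ ν * N (q * y)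
  have hN' : DifferentiableOn ℂ N' (ball 0 (ε / 2)) := by
    intro q hq
    have key := intervalIntegral.hasDerivAt_integral_of_dominated_loc_of_deriv_le
      (μ := volume) (a := 0) (b := 1) (𝕜 := ℂ)
      (F := fun q (y : ℝ) => (y : ℂ) ^ α * ((1 - y : ℝ) : ℂ) ^ ν * N (q * y))
      (F' := fun q (y : ℝ) => (y : ℂ) ^ α * ((1 - y : ℝ) : ℂ) ^ ν * (deriv N (q * y) * y))
      (x₀ := q) (s := ball 0 (ε / 2)) (bound := fun _ => K' * (K * 1))
      (isOpen_ball.mem_nhds hq) ?_ ?_ ?_ ?_ intervalIntegrable_const ?_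
    · exact key.2.differentiableAt.differentiableWithinAt
    · filter_upwards [isOpen_ball.mem_nhds hq] with p hp
      exact (((hc1.mul hc2).continuousOn.mul (hcN p hp)).mono hIoc).aestronglyMeasurable
        measurableSet_uIoc
    · exact (((hc1.mul hc2).continuousOn.mul (hcN q hq)).mono
        (by rw [uIcc_of_le zero_le_one])).intervalIntegrable
    · exact (((hc1.mul hc2).continuousOn.mul ((hcN' q hq).mul
        Complex.continuous_ofReal.continuousOn)).mono hIoc).aestronglyMeasurable measurableSet_uIoc
    · refine .of_forall fun y hy p hp => ?_
      rw [norm_mul, norm_mul (deriv N _)]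
      have hK0 : 0 ≤ K := (norm_nonneg _).trans (hK _ (hmem p hp y (hIoc hy)))
      have hK'0 : 0 ≤ K' := (norm_nonneg _).trans (hK' _ (hIoc hy))
      gcongr
      · exact hK' y (hIoc hy)
      · exact hK _ (hmem p hp y (hIoc hy))
      · rw [Complex.norm_real, Real.norm_of_nonneg (hIoc hy).1]; exact (hIoc hy).2
    · refine .of_forall fun y hy p hp => ?_
      have h1 := (hεN _ (hsub (hmem p hp y (hIoc hy)))).differentiableAt.hasDerivAt
      have h2 := HasDerivAt.comp p h1 ((hasDerivAt_id p).mul_const (y : ℂ))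
      simpa using h2.const_mul ((y : ℂ) ^ α * ((1 - y : ℝ) : ℂ) ^ ν)
  refine ⟨N', ⟨hN'.analyticAt (ball_mem_nhds _ (by positivity)), ?_⟩, ?_⟩
  · obtain ⟨b, hab, hb⟩ := mem_nhdsGT_iff_exists_Ioo_subset.1 h.2
    filter_upwards [Ioo_mem_nhdsGT hab] with X hX
    have hXa : 0 < X - a := sub_pos.2 hX.1
    have hX' : ((X - a : ℝ) : ℂ) ≠ 0 := by exact_mod_cast hXa.ne'
    have h1 := intervalIntegral.smul_integral_comp_add_mul (a := 0) (b := 1)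
      (fun ξ : ℝ => ((X - ξ : ℝ) : ℂ) ^ ν * φ ξ) (X - a) a
    rw [mul_zero, mul_one, add_zero, add_sub_cancel] at h1
    rw [rl, ← h1, Complex.real_smul, smul_eq_mul, ← intervalIntegral.integral_const_mul,
      ← intervalIntegral.integral_const_mul]
    have hα0 : α ≠ 0 := by rintro rfl; norm_num at hα
    have ha0 : φ a = 0 := by
      have l1 : Tendsto φ (𝓝[>] a) (𝓝 (φ a)) := hφ.continuousAt.tendsto.mono_left nhdsWithin_le_nhds
      have l2 : Tendsto (fun X : ℝ => ((X - a : ℝ) : ℂ) ^ α • N ((X - a : ℝ) : ℂ)) (𝓝[>] a)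
          (𝓝 (((0 : ℝ) : ℂ) ^ α • N 0)) := by
        have l3 : Tendsto (fun X : ℝ => ((X - a : ℝ) : ℂ) ^ α) (𝓝 a) (𝓝 (((0 : ℝ) : ℂ) ^ α)) := by
          have := (hc1.comp (continuous_id.sub (continuous_const (y := a)))).tendsto a
          simpa [Function.comp_def] using this
        exact (l3.mono_left nhdsWithin_le_nhds).smul
          (h.1.continuousAt.tendsto.comp (tendsto_sub_nhdsGT a))
      rw [ofReal_zero, zero_cpow hα0, zero_smul] at l2
      exact tendsto_nhds_unique_of_eventuallyEq l1 l2 h.2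
    refine intervalIntegral.integral_congr fun y hy => ?_
    rw [uIcc_of_le zero_le_one] at hy
    have e1 : φ (a + (X - a) * y) = (((X - a) * y : ℝ) : ℂ) ^ α * N (((X - a) * y : ℝ) : ℂ) := by
      rcases eq_or_lt_of_le hy.1 with h0 | h0
      · rw [← h0, mul_zero, add_zero, ha0, ofReal_zero, zero_cpow hα0, zero_mul]
      · have hm : a + (X - a) * y ∈ Ioo a b := by
          constructor
          · nlinarith
          · nlinarith [hX.2, hy.2]
        have := hb hm
        simp only [mem_ofPred_eq, add_sub_cancel_left, smul_eq_mul] at this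
        exact this
    rw [e1, show X - (a + (X - a) * y) = (X - a) * (1 - y) by ring, ofReal_mul (X - a),
      ofReal_mul (X - a), mul_cpow_ofReal_nonneg hXa.le (by linarith [hy.2]),
      mul_cpow_ofReal_nonneg hXa.le hy.1, cpow_add _ _ hX', cpow_add _ _ hX', cpow_one]
    ring
  · simp only [N', zero_mul, intervalIntegral.integral_mul_const]
    congr 1
    rw [betaIntegral]
    refine intervalIntegral.integral_congr fun y _ => ?_
    simp only [add_sub_cancel_right]
    push_cast; ring

end RiemannLiouville

/-! ### The system along a real ray -/

/-- The coefficient matrix of the rank `2n` system, in terms of `A`, `P`, `Q = P⁻¹`, `ρ₁`, `ρ₂`. -/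
def bigMat {R K : Type} [Fintype R] [Fintype K] [DecidableEq K] (A : Matrix R R ℂ)
    (P : Matrix R K ℂ) (Q : Matrix K R ℂ) (ρ₁ ρ₂ : ℂ) : Matrix (R ⊕ K) (R ⊕ K) ℂ :=
  fromBlocks A P
    (-((Q * A * P - ρ₁ • (1 : Matrix K K ℂ)) * (Q * A * P - ρ₂ • (1 : Matrix K K ℂ)) * Q))
    ((ρ₁ + ρ₂) • (1 : Matrix K K ℂ) - Q * A * P)

/-- The data of the rank `2n` system in a coordinate in which the last singular point is `0`:
the other singular points are the `τ i`, and `Q = P⁻¹` diagonalizes `A`. -/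
structure RaySys (R K : Type) [Fintype R] [Fintype K] [DecidableEq R] [DecidableEq K] where
  A : Matrix R R ℂ
  P : Matrix R K ℂ
  Q : Matrix K R ℂ
  τ : R → ℂ
  mu : K → ℂ
  ρ₁ : ℂ
  ρ₂ : ℂ
  PQ : P * Q = 1
  QP : Q * P = 1
  QAP : Q * A * P = diagonal mu
  τ_ne : ∀ i, τ i ≠ 0
  ρ₁_notInt : NotInt ρ₁
  ρ₂_notInt : NotInt ρ₂
  ρ₁₂_notInt : NotInt (ρ₁ - ρ₂)
  ρ₁_mu_notInt : ∀ k, NotInt (ρ₁ - mu k)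
  ρ₂_mu_notInt : ∀ k, NotInt (ρ₂ - mu k)

namespace RaySys

variable {R K : Type} [Fintype R] [Fintype K] [DecidableEq R] [DecidableEq K] (s : RaySys R K)

/-- The coefficient matrix of the system. -/
def B : Matrix (R ⊕ K) (R ⊕ K) ℂ := bigMat s.A s.P s.Q s.ρ₁ s.ρ₂

/-- The singular points attached to the components. -/
def T : R ⊕ K → ℂ := Sum.elim s.τ fun _ => 0

/-- `g` solves the underlying system on the ray, written in the coordinate `ξ` inverse to its
usual one. -/
def GSol (a : ℝ) (g : ℝ → R → ℂ) : Prop :=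
  ∀ ξ > a, ∃ g' : R → ℂ, HasDerivAt g g' ξ ∧
    ∀ i, (ξ : ℂ) * (ξ - s.τ i) * g' i = s.τ i * ((s.A *ᵥ g ξ) i - (s.ρ₂ + 1) * g ξ i)

lemma Q_injective {u w : R → ℂ} (h : s.Q *ᵥ u = s.Q *ᵥ w) : u = w := by
  have := congrArg (s.P *ᵥ ·) h
  simpa [mulVec_mulVec, s.PQ] using this

lemma Q_P (v : K → ℂ) : s.Q *ᵥ (s.P *ᵥ v) = v := by
  rw [mulVec_mulVec, s.QP, one_mulVec]

lemma P_Q (u : R → ℂ) : s.P *ᵥ (s.Q *ᵥ u) = u := by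
  rw [mulVec_mulVec, s.PQ, one_mulVec]

lemma Q_A (u : R → ℂ) (k : K) : (s.Q *ᵥ (s.A *ᵥ u)) k = s.mu k * (s.Q *ᵥ u) k := by
  have h : s.Q * s.A = diagonal s.mu * s.Q := by
    rw [← s.QAP, Matrix.mul_assoc, Matrix.mul_assoc, s.PQ, Matrix.mul_one]
  rw [mulVec_mulVec, h, ← mulVec_mulVec, mulVec_diagonal]

lemma B_inl (f : R ⊕ K → ℂ) (i : R) :
    (s.B *ᵥ f) (Sum.inl i) = (s.A *ᵥ fun i => f (Sum.inl i)) i +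
      (s.P *ᵥ fun k => f (Sum.inr k)) i := by
  rw [B, bigMat, fromBlocks_mulVec]
  rfl

lemma B_inr (f : R ⊕ K → ℂ) (k : K) :
    (s.B *ᵥ f) (Sum.inr k) =
      -((s.mu k - s.ρ₁) * (s.mu k - s.ρ₂) * (s.Q *ᵥ fun i => f (Sum.inl i)) k) +
      (s.ρ₁ + s.ρ₂ - s.mu k) * f (Sum.inr k) := by
  rw [B, bigMat, fromBlocks_mulVec, s.QAP]
  have h : ∀ c : ℂ, diagonal s.mu - c • (1 : Matrix K K ℂ) = diagonal fun k => s.mu k - c := by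
    intro c; rw [smul_one_eq_diagonal, diagonal_sub]
  have h' : ∀ c : ℂ, c • (1 : Matrix K K ℂ) - diagonal s.mu = diagonal fun k => c - s.mu k := by
    intro c; rw [smul_one_eq_diagonal, diagonal_sub]
  rw [h, h, h', diagonal_mul_diagonal]
  simp only [Sum.elim_inr, Pi.add_apply, neg_mulVec, Pi.neg_apply, ← mulVec_mulVec,
    mulVec_diagonal]
  rfl

/-- The matrix `B` becomes a family of `2 × 2` blocks in the coordinates `Q u`, `v` of a vector
`(u, v)`; this is the first row of such a block. -/
lemma Q_B (f : R ⊕ K → ℂ) (k : K) :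
    (s.Q *ᵥ fun i => (s.B *ᵥ f) (Sum.inl i)) k =
      s.mu k * (s.Q *ᵥ fun i => f (Sum.inl i)) k + f (Sum.inr k) := by
  have : (fun i => (s.B *ᵥ f) (Sum.inl i)) =
      s.A *ᵥ (fun i => f (Sum.inl i)) + s.P *ᵥ fun k => f (Sum.inr k) :=
    funext fun i => s.B_inl f i
  rw [this, mulVec_add, Pi.add_apply, s.Q_A, s.Q_P]

end RaySys

section Core

variable {R K : Type} [Fintype R] [Fintype K] [DecidableEq R] [DecidableEq K] (s : RaySys R K)

/-- The fractional integral of a solution of the underlying system is a solution of the rank `2n`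
system. Its lower half is obtained from the upper half by means of the first `n` equations. -/
lemma RaySys.raySol_rl {a : ℝ} (h₂ : 1 < s.ρ₂.re) {m : ℝ → R → ℂ}
    (hm : ∀ i, Continuous fun ξ => m ξ i) (hma : m a = 0)
    (hd : ∀ ξ, a < ξ → ∀ i, HasDerivAt (fun ξ : ℝ => ((ξ : ℂ) - s.τ i) * (ξ * m ξ i))
      ((s.ρ₁ - s.ρ₂) * (ξ * m ξ i) +
        ((s.A *ᵥ fun i => s.τ i * m ξ i) i - s.ρ₁ * (s.τ i * m ξ i))) ξ) :
    RaySol s.T s.B (Ioi a) (fun X => Sum.elim (fun i => rl a s.ρ₂ (fun ξ => ξ * m ξ i) X)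
      (fun k => (s.ρ₁ - s.mu k) * (s.Q *ᵥ fun i => rl a s.ρ₂ (fun ξ => ξ * m ξ i) X -
        s.τ i * rl a s.ρ₂ (fun ξ => m ξ i) X) k)) := by
  intro X hX
  have hX : a < X := hX
  have h0 : 0 < s.ρ₂.re := by linarith
  have hpos : 0 < (s.ρ₂ - 1).re := by simpa using h₂
  have c1 : ∀ i, Continuous fun ξ : ℝ => (ξ : ℂ) * m ξ i := fun i => by
    have := hm i; fun_prop
  have ck : ∀ i, Continuous fun ξ : ℝ => ((ξ : ℂ) - s.τ i) * (ξ * m ξ i) := fun i => by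
    have := hm i; fun_prop
  have cA : ∀ i, Continuous fun ξ : ℝ => (s.A *ᵥ fun i => s.τ i * m ξ i) i := fun i => by
    simp only [mulVec, dotProduct]
    exact continuous_finsetSum _ fun j _ => by have := hm j; fun_prop
  set F : R → ℝ → ℂ := fun i => rl a s.ρ₂ (fun ξ => ξ * m ξ i) with hF
  set L : R → ℝ → ℂ := fun i X => s.τ i * rl a s.ρ₂ (fun ξ => m ξ i) X with hL
  have hF' : ∀ i, HasDerivAt (F i) (s.ρ₂ * rl a (s.ρ₂ - 1) (fun ξ => ξ * m ξ i) X) X :=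
    fun i => hasDerivAt_rl h₂ (c1 i) hX
  have hL' : ∀ i, HasDerivAt (L i) (s.τ i * (s.ρ₂ * rl a (s.ρ₂ - 1) (fun ξ => m ξ i) X)) X :=
    fun i => (hasDerivAt_rl h₂ (hm i) hX).const_mul _
  -- integration by parts
  have hk : ∀ i, s.ρ₂ * rl a (s.ρ₂ - 1) (fun ξ => ((ξ : ℂ) - s.τ i) * (ξ * m ξ i)) X =
      (s.ρ₁ - s.ρ₂) * F i X + ((s.A *ᵥ fun i => L i X) i - s.ρ₁ * L i X) := by
    intro i
    rw [rl_deriv h₂ (ck i) (φ' := fun ξ => (s.ρ₁ - s.ρ₂) * (ξ * m ξ i) +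
        ((s.A *ᵥ fun i => s.τ i * m ξ i) i + (-s.ρ₁) * (s.τ i * m ξ i)))
        (by have := hm i; have := cA i; fun_prop) (by simp [hma])
        (fun ξ hξ => (hd ξ hξ i).congr_deriv (by ring)) hX.le,
      rl_add h0 (by have := hm i; fun_prop) (by have := hm i; have := cA i; fun_prop),
      rl_add h0 (cA i) (by have := hm i; fun_prop), rl_const_mul, rl_const_mul, rl_const_mul]
    have : rl a s.ρ₂ (fun ξ => (s.A *ᵥ fun i => s.τ i * m ξ i) i) X =
        (s.A *ᵥ fun i => L i X) i := by
      simp only [mulVec, dotProduct]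
      rw [rl_sum h0 _ (fun j => by have := hm j; fun_prop)]
      refine Finset.sum_congr rfl fun j _ => ?_
      rw [rl_const_mul, rl_const_mul]
    rw [this]
    ring
  have hsub : ∀ i, rl a (s.ρ₂ - 1) (fun ξ => ((ξ : ℂ) - s.τ i) * (ξ * m ξ i)) X =
      rl a (s.ρ₂ - 1) (fun ξ => ξ * (ξ * m ξ i)) X -
        s.τ i * rl a (s.ρ₂ - 1) (fun ξ => ξ * m ξ i) X := by
    intro i
    have := rl_add (a := a) hpos (φ := fun ξ : ℝ => ξ * (ξ * m ξ i))
      (ψ := fun ξ : ℝ => (-s.τ i) * (ξ * m ξ i)) (by have := hm i; fun_prop)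
      (by have := hm i; fun_prop) X
    rw [rl_const_mul, neg_mul, ← sub_eq_add_neg] at this
    rw [← this]
    congr 1
    funext ξ; ring
  have e1 : ∀ i, ((X : ℂ) - s.τ i) * (s.ρ₂ * rl a (s.ρ₂ - 1) (fun ξ => ξ * m ξ i) X) =
      s.ρ₁ * F i X + ((s.A *ᵥ fun i => L i X) i - s.ρ₁ * L i X) := by
    intro i
    have h1 := rl_mul_id (a := a) h₂ (c1 i) X
    have h2 := hk i
    rw [hsub i] at h2
    simp only [hF] at h2 ⊢
    linear_combination h2 - s.ρ₂ * h1
  have e2 : ∀ i, (X : ℂ) * (s.ρ₂ * rl a (s.ρ₂ - 1) (fun ξ => ξ * m ξ i) X -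
      s.τ i * (s.ρ₂ * rl a (s.ρ₂ - 1) (fun ξ => m ξ i) X)) =
      s.ρ₁ * F i X + ((s.A *ᵥ fun i => L i X) i - (s.ρ₁ + s.ρ₂) * L i X) := by
    intro i
    have h1 := rl_mul_id (a := a) h₂ (c1 i) X
    have h3 := rl_mul_id (a := a) h₂ (hm i) X
    have h2 := hk i
    rw [hsub i] at h2
    simp only [hF, hL] at h2 ⊢
    linear_combination h2 - s.ρ₂ * h1 + s.ρ₂ * s.τ i * h3
  refine ⟨Sum.elim (fun i => s.ρ₂ * rl a (s.ρ₂ - 1) (fun ξ => ξ * m ξ i) X)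
    (fun k => (s.ρ₁ - s.mu k) * (s.Q *ᵥ fun i => s.ρ₂ * rl a (s.ρ₂ - 1) (fun ξ => ξ * m ξ i) X -
      s.τ i * (s.ρ₂ * rl a (s.ρ₂ - 1) (fun ξ => m ξ i) X)) k), ?_, ?_⟩
  · refine hasDerivAt_pi.2 fun j => ?_
    rcases j with i | k
    · exact hF' i
    · simp only [Sum.elim_inr, mulVec, dotProduct]
      refine HasDerivAt.const_mul _ (HasDerivAt.fun_sum fun i _ => ?_)
      exact ((hF' i).sub (hL' i)).const_mul _
  · rintro (i | k)
    · rw [s.B_inl]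
      simp only [Sum.elim_inl, Sum.elim_inr, RaySys.T]
      rw [e1 i]
      have : (s.P *ᵥ fun k => (s.ρ₁ - s.mu k) * (s.Q *ᵥ fun i => F i X - L i X) k) =
          fun i => s.ρ₁ * (F i X - L i X) - (s.A *ᵥ fun i => F i X - L i X) i := by
        apply s.Q_injective
        rw [s.Q_P]
        funext k
        have : (fun i => s.ρ₁ * (F i X - L i X) - (s.A *ᵥ fun i => F i X - L i X) i) =
            s.ρ₁ • (fun i => F i X - L i X) - s.A *ᵥ fun i => F i X - L i X := rfl
        rw [this, mulVec_sub, mulVec_smul, Pi.sub_apply, Pi.smul_apply, s.Q_A, smul_eq_mul]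
        ring
      have h3 : (s.A *ᵥ fun i => F i X - L i X) =
          (s.A *ᵥ fun i => F i X) - s.A *ᵥ fun i => L i X := by
        rw [← mulVec_sub]; rfl
      have h4 := congrFun this i
      rw [h4, h3, Pi.sub_apply]
      ring
    · rw [s.B_inr]
      simp only [Sum.elim_inl, Sum.elim_inr, RaySys.T, sub_zero]
      have h5 : (X : ℂ) * (s.Q *ᵥ fun i => s.ρ₂ * rl a (s.ρ₂ - 1) (fun ξ => ξ * m ξ i) X -
          s.τ i * (s.ρ₂ * rl a (s.ρ₂ - 1) (fun ξ => m ξ i) X)) k =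
          s.ρ₁ * (s.Q *ᵥ fun i => F i X) k +
            (s.mu k - (s.ρ₁ + s.ρ₂)) * (s.Q *ᵥ fun i => L i X) k := by
        rw [← smul_eq_mul, ← Pi.smul_apply, ← mulVec_smul]
        have : ((X : ℂ) • fun i => s.ρ₂ * rl a (s.ρ₂ - 1) (fun ξ => ξ * m ξ i) X -
          s.τ i * (s.ρ₂ * rl a (s.ρ₂ - 1) (fun ξ => m ξ i) X)) =
          s.ρ₁ • (fun i => F i X) + (s.A *ᵥ (fun i => L i X) -
            (s.ρ₁ + s.ρ₂) • fun i => L i X) := funext fun i => e2 i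
        rw [this, mulVec_add, mulVec_sub, mulVec_smul, mulVec_smul, Pi.add_apply, Pi.sub_apply,
          s.Q_A]
        simp only [Pi.smul_apply, smul_eq_mul]
        ring
      have h6 : (s.Q *ᵥ fun i => F i X - L i X) =
          (s.Q *ᵥ fun i => F i X) - s.Q *ᵥ fun i => L i X := by
        rw [← mulVec_sub]; rfl
      rw [mul_left_comm, h5]
      change _ = -((s.mu k - s.ρ₁) * (s.mu k - s.ρ₂) * (s.Q *ᵥ fun i => F i X) k) +
        (s.ρ₁ + s.ρ₂ - s.mu k) * ((s.ρ₁ - s.mu k) * (s.Q *ᵥ fun i => F i X - L i X) k)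
      rw [h6, Pi.sub_apply]
      ring

end Core

/-! ### Leading coefficients of expansions along a ray -/

lemma cpow_add_one' {z e : ℂ} (hz : z ≠ 0) : z ^ (e + 1) = z ^ e * z := by
  rw [cpow_add _ _ hz, cpow_one]

section Lead

variable {E F : Type*} [NormedAddCommGroup E] [NormedSpace ℂ E] [NormedAddCommGroup F]
  [NormedSpace ℂ F] {a : ℝ} {e : ℂ} {v w : E} {f g : ℝ → E}

/-- Near `a`, `f X = (X - a) ^ e • (v + O(X - a))` with an analytic second factor. -/
def LeadFin (a : ℝ) (e : ℂ) (v : E) (f : ℝ → E) : Prop :=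
  ∃ Ψ : ℂ → E, RayExpFin a e Ψ f ∧ Ψ 0 = v

/-- Near infinity, `f X = X ^ e • (v + O(1 / X))` with an analytic second factor. -/
def LeadInf (e : ℂ) (v : E) (f : ℝ → E) : Prop :=
  ∃ Φ : ℂ → E, RayExpInf e Φ f ∧ Φ 0 = v

lemma LeadFin.congr (h : LeadFin a e v f) (hfg : ∀ᶠ X in 𝓝[>] a, g X = f X) :
    LeadFin a e v g := by
  obtain ⟨Ψ, h1, h2⟩ := h
  exact ⟨Ψ, h1.congr hfg, h2⟩

lemma LeadInf.congr (h : LeadInf e v f) (hfg : ∀ᶠ X in atTop, g X = f X) : LeadInf e v g := by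
  obtain ⟨Ψ, h1, h2⟩ := h
  exact ⟨Ψ, ⟨h1.1, by filter_upwards [h1.2, hfg] with X h3 h4 using h4.trans h3⟩, h2⟩

/-- Transport along equalities that need a computation. -/
lemma LeadFin.cast {e' : ℂ} (h : LeadFin a e v f) (he : e' = e) (hv : w = v)
    (hg : ∀ X, g X = f X) : LeadFin a e' w g := by
  rw [he, hv, show g = f from funext hg]; exact h

lemma LeadInf.cast {e' : ℂ} (h : LeadInf e v f) (he : e' = e) (hv : w = v)
    (hg : ∀ X, g X = f X) : LeadInf e' w g := by
  rw [he, hv, show g = f from funext hg]; exact h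

/-- Multiplication by a function that is analytic at `a`. -/
lemma LeadFin.smul_analytic (h : LeadFin a e v f) {u : ℂ → ℂ} (hu : AnalyticAt ℂ u 0) :
    LeadFin a e (u 0 • v) (fun X => u ((X - a : ℝ) : ℂ) • f X) := by
  obtain ⟨Ψ, h1, rfl⟩ := h
  refine ⟨fun y => u y • Ψ y, ⟨hu.smul h1.1, ?_⟩, rfl⟩
  filter_upwards [h1.2] with X h3
  rw [h3, smul_comm]

/-- Multiplication by a function that is analytic at infinity. -/
lemma LeadInf.smul_analytic (h : LeadInf e v f) {u : ℂ → ℂ} (hu : AnalyticAt ℂ u 0) :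
    LeadInf e (u 0 • v) (fun X => u ((X : ℂ)⁻¹) • f X) := by
  obtain ⟨Ψ, h1, rfl⟩ := h
  refine ⟨fun y => u y • Ψ y, ⟨hu.smul h1.1, ?_⟩, rfl⟩
  filter_upwards [h1.2] with X h3
  rw [h3, smul_comm]

lemma LeadFin.smul (h : LeadFin a e v f) (c : ℂ) : LeadFin a e (c • v) (fun X => c • f X) :=
  h.smul_analytic analyticAt_const

lemma LeadInf.smul (h : LeadInf e v f) (c : ℂ) : LeadInf e (c • v) (fun X => c • f X) :=
  h.smul_analytic analyticAt_const

lemma LeadFin.add (h : LeadFin a e v f) (h' : LeadFin a e w g) :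
    LeadFin a e (v + w) (fun X => f X + g X) := by
  obtain ⟨Ψ, h1, rfl⟩ := h
  obtain ⟨Ψ', h3, rfl⟩ := h'
  refine ⟨fun y => Ψ y + Ψ' y, ⟨h1.1.add h3.1, ?_⟩, rfl⟩
  filter_upwards [h1.2, h3.2] with X h5 h6
  rw [h5, h6, smul_add]

lemma LeadInf.add (h : LeadInf e v f) (h' : LeadInf e w g) :
    LeadInf e (v + w) (fun X => f X + g X) := by
  obtain ⟨Ψ, h1, rfl⟩ := h
  obtain ⟨Ψ', h3, rfl⟩ := h'
  refine ⟨fun y => Ψ y + Ψ' y, ⟨h1.1.add h3.1, ?_⟩, rfl⟩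
  filter_upwards [h1.2, h3.2] with X h5 h6
  rw [h5, h6, smul_add]

lemma LeadFin.sub (h : LeadFin a e v f) (h' : LeadFin a e w g) :
    LeadFin a e (v - w) (fun X => f X - g X) := by
  simpa [sub_eq_add_neg] using h.add (h'.smul (-1))

lemma LeadInf.sub (h : LeadInf e v f) (h' : LeadInf e w g) :
    LeadInf e (v - w) (fun X => f X - g X) := by
  simpa [sub_eq_add_neg] using h.add (h'.smul (-1))

lemma LeadFin.clm (h : LeadFin a e v f) (L : E →L[ℂ] F) :
    LeadFin a e (L v) (fun X => L (f X)) := by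
  obtain ⟨Ψ, h1, rfl⟩ := h
  refine ⟨fun y => L (Ψ y), ⟨(L.analyticAt _).comp h1.1, ?_⟩, rfl⟩
  filter_upwards [h1.2] with X h5
  rw [h5, map_smul]

lemma LeadInf.clm (h : LeadInf e v f) (L : E →L[ℂ] F) :
    LeadInf e (L v) (fun X => L (f X)) := by
  obtain ⟨Ψ, h1, rfl⟩ := h
  refine ⟨fun y => L (Ψ y), ⟨(L.analyticAt _).comp h1.1, ?_⟩, rfl⟩
  filter_upwards [h1.2] with X h5
  rw [h5, map_smul]

/-- If the leading coefficient vanishes, the exponent can be raised by one. -/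
lemma LeadFin.raise (h : LeadFin a e v f) (h0 : v = 0) : ∃ v', LeadFin a (e + 1) v' f := by
  obtain ⟨Ψ, h1, rfl⟩ := h
  obtain ⟨Ψ', h2⟩ := h1.raise h0
  exact ⟨_, Ψ', h2, rfl⟩

/-- If the leading coefficient vanishes, the exponent can be lowered by one. -/
lemma LeadInf.lower (h : LeadInf e v f) (h0 : v = 0) : ∃ v', LeadInf (e - 1) v' f := by
  obtain ⟨Ψ, h1, rfl⟩ := h
  obtain ⟨Ψ', h2⟩ := h1.lower h0
  exact ⟨_, Ψ', h2, rfl⟩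

/-- Multiplication by `(X - a) ^ b`. -/
lemma LeadFin.cpow_smul (h : LeadFin a e v f) (b : ℂ) :
    LeadFin a (b + e) v (fun X => ((X - a : ℝ) : ℂ) ^ b • f X) := by
  obtain ⟨Ψ, h1, rfl⟩ := h
  refine ⟨Ψ, ⟨h1.1, ?_⟩, rfl⟩
  filter_upwards [h1.2, self_mem_nhdsWithin] with X h5 hX
  have hX' : ((X - a : ℝ) : ℂ) ≠ 0 := by exact_mod_cast (sub_pos.2 hX).ne'
  rw [h5, smul_smul, cpow_add _ _ hX']

/-- Multiplication by `X ^ b`. -/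
lemma LeadInf.cpow_smul (h : LeadInf e v f) (b : ℂ) :
    LeadInf (b + e) v (fun X => (X : ℂ) ^ b • f X) := by
  obtain ⟨Ψ, h1, rfl⟩ := h
  refine ⟨Ψ, ⟨h1.1, ?_⟩, rfl⟩
  filter_upwards [h1.2, eventually_gt_atTop 0] with X h5 hX
  have hX' : (X : ℂ) ≠ 0 := by exact_mod_cast hX.ne'
  rw [h5, smul_smul, cpow_add _ _ hX']

lemma LeadInf.inv_smul (h : LeadInf e v f) :
    LeadInf e (0 : E) (fun X => ((X : ℂ)⁻¹) • f X) := by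
  simpa using h.smul_analytic analyticAt_id

lemma LeadInf.mul_smul (h : LeadInf e v f) : LeadInf (e + 1) v (fun X => (X : ℂ) • f X) := by
  simpa [add_comm] using h.cpow_smul 1

lemma LeadFin.deriv {f' : ℝ → E} [CompleteSpace E] (h : LeadFin a e v f)
    (hf : ∀ᶠ X in 𝓝[>] a, HasDerivAt f (f' X) X) : LeadFin a (e - 1) (e • v) f' := by
  obtain ⟨Ψ, h1, rfl⟩ := h
  exact ⟨_, h1.deriv hf, by simp⟩

lemma LeadInf.deriv {f' : ℝ → E} [CompleteSpace E] (h : LeadInf e v f)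
    (hf : ∀ᶠ X in atTop, HasDerivAt f (f' X) X) : LeadInf (e - 1) (e • v) f' := by
  obtain ⟨Ψ, h1, rfl⟩ := h
  exact ⟨_, h1.deriv hf, by simp⟩

lemma LeadFin.tendsto (h : LeadFin a e v f) :
    Tendsto (fun X : ℝ => ((X - a : ℝ) : ℂ) ^ (-e) • f X) (𝓝[>] a) (𝓝 v) := by
  obtain ⟨Ψ, h1, rfl⟩ := h
  refine (h1.1.continuousAt.tendsto.comp (tendsto_sub_nhdsGT a)).congr' ?_
  filter_upwards [h1.2, self_mem_nhdsWithin] with X h5 hX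
  have hX' : ((X - a : ℝ) : ℂ) ≠ 0 := by exact_mod_cast (sub_pos.2 hX).ne'
  rw [h5, smul_smul, ← cpow_add _ _ hX']
  simp

lemma LeadInf.tendsto (h : LeadInf e v f) :
    Tendsto (fun X : ℝ => (X : ℂ) ^ (-e) • f X) atTop (𝓝 v) := by
  obtain ⟨Ψ, h1, rfl⟩ := h
  refine (h1.1.continuousAt.tendsto.comp tendsto_inv_atTop_complex).congr' ?_
  filter_upwards [h1.2, eventually_gt_atTop 0] with X h5 hX
  have hX' : (X : ℂ) ≠ 0 := by exact_mod_cast hX.ne'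
  rw [h5, smul_smul, ← cpow_add _ _ hX']
  simp

/-- The leading coefficient is determined by the function and the exponent. -/
lemma LeadFin.unique (h : LeadFin a e v f) (h' : LeadFin a e w f) : v = w :=
  tendsto_nhds_unique h.tendsto h'.tendsto

lemma LeadInf.unique (h : LeadInf e v f) (h' : LeadInf e w f) : v = w :=
  tendsto_nhds_unique h.tendsto h'.tendsto

variable {J : Type*} [Fintype J] {H : ℝ → J → ℂ} {V : J → ℂ}

lemma LeadFin.apply (h : LeadFin a e V H) (j : J) : LeadFin a e (V j) (fun X => H X j) :=
  h.clm (ContinuousLinearMap.proj j)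

lemma LeadInf.apply (h : LeadInf e V H) (j : J) : LeadInf e (V j) (fun X => H X j) :=
  h.clm (ContinuousLinearMap.proj j)

lemma LeadFin.pi (h : ∀ j, LeadFin a e (V j) (fun X => H X j)) : LeadFin a e V H := by
  choose Ψ h1 h2 using h
  refine ⟨fun y j => Ψ j y, ⟨AnalyticAt.pi fun j => (h1 j).1, ?_⟩, funext h2⟩
  filter_upwards [eventually_all.2 fun j => (h1 j).2] with X hX
  exact funext hX

lemma LeadInf.pi (h : ∀ j, LeadInf e (V j) (fun X => H X j)) : LeadInf e V H := by
  choose Ψ h1 h2 using h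
  refine ⟨fun y j => Ψ j y, ⟨AnalyticAt.pi fun j => (h1 j).1, ?_⟩, funext h2⟩
  filter_upwards [eventually_all.2 fun j => (h1 j).2] with X hX
  exact funext hX

variable {I : Type*} [Fintype I]

lemma LeadFin.mulVec (h : LeadFin a e V H) (M : Matrix I J ℂ) :
    LeadFin a e (M *ᵥ V) (fun X => M *ᵥ H X) :=
  h.clm (LinearMap.toContinuousLinearMap M.mulVecLin)

lemma LeadInf.mulVec (h : LeadInf e V H) (M : Matrix I J ℂ) :
    LeadInf e (M *ᵥ V) (fun X => M *ᵥ H X) :=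
  h.clm (LinearMap.toContinuousLinearMap M.mulVecLin)

lemma LeadFin.rl {φ : ℝ → ℂ} {ν α N : ℂ} (hν : 0 < ν.re) (hα : 0 < α.re) (hφ : Continuous φ)
    (h : LeadFin a α N φ) :
    LeadFin a (α + ν + 1) (betaIntegral (α + 1) (ν + 1) * N) (rl a ν φ) := by
  obtain ⟨Ψ, h1, rfl⟩ := h
  exact rl_rayExpFin hν hα hφ h1

end Lead

namespace RaySys

variable {R K : Type} [Fintype R] [Fintype K] [DecidableEq R] [DecidableEq K] (s : RaySys R K)

/-- The solution of the rank `2n` system that is obtained from a solution `g` of the underlying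
system, with its behaviour at `a` and at infinity. -/
lemma exists_raySol_of_gSol {a : ℝ} (ha : 0 ≤ a) {α : ℂ} {M g_inf : R → ℂ} {g : ℝ → R → ℂ}
    (h₂ : 1 < s.ρ₂.re) (h₁₂ : 1 < (s.ρ₁ - s.ρ₂).re) (hα : 0 < α.re) (hg : s.GSol a g)
    (hM : LeadFin a α M (fun ξ i => (ξ : ℂ) ^ (s.ρ₁ - s.ρ₂ - 2) * g ξ i / s.τ i))
    (hinf : Tendsto g atTop (𝓝 g_inf)) :
    ∃ f : ℝ → R ⊕ K → ℂ, RaySol s.T s.B (Ioi a) f ∧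
      LeadFin a (α + s.ρ₂ + 1) (betaIntegral (α + 1) (s.ρ₂ + 1) • Sum.elim (fun i => a * M i)
        (fun k => (s.ρ₁ - s.mu k) * (s.Q *ᵥ fun i => (a - s.τ i) * M i) k)) f ∧
      ∀ i, Tendsto (fun X : ℝ => (X : ℂ) ^ (-s.ρ₁) * f X (Sum.inl i)) atTop
        (𝓝 (betaIntegral (s.ρ₁ - s.ρ₂) (s.ρ₂ + 1) * (g_inf i / s.τ i))) := by
  have h0 : 0 < s.ρ₂.re := by linarith
  -- the density; its extension by zero below `a` is continuous since `Re α > 0`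
  set m : ℝ → R → ℂ := fun ξ i =>
    if a < ξ then (ξ : ℂ) ^ (s.ρ₁ - s.ρ₂ - 2) * g ξ i / s.τ i else 0 with hm_def
  choose! g' hg1 hg2 using hg
  have hmgt : ∀ ξ, a < ξ → ∀ i, m ξ i = (ξ : ℂ) ^ (s.ρ₁ - s.ρ₂ - 2) * g ξ i / s.τ i :=
    fun ξ hξ i => if_pos hξ
  have hmle : ∀ ξ, ξ ≤ a → ∀ i, m ξ i = 0 := fun ξ hξ i => if_neg (not_lt.2 hξ)
  have hMm : ∀ i, LeadFin a α (M i) (fun ξ => m ξ i) := fun i =>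
    (hM.apply i).congr (by filter_upwards [self_mem_nhdsWithin] with ξ hξ using hmgt ξ hξ i)
  -- continuity of `m`
  have hm : ∀ i, Continuous fun ξ => m ξ i := by
    intro i
    refine continuous_iff_continuousAt.2 fun ξ => ?_
    rcases lt_trichotomy ξ a with h | rfl | h
    · refine (continuousAt_const (y := (0 : ℂ))).congr ?_
      filter_upwards [Iio_mem_nhds h] with y hy using (hmle y (le_of_lt hy) i).symm
    · rw [continuousAt_iff_continuous_left'_right']
      constructor
      · refine (continuousWithinAt_const (b := (0 : ℂ))).congr (fun y hy => hmle y (le_of_lt hy) i)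
          (hmle _ le_rfl i)
      · change Tendsto (fun y => m y i) (𝓝[>] ξ) (𝓝 (m ξ i))
        rw [hmle _ le_rfl i]
        have h1 : Tendsto (fun X : ℝ => ((X - ξ : ℝ) : ℂ) ^ α) (𝓝[>] ξ) (𝓝 0) := by
          have : ContinuousAt (fun X : ℝ => ((X - ξ : ℝ) : ℂ) ^ α) ξ :=
            ((Complex.continuous_ofReal_cpow_const hα).comp
              (continuous_id.sub continuous_const)).continuousAt
          have h2 := this.tendsto
          simp only [sub_self, ofReal_zero] at h2
          rw [zero_cpow (by rintro rfl; simp at hα)] at h2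
          exact h2.mono_left nhdsWithin_le_nhds
        have h2 := h1.mul (hMm i).tendsto
        rw [zero_mul] at h2
        refine h2.congr' ?_
        filter_upwards [self_mem_nhdsWithin] with X hX
        have hX' : ((X - ξ : ℝ) : ℂ) ≠ 0 := by exact_mod_cast (sub_pos.2 hX).ne'
        rw [smul_eq_mul, ← mul_assoc, ← cpow_add _ _ hX']
        simp
    · have hpos : 0 < ξ := by linarith
      have h1 : ContinuousAt (fun ξ : ℝ => (ξ : ℂ) ^ (s.ρ₁ - s.ρ₂ - 2) * g ξ i / s.τ i) ξ :=
        ((hasDerivAt_ofReal_cpow hpos _).continuousAt.mul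
          (hasDerivAt_pi.1 (hg1 ξ h) i).continuousAt).div_const _
      refine h1.congr ?_
      filter_upwards [Ioi_mem_nhds h] with y hy using (hmgt y hy i).symm
  have hma : m a = 0 := funext fun i => hmle a le_rfl i
  have hd : ∀ ξ, a < ξ → ∀ i, HasDerivAt (fun ξ : ℝ => ((ξ : ℂ) - s.τ i) * (ξ * m ξ i))
      ((s.ρ₁ - s.ρ₂) * (ξ * m ξ i) +
        ((s.A *ᵥ fun i => s.τ i * m ξ i) i - s.ρ₁ * (s.τ i * m ξ i))) ξ := by
    intro ξ hξ i
    have hpos : 0 < ξ := by linarith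
    have hξ0 : (ξ : ℂ) ≠ 0 := by exact_mod_cast hpos.ne'
    have hτ := s.τ_ne i
    have d0 : HasDerivAt (fun ξ : ℝ => (ξ : ℂ)) 1 ξ := by
      simpa using (hasDerivAt_id ξ).ofReal_comp
    have d1 := hasDerivAt_ofReal_cpow hpos (s.ρ₁ - s.ρ₂ - 1)
    have d2 := (d0.sub_const (s.τ i)).fun_mul ((d1.fun_mul (hasDerivAt_pi.1 (hg1 ξ hξ) i)).div_const (s.τ i))
    have hev : (fun ξ : ℝ => ((ξ : ℂ) - s.τ i) * (ξ * m ξ i)) =ᶠ[𝓝 ξ] fun ξ : ℝ =>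
        ((ξ : ℂ) - s.τ i) * ((ξ : ℂ) ^ (s.ρ₁ - s.ρ₂ - 1) * g ξ i / s.τ i) := by
      filter_upwards [Ioi_mem_nhds hξ] with y hy
      have hy0 : (y : ℂ) ≠ 0 := by exact_mod_cast (lt_of_le_of_lt ha hy).ne'
      rw [hmgt y hy]
      have : (y : ℂ) ^ (s.ρ₁ - s.ρ₂ - 1) = (y : ℂ) ^ (s.ρ₁ - s.ρ₂ - 2) * y := by
        rw [← cpow_add_one' hy0]; congr 1; ring
      rw [this]; ring
    refine (d2.congr_of_eventuallyEq hev).congr_deriv ?_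
    have hA : (s.A *ᵥ fun i => s.τ i * m ξ i) =
        ((ξ : ℂ) ^ (s.ρ₁ - s.ρ₂ - 2)) • (s.A *ᵥ g ξ) := by
      rw [← mulVec_smul]; congr 1; funext j
      rw [hmgt ξ hξ, Pi.smul_apply, smul_eq_mul]
      have := s.τ_ne j
      field_simp
    have hp : (ξ : ℂ) ^ (s.ρ₁ - s.ρ₂ - 1) = (ξ : ℂ) ^ (s.ρ₁ - s.ρ₂ - 2) * ξ := by
      rw [← cpow_add_one' hξ0]; congr 1; ring
    have hp' : (ξ : ℂ) ^ (s.ρ₁ - s.ρ₂ - 1 - 1) = (ξ : ℂ) ^ (s.ρ₁ - s.ρ₂ - 2) := by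
      congr 1; ring
    rw [hA, hmgt ξ hξ, hp, hp', Pi.smul_apply, smul_eq_mul]
    have h3 := hg2 ξ hξ i
    field_simp
    linear_combination ((ξ : ℂ) ^ (s.ρ₁ - s.ρ₂ - 2)) * h3
  have hlead_xi : ∀ i, LeadFin a α (a * M i) (fun ξ => ξ * m ξ i) := by
    intro i
    have := (hMm i).smul_analytic (u := fun y => y + a) (by fun_prop)
    simpa using this
  have cξ : ∀ i, Continuous fun ξ : ℝ => (ξ : ℂ) * m ξ i := fun i => by
    have := hm i; fun_prop
  refine ⟨_, s.raySol_rl h₂ hm hma hd, ?_, fun i => ?_⟩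
  · have hF : ∀ i, LeadFin a (α + s.ρ₂ + 1) (betaIntegral (α + 1) (s.ρ₂ + 1) * (a * M i))
        (rl a s.ρ₂ fun ξ => ξ * m ξ i) := fun i => (hlead_xi i).rl h0 hα (cξ i)
    have hL : ∀ i, LeadFin a (α + s.ρ₂ + 1) (betaIntegral (α + 1) (s.ρ₂ + 1) * M i)
        (rl a s.ρ₂ fun ξ => m ξ i) := fun i => (hMm i).rl h0 hα (hm i)
    refine LeadFin.pi fun j => ?_
    rcases j with i | k
    · exact hF i
    · have h1 : LeadFin a (α + s.ρ₂ + 1)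
          (betaIntegral (α + 1) (s.ρ₂ + 1) • fun i => (a - s.τ i) * M i)
          (fun X i => rl a s.ρ₂ (fun ξ => ξ * m ξ i) X - s.τ i * rl a s.ρ₂ (fun ξ => m ξ i) X) := by
        refine LeadFin.pi fun i => ?_
        refine ((hF i).sub ((hL i).smul (s.τ i))).cast rfl ?_ fun X => by rw [smul_eq_mul]
        simp only [Pi.smul_apply, smul_eq_mul]; ring
      refine (((h1.mulVec s.Q).apply k).smul (s.ρ₁ - s.mu k)).cast rfl ?_ fun X => rfl
      rw [mulVec_smul]
      simp only [Pi.smul_apply, smul_eq_mul, Sum.elim_inr]; ring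
  · have hκ : 0 < (s.ρ₁ - s.ρ₂ - 1).re := by
      simp only [sub_re, one_re] at h₁₂ ⊢; linarith
    have h1 : Tendsto (fun X : ℝ => (X : ℂ) ^ (-(s.ρ₁ - s.ρ₂ - 1)) * (X * m X i)) atTop
        (𝓝 (g_inf i / s.τ i)) := by
      have h2 := (tendsto_pi_nhds.1 hinf i).div_const (s.τ i)
      refine h2.congr' ?_
      filter_upwards [eventually_gt_atTop a] with X hX
      have hX' : (X : ℂ) ≠ 0 := by exact_mod_cast (lt_of_le_of_lt ha hX).ne'
      rw [hmgt X hX]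
      have : (X : ℂ) ^ (-(s.ρ₁ - s.ρ₂ - 1)) * (X * (X : ℂ) ^ (s.ρ₁ - s.ρ₂ - 2)) = 1 := by
        rw [mul_comm (X : ℂ), ← cpow_add_one' hX', ← cpow_add _ _ hX']
        ring_nf
        exact cpow_zero _
      linear_combination (-(g X i / s.τ i)) * this
    have h3 := tendsto_rl h0 hκ ha (cξ i) (fun ξ hξ => by simp [hmle ξ hξ i]) h1
    have e1 : -(s.ρ₂ + (s.ρ₁ - s.ρ₂ - 1) + 1) = -s.ρ₁ := by ring
    rw [e1, sub_add_cancel] at h3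
    exact h3

end RaySys

/-! ### The connection relation along a ray -/

lemma NotInt.add_int {z : ℂ} (h : NotInt z) (n : ℤ) : NotInt (z + n) := fun m hm =>
  h (m - n) (by push_cast; rw [← hm]; ring)

lemma NotInt.add_one {z : ℂ} (h : NotInt z) : NotInt (z + 1) := by simpa using h.add_int 1

lemma NotInt.sub_one {z : ℂ} (h : NotInt z) : NotInt (z - 1) := by
  simpa [sub_eq_add_neg] using h.add_int (-1)

lemma NotInt.ne_zero {z : ℂ} (h : NotInt z) : z ≠ 0 := by simpa using h 0

lemma NotInt.neg {z : ℂ} (h : NotInt z) : NotInt (-z) := fun m hm =>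
  h (-m) (by push_cast; rw [← hm]; ring)

lemma NotInt.congr {z w : ℂ} (h : NotInt z) (hw : w = z) : NotInt w := hw ▸ h

lemma NotInt.Gamma_ne_zero {z : ℂ} (h : NotInt z) : Complex.Gamma z ≠ 0 :=
  Complex.Gamma_ne_zero fun m => by simpa using h (-m)

lemma NotInt.add_nat_ne_zero {z : ℂ} (h : NotInt z) (m : ℕ) : z + m + 1 ≠ 0 :=
  ((h.add_int m).add_one).ne_zero

namespace RaySys

variable {R K : Type} [Fintype R] [Fintype K] [DecidableEq R] [DecidableEq K] (s : RaySys R K)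

/-- The first connection coefficient between `a` and infinity, as a relation. The solution `f` has
leading coefficient `c • lead` at `a` and is the sum of two solutions with exponents `ρ₁` and `ρ₂`
at infinity; the upper half of the leading coefficient of the first one is determined by the value
at infinity of the solution `g` of the underlying system with leading coefficient `c' • glead`
at `a`. -/
def Connects (a : ℝ) (e γ : ℂ) (lead : R ⊕ K → ℂ) (glead : R → ℂ) (κ : ℂ) : Prop :=
  ∀ (f f₁ f₂ : ℝ → R ⊕ K → ℂ) (g : ℝ → R → ℂ) (v₁ v₂ : R ⊕ K → ℂ) (g_inf : R → ℂ)
    (c c' : ℂ) (b : ℝ), RaySol s.T s.B (Ioi a) f → LeadFin a e (c • lead) f →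
    RaySol s.T s.B (Ioi b) f₁ → RaySol s.T s.B (Ioi b) f₂ →
    (∀ᶠ X in atTop, f X = f₁ X + f₂ X) → LeadInf s.ρ₁ v₁ f₁ → LeadInf s.ρ₂ v₂ f₂ →
    s.GSol a g → LeadFin a γ (c' • glead) g → Tendsto g atTop (𝓝 g_inf) →
    ∀ i, c' * v₁ (Sum.inl i) = c * κ * (g_inf i / s.τ i)

/-- If `Re ρ₂`, `Re (ρ₁ - ρ₂)` and `Re α` are large, `f` is a multiple of the fractional
integral of `g`. -/
lemma connects_of_large {a : ℝ} (ha : 0 ≤ a) {e γ α ω : ℂ} {lead : R ⊕ K → ℂ} {glead M : R → ℂ}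
    {β : R ⊕ K → ℂ}
    (h₂ : 1 < s.ρ₂.re) (h₁₂ : 1 < (s.ρ₁ - s.ρ₂).re) (hα : 0 < α.re)
    (hT : ∀ j, ∀ X > a, (X : ℂ) ≠ s.T j)
    (hB : ∀ i j, s.T i = a → s.T j = a → s.B i j = if i = j then β i else 0)
    (he : ∀ m : ℕ, e + m + 1 ≠ 0) (hres : ∀ j, s.T j = a → ∀ m : ℕ, e + m + 1 ≠ β j)
    (heα : e = α + s.ρ₂ + 1)
    (hM : ∀ (c' : ℂ) (g : ℝ → R → ℂ), LeadFin a γ (c' • glead) g →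
      LeadFin a α (c' • M) (fun ξ i => (ξ : ℂ) ^ (s.ρ₁ - s.ρ₂ - 2) * g ξ i / s.τ i))
    (hω : ω ≠ 0)
    (hlead : betaIntegral (α + 1) (s.ρ₂ + 1) • Sum.elim (fun i => a * M i)
        (fun k => (s.ρ₁ - s.mu k) * (s.Q *ᵥ fun i => (a - s.τ i) * M i) k) = ω • lead) :
    s.Connects a e γ lead glead (betaIntegral (s.ρ₁ - s.ρ₂) (s.ρ₂ + 1) / ω) := by
  intro f f₁ f₂ g v₁ v₂ g_inf c c' b hf hfa hf₁ hf₂ hsum hv₁ hv₂ hg hga hginf i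
  obtain ⟨f₀, h0, h0a, h0inf⟩ := s.exists_raySol_of_gSol ha h₂ h₁₂ hα hg (hM c' g hga) hginf
  have hlead' : betaIntegral (α + 1) (s.ρ₂ + 1) • Sum.elim (fun i => a * (c' • M) i)
        (fun k => (s.ρ₁ - s.mu k) * (s.Q *ᵥ fun i => (a - s.τ i) * (c' • M) i) k) =
        (c' * ω) • lead := by
    rw [mul_smul, ← hlead, smul_comm c']
    congr 1
    funext j
    rcases j with i | k
    · simp only [Sum.elim_inl, Pi.smul_apply, smul_eq_mul]; ring
    · have : (fun i => (a - s.τ i) * (c' • M) i) = c' • fun i => (a - s.τ i) * M i := by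
        funext i; simp only [Pi.smul_apply, smul_eq_mul]; ring
      simp only [Sum.elim_inr]
      rw [this, mulVec_smul]
      simp only [Pi.smul_apply, Sum.elim_inr, smul_eq_mul]; ring
  rw [hlead', ← heα] at h0a
  -- the difference of the two multiples vanishes
  set D : ℝ → R ⊕ K → ℂ := (c' * ω) • f - c • f₀ with hD
  have hDs : RaySol s.T s.B (Ioi a) D := (hf.smul _).sub (h0.smul _)
  have hDa : LeadFin a e (0 : R ⊕ K → ℂ) D := by
    refine ((hfa.smul (c' * ω)).sub (h0a.smul c)).cast rfl ?_ fun X => rfl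
    rw [smul_comm, sub_self]
  obtain ⟨Ψ, hΨ, hΨ0⟩ := hDa
  have hev := hDs.eventually_eq_zero hB he hres hΨ hΨ0
  obtain ⟨x₀, hx₀, hx₀a⟩ := (hev.and self_mem_nhdsWithin).exists
  have hD0 : ∀ X ∈ Ioi a, D X = 0 := hDs.eq_zero ordConnected_Ioi (fun X hX j => hT j X hX)
    hx₀a hx₀
  -- comparison at infinity
  have hlim : Tendsto (fun X : ℝ => (X : ℂ) ^ (-s.ρ₁) * f X (Sum.inl i)) atTop
      (𝓝 (v₁ (Sum.inl i))) := by
    -- the part with exponent `ρ₂` is negligible, since `Re ρ₂ < Re ρ₁`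
    have h1 : Tendsto (fun X : ℝ => (X : ℂ) ^ (s.ρ₂ - s.ρ₁)) atTop (𝓝 0) := by
      rw [tendsto_zero_iff_norm_tendsto_zero]
      have h3 : 0 < (s.ρ₁ - s.ρ₂).re := by linarith
      refine (tendsto_rpow_neg_atTop h3).congr' ?_
      filter_upwards [eventually_gt_atTop 0] with X hX
      rw [Complex.norm_cpow_eq_rpow_re_of_pos hX]
      simp
    have h2 := (hv₁.apply (Sum.inl i)).tendsto.add (h1.mul (hv₂.apply (Sum.inl i)).tendsto)
    rw [zero_mul, add_zero] at h2
    refine h2.congr' ?_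
    filter_upwards [hsum, eventually_gt_atTop 0] with X h3 hX
    have hX' : (X : ℂ) ≠ 0 := by exact_mod_cast hX.ne'
    rw [h3, Pi.add_apply, smul_eq_mul, smul_eq_mul, ← mul_assoc, ← cpow_add _ _ hX', mul_add]
    congr 3
    ring
  have e1 := tendsto_nhds_unique_of_eventuallyEq (hlim.const_mul (c' * ω))
    ((h0inf i).const_mul c) (by
      filter_upwards [eventually_gt_atTop a] with X hX
      have := congrFun (hD0 X hX) (Sum.inl i)
      simp only [hD, Pi.sub_apply, Pi.smul_apply, smul_eq_mul, Pi.zero_apply] at this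
      linear_combination (X : ℂ) ^ (-s.ρ₁) * this)
  have : ω * (c' * v₁ (Sum.inl i)) =
      ω * (c * (betaIntegral (s.ρ₁ - s.ρ₂) (s.ρ₂ + 1) / ω) * (g_inf i / s.τ i)) := by
    have h5 : ω * (c * (betaIntegral (s.ρ₁ - s.ρ₂) (s.ρ₂ + 1) / ω) * (g_inf i / s.τ i)) =
        c * (betaIntegral (s.ρ₁ - s.ρ₂) (s.ρ₂ + 1) * (g_inf i / s.τ i)) := by
      field_simp
    rw [h5, ← e1]; ring
  exact mul_left_cancel₀ hω this

/-- The conditions under which the connection problem between `1` and infinity is considered: `i₀`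
is a component that belongs to the singular point `1`, no singular point lies beyond `1` on the
ray, the block of `A` that belongs to `1` is diagonal with entries `lam i`, and the exponent `lam i₀` is not resonant. -/
structure FinCase (lam : R → ℂ) (i₀ : R) : Prop where
  τ_eq : s.τ i₀ = 1
  τ_ne : ∀ i, ∀ X : ℝ, 1 < X → (X : ℂ) ≠ s.τ i
  A_block : ∀ i j, s.τ i = 1 → s.τ j = 1 → s.A i j = if i = j then lam i else 0
  notInt : NotInt (lam i₀)
  nonres : ∀ i, s.τ i = 1 → ∀ m : ℕ, lam i₀ + m + 1 ≠ lam i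
  notInt₂ : NotInt (lam i₀ - s.ρ₂)

/-- The conditions under which the connection problem between `0` and infinity is considered: no
singular point but `0` lies on the ray, and the exponent `ρ₁ + ρ₂ - mu k₀` is not resonant. -/
structure LastCase (k₀ : K) : Prop where
  τ_ne : ∀ i, ∀ X : ℝ, 0 < X → (X : ℂ) ≠ s.τ i
  exp_ne : ∀ m : ℕ, s.ρ₁ + s.ρ₂ - s.mu k₀ + m + 1 ≠ 0
  nonres : ∀ k, ∀ m : ℕ, s.mu k - s.mu k₀ + m + 1 ≠ 0

/-- `betaIntegral` in terms of `Gamma`. -/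
lemma betaIntegral_eq {u v : ℂ} (hu : 0 < u.re) (hv : 0 < v.re) :
    betaIntegral u v = Complex.Gamma u * Complex.Gamma v / Complex.Gamma (u + v) := by
  rw [Complex.Gamma_mul_Gamma_eq_betaIntegral hu hv, mul_div_cancel_left₀]
  exact Complex.Gamma_ne_zero_of_re_pos (by simpa using add_pos hu hv)

/-- The factor in the connection coefficient between `1` and infinity. -/
def finFactor (r₁ r₂ l : ℂ) : ℂ :=
  Complex.Gamma (r₁ - r₂) * Complex.Gamma (l + 1) / (Complex.Gamma (r₁ + 1) * Complex.Gamma (l - r₂))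

/-- The factor in the connection coefficient between `0` and infinity, up to the sign that the
passage from the values at `η₀` to the quantities `γ` contributes. -/
def lastFactor (r₁ r₂ m : ℂ) : ℂ :=
  -(Complex.Gamma (r₁ - r₂) * Complex.Gamma (r₁ + r₂ - m + 1) /
    (Complex.Gamma (r₁ + 1) * Complex.Gamma (r₁ - m + 1)))

/-- At `1` only the component `i₀` of the upper half survives in the leading coefficient of the
fractional integral, since
`glead` is supported there and the lower half carries the factors `1 - τ i`, where `τ i₀ = 1`. -/
lemma FinCase.connects_of_large {lam : R → ℂ} {i₀ : R} (h : s.FinCase lam i₀)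
    (h₂ : 1 < s.ρ₂.re) (h₁₂ : 1 < (s.ρ₁ - s.ρ₂).re) (hα : 0 < (lam i₀ - s.ρ₂ - 1).re) :
    s.Connects 1 (lam i₀) (lam i₀ - s.ρ₂ - 1) (Pi.single (Sum.inl i₀) 1) (Pi.single i₀ 1)
      (finFactor s.ρ₁ s.ρ₂ (lam i₀)) := by
  have hre : 0 < (lam i₀ - s.ρ₂).re := by
    simp only [sub_re, one_re] at hα ⊢; linarith
  have hre1 : 0 < (s.ρ₂ + 1).re := by simp only [add_re, one_re]; linarith
  have hre2 : 0 < (lam i₀ + 1).re := by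
    simp only [sub_re, add_re, one_re] at hre ⊢; linarith
  have hre3 : 0 < (s.ρ₁ + 1).re := by
    simp only [sub_re, add_re, one_re] at h₁₂ ⊢; linarith
  have hb1 : betaIntegral (lam i₀ - s.ρ₂ - 1 + 1) (s.ρ₂ + 1) =
      Complex.Gamma (lam i₀ - s.ρ₂) * Complex.Gamma (s.ρ₂ + 1) / Complex.Gamma (lam i₀ + 1) := by
    rw [sub_add_cancel, betaIntegral_eq hre hre1]; congr 2; ring
  have hb2 : betaIntegral (s.ρ₁ - s.ρ₂) (s.ρ₂ + 1) =
      Complex.Gamma (s.ρ₁ - s.ρ₂) * Complex.Gamma (s.ρ₂ + 1) / Complex.Gamma (s.ρ₁ + 1) := by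
    rw [betaIntegral_eq (by linarith) hre1]; congr 2; ring
  have g1 := Complex.Gamma_ne_zero_of_re_pos hre
  have g2 := Complex.Gamma_ne_zero_of_re_pos hre1
  have g3 := Complex.Gamma_ne_zero_of_re_pos hre2
  have g4 := Complex.Gamma_ne_zero_of_re_pos hre3
  have key := s.connects_of_large (a := 1) zero_le_one (e := lam i₀) (γ := lam i₀ - s.ρ₂ - 1)
    (α := lam i₀ - s.ρ₂ - 1) (ω := betaIntegral (lam i₀ - s.ρ₂ - 1 + 1) (s.ρ₂ + 1))
    (lead := Pi.single (Sum.inl i₀) 1) (glead := Pi.single i₀ 1) (M := Pi.single i₀ 1)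
    (β := Sum.elim lam 0) h₂ h₁₂ hα ?_ ?_ (fun m => h.notInt.add_nat_ne_zero m) ?_ (by ring)
    ?_ ?_ ?_
  · convert key using 1
    rw [hb1, hb2, finFactor]
    field_simp
  · rintro (i | k) X hX
    · exact h.τ_ne i X hX
    · have : (0 : ℝ) < X := by linarith
      simpa [T] using this.ne'
  · rintro (i | k) (j | l) h1 h2
    · simp only [T, Sum.elim_inl, ofReal_one] at h1 h2
      simpa [B, bigMat] using h.A_block i j h1 h2
    all_goals simp [T] at h1 h2
  · rintro (i | k) h1
    · simp only [T, Sum.elim_inl, ofReal_one] at h1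
      exact h.nonres i h1
    · simp [T] at h1
  · intro c' g hg
    refine LeadFin.pi fun i => ?_
    have hu : AnalyticAt ℂ (fun y : ℂ => (y + 1) ^ (s.ρ₁ - s.ρ₂ - 2) / s.τ i) 0 := by
      refine AnalyticAt.div_const ((by fun_prop : AnalyticAt ℂ (fun y : ℂ => y + 1) 0).cpow
        analyticAt_const ?_)
      simp
    refine ((hg.apply i).smul_analytic hu).cast rfl ?_ fun X => ?_
    · simp only [zero_add, one_cpow, Pi.smul_apply, smul_eq_mul]
      by_cases hi : i = i₀
      · subst hi; simp [h.τ_eq]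
      · simp [hi]
    · simp only [smul_eq_mul, ofReal_sub, ofReal_one, sub_add_cancel]; ring
  · rw [hb1]; exact div_ne_zero (mul_ne_zero g1 g2) g3
  · congr 1
    funext j
    rcases j with i | k
    · by_cases hi : i = i₀
      · subst hi; simp
      · simp [hi]
    · have : (fun i => (((1 : ℝ) : ℂ) - s.τ i) * (Pi.single i₀ 1 : R → ℂ) i) = 0 := by
        funext i
        by_cases hi : i = i₀
        · subst hi; simp [h.τ_eq]
        · simp [hi]
      simp only [Sum.elim_inr, this, mulVec_zero, Pi.zero_apply, mul_zero]
      simp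

/-- At `0` the upper half of the leading coefficient of the fractional integral vanishes. The
lower half is a multiple of `Q P = 1`, with the factors `0 - τ i` responsible for the minus sign
in `lastFactor`. -/
lemma LastCase.connects_of_large {k₀ : K} (h : s.LastCase k₀)
    (h₂ : 1 < s.ρ₂.re) (h₁₂ : 1 < (s.ρ₁ - s.ρ₂).re) (hα : 0 < (s.ρ₁ - s.mu k₀ - 1).re) :
    s.Connects 0 (s.ρ₁ + s.ρ₂ - s.mu k₀) (s.ρ₂ + 1 - s.mu k₀) (Pi.single (Sum.inr k₀) 1)
      (fun i => s.P i k₀) (lastFactor s.ρ₁ s.ρ₂ (s.mu k₀)) := by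
  have hre : 0 < (s.ρ₁ - s.mu k₀).re := by
    simp only [sub_re, one_re] at hα ⊢; linarith
  have hre1 : 0 < (s.ρ₂ + 1).re := by simp only [add_re, one_re]; linarith
  have hre2 : 0 < (s.ρ₁ + s.ρ₂ - s.mu k₀ + 1).re := by
    simp only [sub_re, add_re, one_re] at hre ⊢; linarith
  have hre3 : 0 < (s.ρ₁ + 1).re := by
    simp only [sub_re, add_re, one_re] at h₁₂ ⊢; linarith
  have hb1 : betaIntegral (s.ρ₁ - s.mu k₀ - 1 + 1) (s.ρ₂ + 1) =
      Complex.Gamma (s.ρ₁ - s.mu k₀) * Complex.Gamma (s.ρ₂ + 1) /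
        Complex.Gamma (s.ρ₁ + s.ρ₂ - s.mu k₀ + 1) := by
    rw [sub_add_cancel, betaIntegral_eq hre hre1]; congr 2; ring
  have hb2 : betaIntegral (s.ρ₁ - s.ρ₂) (s.ρ₂ + 1) =
      Complex.Gamma (s.ρ₁ - s.ρ₂) * Complex.Gamma (s.ρ₂ + 1) / Complex.Gamma (s.ρ₁ + 1) := by
    rw [betaIntegral_eq (by linarith) hre1]; congr 2; ring
  have g1 := Complex.Gamma_ne_zero_of_re_pos hre
  have g2 := Complex.Gamma_ne_zero_of_re_pos hre1
  have g3 := Complex.Gamma_ne_zero_of_re_pos hre2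
  have g4 := Complex.Gamma_ne_zero_of_re_pos hre3
  have hne : s.ρ₁ - s.mu k₀ ≠ 0 := (s.ρ₁_mu_notInt k₀).ne_zero
  have hg5 : Complex.Gamma (s.ρ₁ - s.mu k₀ + 1) =
      (s.ρ₁ - s.mu k₀) * Complex.Gamma (s.ρ₁ - s.mu k₀) := Complex.Gamma_add_one _ hne
  have key := s.connects_of_large (a := 0) le_rfl (e := s.ρ₁ + s.ρ₂ - s.mu k₀)
    (γ := s.ρ₂ + 1 - s.mu k₀) (α := s.ρ₁ - s.mu k₀ - 1)
    (ω := -((s.ρ₁ - s.mu k₀) * betaIntegral (s.ρ₁ - s.mu k₀ - 1 + 1) (s.ρ₂ + 1)))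
    (lead := Pi.single (Sum.inr k₀) 1) (glead := fun i => s.P i k₀)
    (M := fun i => s.P i k₀ / s.τ i)
    (β := Sum.elim 0 fun k => s.ρ₁ + s.ρ₂ - s.mu k) h₂ h₁₂ hα ?_ ?_ h.exp_ne ?_ (by ring)
    ?_ ?_ ?_
  · convert key using 1
    rw [hb1, hb2, lastFactor, hg5]
    field_simp
  · rintro (i | k) X hX
    · exact h.τ_ne i X hX
    · simpa [T] using (show (0 : ℝ) < X from hX).ne'
  · rintro (i | k) (j | l) h1 h2
    · simp [T, s.τ_ne] at h1
    · simp [T, s.τ_ne] at h1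
    · simp [T, s.τ_ne] at h2
    · rw [B, bigMat, fromBlocks_apply₂₂, s.QAP, smul_one_eq_diagonal, diagonal_sub,
        diagonal_apply]
      simp
  · rintro (i | k) h1
    · simp [T, s.τ_ne] at h1
    · intro m hm
      apply h.nonres k m
      simp only [Sum.elim_inr] at hm
      linear_combination hm
  · intro c' g hg
    refine LeadFin.pi fun i => ?_
    refine (((hg.apply i).cpow_smul (s.ρ₁ - s.ρ₂ - 2)).smul (1 / s.τ i)).cast (by ring) ?_
      fun X => ?_
    · simp only [Pi.smul_apply, smul_eq_mul]; ring
    · simp only [smul_eq_mul, sub_zero]; ring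
  · rw [hb1]; exact neg_ne_zero.2 (mul_ne_zero hne (div_ne_zero (mul_ne_zero g1 g2) g3))
  · have : (fun i => (((0 : ℝ) : ℂ) - s.τ i) * (s.P i k₀ / s.τ i)) =
        -(s.P *ᵥ Pi.single k₀ 1) := by
      funext i
      have := s.τ_ne i
      simp only [mulVec_single_one, Pi.neg_apply, col_apply, ofReal_zero]
      field_simp
      simp
    rw [this, mulVec_neg, s.Q_P]
    funext j
    rcases j with i | k
    · simp
    · by_cases hk : k = k₀
      · subst hk; simp; ring
      · simp [hk]

end RaySys

/-! ### Shifts of the parameters -/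

/-- An expansion can be started one order earlier, with leading coefficient zero. -/
lemma LeadInf.weaken {E : Type*} [NormedAddCommGroup E] [NormedSpace ℂ E] {e : ℂ} {v : E}
    {f : ℝ → E} (h : LeadInf e v f) : LeadInf (e + 1) (0 : E) f := by
  refine h.inv_smul.mul_smul.congr ?_
  filter_upwards [eventually_gt_atTop 0] with X hX
  have hX' : (X : ℂ) ≠ 0 := by exact_mod_cast hX.ne'
  rw [smul_smul, mul_inv_cancel₀ hX', one_smul]

namespace RaySys

variable {R K : Type} [Fintype R] [Fintype K] [DecidableEq R] [DecidableEq K] (s : RaySys R K)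

/-- Vectors are compared in the coordinates `Q u`, `v`. -/
lemma ext_Q {f g : R ⊕ K → ℂ} (h1 : ∀ k, (s.Q *ᵥ fun i => f (Sum.inl i)) k =
    (s.Q *ᵥ fun i => g (Sum.inl i)) k) (h2 : ∀ k, f (Sum.inr k) = g (Sum.inr k)) : f = g := by
  have h3 := s.Q_injective (funext h1)
  funext j
  rcases j with i | k
  · exact congrFun h3 i
  · exact h2 k

/-- `(B - ρ₁) (B - ρ₂) = 0`. -/
lemma B_B (f : R ⊕ K → ℂ) :
    s.B *ᵥ (s.B *ᵥ f) = (s.ρ₁ + s.ρ₂) • (s.B *ᵥ f) - (s.ρ₁ * s.ρ₂) • f := by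
  refine s.ext_Q (fun k => ?_) fun k => ?_
  · rw [s.Q_B, s.Q_B, s.B_inr]
    have : (fun i => ((s.ρ₁ + s.ρ₂) • (s.B *ᵥ f) - (s.ρ₁ * s.ρ₂) • f) (Sum.inl i)) =
        (s.ρ₁ + s.ρ₂) • (fun i => (s.B *ᵥ f) (Sum.inl i)) -
          (s.ρ₁ * s.ρ₂) • fun i => f (Sum.inl i) := rfl
    rw [this, mulVec_sub, mulVec_smul, mulVec_smul, Pi.sub_apply, Pi.smul_apply, Pi.smul_apply,
      s.Q_B, smul_eq_mul, smul_eq_mul]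
    ring
  · rw [s.B_inr, s.Q_B, Pi.sub_apply, Pi.smul_apply, Pi.smul_apply, s.B_inr, smul_eq_mul,
      smul_eq_mul]
    ring

/-- The inverse of `B + 1`. -/
def resolvent (f : R ⊕ K → ℂ) : R ⊕ K → ℂ :=
  ((s.ρ₁ + 1) * (s.ρ₂ + 1))⁻¹ • ((s.ρ₁ + s.ρ₂ + 1) • f - s.B *ᵥ f)

lemma resolvent_eq_mulVec (f : R ⊕ K → ℂ) : s.resolvent f =
    (((s.ρ₁ + 1) * (s.ρ₂ + 1))⁻¹ • ((s.ρ₁ + s.ρ₂ + 1) • (1 : Matrix _ _ ℂ) - s.B)) *ᵥ f := by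
  rw [resolvent, smul_mulVec, sub_mulVec, smul_mulVec, one_mulVec]

lemma resolvent_ne : (s.ρ₁ + 1) * (s.ρ₂ + 1) ≠ 0 :=
  mul_ne_zero s.ρ₁_notInt.add_one.ne_zero s.ρ₂_notInt.add_one.ne_zero

lemma resolvent_add (f : R ⊕ K → ℂ) : s.resolvent (s.B *ᵥ f + f) = f := by
  rw [resolvent, mulVec_add, s.B_B, inv_smul_eq_iff₀ s.resolvent_ne]
  module

lemma add_resolvent (f : R ⊕ K → ℂ) : s.B *ᵥ s.resolvent f + s.resolvent f = f := by
  have h : s.B *ᵥ s.resolvent f = s.resolvent (s.B *ᵥ f) := by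
    rw [resolvent, resolvent, mulVec_smul, mulVec_sub, mulVec_smul]
  rw [h, s.resolvent_eq_mulVec, s.resolvent_eq_mulVec, ← mulVec_add, ← s.resolvent_eq_mulVec,
    s.resolvent_add]

/-- The system with `A`, `ρ₁`, `ρ₂` replaced by `A + 1`, `ρ₁ + 1`, `ρ₂ + 1`. -/
@[simps] def up : RaySys R K where
  A := s.A + 1
  P := s.P
  Q := s.Q
  τ := s.τ
  mu k := s.mu k + 1
  ρ₁ := s.ρ₁ + 1
  ρ₂ := s.ρ₂ + 1
  PQ := s.PQ
  QP := s.QP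
  QAP := by
    rw [Matrix.mul_add, Matrix.add_mul, s.QAP, Matrix.mul_one, s.QP, ← diagonal_one, diagonal_add]
  τ_ne := s.τ_ne
  ρ₁_notInt := s.ρ₁_notInt.add_one
  ρ₂_notInt := s.ρ₂_notInt.add_one
  ρ₁₂_notInt := s.ρ₁₂_notInt.congr (by ring)
  ρ₁_mu_notInt k := (s.ρ₁_mu_notInt k).congr (by ring)
  ρ₂_mu_notInt k := (s.ρ₂_mu_notInt k).congr (by ring)

lemma up_B (f : R ⊕ K → ℂ) : s.up.B *ᵥ f = s.B *ᵥ f + f := by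
  funext j
  rcases j with i | k
  · simp only [B_inl, up_A, up_P, Pi.add_apply, add_mulVec, one_mulVec]; ring
  · simp only [B_inr, up_Q, up_mu, up_ρ₁, up_ρ₂, Pi.add_apply]; ring

lemma up_T : s.up.T = s.T := rfl

/-- The primitive of a solution that is a solution of the shifted system. -/
def primitive (f : ℝ → R ⊕ K → ℂ) (X : ℝ) : R ⊕ K → ℂ :=
  s.resolvent fun j => ((X : ℂ) - s.T j) * f X j

lemma hasDerivAt_primitive {I : Set ℝ} {f : ℝ → R ⊕ K → ℂ} (hf : RaySol s.T s.B I f) {X : ℝ}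
    (hX : X ∈ I) : HasDerivAt (s.primitive f) (f X) X := by
  obtain ⟨f', h1, h2⟩ := hf X hX
  have h3 : HasDerivAt (fun X : ℝ => fun j => ((X : ℂ) - s.T j) * f X j) (s.B *ᵥ f X + f X) X := by
    refine hasDerivAt_pi.2 fun j => ?_
    have d0 : HasDerivAt (fun X : ℝ => (X : ℂ) - s.T j) 1 X := by
      simpa using ((hasDerivAt_id X).ofReal_comp).sub_const (s.T j)
    refine (d0.mul (hasDerivAt_pi.1 h1 j)).congr_deriv ?_
    rw [h2, Pi.add_apply]; ring
  set L := LinearMap.toContinuousLinearMap (mulVecLin (((s.ρ₁ + 1) * (s.ρ₂ + 1))⁻¹ •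
    ((s.ρ₁ + s.ρ₂ + 1) • (1 : Matrix _ _ ℂ) - s.B))) with hL
  have hL' : ∀ f, s.resolvent f = L f := fun f => s.resolvent_eq_mulVec f
  have h4 := (L.restrictScalars ℝ).hasFDerivAt.comp_hasDerivAt X h3
  have h5 : L.restrictScalars ℝ (s.B *ᵥ f X + f X) = f X := by
    rw [ContinuousLinearMap.coe_restrictScalars', ← hL', s.resolvent_add]
  rw [h5] at h4
  refine h4.congr_of_eventuallyEq (Eventually.of_forall fun X => ?_)
  exact hL' _

/-- The shift of `A`, `ρ₁`, `ρ₂` by one amounts to replacing `B` by `B + 1`, and `(x - T) f = (B + 1) F` for the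
primitive `F` of `f` given by `primitive`. -/
lemma raySol_primitive {I : Set ℝ} {f : ℝ → R ⊕ K → ℂ} (hf : RaySol s.T s.B I f) :
    RaySol s.up.T s.up.B I (s.primitive f) := fun X hX =>
  ⟨f X, s.hasDerivAt_primitive hf hX, fun j => by
    rw [s.up_B, primitive, s.add_resolvent, s.up_T]⟩

/-- The factor `1 / (e + 1)` of the primitive. As `lead` is supported on the block of `a`, the
function `(X - T) f` vanishes to one order more than `f`. -/
lemma leadFin_primitive {a : ℝ} {e c : ℂ} {lead : R ⊕ K → ℂ} {f : ℝ → R ⊕ K → ℂ}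
    (he : e + 1 ≠ 0) (hlead : ∀ j, (a - s.T j) * lead j = 0)
    (hf : RaySol s.T s.B (Ioi a) f) (h : LeadFin a e (c • lead) f) :
    LeadFin a (e + 1) ((c / (e + 1)) • lead) (s.primitive f) := by
  have h1 : LeadFin a e (0 : R ⊕ K → ℂ) (fun X j => ((X : ℂ) - s.T j) * f X j) := by
    refine LeadFin.pi fun j => ?_
    have hu : AnalyticAt ℂ (fun y : ℂ => y + a - s.T j) 0 := by fun_prop
    refine ((h.apply j).smul_analytic hu).cast rfl ?_ fun X => ?_
    · rw [Pi.smul_apply, smul_eq_mul, smul_eq_mul, mul_left_comm, zero_add, hlead, mul_zero]; rfl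
    · push_cast; rw [sub_add_cancel, smul_eq_mul]
  obtain ⟨w, hw⟩ := h1.raise rfl
  have h2 : LeadFin a (e + 1) (s.resolvent w) (s.primitive f) := by
    refine (hw.mulVec _).cast rfl (s.resolvent_eq_mulVec w) fun X => s.resolvent_eq_mulVec _
  have h3 := h2.deriv (f' := f) (by
    filter_upwards [self_mem_nhdsWithin] with X hX using s.hasDerivAt_primitive hf hX)
  rw [add_sub_cancel_right] at h3
  have h4 := h3.unique h
  refine h2.cast rfl ?_ fun X => rfl
  rw [div_eq_inv_mul, mul_smul, ← h4, smul_smul, inv_mul_cancel₀ he, one_smul]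

lemma leadInf_primitive {b : ℝ} {e : ℂ} {v : R ⊕ K → ℂ} {f : ℝ → R ⊕ K → ℂ}
    (he : e + 1 ≠ 0) (hf : RaySol s.T s.B (Ioi b) f) (h : LeadInf e v f) :
    LeadInf (e + 1) ((e + 1)⁻¹ • v) (s.primitive f) := by
  have h1 : LeadInf (e + 1) v (fun X j => ((X : ℂ) - s.T j) * f X j) := by
    refine LeadInf.pi fun j => ?_
    refine ((h.apply j).mul_smul.sub ((h.apply j).weaken.smul (s.T j))).cast rfl ?_ fun X => ?_
    · simp
    · simp only [smul_eq_mul]; ring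
  have h2 : LeadInf (e + 1) (s.resolvent v) (s.primitive f) := by
    refine (h1.mulVec _).cast rfl (s.resolvent_eq_mulVec v) fun X => s.resolvent_eq_mulVec _
  have h3 := h2.deriv (f' := f) (by
    filter_upwards [Ioi_mem_atTop b] with X hX using s.hasDerivAt_primitive hf hX)
  rw [add_sub_cancel_right] at h3
  refine h2.cast rfl ?_ fun X => rfl
  rw [inv_smul_eq_iff₀ he]
  exact (h3.unique h).symm

/-- The shift by a primitive does not affect the underlying system: `A` and `ρ₂` enter there only
in the combination `A - ρ₂`. -/
lemma connects_of_up {a : ℝ} {e γ κ : ℂ} {lead : R ⊕ K → ℂ} {glead : R → ℂ} (he : e + 1 ≠ 0)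
    (hlead : ∀ j, (a - s.T j) * lead j = 0) (h : s.up.Connects a (e + 1) γ lead glead κ) :
    s.Connects a e γ lead glead (κ * (s.ρ₁ + 1) / (e + 1)) := by
  intro f f₁ f₂ g v₁ v₂ g_inf c c' b hf hfa hf₁ hf₂ hsum hv₁ hv₂ hg hga hginf i
  have h1 := s.ρ₁_notInt.add_one.ne_zero
  have h2 := s.ρ₂_notInt.add_one.ne_zero
  have key := h (s.primitive f) (s.primitive f₁) (s.primitive f₂) g _ _ g_inf _ c' b
    (s.raySol_primitive hf) (s.leadFin_primitive he hlead hf hfa) (s.raySol_primitive hf₁)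
    (s.raySol_primitive hf₂) ?_ (s.leadInf_primitive h1 hf₁ hv₁) (s.leadInf_primitive h2 hf₂ hv₂)
    ?_ hga hginf i
  · rw [Pi.smul_apply, smul_eq_mul, up_τ] at key
    have h3 : c' * v₁ (Sum.inl i) = (s.ρ₁ + 1) * (c' * ((s.ρ₁ + 1)⁻¹ * v₁ (Sum.inl i))) := by
      field_simp
    rw [h3, key]; ring
  · filter_upwards [hsum] with X hX
    simp only [primitive, resolvent_eq_mulVec]
    rw [← mulVec_add, hX]
    congr 1
    funext j
    simp only [Pi.add_apply]; ring
  · intro ξ hξ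
    obtain ⟨g', h3, h4⟩ := hg ξ hξ
    refine ⟨g', h3, fun i => ?_⟩
    rw [up_τ, h4, up_A, up_ρ₂, add_mulVec, one_mulVec, Pi.add_apply]; ring

end RaySys

lemma hasDerivAt_mulVec {I J : Type*} [Fintype I] [Fintype J] (M : Matrix I J ℂ) {f : ℝ → J → ℂ}
    {f' : J → ℂ} {X : ℝ} (h : HasDerivAt f f' X) (i : I) :
    HasDerivAt (fun X => (M *ᵥ f X) i) ((M *ᵥ f') i) X := by
  simp only [mulVec, dotProduct]
  exact HasDerivAt.fun_sum fun j _ => (hasDerivAt_pi.1 h j).const_mul _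

lemma hasDerivAt_inl {I J : Type*} {f : ℝ → I ⊕ J → ℂ} {f' : I ⊕ J → ℂ} {X : ℝ} (h : HasDerivAt f f' X) :
    HasDerivAt (fun X i => f X (Sum.inl i)) (fun i => f' (Sum.inl i)) X :=
  hasDerivAt_pi.2 fun i => hasDerivAt_pi.1 h (Sum.inl i)

namespace RaySys

variable {R K : Type} [Fintype R] [Fintype K] [DecidableEq R] [DecidableEq K] (s : RaySys R K)

/-- The system with `A`, `ρ₂` replaced by `A - 1`, `ρ₂ - 1`. -/
@[simps] def down : RaySys R K where
  A := s.A - 1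
  P := s.P
  Q := s.Q
  τ := s.τ
  mu k := s.mu k - 1
  ρ₁ := s.ρ₁
  ρ₂ := s.ρ₂ - 1
  PQ := s.PQ
  QP := s.QP
  QAP := by
    rw [Matrix.mul_sub, Matrix.sub_mul, s.QAP, Matrix.mul_one, s.QP, ← diagonal_one, diagonal_sub]
  τ_ne := s.τ_ne
  ρ₁_notInt := s.ρ₁_notInt
  ρ₂_notInt := s.ρ₂_notInt.sub_one
  ρ₁₂_notInt := s.ρ₁₂_notInt.add_one.congr (by ring)
  ρ₁_mu_notInt k := (s.ρ₁_mu_notInt k).add_one.congr (by ring)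
  ρ₂_mu_notInt k := (s.ρ₂_mu_notInt k).congr (by ring)

lemma down_T : s.down.T = s.T := rfl

/-- The solution of the system `s.down` that corresponds to a solution `f`. -/
def downMap (f : ℝ → R ⊕ K → ℂ) (X : ℝ) : R ⊕ K → ℂ :=
  Sum.elim (fun i => X * ((s.B *ᵥ f X) (Sum.inl i) / (X - s.τ i)) - s.ρ₂ * f X (Sum.inl i))
    (fun k => (1 + s.ρ₁ - s.mu k) *
      ((s.mu k - s.ρ₂) * (s.Q *ᵥ fun i => f X (Sum.inl i)) k + f X (Sum.inr k)))

/-- The upper half of the new solution is `X u' - ρ₂ u` for the upper half `u` of `f`. -/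
lemma raySol_downMap {I : Set ℝ} (hI : ∀ X ∈ I, ∀ i, (X : ℂ) ≠ s.τ i) {f : ℝ → R ⊕ K → ℂ}
    (hf : RaySol s.T s.B I f) : RaySol s.down.T s.down.B I (s.downMap f) := by
  intro X hX
  obtain ⟨f', h1, h2⟩ := hf X hX
  have hne : ∀ i, (X : ℂ) - s.τ i ≠ 0 := fun i => sub_ne_zero.2 (hI X hX i)
  have hu : ∀ i, (s.B *ᵥ f X) (Sum.inl i) / (X - s.τ i) = f' (Sum.inl i) := fun i => by
    rw [div_eq_iff (hne i), mul_comm]; exact (h2 (Sum.inl i)).symm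
  have hv : ∀ k, (X : ℂ) * f' (Sum.inr k) = -((s.mu k - s.ρ₁) * (s.mu k - s.ρ₂) *
      (s.Q *ᵥ fun i => f X (Sum.inl i)) k) + (s.ρ₁ + s.ρ₂ - s.mu k) * f X (Sum.inr k) := by
    intro k
    have := h2 (Sum.inr k)
    rw [s.B_inr] at this
    simpa [T] using this
  set u : R → ℂ := fun i => f X (Sum.inl i) with hu_def
  set u' : R → ℂ := fun i => f' (Sum.inl i) with hu'_def
  have e1 : (fun i => s.downMap f X (Sum.inl i)) = (X : ℂ) • u' - s.ρ₂ • u := by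
    funext i
    simp only [downMap, Sum.elim_inl, hu, Pi.sub_apply, Pi.smul_apply, smul_eq_mul, hu_def,
      hu'_def]
  refine ⟨Sum.elim
    (fun i => f' (Sum.inl i) + X * (((s.B *ᵥ f') (Sum.inl i) - f' (Sum.inl i)) / (X - s.τ i)) -
      s.ρ₂ * f' (Sum.inl i))
    (fun k => (1 + s.ρ₁ - s.mu k) * ((s.mu k - s.ρ₂) * (s.Q *ᵥ u') k + f' (Sum.inr k))), ?_, ?_⟩
  · refine hasDerivAt_pi.2 fun j => ?_
    rcases j with i | k
    · simp only [downMap, Sum.elim_inl]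
      have d0 : HasDerivAt (fun X : ℝ => (X : ℂ)) 1 X := by
        simpa using (hasDerivAt_id X).ofReal_comp
      have d1 := (hasDerivAt_mulVec s.B h1 (Sum.inl i)).fun_div (d0.sub_const (s.τ i)) (hne i)
      refine ((d0.fun_mul d1).sub ((hasDerivAt_pi.1 h1 (Sum.inl i)).const_mul s.ρ₂)).congr_deriv ?_
      rw [hu, ← hu i]
      have := hne i
      field_simp
    · simp only [downMap, Sum.elim_inr]
      exact (((hasDerivAt_mulVec s.Q (hasDerivAt_inl h1) k).const_mul _).add
        (hasDerivAt_pi.1 h1 (Sum.inr k))).const_mul _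
  · rintro (i | k)
    · rw [B_inl, e1, down_T]
      have h3 : (s.P *ᵥ fun k => s.downMap f X (Sum.inr k)) =
          (X : ℂ) • (s.P *ᵥ fun k => f' (Sum.inr k)) +
            (1 - s.ρ₂) • (s.P *ᵥ fun k => f X (Sum.inr k)) + s.A *ᵥ u - s.ρ₂ • u := by
        apply s.Q_injective
        funext k
        simp only [mulVec_add, mulVec_sub, mulVec_smul, s.Q_P, Pi.add_apply, Pi.sub_apply,
          Pi.smul_apply, smul_eq_mul, s.Q_A, hv, downMap, Sum.elim_inr, ← hu_def]
        ring
      have h4 := hu i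
      rw [div_eq_iff (hne i), s.B_inl, ← hu_def] at h4
      rw [down_P, h3, down_A]
      simp only [Sum.elim_inl, T, sub_mulVec, one_mulVec, mulVec_sub, mulVec_smul, Pi.sub_apply,
        Pi.add_apply, Pi.smul_apply, smul_eq_mul, s.B_inl, ← hu'_def]
      have := hne i
      have h5 : u' i = f' (Sum.inl i) := rfl
      have h6 : u i = f X (Sum.inl i) := rfl
      rw [← h5] at *
      field_simp
      linear_combination (-1 + s.ρ₂) * h4
    · rw [B_inr, e1, down_T]
      simp only [Sum.elim_inr, T, sub_zero, down_mu, down_ρ₁, down_ρ₂, down_Q, mulVec_sub,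
        mulVec_smul, Pi.sub_apply, Pi.smul_apply, smul_eq_mul, downMap, ← hu_def]
      have := hv k
      linear_combination (1 + s.ρ₁ - s.mu k) * this

/-- The leading coefficient of a solution at infinity is determined by its upper half. -/
lemma leadInf_inr {b : ℝ} {e : ℂ} {v : R ⊕ K → ℂ} {f : ℝ → R ⊕ K → ℂ}
    (hf : RaySol s.T s.B (Ioi b) f) (h : LeadInf e v f) (k : K) :
    v (Sum.inr k) = (e - s.mu k) * (s.Q *ᵥ fun i => v (Sum.inl i)) k := by
  obtain ⟨Φ, h1, rfl⟩ := h
  have h2 := hf.mulVec_leading_inf h1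
  have h3 := s.Q_B (Φ 0) k
  rw [h2] at h3
  have : (fun i => (e • Φ 0) (Sum.inl i)) = e • fun i => Φ 0 (Sum.inl i) := rfl
  rw [this, mulVec_smul, Pi.smul_apply, smul_eq_mul] at h3
  linear_combination -h3

/-- The operator `X d/dX - ρ₂` multiplies the upper half of the leading coefficient by `e - ρ₂`.
For `e = ρ₂` this is zero, in accordance with the exponent `ρ₂ - 1` of the new system. -/
lemma leadInf_downMap {b : ℝ} (hb : ∀ X > b, ∀ i, (X : ℂ) ≠ s.τ i) {e : ℂ} {v : R ⊕ K → ℂ}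
    {f : ℝ → R ⊕ K → ℂ} (hf : RaySol s.T s.B (Ioi b) f) (h : LeadInf e v f) :
    LeadInf e (Sum.elim (fun i => (e - s.ρ₂) * v (Sum.inl i)) (fun k => (1 + s.ρ₁ - s.mu k) *
      ((e - s.ρ₂) * (s.Q *ᵥ fun i => v (Sum.inl i)) k))) (s.downMap f) := by
  have h0 := h
  choose! f' h1 h2 using hf
  have hd := h.deriv (f' := f') (by filter_upwards [Ioi_mem_atTop b] with X hX using h1 X hX)
  refine LeadInf.pi fun j => ?_
  rcases j with i | k
  · have h3 := ((hd.apply (Sum.inl i)).mul_smul).sub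
      (((h.apply (Sum.inl i)).smul s.ρ₂).cast (sub_add_cancel e 1) rfl fun X => rfl)
    refine ((h3.cast (sub_add_cancel e 1).symm ?_ fun X => rfl).congr ?_)
    · simp only [Sum.elim_inl, Pi.smul_apply, smul_eq_mul]; ring
    · filter_upwards [Ioi_mem_atTop b] with X hX
      have := h2 X hX (Sum.inl i)
      simp only [downMap, Sum.elim_inl, smul_eq_mul]
      rw [← this, T, Sum.elim_inl, mul_div_cancel_left₀]
      exact sub_ne_zero.2 (hb X hX i)
  · have h3 : LeadInf e (fun i => v (Sum.inl i)) (fun X i => f X (Sum.inl i)) :=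
      LeadInf.pi fun i => h.apply (Sum.inl i)
    refine ((((h3.mulVec s.Q).apply k).smul (s.mu k - s.ρ₂)).add (h.apply (Sum.inr k))).smul
      (1 + s.ρ₁ - s.mu k) |>.cast rfl ?_ fun X => rfl
    have h4 : RaySol s.T s.B (Ioi b) f := fun X hX => ⟨f' X, h1 X hX, h2 X hX⟩
    rw [s.leadInf_inr h4 h]
    simp only [Sum.elim_inr, smul_eq_mul]; ring

lemma leadFin_downMap {e c : ℂ} {k₀ : K} (h0 : ∀ X : ℝ, 0 < X → ∀ i, (X : ℂ) ≠ s.τ i)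
    {f : ℝ → R ⊕ K → ℂ} (hf : RaySol s.T s.B (Ioi 0) f)
    (h : LeadFin 0 e (c • Pi.single (Sum.inr k₀) 1) f) :
    LeadFin 0 e (((1 + s.ρ₁ - s.mu k₀) * c) • Pi.single (Sum.inr k₀) 1) (s.downMap f) := by
  choose! f' h1 h2 using hf
  have hd := h.deriv (f' := f') (by filter_upwards [self_mem_nhdsWithin] with X hX using h1 X hX)
  refine LeadFin.pi fun j => ?_
  rcases j with i | k
  · have h3 := ((hd.apply (Sum.inl i)).cpow_smul 1).sub
      (((h.apply (Sum.inl i)).smul s.ρ₂).cast (by ring : 1 + (e - 1) = e) rfl fun X => rfl)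
    refine ((h3.cast (by ring : e = 1 + (e - 1)) ?_ fun X => rfl).congr ?_)
    · simp
    · filter_upwards [self_mem_nhdsWithin] with X hX
      have := h2 X hX (Sum.inl i)
      simp only [downMap, Sum.elim_inl, smul_eq_mul, cpow_one, sub_zero]
      rw [← this, T, Sum.elim_inl, mul_div_cancel_left₀]
      exact sub_ne_zero.2 (h0 X hX i)
  · have h3 : LeadFin 0 e (0 : R → ℂ) (fun X i => f X (Sum.inl i)) :=
      LeadFin.pi fun i => (h.apply (Sum.inl i)).cast rfl (by simp) fun X => rfl
    refine ((((h3.mulVec s.Q).apply k).smul (s.mu k - s.ρ₂)).add (h.apply (Sum.inr k))).smul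
      (1 + s.ρ₁ - s.mu k) |>.cast rfl ?_ fun X => rfl
    by_cases hk : k = k₀
    · subst hk; simp
    · simp [hk]

/-- The shift leaves the underlying system unchanged, as `A - ρ₂` and `τ` are unchanged. -/
lemma connects_of_down {γ κ : ℂ} {k₀ : K} {glead : R → ℂ}
    (h0 : ∀ X : ℝ, 0 < X → ∀ i, (X : ℂ) ≠ s.τ i)
    (h : s.down.Connects 0 (s.ρ₁ + s.ρ₂ - s.mu k₀) γ (Pi.single (Sum.inr k₀) 1) glead κ) :
    s.Connects 0 (s.ρ₁ + s.ρ₂ - s.mu k₀) γ (Pi.single (Sum.inr k₀) 1) glead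
      (κ * (s.ρ₁ - s.mu k₀ + 1) / (s.ρ₁ - s.ρ₂)) := by
  intro f f₁ f₂ g v₁ v₂ g_inf c c' b hf hfa hf₁ hf₂ hsum hv₁ hv₂ hg hga hginf i
  have hne := s.ρ₁₂_notInt.ne_zero
  have hb : ∀ X > max b 0, ∀ i, (X : ℂ) ≠ s.τ i := fun X hX =>
    h0 X (lt_of_le_of_lt (le_max_right b 0) hX)
  replace hf₁ : RaySol s.T s.B (Ioi (max b 0)) f₁ := hf₁.mono (Ioi_subset_Ioi (le_max_left b 0))
  replace hf₂ : RaySol s.T s.B (Ioi (max b 0)) f₂ := hf₂.mono (Ioi_subset_Ioi (le_max_left b 0))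
  -- with exponent `ρ₂` the leading coefficient is zero, and one order is lost
  obtain ⟨w₂, hw₂⟩ := (s.leadInf_downMap hb hf₂ hv₂).lower (by
    funext j; rcases j with i | k <;> simp)
  have key := h (s.downMap f) (s.downMap f₁) (s.downMap f₂) g _ w₂ g_inf _ c' (max b 0)
    (s.raySol_downMap (fun X hX => h0 X hX) hf) (s.leadFin_downMap h0 hf hfa)
    (s.raySol_downMap hb hf₁) (s.raySol_downMap hb hf₂) ?_
    (s.leadInf_downMap hb hf₁ hv₁) hw₂ ?_ hga hginf i
  · rw [Sum.elim_inl, down_τ, down_ρ₁] at key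
    have h3 : c' * v₁ (Sum.inl i) =
        (c' * ((s.ρ₁ - s.ρ₂) * v₁ (Sum.inl i))) / (s.ρ₁ - s.ρ₂) := by
      field_simp
    rw [h3, key]; ring
  · filter_upwards [hsum] with X hX
    have hu : (fun i => f X (Sum.inl i)) =
        (fun i => f₁ X (Sum.inl i)) + fun i => f₂ X (Sum.inl i) := by
      rw [hX]; rfl
    funext j
    rcases j with i | k
    · simp only [downMap, Sum.elim_inl, Pi.add_apply, hX, mulVec_add]; ring
    · simp only [downMap, Sum.elim_inr, Pi.add_apply, hu, mulVec_add]; rw [hX, Pi.add_apply]; ring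
  · intro ξ hξ
    obtain ⟨g', h3, h4⟩ := hg ξ hξ
    refine ⟨g', h3, fun i => ?_⟩
    rw [down_τ, h4, down_A, down_ρ₂, sub_mulVec, one_mulVec, Pi.sub_apply]; ring

end RaySys

namespace RaySys

variable {R K : Type} [Fintype R] [Fintype K] [DecidableEq R] [DecidableEq K] (s : RaySys R K)

/-- The system with `ρ₂` replaced by `ρ₂ - 1`. -/
@[simps] def lower : RaySys R K where
  A := s.A
  P := s.P
  Q := s.Q
  τ := s.τ
  mu := s.mu
  ρ₁ := s.ρ₁
  ρ₂ := s.ρ₂ - 1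
  PQ := s.PQ
  QP := s.QP
  QAP := s.QAP
  τ_ne := s.τ_ne
  ρ₁_notInt := s.ρ₁_notInt
  ρ₂_notInt := s.ρ₂_notInt.sub_one
  ρ₁₂_notInt := s.ρ₁₂_notInt.add_one.congr (by ring)
  ρ₁_mu_notInt := s.ρ₁_mu_notInt
  ρ₂_mu_notInt k := (s.ρ₂_mu_notInt k).sub_one.congr (by ring)

lemma lower_T : s.lower.T = s.T := rfl

/-- The vector `u + (A - ρ₂)⁻¹ P v`. -/
def aux (x : R ⊕ K → ℂ) : R → ℂ :=
  (fun i => x (Sum.inl i)) + s.P *ᵥ fun k => x (Sum.inr k) / (s.mu k - s.ρ₂)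

lemma Q_aux (x : R ⊕ K → ℂ) (k : K) : (s.Q *ᵥ s.aux x) k =
    (s.Q *ᵥ fun i => x (Sum.inl i)) k + x (Sum.inr k) / (s.mu k - s.ρ₂) := by
  rw [aux, mulVec_add, s.Q_P]; rfl

/-- The solution of the system `s.lower` that corresponds to a solution `f`. -/
def lowerMap (f : ℝ → R ⊕ K → ℂ) (X : ℝ) : R ⊕ K → ℂ :=
  Sum.elim (fun i => s.aux (f X) i / s.τ i)
    (fun k => (s.ρ₁ - s.mu k) * (s.Q *ᵥ fun i => s.aux (f X) i / s.τ i) k +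
      (X : ℂ)⁻¹ * ((s.mu k - s.ρ₁ - s.ρ₂) * (s.Q *ᵥ s.aux (f X)) k +
        s.ρ₂ * (s.Q *ᵥ fun i => f X (Sum.inl i)) k))

lemma mu_sub_ne (k : K) : s.mu k - s.ρ₂ ≠ 0 := by
  have := (s.ρ₂_mu_notInt k).ne_zero
  rw [sub_ne_zero] at this ⊢
  exact this.symm

/-- Both halves are verified in the coordinates in which `A` is diagonal. -/
lemma raySol_lowerMap {I : Set ℝ} (hI : ∀ X ∈ I, (X : ℂ) ≠ 0) {f : ℝ → R ⊕ K → ℂ}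
    (hf : RaySol s.T s.B I f) : RaySol s.lower.T s.lower.B I (s.lowerMap f) := by
  intro X hX
  obtain ⟨f', h1, h2⟩ := hf X hX
  have hX0 := hI X hX
  have hμ := s.mu_sub_ne
  set u : R → ℂ := fun i => f X (Sum.inl i) with hu_def
  set u' : R → ℂ := fun i => f' (Sum.inl i) with hu'_def
  set y : R → ℂ := s.aux (f X) with hy
  set y' : R → ℂ := s.aux f' with hy'
  have hu : ∀ i, ((X : ℂ) - s.τ i) * u' i = (s.A *ᵥ u) i + (s.P *ᵥ fun k => f X (Sum.inr k)) i := by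
    intro i
    rw [← s.B_inl]; exact h2 (Sum.inl i)
  have hv : ∀ k, (X : ℂ) * f' (Sum.inr k) = -((s.mu k - s.ρ₁) * (s.mu k - s.ρ₂) *
      (s.Q *ᵥ u) k) + (s.ρ₁ + s.ρ₂ - s.mu k) * f X (Sum.inr k) := by
    intro k
    have := h2 (Sum.inr k)
    rw [s.B_inr] at this
    simpa [T] using this
  -- `A y - ρ₂ y = A u - ρ₂ u + P v`
  have hAy : (s.A *ᵥ y) - s.ρ₂ • y = (s.A *ᵥ u) - s.ρ₂ • u + s.P *ᵥ fun k => f X (Sum.inr k) := by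
    apply s.Q_injective
    funext k
    simp only [mulVec_add, mulVec_sub, mulVec_smul, s.Q_P, Pi.add_apply, Pi.sub_apply,
      Pi.smul_apply, smul_eq_mul, s.Q_A, hy, s.Q_aux, ← hu_def]
    have := hμ k
    field_simp
  -- `X y' = τ u' + ρ₁ y`
  have hXy : ∀ i, (X : ℂ) * y' i = s.τ i * u' i + s.ρ₁ * y i := by
    have : (X : ℂ) • (y' - u') = s.ρ₁ • y - (s.A *ᵥ u) - s.P *ᵥ fun k => f X (Sum.inr k) := by
      apply s.Q_injective
      funext k
      simp only [mulVec_sub, mulVec_smul, s.Q_P, Pi.sub_apply,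
        Pi.smul_apply, smul_eq_mul, s.Q_A, hy, hy', s.Q_aux, ← hu_def, ← hu'_def]
      have h3 := hv k
      have := hμ k
      field_simp
      linear_combination h3
    intro i
    have h3 := congrFun this i
    simp only [Pi.sub_apply, Pi.smul_apply, smul_eq_mul] at h3
    linear_combination h3 + hu i
  have hUi : ∀ i, (X : ℂ) * (y' i / s.τ i) = u' i + s.ρ₁ * (y i / s.τ i) := by
    intro i
    have := s.τ_ne i
    field_simp
    linear_combination hXy i
  have dinl := hasDerivAt_inl h1
  have daux : HasDerivAt (fun X => s.aux (f X)) y' X := by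
    refine hasDerivAt_pi.2 fun i => ?_
    refine (hasDerivAt_pi.1 h1 (Sum.inl i)).add (hasDerivAt_mulVec s.P ?_ i)
    exact hasDerivAt_pi.2 fun k => (hasDerivAt_pi.1 h1 (Sum.inr k)).div_const _
  have dU : HasDerivAt (fun X i => s.aux (f X) i / s.τ i) (fun i => y' i / s.τ i) X :=
    hasDerivAt_pi.2 fun i => (hasDerivAt_pi.1 daux i).div_const _
  have d0 : HasDerivAt (fun X : ℝ => (X : ℂ)⁻¹) (-((X : ℂ) ^ 2)⁻¹) X := by
    simpa using (hasDerivAt_inv hX0).comp_ofReal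
  refine ⟨Sum.elim (fun i => y' i / s.τ i) (fun k => (s.ρ₁ - s.mu k) *
      (s.Q *ᵥ fun i => y' i / s.τ i) k +
      ((-((X : ℂ) ^ 2)⁻¹) * ((s.mu k - s.ρ₁ - s.ρ₂) * (s.Q *ᵥ y) k + s.ρ₂ * (s.Q *ᵥ u) k) +
      (X : ℂ)⁻¹ * ((s.mu k - s.ρ₁ - s.ρ₂) * (s.Q *ᵥ y') k + s.ρ₂ * (s.Q *ᵥ u') k))), ?_, ?_⟩
  · refine hasDerivAt_pi.2 fun j => ?_
    rcases j with i | k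
    · exact hasDerivAt_pi.1 dU i
    · simp only [lowerMap, Sum.elim_inr]
      exact ((hasDerivAt_mulVec s.Q dU k).const_mul _).add
        (d0.mul (((hasDerivAt_mulVec s.Q daux k).const_mul _).add
          ((hasDerivAt_mulVec s.Q dinl k).const_mul _)))
  · rintro (i | k)
    · rw [B_inl, lower_T]
      have h3 : (s.P *ᵥ fun k => s.lowerMap f X (Sum.inr k)) =
          s.ρ₁ • (fun i => y i / s.τ i) - (s.A *ᵥ fun i => y i / s.τ i) +
            (X : ℂ)⁻¹ • ((s.A *ᵥ y) - (s.ρ₁ + s.ρ₂) • y + s.ρ₂ • u) := by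
        apply s.Q_injective
        funext k
        simp only [mulVec_add, mulVec_sub, mulVec_smul, s.Q_P, Pi.add_apply, Pi.sub_apply,
          Pi.smul_apply, smul_eq_mul, s.Q_A, lowerMap, Sum.elim_inr, ← hu_def, ← hy]
        ring
      have e1 : (fun i => s.lowerMap f X (Sum.inl i)) = fun i => y i / s.τ i := rfl
      rw [lower_P, h3, lower_A, e1]
      have h4 := congrFun hAy i
      simp only [Pi.add_apply, Pi.sub_apply, Pi.smul_apply, smul_eq_mul, Sum.elim_inl, T] at h4 ⊢
      have h5 := hUi i
      have h6 := hXy i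
      have h7 := hu i
      have hτ := s.τ_ne i
      have h8 : s.τ i * (y' i / s.τ i) = y' i := by field_simp
      rw [sub_mul, h8, h5]
      have h9 : (X : ℂ) * (u' i - y' i) = (s.A *ᵥ y) i - (s.ρ₁ + s.ρ₂) * y i + s.ρ₂ * u i := by
        linear_combination h7 - h6 - h4
      rw [← h9, inv_mul_cancel_left₀ hX0]
      ring
    · have e1 : (fun i => s.lowerMap f X (Sum.inl i)) = fun i => y i / s.τ i := rfl
      rw [B_inr, lower_T, lower_Q, e1]
      simp only [Sum.elim_inr, T, sub_zero, lower_mu, lower_ρ₁, lower_ρ₂, lowerMap,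
        ← hu_def, ← hy]
      have hU : (X : ℂ) * (s.Q *ᵥ fun i => y' i / s.τ i) k =
          (s.Q *ᵥ u') k + s.ρ₁ * (s.Q *ᵥ fun i => y i / s.τ i) k := by
        have : (X : ℂ) • (fun i => y' i / s.τ i) = u' + s.ρ₁ • fun i => y i / s.τ i :=
          funext hUi
        rw [← smul_eq_mul, ← Pi.smul_apply, ← mulVec_smul, this, mulVec_add, mulVec_smul]
        rfl
      have hZ : (X : ℂ) * ((s.Q *ᵥ u') k - (s.Q *ᵥ y') k) =
          (s.mu k - s.ρ₁ - s.ρ₂) * (s.Q *ᵥ y) k + s.ρ₂ * (s.Q *ᵥ u) k := by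
        simp only [hy, hy', s.Q_aux, ← hu_def, ← hu'_def]
        have h3 := hv k
        have := hμ k
        field_simp
        linear_combination -h3
      rw [← hZ]
      have e2 : (X : ℂ)⁻¹ * ((X : ℂ) * ((s.Q *ᵥ u') k - (s.Q *ᵥ y') k)) =
        (s.Q *ᵥ u') k - (s.Q *ᵥ y') k := inv_mul_cancel_left₀ hX0 _
      rw [e2]
      have e3 : (X : ℂ) * (-((X : ℂ) ^ 2)⁻¹ * ((X : ℂ) * ((s.Q *ᵥ u') k - (s.Q *ᵥ y') k))) =
          -((s.Q *ᵥ u') k - (s.Q *ᵥ y') k) := by field_simp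
      have e4 : (X : ℂ) * ((X : ℂ)⁻¹ * ((s.mu k - s.ρ₁ - s.ρ₂) * (s.Q *ᵥ y') k +
          s.ρ₂ * (s.Q *ᵥ u') k)) = (s.mu k - s.ρ₁ - s.ρ₂) * (s.Q *ᵥ y') k +
          s.ρ₂ * (s.Q *ᵥ u') k := mul_inv_cancel_left₀ hX0 _
      rw [mul_add, mul_add, e3, e4]
      linear_combination (s.ρ₁ - s.mu k) * hU

lemma leadInf_aux {e : ℂ} {v : R ⊕ K → ℂ} {f : ℝ → R ⊕ K → ℂ} (h : LeadInf e v f) :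
    LeadInf e (s.aux v) (fun X => s.aux (f X)) := by
  have h1 : LeadInf e (fun i => v (Sum.inl i)) (fun X i => f X (Sum.inl i)) :=
    LeadInf.pi fun i => h.apply (Sum.inl i)
  have h2 : LeadInf e (fun k => v (Sum.inr k) / (s.mu k - s.ρ₂))
      (fun X k => f X (Sum.inr k) / (s.mu k - s.ρ₂)) :=
    LeadInf.pi fun k => ((h.apply (Sum.inr k)).smul (s.mu k - s.ρ₂)⁻¹).cast rfl
      (by rw [smul_eq_mul]; ring) fun X => by rw [smul_eq_mul]; ring
  exact h1.add (h2.mulVec s.P)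

lemma leadFin_aux {a : ℝ} {e : ℂ} {v : R ⊕ K → ℂ} {f : ℝ → R ⊕ K → ℂ} (h : LeadFin a e v f) :
    LeadFin a e (s.aux v) (fun X => s.aux (f X)) := by
  have h1 : LeadFin a e (fun i => v (Sum.inl i)) (fun X i => f X (Sum.inl i)) :=
    LeadFin.pi fun i => h.apply (Sum.inl i)
  have h2 : LeadFin a e (fun k => v (Sum.inr k) / (s.mu k - s.ρ₂))
      (fun X k => f X (Sum.inr k) / (s.mu k - s.ρ₂)) :=
    LeadFin.pi fun k => ((h.apply (Sum.inr k)).smul (s.mu k - s.ρ₂)⁻¹).cast rfl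
      (by rw [smul_eq_mul]; ring) fun X => by rw [smul_eq_mul]; ring
  exact h1.add (h2.mulVec s.P)

lemma leadInf_lowerMap {e : ℂ} {v : R ⊕ K → ℂ} {f : ℝ → R ⊕ K → ℂ} (h : LeadInf e v f) :
    LeadInf e (Sum.elim (fun i => s.aux v i / s.τ i) (fun k => (s.ρ₁ - s.mu k) *
      (s.Q *ᵥ fun i => s.aux v i / s.τ i) k)) (s.lowerMap f) := by
  have h1 := s.leadInf_aux h
  have h2 : LeadInf e (fun i => s.aux v i / s.τ i) (fun X i => s.aux (f X) i / s.τ i) :=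
    LeadInf.pi fun i => ((h1.apply i).smul (s.τ i)⁻¹).cast rfl
      (by rw [smul_eq_mul]; ring) fun X => by rw [smul_eq_mul]; ring
  have h3 : LeadInf e (fun i => v (Sum.inl i)) (fun X i => f X (Sum.inl i)) :=
    LeadInf.pi fun i => h.apply (Sum.inl i)
  refine LeadInf.pi fun j => ?_
  rcases j with i | k
  · exact h2.apply i
  · refine ((((h2.mulVec s.Q).apply k).smul (s.ρ₁ - s.mu k)).add
      ((((h1.mulVec s.Q).apply k).smul (s.mu k - s.ρ₁ - s.ρ₂)).add
        (((h3.mulVec s.Q).apply k).smul s.ρ₂)).inv_smul).cast rfl ?_ fun X => rfl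
    simp

lemma leadFin_lowerMap {e c : ℂ} {i₀ : R} (hi₀ : s.τ i₀ = 1) {f : ℝ → R ⊕ K → ℂ}
    (h : LeadFin 1 e (c • Pi.single (Sum.inl i₀) 1) f) :
    LeadFin 1 e (c • Pi.single (Sum.inl i₀) 1) (s.lowerMap f) := by
  have hv : s.aux (c • Pi.single (Sum.inl i₀) 1) = c • Pi.single i₀ 1 := by
    have e1 : (fun k => (c • Pi.single (Sum.inl i₀) 1 : R ⊕ K → ℂ) (Sum.inr k) /
      (s.mu k - s.ρ₂)) = 0 := by funext k; simp
    rw [aux, e1, mulVec_zero, add_zero]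
    funext i
    by_cases hi : i = i₀
    · subst hi; simp
    · simp [hi]
  have h1 := s.leadFin_aux h
  rw [hv] at h1
  have h2 : LeadFin 1 e (c • Pi.single i₀ 1 : R → ℂ) (fun X i => s.aux (f X) i / s.τ i) :=
    LeadFin.pi fun i => ((h1.apply i).smul (s.τ i)⁻¹).cast rfl
      (by
        by_cases hi : i = i₀
        · subst hi; simp [hi₀]
        · simp [hi]) fun X => by rw [smul_eq_mul]; ring
  have h3 : LeadFin 1 e (c • Pi.single i₀ 1 : R → ℂ) (fun X i => f X (Sum.inl i)) :=
    LeadFin.pi fun i => (h.apply (Sum.inl i)).cast rfl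
      (by
        by_cases hi : i = i₀
        · subst hi; simp
        · simp [hi]) fun X => rfl
  have hu : AnalyticAt ℂ (fun y : ℂ => (y + 1)⁻¹) 0 :=
    (by fun_prop : AnalyticAt ℂ (fun y : ℂ => y + 1) 0).inv (by simp)
  refine LeadFin.pi fun j => ?_
  rcases j with i | k
  · refine (h2.apply i).cast rfl ?_ fun X => rfl
    by_cases hi : i = i₀
    · subst hi; simp
    · simp [hi]
  · refine ((((h2.mulVec s.Q).apply k).smul (s.ρ₁ - s.mu k)).add
      (((((h1.mulVec s.Q).apply k).smul (s.mu k - s.ρ₁ - s.ρ₂)).add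
        (((h3.mulVec s.Q).apply k).smul s.ρ₂)).smul_analytic hu)).cast rfl ?_ fun X => ?_
    · simp only [zero_add, inv_one, smul_eq_mul, Pi.smul_apply]
      simp only [ne_eq, reduceCtorEq, not_false_eq_true, Pi.single_eq_of_ne, mul_zero]
      ring
    · simp [lowerMap]

/-- The solution of the underlying system of `s.lower` that corresponds to a solution `g`. -/
def lowerG (g : ℝ → R → ℂ) (ξ : ℝ) : R → ℂ :=
  s.P *ᵥ fun k => (s.mu k - s.ρ₂)⁻¹ *
    (s.Q *ᵥ fun i => ((ξ : ℂ)⁻¹ - (s.τ i)⁻¹) * g ξ i) k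

/-- The function `lowerG` is obtained from `(1 / ξ - 1 / τ) g` by inverting `A - ρ₂`. -/
lemma A_sub_lowerG (g : ℝ → R → ℂ) (ξ : ℝ) (i : R) :
    (s.A *ᵥ s.lowerG g ξ) i - s.ρ₂ * s.lowerG g ξ i = ((ξ : ℂ)⁻¹ - (s.τ i)⁻¹) * g ξ i := by
  have : (s.A *ᵥ s.lowerG g ξ) - s.ρ₂ • s.lowerG g ξ =
      fun i => ((ξ : ℂ)⁻¹ - (s.τ i)⁻¹) * g ξ i := by
    apply s.Q_injective
    funext k
    rw [mulVec_sub, mulVec_smul, Pi.sub_apply, Pi.smul_apply, s.Q_A, lowerG, s.Q_P, smul_eq_mul,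
      ← sub_mul, mul_inv_cancel_left₀ (s.mu_sub_ne k)]
  exact congrFun this i

/-- Up to the factor `- 1 / ξ ^ 2`, which comes from the coordinate `1 / ξ`, the function `lowerG`
is a primitive of `g`. -/
lemma hasDerivAt_lowerG {a : ℝ} (ha : 0 ≤ a) {g : ℝ → R → ℂ} (hg : s.GSol a g) {ξ : ℝ}
    (hξ : a < ξ) : HasDerivAt (s.lowerG g) (fun i => -((ξ : ℂ) ^ 2)⁻¹ * g ξ i) ξ := by
  obtain ⟨g', h1, h2⟩ := hg ξ hξ
  have hξ0 : (ξ : ℂ) ≠ 0 := by exact_mod_cast (lt_of_le_of_lt ha hξ).ne'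
  have d0 : HasDerivAt (fun X : ℝ => (X : ℂ)⁻¹) (-((ξ : ℂ) ^ 2)⁻¹) ξ := by
    simpa using (hasDerivAt_inv hξ0).comp_ofReal
  have d1 : HasDerivAt (fun (ξ : ℝ) i => ((ξ : ℂ)⁻¹ - (s.τ i)⁻¹) * g ξ i)
      ((-((ξ : ℂ) ^ 2)⁻¹) • ((s.A *ᵥ g ξ) - s.ρ₂ • g ξ)) ξ := by
    refine hasDerivAt_pi.2 fun i => ?_
    refine ((d0.sub_const _).mul (hasDerivAt_pi.1 h1 i)).congr_deriv ?_
    have h3 := h2 i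
    have := s.τ_ne i
    simp only [Pi.smul_apply, Pi.sub_apply, smul_eq_mul]
    field_simp
    linear_combination -h3
  have d2 : HasDerivAt (fun (ξ : ℝ) k => (s.mu k - s.ρ₂)⁻¹ *
      (s.Q *ᵥ fun i => ((ξ : ℂ)⁻¹ - (s.τ i)⁻¹) * g ξ i) k)
      ((-((ξ : ℂ) ^ 2)⁻¹) • (s.Q *ᵥ g ξ)) ξ := by
    refine hasDerivAt_pi.2 fun k => ?_
    refine ((hasDerivAt_mulVec s.Q d1 k).const_mul _).congr_deriv ?_
    rw [mulVec_smul, mulVec_sub, mulVec_smul]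
    simp only [Pi.smul_apply, Pi.sub_apply, smul_eq_mul, s.Q_A]
    have := s.mu_sub_ne k
    field_simp
  refine hasDerivAt_pi.2 fun i => ?_
  refine (hasDerivAt_mulVec s.P d2 i).congr_deriv ?_
  rw [mulVec_smul, s.P_Q, Pi.smul_apply, smul_eq_mul]

/-- Here the underlying system changes as well: `A - ρ₂` becomes `A - ρ₂ + 1`, and `g` is replaced
by the primitive `lowerG`. In the relation obtained for the shifted system, `(A - ρ₂)⁻¹` occurs on
both sides. -/
lemma connects_of_lower {lam₀ κ : ℂ} {i₀ : R} (hi₀ : s.τ i₀ = 1) (hlam : lam₀ - s.ρ₂ ≠ 0)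
    (h : s.lower.Connects 1 lam₀ (lam₀ - s.ρ₂ - 1 + 1) (Pi.single (Sum.inl i₀) 1)
      (Pi.single i₀ 1) κ) :
    s.Connects 1 lam₀ (lam₀ - s.ρ₂ - 1) (Pi.single (Sum.inl i₀) 1) (Pi.single i₀ 1)
      (κ * (lam₀ - s.ρ₂) / (s.ρ₁ - s.ρ₂)) := by
  intro f f₁ f₂ g v₁ v₂ g_inf c c' b hf hfa hf₁ hf₂ hsum hv₁ hv₂ hg hga hginf
  have hne := s.ρ₁₂_notInt.ne_zero
  have hb : ∀ X ∈ Ioi (max b 0), (X : ℂ) ≠ 0 := fun X hX => by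
    exact_mod_cast (lt_of_le_of_lt (le_max_right b 0) hX).ne'
  replace hf₁ : RaySol s.T s.B (Ioi (max b 0)) f₁ := hf₁.mono (Ioi_subset_Ioi (le_max_left b 0))
  replace hf₂ : RaySol s.T s.B (Ioi (max b 0)) f₂ := hf₂.mono (Ioi_subset_Ioi (le_max_left b 0))
  have haux : ∀ {e v f}, RaySol s.T s.B (Ioi (max b 0)) f → LeadInf e v f → ∀ k,
      (s.Q *ᵥ s.aux v) k = (e - s.ρ₂) / (s.mu k - s.ρ₂) * (s.Q *ᵥ fun i => v (Sum.inl i)) k := by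
    intro e v f hf hv k
    rw [s.Q_aux, s.leadInf_inr hf hv]
    have := s.mu_sub_ne k
    field_simp
    ring
  -- with exponent `ρ₂` the leading coefficient is zero, and one order is lost
  obtain ⟨w₂, hw₂⟩ := (s.leadInf_lowerMap hv₂).lower (by
    have : s.aux v₂ = 0 := by
      apply s.Q_injective
      funext k
      rw [haux hf₂ hv₂]; simp
    funext j; rcases j with i | k <;> simp [this]
    right
    exact congrFun (mulVec_zero s.Q) k)
  -- the solution of the underlying system
  have hG0 : LeadFin 1 (lam₀ - s.ρ₂ - 1) (0 : R → ℂ) (s.lowerG g) := by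
    have h1 : LeadFin 1 (lam₀ - s.ρ₂ - 1) (0 : R → ℂ)
        (fun ξ i => ((ξ : ℂ)⁻¹ - (s.τ i)⁻¹) * g ξ i) := by
      refine LeadFin.pi fun i => ?_
      have hu : AnalyticAt ℂ (fun y : ℂ => (y + 1)⁻¹ - (s.τ i)⁻¹) 0 :=
        ((by fun_prop : AnalyticAt ℂ (fun y : ℂ => y + 1) 0).inv (by simp)).sub analyticAt_const
      refine ((hga.apply i).smul_analytic hu).cast rfl ?_ fun X => by simp
      by_cases hi : i = i₀
      · subst hi; simp [hi₀]
      · simp [hi]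
    have h2 : LeadFin 1 (lam₀ - s.ρ₂ - 1) (0 : K → ℂ) (fun (ξ : ℝ) k => (s.mu k - s.ρ₂)⁻¹ *
        (s.Q *ᵥ fun i => ((ξ : ℂ)⁻¹ - (s.τ i)⁻¹) * g ξ i) k) :=
      LeadFin.pi fun k => (((h1.mulVec s.Q).apply k).smul (s.mu k - s.ρ₂)⁻¹).cast rfl
        (by simp) fun X => rfl
    exact (h2.mulVec s.P).cast rfl (by simp) fun X => rfl
  obtain ⟨w, hw⟩ := hG0.raise rfl
  -- its leading coefficient is found by differentiation
  have hw' : w = (-c' / (lam₀ - s.ρ₂)) • (Pi.single i₀ 1 : R → ℂ) := by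
    have h1 := hw.deriv (f' := fun (ξ : ℝ) i => -((ξ : ℂ) ^ 2)⁻¹ * g ξ i) (by
      filter_upwards [self_mem_nhdsWithin] with ξ hξ
        using s.hasDerivAt_lowerG zero_le_one hg hξ)
    rw [add_sub_cancel_right] at h1
    have hu : AnalyticAt ℂ (fun y : ℂ => -((y + 1) ^ 2)⁻¹) 0 :=
      ((by fun_prop : AnalyticAt ℂ (fun y : ℂ => (y + 1) ^ 2) 0).inv (by simp)).neg
    have h2 : LeadFin 1 (lam₀ - s.ρ₂ - 1) (-(c' • (Pi.single i₀ 1 : R → ℂ)))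
        (fun (ξ : ℝ) i => -((ξ : ℂ) ^ 2)⁻¹ * g ξ i) :=
      (hga.smul_analytic hu).cast rfl (by simp) fun X => by funext i; simp
    have h3 := h1.unique h2
    rw [sub_add_cancel] at h3
    rw [neg_div, neg_smul, div_eq_inv_mul, mul_smul, ← smul_neg, ← h3, smul_smul,
      inv_mul_cancel₀ hlam, one_smul]
  rw [hw'] at hw
  have hGs : s.lower.GSol 1 (s.lowerG g) := by
    intro ξ hξ
    refine ⟨_, s.hasDerivAt_lowerG zero_le_one hg hξ, fun i => ?_⟩
    have h1 := s.A_sub_lowerG g ξ i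
    have hξ0 : (ξ : ℂ) ≠ 0 := by exact_mod_cast (lt_trans zero_lt_one hξ).ne'
    have := s.τ_ne i
    rw [lower_τ, lower_A, lower_ρ₂, sub_add_cancel, h1]
    field_simp
    ring
  set G : R → ℂ := s.P *ᵥ fun k => (s.mu k - s.ρ₂)⁻¹ *
    (s.Q *ᵥ fun i => -((s.τ i)⁻¹ * g_inf i)) k with hG
  have hGinf : Tendsto (s.lowerG g) atTop (𝓝 G) := by
    have h1 : Tendsto (fun (ξ : ℝ) i => ((ξ : ℂ)⁻¹ - (s.τ i)⁻¹) * g ξ i) atTop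
        (𝓝 fun i => -((s.τ i)⁻¹ * g_inf i)) := by
      refine tendsto_pi_nhds.2 fun i => ?_
      have := (tendsto_inv_atTop_complex.sub_const (s.τ i)⁻¹).mul (tendsto_pi_nhds.1 hginf i)
      simpa using this
    have hc : Continuous fun x : R → ℂ => s.P *ᵥ fun k => (s.mu k - s.ρ₂)⁻¹ * (s.Q *ᵥ x) k := by
      fun_prop
    exact (hc.tendsto _).comp h1
  have key := h (s.lowerMap f) (s.lowerMap f₁) (s.lowerMap f₂) (s.lowerG g) _ w₂ G c _
    (max b 0) (s.raySol_lowerMap (fun X hX => by exact_mod_cast (lt_trans zero_lt_one hX).ne') hf)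
    (s.leadFin_lowerMap hi₀ hfa) (s.raySol_lowerMap hb hf₁) (s.raySol_lowerMap hb hf₂) ?_
    (s.leadInf_lowerMap hv₁) hw₂ hGs hw hGinf
  · -- apply `A - ρ₂` to the relation for the shifted system
    have e1 : (-c' / (lam₀ - s.ρ₂)) • s.aux v₁ = (c * κ) • G := by
      funext i
      have := key i
      have hτ := s.τ_ne i
      rw [Sum.elim_inl, lower_τ] at this
      simp only [Pi.smul_apply, smul_eq_mul]
      field_simp at this ⊢
      linear_combination this
    have e2 : (c' * (s.ρ₁ - s.ρ₂)) • (fun i => v₁ (Sum.inl i)) =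
        (c * κ * (lam₀ - s.ρ₂)) • fun i => (s.τ i)⁻¹ * g_inf i := by
      apply s.Q_injective
      funext k
      have h1 := congrArg (fun x => (s.Q *ᵥ x) k) e1
      simp only [mulVec_smul, Pi.smul_apply, smul_eq_mul, haux hf₁ hv₁, hG, s.Q_P] at h1 ⊢
      have h2 : (s.Q *ᵥ fun i => -((s.τ i)⁻¹ * g_inf i)) k =
          -(s.Q *ᵥ fun i => (s.τ i)⁻¹ * g_inf i) k := by
        rw [← Pi.neg_apply, ← mulVec_neg]; rfl
      rw [h2] at h1
      have h3 := s.mu_sub_ne k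
      generalize (s.Q *ᵥ fun i => (s.τ i)⁻¹ * g_inf i) k = W at h1 ⊢
      field_simp at h1
      linear_combination -h1
    intro i
    have e3 := congrFun e2 i
    simp only [Pi.smul_apply, smul_eq_mul] at e3
    field_simp
    linear_combination e3
  · filter_upwards [hsum] with X hX
    have h1 : s.aux (f X) = s.aux (f₁ X) + s.aux (f₂ X) := by
      apply s.Q_injective
      funext k
      have hu : (fun i => f X (Sum.inl i)) =
        (fun i => f₁ X (Sum.inl i)) + fun i => f₂ X (Sum.inl i) := by
        rw [hX]; rfl
      rw [mulVec_add, Pi.add_apply, s.Q_aux, s.Q_aux, s.Q_aux, hu, mulVec_add, Pi.add_apply, hX,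
        Pi.add_apply]
      ring
    have h2 : (fun i => s.aux (f X) i / s.τ i) =
        (fun i => s.aux (f₁ X) i / s.τ i) + fun i => s.aux (f₂ X) i / s.τ i := by
      funext i
      rw [h1, Pi.add_apply, Pi.add_apply, add_div]
    have hu : (fun i => f X (Sum.inl i)) =
        (fun i => f₁ X (Sum.inl i)) + fun i => f₂ X (Sum.inl i) := by
      rw [hX]; rfl
    funext j
    rcases j with i | k
    · exact congrFun h2 i
    · simp only [lowerMap, Sum.elim_inr, Pi.add_apply]
      rw [h2, h1, hu]
      simp only [mulVec_add, Pi.add_apply]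
      ring

end RaySys

namespace RaySys

variable {R K : Type} [Fintype R] [Fintype K] [DecidableEq R] [DecidableEq K] {s : RaySys R K}

lemma FinCase.up {lam : R → ℂ} {i₀ : R} (h : s.FinCase lam i₀) :
    s.up.FinCase (fun i => lam i + 1) i₀ where
  τ_eq := h.τ_eq
  τ_ne := h.τ_ne
  A_block i j hi hj := by
    rw [up_A, Matrix.add_apply, h.A_block i j hi hj, one_apply]
    split_ifs <;> simp
  notInt := h.notInt.add_one
  nonres i hi m hm := h.nonres i hi m (by linear_combination hm)
  notInt₂ := h.notInt₂.congr (by rw [up_ρ₂]; ring)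

lemma FinCase.lower {lam : R → ℂ} {i₀ : R} (h : s.FinCase lam i₀) : s.lower.FinCase lam i₀ where
  τ_eq := h.τ_eq
  τ_ne := h.τ_ne
  A_block := h.A_block
  notInt := h.notInt
  nonres := h.nonres
  notInt₂ := h.notInt₂.add_one.congr (by rw [lower_ρ₂]; ring)

lemma LastCase.up {k₀ : K} (h : s.LastCase k₀) : s.up.LastCase k₀ where
  τ_ne := h.τ_ne
  exp_ne m hm := h.exp_ne (m + 1) (by
    rw [up_ρ₁, up_ρ₂, up_mu] at hm; push_cast; linear_combination hm)
  nonres k m hm := h.nonres k m (by rw [up_mu, up_mu] at hm; linear_combination hm)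

lemma LastCase.down {k₀ : K} (h : s.LastCase k₀) : s.down.LastCase k₀ where
  τ_ne := h.τ_ne
  exp_ne m hm := h.exp_ne m (by rw [down_ρ₁, down_ρ₂, down_mu] at hm; linear_combination hm)
  nonres k m hm := h.nonres k m (by rw [down_mu, down_mu] at hm; linear_combination hm)

/-- The connection relation between `1` and infinity when only `Re ρ₂` may be small. The shift `up`
increases `Re ρ₂` and preserves the other two quantities that have to be large. -/
lemma FinCase.connects_of_re_sub {lam : R → ℂ} {i₀ : R} (M : ℕ) (h : s.FinCase lam i₀)
    (h₂ : 1 < s.ρ₂.re + M) (h₁₂ : 1 < (s.ρ₁ - s.ρ₂).re) (hα : 0 < (lam i₀ - s.ρ₂ - 1).re) :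
    s.Connects 1 (lam i₀) (lam i₀ - s.ρ₂ - 1) (Pi.single (Sum.inl i₀) 1) (Pi.single i₀ 1)
      (finFactor s.ρ₁ s.ρ₂ (lam i₀)) := by
  induction M generalizing s lam with
  | zero => exact h.connects_of_large s (by simpa using h₂) h₁₂ hα
  | succ M ih =>
    have h1 := ih h.up (by
        rw [up_ρ₂, add_re, one_re]; push_cast at h₂; linarith)
      (by rw [up_ρ₁, up_ρ₂, add_sub_add_right_eq_sub]; exact h₁₂)
      (by rw [up_ρ₂, add_sub_add_right_eq_sub]; exact hα)
    have e1 : lam i₀ + 1 - s.up.ρ₂ - 1 = lam i₀ - s.ρ₂ - 1 := by rw [up_ρ₂]; ring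
    rw [e1] at h1
    have hne := h.notInt.add_one.ne_zero
    have h2 := s.connects_of_up hne (fun j => ?_) h1
    · convert h2 using 1
      rw [finFactor, finFactor, up_ρ₁, up_ρ₂, Complex.Gamma_add_one _ hne,
        Complex.Gamma_add_one (s.ρ₁ + 1) s.ρ₁_notInt.add_one.ne_zero, add_sub_add_right_eq_sub,
        add_sub_add_right_eq_sub]
      have g1 := s.ρ₁_notInt.add_one.Gamma_ne_zero
      have g2 := h.notInt₂.Gamma_ne_zero
      have g3 := s.ρ₁_notInt.add_one.ne_zero
      field_simp
    · by_cases hj : j = Sum.inl i₀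
      · subst hj; simp [T, h.τ_eq]
      · simp [hj]

/-- The connection relation between `1` and infinity. The shift `lower` increases
`Re (ρ₁ - ρ₂)` and `Re (lam i₀ - ρ₂)`; that it decreases `Re ρ₂` does not matter. -/
lemma FinCase.connects {lam : R → ℂ} {i₀ : R} (h : s.FinCase lam i₀) :
    s.Connects 1 (lam i₀) (lam i₀ - s.ρ₂ - 1) (Pi.single (Sum.inl i₀) 1) (Pi.single i₀ 1)
      (finFactor s.ρ₁ s.ρ₂ (lam i₀)) := by
  obtain ⟨N, hN⟩ : ∃ N : ℕ, 1 < (s.ρ₁ - s.ρ₂).re + N ∧ 0 < (lam i₀ - s.ρ₂ - 1).re + N := by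
    obtain ⟨N, hN⟩ := exists_nat_gt (max (1 - (s.ρ₁ - s.ρ₂).re) (-(lam i₀ - s.ρ₂ - 1).re))
    have := max_lt_iff.1 hN
    exact ⟨N, by linarith, by linarith⟩
  induction N generalizing s with
  | zero =>
    obtain ⟨M, hM⟩ := exists_nat_gt (1 - s.ρ₂.re)
    exact h.connects_of_re_sub M (by linarith) (by simpa using hN.1) (by simpa using hN.2)
  | succ N ih =>
    have h1 := ih h.lower (by
      rw [lower_ρ₁, lower_ρ₂]
      simp only [sub_re, one_re, Nat.cast_add, Nat.cast_one] at hN ⊢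
      exact ⟨by linarith [hN.1], by linarith [hN.2]⟩)
    have e1 : lam i₀ - s.lower.ρ₂ - 1 = lam i₀ - s.ρ₂ - 1 + 1 := by rw [lower_ρ₂]; ring
    rw [e1] at h1
    convert s.connects_of_lower h.τ_eq h.notInt₂.ne_zero h1 using 1
    have e2 : s.ρ₁ - (s.ρ₂ - 1) = s.ρ₁ - s.ρ₂ + 1 := by ring
    have e3 : lam i₀ - (s.ρ₂ - 1) = lam i₀ - s.ρ₂ + 1 := by ring
    rw [finFactor, finFactor, lower_ρ₁, lower_ρ₂, e2, e3,
      Complex.Gamma_add_one _ s.ρ₁₂_notInt.ne_zero, Complex.Gamma_add_one _ h.notInt₂.ne_zero]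
    have g1 := s.ρ₁_notInt.add_one.Gamma_ne_zero
    have g2 := h.notInt₂.Gamma_ne_zero
    have g3 := s.ρ₁₂_notInt.ne_zero
    have g4 := h.notInt₂.ne_zero
    field_simp

/-- The connection relation between `0` and infinity when only `Re ρ₂` may be small, by means of
the shift `up`. -/
lemma LastCase.connects_of_re_sub {k₀ : K} (M : ℕ) (h : s.LastCase k₀)
    (h₂ : 1 < s.ρ₂.re + M) (h₁₂ : 1 < (s.ρ₁ - s.ρ₂).re) (hα : 0 < (s.ρ₁ - s.mu k₀ - 1).re) :
    s.Connects 0 (s.ρ₁ + s.ρ₂ - s.mu k₀) (s.ρ₂ + 1 - s.mu k₀) (Pi.single (Sum.inr k₀) 1)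
      (fun i => s.P i k₀) (lastFactor s.ρ₁ s.ρ₂ (s.mu k₀)) := by
  induction M generalizing s with
  | zero => exact h.connects_of_large s (by simpa using h₂) h₁₂ hα
  | succ M ih =>
    have h1 := ih h.up (by
        rw [up_ρ₂, add_re, one_re]; push_cast at h₂; linarith)
      (by rw [up_ρ₁, up_ρ₂, add_sub_add_right_eq_sub]; exact h₁₂)
      (by rw [up_ρ₁, up_mu, add_sub_add_right_eq_sub]; exact hα)
    have e1 : s.up.ρ₁ + s.up.ρ₂ - s.up.mu k₀ = s.ρ₁ + s.ρ₂ - s.mu k₀ + 1 := by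
      rw [up_ρ₁, up_ρ₂, up_mu]; ring
    have e2 : s.up.ρ₂ + 1 - s.up.mu k₀ = s.ρ₂ + 1 - s.mu k₀ := by
      rw [up_ρ₂, up_mu]; ring
    rw [e1, e2] at h1
    have hne : s.ρ₁ + s.ρ₂ - s.mu k₀ + 1 ≠ 0 := by simpa using h.exp_ne 0
    have h2 := s.connects_of_up (glead := fun i => s.P i k₀) hne (fun j => ?_) h1
    · convert h2 using 1
      have e3 : s.ρ₁ + 1 + (s.ρ₂ + 1) - (s.mu k₀ + 1) + 1 =
          s.ρ₁ + s.ρ₂ - s.mu k₀ + 1 + 1 := by ring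
      simp only [lastFactor]
      rw [up_ρ₁, up_ρ₂, up_mu, e3, Complex.Gamma_add_one _ hne,
        Complex.Gamma_add_one (s.ρ₁ + 1) s.ρ₁_notInt.add_one.ne_zero, add_sub_add_right_eq_sub,
        add_sub_add_right_eq_sub]
      have g1 := s.ρ₁_notInt.add_one.Gamma_ne_zero
      have g2 := (s.ρ₁_mu_notInt k₀).add_one.Gamma_ne_zero
      have g3 := s.ρ₁_notInt.add_one.ne_zero
      field_simp
    · by_cases hj : j = Sum.inr k₀
      · subst hj; simp [T]
      · simp [hj]

/-- The connection relation between `0` and infinity. The shift `down` increases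
`Re (ρ₁ - ρ₂)` and `Re (ρ₁ - mu k₀)`; that it decreases `Re ρ₂` does not matter. -/
lemma LastCase.connects {k₀ : K} (h : s.LastCase k₀) :
    s.Connects 0 (s.ρ₁ + s.ρ₂ - s.mu k₀) (s.ρ₂ + 1 - s.mu k₀) (Pi.single (Sum.inr k₀) 1)
      (fun i => s.P i k₀) (lastFactor s.ρ₁ s.ρ₂ (s.mu k₀)) := by
  obtain ⟨N, hN⟩ : ∃ N : ℕ, 1 < (s.ρ₁ - s.ρ₂).re + N ∧ 0 < (s.ρ₁ - s.mu k₀ - 1).re + N := by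
    obtain ⟨N, hN⟩ := exists_nat_gt (max (1 - (s.ρ₁ - s.ρ₂).re) (-(s.ρ₁ - s.mu k₀ - 1).re))
    have := max_lt_iff.1 hN
    exact ⟨N, by linarith, by linarith⟩
  induction N generalizing s with
  | zero =>
    obtain ⟨M, hM⟩ := exists_nat_gt (1 - s.ρ₂.re)
    exact h.connects_of_re_sub M (by linarith) (by simpa using hN.1) (by simpa using hN.2)
  | succ N ih =>
    have h1 := ih h.down (by
      rw [down_ρ₁, down_ρ₂, down_mu]
      simp only [sub_re, one_re, Nat.cast_add, Nat.cast_one] at hN ⊢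
      exact ⟨by linarith [hN.1], by linarith [hN.2]⟩)
    have e1 : s.down.ρ₁ + s.down.ρ₂ - s.down.mu k₀ = s.ρ₁ + s.ρ₂ - s.mu k₀ := by
      rw [down_ρ₁, down_ρ₂, down_mu]; ring
    have e2 : s.down.ρ₂ + 1 - s.down.mu k₀ = s.ρ₂ + 1 - s.mu k₀ := by
      rw [down_ρ₂, down_mu]; ring
    rw [e1, e2] at h1
    convert s.connects_of_down (glead := fun i => s.P i k₀) (fun X hX i => h.τ_ne i X hX) h1 using 1
    have e3 : s.ρ₁ - (s.ρ₂ - 1) = s.ρ₁ - s.ρ₂ + 1 := by ring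
    have e4 : s.ρ₁ + (s.ρ₂ - 1) - (s.mu k₀ - 1) + 1 = s.ρ₁ + s.ρ₂ - s.mu k₀ + 1 := by ring
    have e5 : s.ρ₁ - (s.mu k₀ - 1) + 1 = s.ρ₁ - s.mu k₀ + 1 + 1 := by ring
    have hne := (s.ρ₁_mu_notInt k₀).add_one.ne_zero
    simp only [lastFactor]
    rw [down_ρ₁, down_ρ₂, down_mu, e3, e4, e5,
      Complex.Gamma_add_one _ s.ρ₁₂_notInt.ne_zero, Complex.Gamma_add_one _ hne]
    have g1 := s.ρ₁_notInt.add_one.Gamma_ne_zero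
    have g2 := (s.ρ₁_mu_notInt k₀).add_one.Gamma_ne_zero
    have g3 := s.ρ₁₂_notInt.ne_zero
    field_simp

end RaySys

/-! ### Powers with a prescribed argument and wedges -/

section ArgPow

variable {φ : ℝ} {z w : ℂ}

lemma exp_argLog (φ : ℝ) (hz : z ≠ 0) : Complex.exp (argLog φ z) = z := by
  rw [argLog, Complex.exp_add, Complex.exp_log (mul_ne_zero hz (Complex.exp_ne_zero _)), mul_assoc,
    ← Complex.exp_add, neg_add_cancel, Complex.exp_zero, mul_one]

/-- The logarithm is characterized by its imaginary part. -/
lemma argLog_eq (h : Complex.exp w = z) (h1 : φ - Real.pi < w.im) (h2 : w.im ≤ φ + Real.pi) :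
    argLog φ z = w := by
  have him : (w - φ * I).im = w.im - φ := by simp
  rw [argLog, ← h, ← Complex.exp_add, ← sub_eq_add_neg, Complex.log_exp, sub_add_cancel]
  · rw [him]; linarith
  · rw [him]; linarith

lemma argNear_mem (φ : ℝ) (z : ℂ) : argNear φ z ∈ Ioc (φ - Real.pi) (φ + Real.pi) := by
  have h : argNear φ z = (Complex.log (z * Complex.exp (-(φ * I)))).im + φ := by
    simp [argNear, argLog]
  rw [h]
  have h1 := Complex.neg_pi_lt_log_im (z * Complex.exp (-(φ * I)))
  have h2 := Complex.log_im_le_pi (z * Complex.exp (-(φ * I)))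
  constructor <;> linarith

lemma argLog_mul_ofReal (φ : ℝ) (hz : z ≠ 0) {X : ℝ} (hX : 0 < X) :
    argLog φ (z * X) = argLog φ z + Real.log X := by
  have h := argNear_mem φ z
  refine argLog_eq ?_ ?_ ?_
  · rw [Complex.exp_add, exp_argLog φ hz, ← Complex.ofReal_exp, Real.exp_log hX]
  · rw [Complex.add_im, Complex.ofReal_im, add_zero]; exact h.1
  · rw [Complex.add_im, Complex.ofReal_im, add_zero]; exact h.2

lemma argPow_mul_ofReal (φ : ℝ) (hz : z ≠ 0) {X : ℝ} (hX : 0 < X) (a : ℂ) :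
    argPow φ (z * X) a = argPow φ z a * (X : ℂ) ^ a := by
  have hX' : (X : ℂ) ≠ 0 := by exact_mod_cast hX.ne'
  rw [argPow, argPow, argLog_mul_ofReal φ hz hX, mul_add, Complex.exp_add,
    Complex.cpow_def_of_ne_zero hX', Complex.ofReal_log hX.le]
  congr 2; ring

lemma argPow_ne_zero (φ : ℝ) (z a : ℂ) : argPow φ z a ≠ 0 := Complex.exp_ne_zero _

lemma hasDerivAt_argPow (h : z * Complex.exp (-(φ * I)) ∈ slitPlane) (a : ℂ) :
    HasDerivAt (fun z => argPow φ z a) (argPow φ z a * (a / z)) z := by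
  have h1 : HasDerivAt (fun z => z * Complex.exp (-(φ * I))) (Complex.exp (-(φ * I))) z := by
    simpa using (hasDerivAt_id z).mul_const (Complex.exp (-(φ * I)))
  have h2 : HasDerivAt (argLog φ) (Complex.exp (-(φ * I)) / (z * Complex.exp (-(φ * I)))) z :=
    (h1.clog h).add_const _
  refine ((h2.const_mul a).cexp).congr_deriv ?_
  have h0 := Complex.exp_ne_zero (-(φ * I))
  have hz : z ≠ 0 := by
    rintro rfl
    rw [zero_mul] at h
    exact Complex.zero_notMem_slitPlane h
  rw [argPow]
  field_simp

end ArgPow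

/-- The open wedge of all `r e^{iψ}` with `r > 0` and `α < ψ < β`. -/
def wedge (α β : ℝ) : Set ℂ :=
  {z | ∃ r : ℝ, 0 < r ∧ ∃ ψ ∈ Ioo α β, z = r * Complex.exp (ψ * I)}

section Wedge

variable {α β φ : ℝ} {z w : ℂ}

lemma polar_mul_exp_im (r ψ α : ℝ) :
    ((r : ℂ) * Complex.exp (ψ * I) * Complex.exp (-(α * I))).im = r * Real.sin (ψ - α) := by
  rw [mul_assoc, ← Complex.exp_add]
  have : (ψ : ℂ) * I + -(α * I) = ((ψ - α : ℝ) : ℂ) * I := by push_cast; ring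
  rw [this, Complex.im_ofReal_mul, Complex.exp_ofReal_mul_I_im]

lemma argLog_polar {r ψ : ℝ} (hr : 0 < r) (h1 : φ - Real.pi < ψ) (h2 : ψ ≤ φ + Real.pi) :
    argLog φ (r * Complex.exp (ψ * I)) = Real.log r + ψ * I := by
  refine argLog_eq ?_ (by simpa using h1) (by simpa using h2)
  rw [Complex.exp_add, ← Complex.ofReal_exp, Real.exp_log hr]

lemma eq_polar_argNear (φ : ℝ) (hz : z ≠ 0) :
    z = (Real.exp (argLog φ z).re : ℝ) * Complex.exp (argNear φ z * I) := by
  rw [Complex.ofReal_exp, ← Complex.exp_add, argNear, Complex.re_add_im, exp_argLog φ hz]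

lemma mem_wedge_iff_argNear (h1 : φ - Real.pi ≤ α) (h2 : β ≤ φ + Real.pi) :
    z ∈ wedge α β ↔ z ≠ 0 ∧ argNear φ z ∈ Ioo α β := by
  constructor
  · rintro ⟨r, hr, ψ, hψ, rfl⟩
    refine ⟨mul_ne_zero (by exact_mod_cast hr.ne') (Complex.exp_ne_zero _), ?_⟩
    rw [argNear, argLog_polar hr (by linarith [hψ.1]) (by linarith [hψ.2])]
    simpa using hψ
  · rintro ⟨hz, h⟩
    exact ⟨_, Real.exp_pos _, _, h, eq_polar_argNear φ hz⟩

/-- A wedge of angle at most `π` is an intersection of two half-planes. -/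
lemma mem_wedge_iff_im (h1 : α < β) (h2 : β ≤ α + Real.pi) :
    z ∈ wedge α β ↔ 0 < (z * Complex.exp (-(α * I))).im ∧ (z * Complex.exp (-(β * I))).im < 0 := by
  constructor
  · rintro ⟨r, hr, ψ, hψ, rfl⟩
    rw [polar_mul_exp_im, polar_mul_exp_im]
    refine ⟨mul_pos hr (Real.sin_pos_of_pos_of_lt_pi (by linarith [hψ.1]) (by linarith [hψ.2])),
      mul_neg_of_pos_of_neg hr (Real.sin_neg_of_neg_of_neg_pi_lt (by linarith [hψ.2])
        (by linarith [hψ.1]))⟩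
  · rintro ⟨h3, h4⟩
    have hz : z ≠ 0 := by rintro rfl; simp at h3
    have hp := eq_polar_argNear α hz
    have hr := Real.exp_pos (argLog α z).re
    have hm := argNear_mem α z
    rw [hp, polar_mul_exp_im] at h3 h4
    have h5 := pos_of_mul_pos_right h3 hr.le
    have h6 : Real.sin (argNear α z - β) < 0 := by
      by_contra hcon
      exact absurd h4 (not_lt.2 (mul_nonneg hr.le (not_lt.1 hcon)))
    have h7 : α < argNear α z := by
      by_contra hcon
      exact absurd h5 (not_lt.2 (Real.sin_nonpos_of_nonpos_of_neg_pi_le (by linarith [not_lt.1 hcon])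
        (by linarith [hm.1])))
    have h8 : argNear α z < β := by
      by_contra hcon
      exact absurd h6 (not_lt.2 (Real.sin_nonneg_of_nonneg_of_le_pi (by linarith [not_lt.1 hcon])
        (by linarith [hm.2])))
    exact ⟨_, hr, _, ⟨h7, h8⟩, hp⟩

lemma wedge_ne_zero (h : z ∈ wedge α β) : z ≠ 0 := by
  obtain ⟨r, hr, ψ, hψ, rfl⟩ := h
  exact mul_ne_zero (by exact_mod_cast hr.ne') (Complex.exp_ne_zero _)

lemma wedge_nonempty (h : α < β) : (wedge α β).Nonempty := by
  obtain ⟨ψ, hψ⟩ := exists_between h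
  exact ⟨_, 1, one_pos, ψ, hψ, rfl⟩

lemma mul_ofReal_mem_wedge (h : z ∈ wedge α β) {X : ℝ} (hX : 0 < X) : z * X ∈ wedge α β := by
  obtain ⟨r, hr, ψ, hψ, rfl⟩ := h
  exact ⟨r * X, by positivity, ψ, hψ, by push_cast; ring⟩

lemma inv_mem_wedge (h : z ∈ wedge α β) : z⁻¹ ∈ wedge (-β) (-α) := by
  obtain ⟨r, hr, ψ, hψ, rfl⟩ := h
  refine ⟨r⁻¹, by positivity, -ψ, ⟨by linarith [hψ.2], by linarith [hψ.1]⟩, ?_⟩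
  rw [mul_inv, ← Complex.exp_neg]
  push_cast
  rw [neg_mul]

lemma isOpen_wedge (h1 : α < β) (h2 : β ≤ α + Real.pi) : IsOpen (wedge α β) := by
  have : wedge α β = {z : ℂ | 0 < (z * Complex.exp (-(α * I))).im} ∩
      {z : ℂ | (z * Complex.exp (-(β * I))).im < 0} := Set.ext fun z => mem_wedge_iff_im h1 h2
  rw [this]
  exact (isOpen_lt continuous_const (by fun_prop)).inter (isOpen_lt (by fun_prop) continuous_const)

lemma add_mem_wedge (h1 : α < β) (h2 : β ≤ α + Real.pi) (hz : z ∈ wedge α β)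
    (hw : w ∈ wedge α β) : z + w ∈ wedge α β := by
  rw [mem_wedge_iff_im h1 h2] at *
  rw [add_mul, add_mul, Complex.add_im, Complex.add_im]
  exact ⟨add_pos hz.1 hw.1, add_neg hz.2 hw.2⟩

/-- The sum of a point on the boundary and a point of the wedge is a point of the wedge. -/
lemma add_mem_wedge_of_boundary (h1 : α < β) (h2 : β ≤ α + Real.pi) {r ψ : ℝ} (hr : 0 ≤ r)
    (hψ : ψ = α ∨ ψ = β) (hw : w ∈ wedge α β) :
    (r : ℂ) * Complex.exp (ψ * I) + w ∈ wedge α β := by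
  rw [mem_wedge_iff_im h1 h2] at *
  rw [add_mul, add_mul, Complex.add_im, Complex.add_im, polar_mul_exp_im, polar_mul_exp_im]
  rcases hψ with rfl | rfl
  · rw [sub_self, Real.sin_zero, mul_zero, zero_add]
    refine ⟨hw.1, add_neg_of_nonpos_of_neg (mul_nonpos_of_nonneg_of_nonpos hr ?_) hw.2⟩
    exact Real.sin_nonpos_of_nonpos_of_neg_pi_le (by linarith) (by linarith)
  · rw [sub_self, Real.sin_zero, mul_zero, zero_add]
    refine ⟨add_pos_of_nonneg_of_pos (mul_nonneg hr ?_) hw.1, hw.2⟩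
    exact Real.sin_nonneg_of_nonneg_of_le_pi (by linarith) (by linarith)

lemma convex_wedge (h1 : α < β) (h2 : β ≤ α + Real.pi) : Convex ℝ (wedge α β) := by
  refine convex_iff_forall_pos.2 fun z hz w hw a b ha hb _ => ?_
  have h3 := add_mem_wedge h1 h2 (mul_ofReal_mem_wedge hz ha) (mul_ofReal_mem_wedge hw hb)
  convert h3 using 1
  simp only [Complex.real_smul]; ring

/-- The part of a wedge outside a disc is the image of a convex set under inversion. -/
lemma isPreconnected_wedge_diff (h1 : α < β) (h2 : β ≤ α + Real.pi) {R : ℝ} (hR : 0 < R) :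
    IsPreconnected {z | z ∈ wedge α β ∧ R < ‖z‖} := by
  have h3 : IsPreconnected (wedge (-β) (-α) ∩ ball 0 R⁻¹) :=
    ((convex_wedge (by linarith) (by linarith)).inter (convex_ball 0 R⁻¹)).isPreconnected
  have h4 : {z | z ∈ wedge α β ∧ R < ‖z‖} = (fun z : ℂ => z⁻¹) ''
      (wedge (-β) (-α) ∩ ball 0 R⁻¹) := by
    ext z
    constructor
    · rintro ⟨hz, hz'⟩
      refine ⟨z⁻¹, ⟨inv_mem_wedge hz, ?_⟩, inv_inv z⟩
      rw [mem_ball_zero_iff, norm_inv]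
      exact inv_strictAnti₀ hR hz'
    · rintro ⟨y, ⟨hy, hy'⟩, rfl⟩
      refine ⟨by simpa using inv_mem_wedge hy, ?_⟩
      rw [mem_ball_zero_iff] at hy'
      rw [norm_inv]
      exact (lt_inv_comm₀ hR (norm_pos_iff.2 (wedge_ne_zero hy))).2 hy'
  rw [h4]
  refine h3.image _ fun y hy => ?_
  exact (continuousAt_inv₀ (wedge_ne_zero hy.1)).continuousWithinAt

/-- On a wedge that contains no point with the argument `φ + π`, the power is holomorphic. -/
lemma wedge_slit (h1 : φ - Real.pi ≤ α) (h2 : β ≤ φ + Real.pi) (hz : z ∈ wedge α β) :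
    z * Complex.exp (-(φ * I)) ∈ slitPlane := by
  obtain ⟨r, hr, ψ, hψ, rfl⟩ := hz
  have h : (r : ℂ) * Complex.exp (ψ * I) * Complex.exp (-(φ * I)) =
      r * Complex.exp (((ψ - φ : ℝ) : ℂ) * I) := by
    rw [mul_assoc, ← Complex.exp_add]; congr 2; push_cast; ring
  rw [h, Complex.mem_slitPlane_iff_arg, Complex.exp_mul_I, Complex.arg_mul_cos_add_sin_mul_I hr
    ⟨by linarith [hψ.1], by linarith [hψ.2]⟩, ← Complex.exp_mul_I]
  exact ⟨by linarith [hψ.2], mul_ne_zero (by exact_mod_cast hr.ne') (Complex.exp_ne_zero _)⟩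

end Wedge

/-! ### Local expansions in the complex domain -/

section Local

variable {J : Type} [Fintype J] {t : J → ℂ} {B : Matrix J J ℂ} {S : Set ℂ} {c e : ℂ} {φ : ℝ}
  {v : J → ℂ} {U : ℂ → J → ℂ}

/-- The function `(x - c) ^ e • Ψ (x - c)`. -/
def locFin (φ : ℝ) (c e : ℂ) (Ψ : ℂ → J → ℂ) (x : ℂ) : J → ℂ := argPow φ (x - c) e • Ψ (x - c)

/-- The function `(x - c) ^ e • Φ (1 / (x - c))`. -/
def locInf (φ : ℝ) (c e : ℂ) (Φ : ℂ → J → ℂ) (x : ℂ) : J → ℂ := argPow φ (x - c) e • Φ (x - c)⁻¹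

/-- The coefficients of a series that converges at some point grow at most geometrically. -/
lemma exists_bound_of_hasSum {a y : ℂ} {G : ℕ → J → ℂ} {V : J → ℂ} (ha : a ≠ 0) (hy : y ≠ 0)
    (h : HasSum (fun m : ℕ => (a * y ^ m) • G m) V) :
    ∃ C : ℝ, ∀ m, ‖G m‖ ≤ C * ‖y‖⁻¹ ^ m := by
  obtain ⟨C, hC⟩ := (h.summable.tendsto_atTop_zero.norm).bddAbove_range
  refine ⟨‖a‖⁻¹ * C, fun m => ?_⟩
  have h1 : ‖(a * y ^ m) • G m‖ ≤ C := hC ⟨m, rfl⟩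
  rw [norm_smul, norm_mul, norm_pow] at h1
  have ha' := norm_pos_iff.2 ha
  have hy' := norm_pos_iff.2 hy
  rw [inv_pow, mul_assoc, ← div_eq_inv_mul, ← div_eq_mul_inv, div_div, le_div_iff₀ (by positivity)]
  linarith [mul_comm (‖G m‖) (‖y‖ ^ m * ‖a‖), mul_comm (‖y‖ ^ m) ‖a‖, h1,
    mul_comm (‖G m‖) (‖a‖ * ‖y‖ ^ m)]

/-- An expansion that holds on a set accumulating at `c` has an analytic second factor:
convergence at one point bounds the coefficients. -/
lemma HasExpansionAt.exists_analyticAt (h : HasExpansionAt c φ e v S U)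
    (hS : ∀ ε > 0, ∃ x ∈ S, x ≠ c ∧ ‖x - c‖ < ε) :
    ∃ Ψ : ℂ → J → ℂ, AnalyticAt ℂ Ψ 0 ∧ Ψ 0 = v ∧
      ∃ r > 0, ∀ x ∈ S, ‖x - c‖ < r → U x = locFin φ c e Ψ x := by
  obtain ⟨G, hG0, R, hR, hG⟩ := h
  obtain ⟨x₁, hx₁, hne, hx₁R⟩ := hS R hR
  have hy : x₁ - c ≠ 0 := sub_ne_zero.2 hne
  obtain ⟨C, hC⟩ := exists_bound_of_hasSum (argPow_ne_zero _ _ _) hy (hG x₁ hx₁ hx₁R)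
  have hK : 0 < ‖x₁ - c‖⁻¹ := inv_pos.2 (norm_pos_iff.2 hy)
  refine ⟨fun y => ∑' m, y ^ m • G m, powerSeries_analyticAt hK hC, ?_,
    min R ‖x₁ - c‖, lt_min hR (norm_pos_iff.2 hy), fun x hx hxr => ?_⟩
  · simp only
    rw [tsum_eq_single 0]
    · simpa using hG0
    · intro m hm; simp [hm]
  · have h1 := (powerSeries_facts hK hC (y := x - c)
      (by rw [inv_inv]; exact hxr.trans_le (min_le_right _ _))).1
    have h2 := h1.const_smul (argPow φ (x - c) e)
    simp only [smul_smul] at h2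
    exact (hG x hx (hxr.trans_le (min_le_left _ _))).unique h2

/-- An expansion that holds on an unbounded set has a second factor that is analytic at infinity.
-/
lemma HasExpansionAtInfinity.exists_analyticAt (h : HasExpansionAtInfinity c φ e v S U)
    (hS : ∀ R : ℝ, ∃ x ∈ S, R < ‖x - c‖) :
    ∃ Φ : ℂ → J → ℂ, AnalyticAt ℂ Φ 0 ∧ Φ 0 = v ∧
      ∃ R > 0, ∀ x ∈ S, R < ‖x - c‖ → U x = locInf φ c e Φ x := by
  obtain ⟨G, hG0, R, hR, hG⟩ := h
  obtain ⟨x₁, hx₁, hx₁R⟩ := hS R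
  have hy : (x₁ - c)⁻¹ ≠ 0 := inv_ne_zero (norm_pos_iff.1 (hR.trans hx₁R))
  obtain ⟨C, hC⟩ := exists_bound_of_hasSum (argPow_ne_zero _ _ _) hy (hG x₁ hx₁ hx₁R)
  have hK : 0 < ‖(x₁ - c)⁻¹‖⁻¹ := inv_pos.2 (norm_pos_iff.2 hy)
  refine ⟨fun y => ∑' m, y ^ m • G m, powerSeries_analyticAt hK hC, ?_,
    ‖x₁ - c‖, hR.trans hx₁R, fun x hx hxr => ?_⟩
  · simp only
    rw [tsum_eq_single 0]
    · simpa using hG0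
    · intro m hm; simp [hm]
  · have h1 := (powerSeries_facts hK hC (y := (x - c)⁻¹)
      (by
        rw [inv_inv, norm_inv, norm_inv]
        exact inv_strictAnti₀ (hR.trans hx₁R) hxr)).1
    have h2 := h1.const_smul (argPow φ (x - c) e)
    simp only [smul_smul] at h2
    exact (hG x hx (hx₁R.trans hxr)).unique h2

lemma exists_coeff_of_analyticAt {Ψ : ℂ → J → ℂ} (h : AnalyticAt ℂ Ψ 0) :
    ∃ G : ℕ → J → ℂ, G 0 = Ψ 0 ∧ ∃ r > 0, ∀ y : ℂ, ‖y‖ < r →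
      HasSum (fun m : ℕ => y ^ m • G m) (Ψ y) := by
  obtain ⟨p, hp⟩ := h
  obtain ⟨r, hr, h1⟩ := Metric.eventually_nhds_iff_ball.1 (hasFPowerSeriesAt_iff.1 hp)
  refine ⟨p.coeff, ?_, r, hr, fun y hy => by simpa using h1 y (by simpa using hy)⟩
  have h2 := h1 0 (mem_ball_self hr)
  have h3 := hasSum_single (f := fun m : ℕ => (0 : ℂ) ^ m • p.coeff m) 0 (by
    intro m hm; simp [hm])
  have := h3.unique h2
  simpa using this

lemma hasExpansionAt_of_eq {Ψ : ℂ → J → ℂ} (h : AnalyticAt ℂ Ψ 0) {r : ℝ} (hr : 0 < r)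
    (hU : ∀ x ∈ S, ‖x - c‖ < r → U x = locFin φ c e Ψ x) : HasExpansionAt c φ e (Ψ 0) S U := by
  obtain ⟨G, h0, r', hr', hG⟩ := exists_coeff_of_analyticAt h
  refine ⟨G, h0, min r r', lt_min hr hr', fun x hx hxr => ?_⟩
  rw [hU x hx (hxr.trans_le (min_le_left _ _)), locFin]
  have := (hG (x - c) (hxr.trans_le (min_le_right _ _))).const_smul (argPow φ (x - c) e)
  simpa only [smul_smul] using this

lemma hasExpansionAtInfinity_of_eq {Φ : ℂ → J → ℂ} (h : AnalyticAt ℂ Φ 0) {R : ℝ} (hR : 0 < R)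
    (hU : ∀ x ∈ S, R < ‖x - c‖ → U x = locInf φ c e Φ x) :
    HasExpansionAtInfinity c φ e (Φ 0) S U := by
  obtain ⟨G, h0, r', hr', hG⟩ := exists_coeff_of_analyticAt h
  refine ⟨G, h0, max R r'⁻¹, lt_max_of_lt_left hR, fun x hx hxr => ?_⟩
  rw [hU x hx ((le_max_left _ _).trans_lt hxr), locInf]
  have h1 : r'⁻¹ < ‖x - c‖ := (le_max_right _ _).trans_lt hxr
  have := (hG (x - c)⁻¹ (by
    rw [norm_inv]
    exact inv_lt_of_inv_lt₀ hr' h1)).const_smul (argPow φ (x - c) e)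
  simpa only [smul_smul] using this

lemma hasDerivAt_locFin {Ψ : ℂ → J → ℂ} {x : ℂ}
    (hx : (x - c) * Complex.exp (-(φ * I)) ∈ slitPlane) (h : DifferentiableAt ℂ Ψ (x - c)) :
    HasDerivAt (locFin φ c e Ψ)
      (argPow φ (x - c) e • ((e / (x - c)) • Ψ (x - c) + deriv Ψ (x - c))) x := by
  have d0 : HasDerivAt (fun x => x - c) 1 x := (hasDerivAt_id x).sub_const c
  have d1 := HasDerivAt.scomp x (hasDerivAt_argPow hx e) d0
  have d2 := HasDerivAt.scomp x h.hasDerivAt d0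
  refine (d1.smul d2).congr_deriv ?_
  simp only [Function.comp, one_smul]
  module

lemma hasDerivAt_locInf {Φ : ℂ → J → ℂ} {x : ℂ}
    (hx : (x - c) * Complex.exp (-(φ * I)) ∈ slitPlane) (h : DifferentiableAt ℂ Φ (x - c)⁻¹) :
    HasDerivAt (locInf φ c e Φ)
      (argPow φ (x - c) e • ((e / (x - c)) • Φ (x - c)⁻¹ -
        ((x - c) ^ 2)⁻¹ • deriv Φ (x - c)⁻¹)) x := by
  have hne : x - c ≠ 0 := by
    intro h0
    rw [h0, zero_mul] at hx
    exact Complex.zero_notMem_slitPlane hx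
  have d0 : HasDerivAt (fun x => x - c) 1 x := (hasDerivAt_id x).sub_const c
  have d1 := HasDerivAt.scomp x (hasDerivAt_argPow hx e) d0
  have d2 := HasDerivAt.scomp x h.hasDerivAt (d0.inv hne)
  refine (d1.smul d2).congr_deriv ?_
  simp only [Function.comp, one_smul]
  module

/-- The factor `(x - c) ^ e` and its derivative cancel from the system. -/
lemma eulerFin_point {Ψ : ℂ → J → ℂ} {y : ℂ} (hy : y ≠ 0) {a : ℂ} (ha : a ≠ 0) (j : J) :
    (y + c - t j) * (a • ((e / y) • Ψ y + deriv Ψ y)) j = (B *ᵥ (a • Ψ y)) j ↔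
      (y + c - t j) * (e * Ψ y j + y * deriv Ψ y j) = y * (B *ᵥ Ψ y) j := by
  rw [mulVec_smul]
  simp only [Pi.smul_apply, Pi.add_apply, smul_eq_mul]
  have h1 : (y + c - t j) * (a * (e / y * Ψ y j + deriv Ψ y j)) =
      a * y⁻¹ * ((y + c - t j) * (e * Ψ y j + y * deriv Ψ y j)) := by
    field_simp
  have h2 : a * (B *ᵥ Ψ y) j = a * y⁻¹ * (y * (B *ᵥ Ψ y) j) := by
    field_simp
  rw [h1, h2, mul_right_inj' (mul_ne_zero ha (inv_ne_zero hy))]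

/-- The factor `(x - c) ^ e` and its derivative cancel from the system. -/
lemma eulerInf_point {Φ : ℂ → J → ℂ} {x : ℂ} (hx : x - c ≠ 0) {a : ℂ} (ha : a ≠ 0) (j : J) :
    (x - t j) * (a • ((e / (x - c)) • Φ (x - c)⁻¹ - ((x - c) ^ 2)⁻¹ • deriv Φ (x - c)⁻¹)) j =
      (B *ᵥ (a • Φ (x - c)⁻¹)) j ↔
      (1 - (t j - c) * (x - c)⁻¹) * (e * Φ (x - c)⁻¹ j - (x - c)⁻¹ * deriv Φ (x - c)⁻¹ j) =
        (B *ᵥ Φ (x - c)⁻¹) j := by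
  rw [mulVec_smul]
  simp only [Pi.smul_apply, Pi.sub_apply, smul_eq_mul]
  have : (x - t j) * (a * (e / (x - c) * Φ (x - c)⁻¹ j -
      ((x - c) ^ 2)⁻¹ * deriv Φ (x - c)⁻¹ j)) =
      a * ((1 - (t j - c) * (x - c)⁻¹) *
        (e * Φ (x - c)⁻¹ j - (x - c)⁻¹ * deriv Φ (x - c)⁻¹ j)) := by
    field_simp
    ring
  rw [this, mul_right_inj' ha]

/-- A solution of the Euler equation gives a solution of the system on a slit disc. -/
lemma okSol_locFin {Ψ : ℂ → J → ℂ} (hΨ : AnalyticAt ℂ Ψ 0) (h : EulerFin t B c e Ψ) :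
    ∃ r > 0, OkSol t B {x | ‖x - c‖ < r ∧ (x - c) * Complex.exp (-(φ * I)) ∈ slitPlane}
      (locFin φ c e Ψ) := by
  obtain ⟨r, hr, h1⟩ := Metric.eventually_nhds_iff_ball.1 (h.and hΨ.eventually_analyticAt)
  refine ⟨r, hr, fun x hx => ⟨_, hasDerivAt_locFin hx.2 ?_, fun j => ?_⟩⟩
  · exact (h1 (x - c) (by simpa using hx.1)).2.differentiableAt
  · have h2 := (h1 (x - c) (by simpa using hx.1)).1 j
    have hne : x - c ≠ 0 := by
      intro h0
      have := hx.2
      rw [h0, zero_mul] at this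
      exact Complex.zero_notMem_slitPlane this
    have := (eulerFin_point (a := argPow φ (x - c) e) hne (argPow_ne_zero _ _ _) j).2 h2
    rwa [sub_add_cancel] at this

lemma okSol_locInf {Φ : ℂ → J → ℂ} (hΦ : AnalyticAt ℂ Φ 0) (h : EulerInf t B c e Φ) :
    ∃ R > 0, OkSol t B {x | R < ‖x - c‖ ∧ (x - c) * Complex.exp (-(φ * I)) ∈ slitPlane}
      (locInf φ c e Φ) := by
  obtain ⟨r, hr, h1⟩ := Metric.eventually_nhds_iff_ball.1 (h.and hΦ.eventually_analyticAt)
  have hb : ∀ x : ℂ, r⁻¹ < ‖x - c‖ → (x - c)⁻¹ ∈ ball (0 : ℂ) r := fun x hx => by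
    rw [mem_ball_zero_iff, norm_inv]
    exact inv_lt_of_inv_lt₀ hr hx
  refine ⟨r⁻¹, inv_pos.2 hr, fun x hx => ⟨_, hasDerivAt_locInf hx.2 ?_, fun j => ?_⟩⟩
  · exact (h1 _ (hb x hx.1)).2.differentiableAt
  · have h2 := (h1 _ (hb x hx.1)).1 j
    have hne : x - c ≠ 0 := norm_pos_iff.1 ((inv_pos.2 hr).trans hx.1)
    exact (eulerInf_point hne (argPow_ne_zero _ _ _) j).2 h2

/-- The expansion of a solution satisfies the Euler equation, by the identity theorem. -/
lemma eulerFin_of_okSol (hSo : IsOpen S) (hU : OkSol t B S U) {Ψ : ℂ → J → ℂ}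
    (hΨ : AnalyticAt ℂ Ψ 0) {r : ℝ} (hr : 0 < r)
    (hUΨ : ∀ x ∈ S, ‖x - c‖ < r → U x = locFin φ c e Ψ x)
    (hS : ∀ ε > 0, ∃ x ∈ S, ‖x - c‖ < ε)
    (hslit : ∀ x ∈ S, (x - c) * Complex.exp (-(φ * I)) ∈ slitPlane) : EulerFin t B c e Ψ := by
  refine Filter.eventually_all.2 fun j => ?_
  obtain ⟨r', hr', h1⟩ := Metric.eventually_nhds_iff_ball.1 hΨ.eventually_analyticAt
  have hΨj : AnalyticAt ℂ (fun y => Ψ y j) 0 := analyticAt_pi_iff.1 hΨ j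
  have hΨ'j : AnalyticAt ℂ (fun y => deriv Ψ y j) 0 := analyticAt_pi_iff.1 hΨ.deriv j
  have hBj : AnalyticAt ℂ (fun y => (B *ᵥ Ψ y) j) 0 := by
    simp only [mulVec, dotProduct]
    exact Finset.analyticAt_fun_sum _ fun i _ => analyticAt_const.mul (analyticAt_pi_iff.1 hΨ i)
  refine (AnalyticAt.frequently_eq_iff_eventually_eq (by fun_prop) (by fun_prop)).1 ?_
  rw [Filter.frequently_iff]
  intro s hs
  obtain ⟨ε, hε, hsub⟩ := Metric.mem_nhdsWithin_iff.1 hs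
  obtain ⟨x, hx, hxε⟩ := hS (min ε (min r r')) (lt_min hε (lt_min hr hr'))
  have hne : x - c ≠ 0 := by
    intro h0
    have := hslit x hx
    rw [h0, zero_mul] at this
    exact Complex.zero_notMem_slitPlane this
  refine ⟨x - c, hsub ⟨?_, hne⟩, ?_⟩
  · simpa using hxε.trans_le (min_le_left _ _)
  · obtain ⟨U', h2, h3⟩ := hU x hx
    have hxr : ‖x - c‖ < r := hxε.trans_le ((min_le_right _ _).trans (min_le_left _ _))
    have hxr' : ‖x - c‖ < r' := hxε.trans_le ((min_le_right _ _).trans (min_le_right _ _))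
    have h4 := hasDerivAt_locFin (e := e) (hslit x hx)
      (h1 (x - c) (by simpa using hxr')).differentiableAt
    have hev : U =ᶠ[𝓝 x] locFin φ c e Ψ := by
      have : {y : ℂ | ‖y - c‖ < r} ∈ 𝓝 x :=
        (isOpen_lt (by fun_prop) continuous_const).mem_nhds hxr
      filter_upwards [hSo.mem_nhds hx, this] with y hy hyr using hUΨ y hy hyr
    have h5 := h2.unique (h4.congr_of_eventuallyEq hev)
    have h6 := h3 j
    rw [h5, hUΨ x hx hxr, locFin] at h6
    refine (eulerFin_point (a := argPow φ (x - c) e) hne (argPow_ne_zero _ _ _) j).1 ?_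
    rwa [sub_add_cancel]

lemma eulerInf_of_okSol (hSo : IsOpen S) (hU : OkSol t B S U) {Φ : ℂ → J → ℂ}
    (hΦ : AnalyticAt ℂ Φ 0) {R : ℝ} (hR : 0 < R)
    (hUΦ : ∀ x ∈ S, R < ‖x - c‖ → U x = locInf φ c e Φ x)
    (hS : ∀ R : ℝ, ∃ x ∈ S, R < ‖x - c‖)
    (hslit : ∀ x ∈ S, (x - c) * Complex.exp (-(φ * I)) ∈ slitPlane) : EulerInf t B c e Φ := by
  refine Filter.eventually_all.2 fun j => ?_
  obtain ⟨r', hr', h1⟩ := Metric.eventually_nhds_iff_ball.1 hΦ.eventually_analyticAt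
  have hΨj : AnalyticAt ℂ (fun y => Φ y j) 0 := analyticAt_pi_iff.1 hΦ j
  have hΨ'j : AnalyticAt ℂ (fun y => deriv Φ y j) 0 := analyticAt_pi_iff.1 hΦ.deriv j
  have hBj : AnalyticAt ℂ (fun y => (B *ᵥ Φ y) j) 0 := by
    simp only [mulVec, dotProduct]
    exact Finset.analyticAt_fun_sum _ fun i _ => analyticAt_const.mul (analyticAt_pi_iff.1 hΦ i)
  refine (AnalyticAt.frequently_eq_iff_eventually_eq (by fun_prop) (by fun_prop)).1 ?_
  rw [Filter.frequently_iff]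
  intro s hs
  obtain ⟨ε, hε, hsub⟩ := Metric.mem_nhdsWithin_iff.1 hs
  obtain ⟨x, hx, hxε⟩ := hS (max ε⁻¹ (max R r'⁻¹))
  have hxR : R < ‖x - c‖ := ((le_max_left _ _).trans (le_max_right _ _)).trans_lt hxε
  have hxr' : r'⁻¹ < ‖x - c‖ := ((le_max_right _ _).trans (le_max_right _ _)).trans_lt hxε
  have hne : x - c ≠ 0 := norm_pos_iff.1 (hR.trans hxR)
  refine ⟨(x - c)⁻¹, hsub ⟨?_, inv_ne_zero hne⟩, ?_⟩
  · rw [mem_ball_zero_iff, norm_inv]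
    exact inv_lt_of_inv_lt₀ hε ((le_max_left _ _).trans_lt hxε)
  · obtain ⟨U', h2, h3⟩ := hU x hx
    have h4 := hasDerivAt_locInf (e := e) (hslit x hx)
      (h1 (x - c)⁻¹ (by
        rw [mem_ball_zero_iff, norm_inv]; exact inv_lt_of_inv_lt₀ hr' hxr')).differentiableAt
    have hev : U =ᶠ[𝓝 x] locInf φ c e Φ := by
      have : {y : ℂ | R < ‖y - c‖} ∈ 𝓝 x :=
        (isOpen_lt continuous_const (by fun_prop)).mem_nhds hxR
      filter_upwards [hSo.mem_nhds hx, this] with y hy hyr using hUΦ y hy hyr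
    have h5 := h2.unique (h4.congr_of_eventuallyEq hev)
    have h6 := h3 j
    rw [h5, hUΦ x hx hxR, locInf] at h6
    exact (eulerInf_point hne (argPow_ne_zero _ _ _) j).1 h6

end Local

section Global

variable {J : Type} [Fintype J] {t : J → ℂ} {B : Matrix J J ℂ} {S : Set ℂ}

/-- On a star-shaped domain a solution can be prescribed at any point. -/
lemma exists_okSol_at (B : Matrix J J ℂ) (hSo : IsOpen S) {x₀ : ℂ} (hs : StarConvex ℝ x₀ S)
    (hx₀ : x₀ ∈ S) (hS : ∀ x ∈ S, ∀ j, x ≠ t j) {x₁ : ℂ} (hx₁ : x₁ ∈ S) (v : J → ℂ) :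
    ∃ U, U x₁ = v ∧ OkSol t B S U := by
  classical
  choose W hW0 hW using fun j : J => exists_okSol B hSo hs hS (Pi.single j 1)
  have hc : IsPreconnected S := (hs.isPathConnected hx₀).isConnected.isPreconnected
  let L : (J → ℂ) →ₗ[ℂ] (J → ℂ) := Fintype.linearCombination ℂ fun j => W j x₁
  have hL : ∀ a, L a = (∑ j, a j • W j) x₁ := fun a => by
    simp [L, Fintype.linearCombination_apply, Finset.sum_apply]
  have hinj : Function.Injective L := by
    rw [← LinearMap.ker_eq_bot, LinearMap.ker_eq_bot']
    intro a ha
    rw [hL] at ha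
    have h1 : OkSol t B S (∑ j, a j • W j) := OkSol.sum _ fun j _ => (hW j).smul (a j)
    have h2 := h1.eq_zero hSo hc hS hx₁ ha x₀ hx₀
    simp only [Finset.sum_apply, Pi.smul_apply, hW0] at h2
    funext j
    have h3 := congrFun h2 j
    simpa [Finset.sum_apply, Pi.single_apply] using h3
  obtain ⟨a, ha⟩ := LinearMap.injective_iff_surjective.1 hinj v
  exact ⟨∑ j, a j • W j, by rw [← hL, ha], OkSol.sum _ fun j _ => (hW j).smul (a j)⟩

/-- The complement of the rays that start at the points `t b` in the direction away from `x₀`. -/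
def starCut {ι : Type*} (t : ι → ℂ) (x₀ : ℂ) : Set ℂ :=
  {x | ∀ (b : ι) (s : ℝ), 1 ≤ s → x ≠ x₀ + s * (t b - x₀)}

variable {ι : Type*} {p : ι → ℂ} {x₀ x : ℂ}

lemma isOpen_starCut [Finite ι] (hx₀ : ∀ b, p b ≠ x₀) : IsOpen (starCut p x₀) := by
  have : starCut p x₀ = ⋂ b, ((fun s : ℝ => x₀ + s * (p b - x₀)) '' Ici 1)ᶜ := by
    ext x
    simp only [starCut, mem_ofPred_eq, mem_iInter, mem_compl_iff, mem_image, mem_Ici, not_exists,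
      not_and]
    exact forall_congr' fun b => forall₂_congr fun s _ => ne_comm
  rw [this]
  refine isOpen_iInter_of_finite fun b => IsClosed.isOpen_compl (self := ?_)
  have hne : p b - x₀ ≠ 0 := sub_ne_zero.2 (hx₀ b)
  have h1 : IsClosedEmbedding fun s : ℝ => x₀ + s * (p b - x₀) := by
    have h2 : IsClosedEmbedding fun z : ℂ => x₀ + z * (p b - x₀) :=
      ((Homeomorph.mulRight₀ (p b - x₀) hne).trans (Homeomorph.addLeft x₀)).isClosedEmbedding
    exact h2.comp Complex.isometry_ofReal.isClosedEmbedding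
  exact h1.isClosedMap _ isClosed_Ici

lemma starConvex_starCut (hx₀ : ∀ b, p b ≠ x₀) : StarConvex ℝ x₀ (starCut p x₀) := by
  intro x hx a u ha hu hau b s hs h
  have hne : p b - x₀ ≠ 0 := sub_ne_zero.2 (hx₀ b)
  have e1 : (u : ℂ) * (x - x₀) = s * (p b - x₀) := by
    have h1 : (a : ℂ) + u = 1 := by exact_mod_cast hau
    simp only [Complex.real_smul] at h
    linear_combination h - x₀ * h1
  have hu0 : u ≠ 0 := by
    rintro rfl
    rw [ofReal_zero, zero_mul, eq_comm, mul_eq_zero] at e1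
    rcases e1 with h1 | h1
    · have : s = 0 := by exact_mod_cast h1
      linarith
    · exact hne h1
  have hu1 : u ≤ 1 := by linarith
  have hu2 : 0 < u := lt_of_le_of_ne hu (Ne.symm hu0)
  refine hx b (s / u) ((le_div_iff₀ hu2).2 (by linarith)) ?_
  have hu' : (u : ℂ) ≠ 0 := by exact_mod_cast hu0
  push_cast
  field_simp
  linear_combination e1

lemma mem_starCut_self (hx₀ : ∀ b, p b ≠ x₀) : x₀ ∈ starCut p x₀ := by
  intro b s hs h
  have hne : p b - x₀ ≠ 0 := sub_ne_zero.2 (hx₀ b)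
  have : (s : ℂ) * (p b - x₀) = 0 := by linear_combination -h
  rcases mul_eq_zero.1 this with h1 | h1
  · have : s = 0 := by exact_mod_cast h1
    linarith
  · exact hne h1

lemma ne_of_mem_starCut (hx : x ∈ starCut p x₀) (b : ι) : x ≠ p b := fun h =>
  hx b 1 le_rfl (by rw [h]; push_cast; ring)

/-- A convex open set without singular points whose closure contains `x₀` does not meet the
cuts. -/
lemma subset_starCut (hSo : IsOpen S) (hSc : Convex ℝ S) (hS : ∀ x ∈ S, ∀ b, x ≠ p b)
    (hx₀ : x₀ ∈ closure S) : S ⊆ starCut p x₀ := by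
  rintro x hx b s hs rfl
  have hs0 : 0 < s := by linarith
  have h1 : p b ∈ S := by
    have h2 := hSc.openSegment_closure_interior_subset_interior hx₀
      (y := x₀ + s * (p b - x₀)) (by rwa [hSo.interior_eq])
    rw [hSo.interior_eq] at h2
    rcases eq_or_lt_of_le hs with rfl | hs1
    · simpa using hx
    · apply h2
      refine ⟨1 - s⁻¹, s⁻¹, sub_pos.2 (inv_lt_one_of_one_lt₀ hs1), inv_pos.2 hs0, by ring, ?_⟩
      have : (s : ℂ) ≠ 0 := by exact_mod_cast hs0.ne'
      simp only [Complex.real_smul]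
      push_cast
      field_simp
      ring
  exact hS _ h1 b rfl

end Global

/-! ### Continuation of local solutions -/

section Extend

variable {J : Type} [Fintype J] {t : J → ℂ} {B : Matrix J J ℂ} {S D : Set ℂ} {c e : ℂ} {φ : ℝ}

/-- A solution on a connected part of a star-shaped domain extends to the whole domain. -/
lemma exists_okSol_extend (hSo : IsOpen S) {x₀ : ℂ} (hs : StarConvex ℝ x₀ S) (hx₀ : x₀ ∈ S)
    (hS : ∀ x ∈ S, ∀ j, x ≠ t j) (hDo : IsOpen D) (hDc : IsPreconnected D) (hDS : D ⊆ S)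
    (hD : D.Nonempty) {W : ℂ → J → ℂ} (hW : OkSol t B D W) :
    ∃ V, OkSol t B S V ∧ ∀ x ∈ D, V x = W x := by
  classical
  obtain ⟨x₁, hx₁⟩ := hD
  obtain ⟨V, hV1, hV⟩ := exists_okSol_at B hSo hs hx₀ hS (hDS hx₁) (W x₁)
  exact ⟨V, hV, (hV.mono hDS).eqOn hDo hDc (fun x hx => hS x (hDS hx)) hW hx₁ hV1⟩

lemma isOpen_slit (c : ℂ) (φ : ℝ) :
    IsOpen {x : ℂ | (x - c) * Complex.exp (-(φ * I)) ∈ slitPlane} :=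
  Complex.isOpen_slitPlane.preimage (by fun_prop)

lemma starConvex_slit (c : ℂ) (φ : ℝ) {r : ℝ} (hr : 0 < r) :
    StarConvex ℝ (c + r * Complex.exp (φ * I))
      {x : ℂ | (x - c) * Complex.exp (-(φ * I)) ∈ slitPlane} := by
  intro x hx a u ha hu hau
  have h1 : (a : ℂ) + u = 1 := by exact_mod_cast hau
  have e1 : (a • (c + r * Complex.exp (φ * I)) + u • x - c) * Complex.exp (-(φ * I)) =
      ((a * r : ℝ) : ℂ) + u * ((x - c) * Complex.exp (-(φ * I))) := by
    have h2 : Complex.exp (φ * I) * Complex.exp (-(φ * I)) = 1 := by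
      rw [← Complex.exp_add, add_neg_cancel, Complex.exp_zero]
    simp only [Complex.real_smul]
    push_cast
    linear_combination (a * r : ℂ) * h2 + c * Complex.exp (-(φ * I)) * h1
  have hx' : (x - c) * Complex.exp (-(φ * I)) ∈ slitPlane := hx
  change (a • (c + r * Complex.exp (φ * I)) + u • x - c) * Complex.exp (-(φ * I)) ∈ slitPlane
  rw [e1]
  rw [Complex.mem_slitPlane_iff] at hx' ⊢
  rw [Complex.add_re, Complex.add_im, Complex.ofReal_re, Complex.ofReal_im, Complex.re_ofReal_mul,
    Complex.im_ofReal_mul, zero_add]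
  rcases eq_or_lt_of_le hu with rfl | hu'
  · left
    have : a = 1 := by linarith
    rw [this]; simpa using hr
  · rcases hx' with h | h
    · left
      exact add_pos_of_nonneg_of_pos (by positivity) (mul_pos hu' h)
    · right
      exact mul_ne_zero hu'.ne' h

variable {ι : Type*} [Finite ι] {p : ι → ℂ} {x₀ : ℂ}

/-- The local solution at a singular point extends to the plane cut along rays in the direction
away from `x₀`. -/
lemma exists_okSol_starCut (hx₀ : ∀ b, p b ≠ x₀) (ht : ∀ j, ∃ b, t j = p b) {r₀ : ℝ} (hr₀ : 0 < r₀)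
    (hφ : x₀ - c = r₀ * Complex.exp (φ * I))
    (hc : ∃ b, p b = c)
    (hp : ∀ b, p b ≠ c → ∀ s : ℝ, 1 ≤ s → c ≠ x₀ + s * (p b - x₀)) {Ψ : ℂ → J → ℂ}
    (hΨ : AnalyticAt ℂ Ψ 0) (h : EulerFin t B c e Ψ) :
    ∃ V, OkSol t B (starCut p x₀) V ∧
      ∃ r > 0, ∀ x ∈ starCut p x₀, ‖x - c‖ < r → V x = locFin φ c e Ψ x := by
  obtain ⟨r₁, hr₁, h1⟩ := okSol_locFin (φ := φ) hΨ h
  -- a disc that meets no cut but the one at `c`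
  have ho : IsOpen (starCut (fun b : {b // p b ≠ c} => p b) x₀) := isOpen_starCut fun b => hx₀ b
  obtain ⟨r₂, hr₂, h2⟩ := Metric.isOpen_iff.1 ho c (fun b s hs => hp b b.2 s hs)
  have hcut : ∀ x, x ∈ starCut p x₀ → (x - c) * Complex.exp (-(φ * I)) ∈ slitPlane := by
    intro x hx
    by_contra hcon
    obtain ⟨b, hb⟩ := hc
    rw [Complex.mem_slitPlane_iff, not_or, not_lt, not_not] at hcon
    have e2 : x - c = ((x - c) * Complex.exp (-(φ * I))) * Complex.exp (φ * I) := by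
      rw [mul_assoc, ← Complex.exp_add, neg_add_cancel, Complex.exp_zero, mul_one]
    generalize (x - c) * Complex.exp (-(φ * I)) = z at hcon e2
    have hz : z = (z.re : ℂ) := by
      apply Complex.ext <;> simp [hcon.2]
    refine hx b (1 + (-z.re) / r₀) ?_ ?_
    · have : 0 ≤ (-z.re) / r₀ := div_nonneg (by linarith [hcon.1]) hr₀.le
      linarith
    · have hr' : (r₀ : ℂ) ≠ 0 := by exact_mod_cast hr₀.ne'
      rw [hb]
      have e3 : c - x₀ = -(r₀ * Complex.exp (φ * I)) := by rw [← hφ]; ring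
      rw [e3]
      push_cast
      rw [hz] at e2
      field_simp
      linear_combination e2 - hφ
  set r := min r₁ r₂ with hr_def
  have hr : 0 < r := lt_min hr₁ hr₂
  have hD : ball c r ∩ {x : ℂ | (x - c) * Complex.exp (-(φ * I)) ∈ slitPlane} ⊆ starCut p x₀ := by
    rintro x ⟨hxr, hx⟩ b s hs rfl
    by_cases hb : p b = c
    · have hx' : (x₀ + s * (p b - x₀) - c) * Complex.exp (-(φ * I)) ∈ slitPlane := hx
      have e2 : (x₀ + s * (p b - x₀) - c) * Complex.exp (-(φ * I)) = (((1 - s) * r₀ : ℝ) : ℂ) := by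
        have h3 : Complex.exp (φ * I) * Complex.exp (-(φ * I)) = 1 := by
          rw [← Complex.exp_add, add_neg_cancel, Complex.exp_zero]
        have e3 : x₀ + s * (p b - x₀) - c = (1 - s) * (x₀ - c) := by rw [hb]; ring
        rw [e3, hφ]
        push_cast
        linear_combination ((1 - s) * r₀ : ℂ) * h3
      rw [e2, Complex.ofReal_mem_slitPlane] at hx'
      have : (1 - s) * r₀ ≤ 0 := mul_nonpos_of_nonpos_of_nonneg (by linarith) hr₀.le
      linarith
    · have h3 : x₀ + s * (p b - x₀) ∈ starCut (fun b : {b // p b ≠ c} => p b) x₀ :=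
        h2 (ball_subset_ball (min_le_right _ _) hxr)
      exact h3 ⟨b, hb⟩ s hs rfl
  have hx₁ : c + ((r / 2 : ℝ) : ℂ) * Complex.exp (φ * I) ∈
      ball c r ∩ {x : ℂ | (x - c) * Complex.exp (-(φ * I)) ∈ slitPlane} := by
    constructor
    · rw [mem_ball, dist_eq_norm, add_sub_cancel_left, norm_mul, Complex.norm_exp_ofReal_mul_I,
        mul_one, Complex.norm_real, Real.norm_of_nonneg (by positivity)]
      linarith
    · change (c + ((r / 2 : ℝ) : ℂ) * Complex.exp (φ * I) - c) * _ ∈ slitPlane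
      rw [add_sub_cancel_left, mul_assoc, ← Complex.exp_add, add_neg_cancel, Complex.exp_zero,
        mul_one, Complex.ofReal_mem_slitPlane]
      positivity
  have hsc : StarConvex ℝ (c + ((r / 2 : ℝ) : ℂ) * Complex.exp (φ * I))
      (ball c r ∩ {x : ℂ | (x - c) * Complex.exp (-(φ * I)) ∈ slitPlane}) :=
    ((convex_ball c r).starConvex hx₁.1).inter (starConvex_slit c φ (by positivity))
  obtain ⟨V, hV, hVD⟩ := exists_okSol_extend (isOpen_starCut hx₀) (starConvex_starCut hx₀)
    (mem_starCut_self hx₀) (fun x hx j => by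
      obtain ⟨b, hb⟩ := ht j
      rw [hb]; exact ne_of_mem_starCut hx b)
    (isOpen_ball.inter (isOpen_slit c φ)) (hsc.isPathConnected hx₁).isConnected.isPreconnected
    hD ⟨_, hx₁⟩ (W := locFin φ c e Ψ) (h1.mono (by
      rintro x ⟨hxr, hx⟩
      refine ⟨?_, hx⟩
      rw [mem_ball, dist_eq_norm] at hxr
      exact hxr.trans_le (min_le_left _ _)))
  refine ⟨V, hV, r, hr, fun x hx hxr => hVD x ⟨?_, hcut x hx⟩⟩
  rwa [mem_ball, dist_eq_norm]

end Extend

/-! ### From the complex domain to a ray -/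

section ToRay

variable {J : Type} [Fintype J] {t : J → ℂ} {B : Matrix J J ℂ} {S : Set ℂ} {c e ω : ℂ} {φ : ℝ}
  {U : ℂ → J → ℂ}

/-- Restriction to the ray `c + ω X` and the change of the coordinate to `X`. -/
lemma OkSol.raySol (hU : OkSol t B S U) (hω : ω ≠ 0) {I : Set ℝ}
    (hI : ∀ X ∈ I, c + ω * (X : ℂ) ∈ S) :
    RaySol (fun j => (t j - c) / ω) B I (fun X => U (c + ω * (X : ℂ))) := by
  intro X hX
  obtain ⟨U', h1, h2⟩ := hU _ (hI X hX)
  have d0 : HasDerivAt (fun X : ℝ => c + ω * (X : ℂ)) ω X := by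
    have := (((hasDerivAt_id (X : ℂ)).const_mul ω).const_add c).comp_ofReal
    simpa using this
  refine ⟨ω • U', HasDerivAt.scomp X h1 d0, fun j => ?_⟩
  rw [← h2 j, Pi.smul_apply, smul_eq_mul]
  field_simp
  ring

/-- The expansion at `c + a ω` along the ray `c + ω X`. -/
lemma leadFin_of_locFin {c₀ : ℂ} {a : ℝ} (hω : ω ≠ 0) (hc₀ : c₀ = c + ω * a) {Ψ : ℂ → J → ℂ}
    (hΨ : AnalyticAt ℂ Ψ 0) {r : ℝ} (hr : 0 < r)
    (hS : ∀ X > a, c + ω * (X : ℂ) ∈ S)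
    (hU : ∀ x ∈ S, ‖x - c₀‖ < r → U x = locFin φ c₀ e Ψ x) :
    LeadFin a e (argPow φ ω e • Ψ 0) (fun X => U (c + ω * (X : ℂ))) := by
  refine ⟨fun y => argPow φ ω e • Ψ (ω * y), ⟨?_, ?_⟩, by simp⟩
  · have h1 : AnalyticAt ℂ (fun y : ℂ => ω * y) 0 := by fun_prop
    have h2 : AnalyticAt ℂ Ψ (ω * 0) := by simpa using hΨ
    have h3 : AnalyticAt ℂ (fun y : ℂ => Ψ (ω * y)) 0 :=
      AnalyticAt.comp (f := fun y : ℂ => ω * y) h2 h1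
    exact (analyticAt_const (v := argPow φ ω e)).smul h3
  · have h3 : ∀ᶠ X : ℝ in 𝓝[>] a, ‖ω * ((X - a : ℝ) : ℂ)‖ < r := by
      have := (tendsto_sub_nhdsGT a).const_mul ω
      rw [mul_zero] at this
      have h4 := this.norm
      rw [norm_zero] at h4
      exact h4.eventually (gt_mem_nhds hr)
    filter_upwards [h3, self_mem_nhdsWithin] with X hX hXa
    have e1 : c + ω * (X : ℂ) - c₀ = ω * ((X - a : ℝ) : ℂ) := by
      rw [hc₀]; push_cast; ring
    rw [hU _ (hS X hXa) (by rw [e1]; exact hX), locFin, e1,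
      argPow_mul_ofReal φ hω (sub_pos.2 hXa), mul_comm, mul_smul]

/-- The expansion at infinity along the ray `c + ω X`. -/
lemma leadInf_of_locInf (hω : ω ≠ 0) {Φ : ℂ → J → ℂ} (hΦ : AnalyticAt ℂ Φ 0) {f : ℝ → J → ℂ}
    (hU : ∀ᶠ X : ℝ in atTop, f X = locInf φ c e Φ (c + ω * (X : ℂ))) :
    LeadInf e (argPow φ ω e • Φ 0) f := by
  refine ⟨fun y => argPow φ ω e • Φ (ω⁻¹ * y), ⟨?_, ?_⟩, by simp⟩
  · have h1 : AnalyticAt ℂ (fun y : ℂ => ω⁻¹ * y) 0 := by fun_prop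
    have h2 : AnalyticAt ℂ Φ (ω⁻¹ * 0) := by simpa using hΦ
    have h3 : AnalyticAt ℂ (fun y : ℂ => Φ (ω⁻¹ * y)) 0 :=
      AnalyticAt.comp (f := fun y : ℂ => ω⁻¹ * y) h2 h1
    exact (analyticAt_const (v := argPow φ ω e)).smul h3
  · filter_upwards [hU, eventually_gt_atTop 0] with X hX hX0
    rw [hX, locInf, add_sub_cancel_left, argPow_mul_ofReal φ hω hX0, mul_inv, mul_comm (argPow φ ω e),
      mul_smul]

lemma tendsto_norm_mul_atTop (hω : ω ≠ 0) :
    Tendsto (fun X : ℝ => ‖ω * (X : ℂ)‖) atTop atTop := by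
  simp only [norm_mul, Complex.norm_real]
  exact (tendsto_norm_atTop_atTop).const_mul_atTop (norm_pos_iff.2 hω)

end ToRay

namespace RaySys

variable {R K : Type} [Fintype R] [Fintype K] [DecidableEq R] [DecidableEq K] (s : RaySys R K)

/-- The leading coefficient of the `k`-th solution with exponent `ρ₁` at infinity. -/
def leadVec (k : K) : R ⊕ K → ℂ :=
  Sum.elim (fun i => s.P i k) (Pi.single k (s.ρ₁ - s.mu k))

/-- Existence of the solutions with exponent `ρ₁` at infinity. -/
lemma exists_eulerInf (t : R ⊕ K → ℂ) (c : ℂ) (k : K) : ∃ Φ : ℂ → R ⊕ K → ℂ,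
    AnalyticAt ℂ Φ 0 ∧ Φ 0 = s.leadVec k ∧ EulerInf t s.B c s.ρ₁ Φ := by
  have hne := s.ρ₁₂_notInt.ne_zero
  have hvec : ∀ (e : ℂ) (he : e = s.ρ₁ ∨ e = s.ρ₂) (k : K),
      s.B *ᵥ Sum.elim (fun i => s.P i k) (Pi.single k (e - s.mu k)) =
        e • (Sum.elim (fun i => s.P i k) (Pi.single k (e - s.mu k)) : R ⊕ K → ℂ) := by
    intro e he k
    have hP : (fun i => s.P i k) = s.P *ᵥ Pi.single k 1 := by
      rw [mulVec_single_one]; rfl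
    refine s.ext_Q (fun l => ?_) fun l => ?_
    · rw [s.Q_B]
      have : (fun i => (e • (Sum.elim (fun i => s.P i k) (Pi.single k (e - s.mu k)) :
        R ⊕ K → ℂ)) (Sum.inl i)) = e • fun i => s.P i k := rfl
      rw [this, mulVec_smul]
      simp only [Sum.elim_inl, Sum.elim_inr, hP, s.Q_P, Pi.smul_apply, smul_eq_mul]
      by_cases hl : l = k
      · subst hl; simp
      · simp [hl]
    · rw [s.B_inr]
      simp only [Sum.elim_inl, Sum.elim_inr, hP, s.Q_P, Pi.smul_apply, smul_eq_mul]
      by_cases hl : l = k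
      · subst hl
        rcases he with rfl | rfl
        · simp; ring
        · simp; ring
      · simp [hl]
  let Qm : Matrix (R ⊕ K) (K ⊕ K) ℂ := fromBlocks s.P s.P (diagonal fun k => s.ρ₁ - s.mu k)
    (diagonal fun k => s.ρ₂ - s.mu k)
  let Qi : Matrix (K ⊕ K) (R ⊕ K) ℂ := fromBlocks
    ((diagonal fun k => (s.mu k - s.ρ₂) / (s.ρ₁ - s.ρ₂)) * s.Q)
    (diagonal fun _ => (s.ρ₁ - s.ρ₂)⁻¹)
    ((diagonal fun k => (s.ρ₁ - s.mu k) / (s.ρ₁ - s.ρ₂)) * s.Q)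
    (diagonal fun _ => -(s.ρ₁ - s.ρ₂)⁻¹)
  have hcol : ∀ k, Qm *ᵥ Pi.single (Sum.inl k) 1 =
      Sum.elim (fun i => s.P i k) (Pi.single k (s.ρ₁ - s.mu k)) := by
    intro k
    rw [mulVec_single_one]
    funext j
    rcases j with i | l
    · rfl
    · simp only [Qm, col_apply, fromBlocks_apply₂₁, Sum.elim_inr, diagonal_apply, Pi.single_apply]
      split_ifs with h
      · rw [h]
      · rfl
  have hcol' : ∀ k, Qm *ᵥ Pi.single (Sum.inr k) 1 =
      Sum.elim (fun i => s.P i k) (Pi.single k (s.ρ₂ - s.mu k)) := by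
    intro k
    rw [mulVec_single_one]
    funext j
    rcases j with i | l
    · rfl
    · simp only [Qm, col_apply, fromBlocks_apply₂₂, Sum.elim_inr, diagonal_apply, Pi.single_apply]
      split_ifs with h
      · rw [h]
      · rfl
  refine Okubo.exists_eulerInf (Q := Qm) (Qi := Qi)
    (b := Sum.elim (fun _ => s.ρ₁) fun _ => s.ρ₂) ?_ ?_ ?_ (hvec _ (Or.inl rfl) k)
  · rw [fromBlocks_multiply, ← Matrix.mul_assoc, ← Matrix.mul_assoc, ← Matrix.mul_assoc,
      ← Matrix.mul_assoc, ← Matrix.add_mul, ← Matrix.add_mul, ← Matrix.mul_add, ← Matrix.mul_add,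
      diagonal_mul_diagonal, diagonal_mul_diagonal, diagonal_mul_diagonal, diagonal_mul_diagonal,
      diagonal_add, diagonal_add, diagonal_add, diagonal_add]
    have e1 : (fun k => (s.mu k - s.ρ₂) / (s.ρ₁ - s.ρ₂) + (s.ρ₁ - s.mu k) / (s.ρ₁ - s.ρ₂)) =
        fun _ => 1 := by
      funext k; field_simp; ring
    have e2 : (fun _ : K => (s.ρ₁ - s.ρ₂)⁻¹ + -(s.ρ₁ - s.ρ₂)⁻¹) = fun _ => 0 := by
      funext k; ring
    have e3 : (fun k => (s.ρ₁ - s.mu k) * ((s.mu k - s.ρ₂) / (s.ρ₁ - s.ρ₂)) +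
        (s.ρ₂ - s.mu k) * ((s.ρ₁ - s.mu k) / (s.ρ₁ - s.ρ₂))) = fun _ => 0 := by
      funext k; field_simp; ring
    have e4 : (fun k => (s.ρ₁ - s.mu k) * (s.ρ₁ - s.ρ₂)⁻¹ +
        (s.ρ₂ - s.mu k) * -(s.ρ₁ - s.ρ₂)⁻¹) = fun _ => 1 := by
      funext k; field_simp; ring
    rw [e1, e2, e3, e4, diagonal_one, diagonal_zero, Matrix.mul_one, s.PQ, Matrix.mul_zero,
      Matrix.zero_mul, fromBlocks_one]
  · refine Matrix.ext_of_mulVec_single fun l => ?_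
    rw [← mulVec_mulVec, ← mulVec_mulVec]
    rcases l with l | l
    · have : diagonal (Sum.elim (fun _ => s.ρ₁) fun _ => s.ρ₂) *ᵥ
          (Pi.single (Sum.inl l) 1 : K ⊕ K → ℂ) = s.ρ₁ • Pi.single (Sum.inl l) 1 := by
        rw [diagonal_mulVec_single]; simp [← Pi.single_smul]
      rw [this, mulVec_smul, hcol, hvec _ (Or.inl rfl)]
    · have : diagonal (Sum.elim (fun _ => s.ρ₁) fun _ => s.ρ₂) *ᵥ
          (Pi.single (Sum.inr l) 1 : K ⊕ K → ℂ) = s.ρ₂ • Pi.single (Sum.inr l) 1 := by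
        rw [diagonal_mulVec_single]; simp [← Pi.single_smul]
      rw [this, mulVec_smul, hcol', hvec _ (Or.inr rfl)]
  · rintro (l | l) m h
    · have : ((m : ℂ) + 1) = 0 := by simp only [Sum.elim_inl] at h; linear_combination -h
      exact absurd this (by exact_mod_cast Nat.succ_ne_zero m)
    · refine s.ρ₁₂_notInt (m + 1) ?_
      simp only [Sum.elim_inr] at h
      push_cast
      linear_combination h

end RaySys

/-! ### The sectors and the singular points -/

namespace Data

variable (d : Data)

/-- The singular points of the rank `2n` system, attached to the components. -/
def tt : d.Row ⊕ d.Col → ℂ := Sum.elim (fun a => d.t a.1.castSucc) fun _ => d.tLast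

lemma bigT_eq : d.bigT = diagonal d.tt := by
  rw [bigT, T, smul_one_eq_diagonal, fromBlocks_diagonal]
  rfl

/-- The lower bound of the angles in `S_i^±`. -/
def lo (δ : ℝ) (i : Fin d.p) : Side → ℝ
  | .plus => d.ang i
  | .minus => max (d.angPrev i + δ) (d.ang i - Real.pi)

/-- The upper bound of the angles in `S_i^±`. -/
def hi (δ : ℝ) (i : Fin d.p) : Side → ℝ
  | .plus => min (d.angNext i - δ) (d.ang i + Real.pi)
  | .minus => d.ang i

variable {d} {δ : ℝ} (hδ : d.SmallAngle δ) (i : Fin d.p) (σ : Side)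

lemma SmallAngle.lo_lt_hi (hδ : d.SmallAngle δ) (i : Fin d.p) (σ : Side) :
    d.lo δ i σ < d.hi δ i σ := by
  have := hδ.2 i
  have hπ := Real.pi_pos
  cases σ
  · exact lt_min (by simp only [lo]; linarith [this.2]) (by simp only [lo]; linarith)
  · exact max_lt this.1 (by simp only [hi]; linarith)

lemma sub_pi_le_lo : d.ang i - Real.pi ≤ d.lo δ i σ := by
  have hπ := Real.pi_pos
  cases σ
  · simp only [lo]; linarith
  · exact le_max_right _ _

lemma hi_le_add_pi : d.hi δ i σ ≤ d.ang i + Real.pi := by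
  have hπ := Real.pi_pos
  cases σ
  · exact min_le_right _ _
  · simp only [hi]; linarith

lemma ang_eq_lo_or_hi : d.ang i = d.lo δ i σ ∨ d.ang i = d.hi δ i σ := by
  cases σ
  · exact Or.inl rfl
  · exact Or.inr rfl

lemma hi_le_lo_add_pi : d.hi δ i σ ≤ d.lo δ i σ + Real.pi := by
  cases σ
  · exact min_le_right _ _
  · have := le_max_right (d.angPrev i + δ) (d.ang i - Real.pi)
    simp only [hi, lo]
    linarith

lemma mem_sector {x : ℂ} :
    x ∈ d.sector δ i σ ↔ x - d.tLast ∈ wedge (d.lo δ i σ) (d.hi δ i σ) := by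
  rw [mem_wedge_iff_argNear (sub_pi_le_lo i σ) (hi_le_add_pi i σ), sub_ne_zero]
  cases σ <;> rfl

/-- The inversion `x - t_{p+1} = 1 / (ζ - η₀)` changes the sign of the argument. Hence it
interchanges the two sides of the ray through `t_i`. -/
lemma mem_sector'_opp {z : ℂ} :
    z ∈ d.sector' δ i σ.opp ↔ z - d.η₀ ∈ wedge (-d.hi δ i σ) (-d.lo δ i σ) := by
  have h1 := sub_pi_le_lo (δ := δ) i σ
  have h2 := hi_le_add_pi (δ := δ) i σ
  rw [mem_wedge_iff_argNear (φ := d.ang' i) (by rw [ang']; linarith) (by rw [ang']; linarith),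
    sub_ne_zero]
  cases σ
  · have : -d.hi δ i .plus = max (d.angNext' i + δ) (d.ang' i - Real.pi) := by
      rw [hi, ← max_neg_neg, angNext', ang']
      congr 1 <;> ring
    rw [this]; rfl
  · have : -d.lo δ i .minus = min (d.angPrev' i - δ) (d.ang' i + Real.pi) := by
      rw [lo, ← min_neg_neg, angPrev', ang']
      congr 1 <;> ring
    rw [this]; rfl

lemma sector_slit {x : ℂ} (hx : x ∈ d.sector δ i σ) :
    (x - d.tLast) * Complex.exp (-(d.ang i * I)) ∈ slitPlane :=
  wedge_slit (sub_pi_le_lo i σ) (hi_le_add_pi i σ) ((mem_sector i σ).1 hx)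

lemma sector_eq : d.sector δ i σ =
    (fun x => x - d.tLast) ⁻¹' wedge (d.lo δ i σ) (d.hi δ i σ) :=
  Set.ext fun _ => mem_sector i σ

include hδ in
lemma isOpen_sector : IsOpen (d.sector δ i σ) := by
  rw [sector_eq]
  exact (isOpen_wedge (hδ.lo_lt_hi i σ) (hi_le_lo_add_pi i σ)).preimage (by fun_prop)

include hδ in
lemma convex_sector : Convex ℝ (d.sector δ i σ) := by
  intro x hx y hy a b ha hb hab
  rw [mem_sector] at hx hy ⊢
  have h1 : (a : ℂ) + b = 1 := by exact_mod_cast hab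
  have := convex_wedge (hδ.lo_lt_hi i σ) (hi_le_lo_add_pi i σ) hx hy ha hb hab
  convert this using 1
  simp only [Complex.real_smul]
  linear_combination d.tLast * h1

include hδ in
lemma sector_nonempty : (d.sector δ i σ).Nonempty := by
  obtain ⟨z, hz⟩ := wedge_nonempty (hδ.lo_lt_hi i σ)
  exact ⟨z + d.tLast, by rw [mem_sector]; simpa using hz⟩

lemma add_mul_mem_sector {ω : ℂ} (hω : ω ∈ wedge (d.lo δ i σ) (d.hi δ i σ)) {X : ℝ} (hX : 0 < X) :
    d.tLast + ω * X ∈ d.sector δ i σ := by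
  rw [mem_sector, add_sub_cancel_left]
  exact mul_ofReal_mem_wedge hω hX

end Data

namespace Data.Generic

variable {d : Data} (hd : d.Generic)

include hd

lemma sub_ne_zero (b : Fin d.p) : d.t b.castSucc - d.tLast ≠ 0 := by
  rw [_root_.sub_ne_zero, tLast]
  exact fun h => (Fin.castSucc_lt_last b).ne (hd.t_injective h)

/-- Two singular points on one line through `t_{p+1}` coincide, since no three singular points are
collinear. -/
lemma eq_of_smul {a b : Fin d.p} {s : ℝ}
    (h : d.t a.castSucc - d.tLast = s * (d.t b.castSucc - d.tLast)) : a = b := by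
  by_contra hab
  refine hd.no_three_collinear a.castSucc b.castSucc (Fin.last d.p)
    (fun h => hab (Fin.castSucc_injective _ h)) (Fin.castSucc_lt_last b).ne
    (Fin.castSucc_lt_last a).ne ?_
  rw [collinear_iff_of_mem (p₀ := d.t (Fin.last d.p)) (by simp)]
  refine ⟨d.t b.castSucc - d.tLast, ?_⟩
  rintro p (rfl | rfl | rfl)
  · refine ⟨s, ?_⟩
    rw [Complex.real_smul, ← h, vadd_eq_add, tLast, sub_add_cancel]
  · refine ⟨1, ?_⟩
    rw [one_smul, vadd_eq_add, tLast, sub_add_cancel]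
  · refine ⟨0, ?_⟩
    rw [zero_smul, vadd_eq_add, zero_add]

/-- No angle of a singular point lies strictly between two consecutive ones. -/
lemma angle_between (i b : Fin d.p) (k : ℤ) :
    (d.ang b + k * (2 * Real.pi) ≤ d.ang i ∨ d.angNext i ≤ d.ang b + k * (2 * Real.pi)) ∧
      (d.ang b + k * (2 * Real.pi) ≤ d.angPrev i ∨ d.ang i ≤ d.ang b + k * (2 * Real.pi)) := by
  have hπ := Real.pi_pos
  have hmono := hd.θ_strictMono.monotone
  have hlast : ∀ a, d.θ a ≤ d.θ (Fin.last d.p) := fun a => hmono (Fin.le_last a)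
  have hfirst : ∀ a, d.θ (Fin.last d.p) - 2 * Real.pi < d.θ a := fun a => by
    have := hmono (Fin.zero_le a)
    linarith [hd.θ_last_lt]
  have hprev : d.θ (Fin.last d.p) - 2 * Real.pi ≤ d.angPrev i := by
    rw [angPrev]; split_ifs
    · exact le_rfl
    · exact (hfirst _).le
  have hk : k ≤ -1 ∨ k = 0 ∨ 1 ≤ k := by omega
  rcases hk with hk | rfl | hk
  · have h1 : (k : ℝ) * (2 * Real.pi) ≤ -1 * (2 * Real.pi) :=
      mul_le_mul_of_nonneg_right (by exact_mod_cast hk) (by positivity)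
    have h2 : d.ang b ≤ d.θ (Fin.last d.p) := hlast _
    have h3 : _ < d.ang i := hfirst i.castSucc
    exact ⟨Or.inl (by linarith), Or.inl (by linarith)⟩
  · simp only [Int.cast_zero, zero_mul, add_zero]
    constructor
    · rcases le_or_gt b i with h | h
      · exact Or.inl (hmono (by simpa using h))
      · exact Or.inr (hmono (by
          rw [Fin.le_def]; simp only [Fin.val_succ, Fin.val_castSucc]; exact h))
    · rcases le_or_gt i b with h | h
      · exact Or.inr (hmono (by simpa using h))
      · left
        have hi0 : i.val ≠ 0 := by have : b.val < i.val := h; omega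
        rw [angPrev, if_neg hi0]
        exact hmono (by
          rw [Fin.le_def]; simp only [Fin.val_castSucc]
          have : b.val < i.val := h
          omega)
  · have h1 : 1 * (2 * Real.pi) ≤ (k : ℝ) * (2 * Real.pi) :=
      mul_le_mul_of_nonneg_right (by exact_mod_cast hk) (by positivity)
    have h2 : d.angNext i ≤ d.θ (Fin.last d.p) := hlast _
    have h3 : _ < d.ang b := hfirst b.castSucc
    have h4 : d.ang i ≤ d.θ (Fin.last d.p) := hlast _
    exact ⟨Or.inr (by linarith), Or.inr (by linarith)⟩

variable {δ : ℝ} (hδ : d.SmallAngle δ) (i : Fin d.p) (σ : Side)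

include hδ

/-- No singular point lies in a sector. -/
lemma sub_notMem_wedge (b : Fin d.p) :
    d.t b.castSucc - d.tLast ∉ wedge (d.lo δ i σ) (d.hi δ i σ) := by
  rintro ⟨r, hr, ψ, hψ, h⟩
  have hn : (0 : ℝ) < ‖d.t b.castSucc - d.tLast‖ := norm_pos_iff.2 (hd.sub_ne_zero b)
  have h1 := hd.θ_arg b
  rw [h] at h1
  have hnorm : r = ‖(r : ℂ) * Complex.exp (ψ * I)‖ := by
    rw [norm_mul, Complex.norm_exp_ofReal_mul_I, mul_one, Complex.norm_real,
      Real.norm_of_nonneg hr.le]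
  rw [← hnorm] at h1
  have h2 : Complex.exp (ψ * I) = Complex.exp (d.θ b.castSucc * I) :=
    mul_left_cancel₀ (by exact_mod_cast hr.ne') h1
  obtain ⟨k, hk⟩ := Complex.exp_eq_exp_iff_exists_int.1 h2
  have h3 : ψ = d.ang b + k * (2 * Real.pi) := by
    have := congrArg Complex.im hk
    simpa [ang] using this
  have hb := hd.angle_between i b k
  rw [← h3] at hb
  cases σ
  · simp only [lo, hi, mem_Ioo, lt_min_iff] at hψ
    rcases hb.1 with h4 | h4 <;> linarith [hδ.1, hψ.1, hψ.2.1]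
  · simp only [lo, hi, mem_Ioo, max_lt_iff] at hψ
    rcases hb.2 with h4 | h4 <;> linarith [hδ.1, hψ.1.1, hψ.2]

lemma ne_of_mem_sector {x : ℂ} (hx : x ∈ d.sector δ i σ) (b : Fin (d.p + 1)) : x ≠ d.t b := by
  rintro rfl
  rw [mem_sector] at hx
  refine Fin.lastCases (fun hx => ?_) (fun b hx => ?_) b hx
  · exact wedge_ne_zero hx (sub_self _)
  · exact hd.sub_notMem_wedge hδ i σ b hx

lemma ne_tt_of_mem_sector {x : ℂ} (hx : x ∈ d.sector δ i σ) (j : d.Row ⊕ d.Col) : x ≠ d.tt j := by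
  rcases j with a | b
  · exact hd.ne_of_mem_sector hδ i σ hx _
  · exact hd.ne_of_mem_sector hδ i σ hx _

end Data.Generic

namespace Data

variable {d : Data} {δ : ℝ} (hδ : d.SmallAngle δ) (i : Fin d.p) (σ : Side)

include hδ

/-- The sector is unbounded and accumulates at its vertex. -/
lemma exists_mem_sector_norm (r : ℝ) (hr : 0 < r) :
    ∃ x ∈ d.sector δ i σ, ‖x - d.tLast‖ = r := by
  obtain ⟨z, hz⟩ := wedge_nonempty (hδ.lo_lt_hi i σ)
  have hz0 : 0 < ‖z‖ := norm_pos_iff.2 (wedge_ne_zero hz)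
  refine ⟨_, add_mul_mem_sector i σ hz (div_pos hr hz0), ?_⟩
  rw [add_sub_cancel_left, norm_mul, Complex.norm_real, Real.norm_of_nonneg (by positivity)]
  field_simp

/-- The ray through a singular point is on the boundary of the adjacent sectors. -/
lemma ray_mem_closure_sector {r : ℝ} (hr : 0 ≤ r) :
    d.tLast + r * Complex.exp (d.ang i * I) ∈ closure (d.sector δ i σ) := by
  obtain ⟨z, hz⟩ := wedge_nonempty (hδ.lo_lt_hi i σ)
  have h1 : Tendsto (fun ε : ℝ => d.tLast + (r * Complex.exp (d.ang i * I) + z * ε))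
      (𝓝[>] 0) (𝓝 (d.tLast + (r * Complex.exp (d.ang i * I) + z * (0 : ℝ)))) :=
    (Continuous.tendsto (by fun_prop) 0).mono_left nhdsWithin_le_nhds
  rw [Complex.ofReal_zero, mul_zero, add_zero] at h1
  refine mem_closure_of_tendsto h1 ?_
  filter_upwards [self_mem_nhdsWithin] with ε hε
  rw [mem_sector, add_sub_cancel_left]
  exact add_mem_wedge_of_boundary (hδ.lo_lt_hi i σ) (hi_le_lo_add_pi i σ) hr
    (ang_eq_lo_or_hi i σ) (mul_ofReal_mem_wedge hz hε)

end Data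

/-! ### Existence of the solutions -/

/-- Existence of the solutions of the underlying system at infinity. -/
lemma RaySys.exists_eulerInf_underlying {R K : Type} [Fintype R] [Fintype K] [DecidableEq R]
    [DecidableEq K] (s : RaySys R K) (t : R → ℂ) (c e : ℂ) (k : K)
    (hres : ∀ l, ∀ m : ℕ, s.mu l - s.mu k + m + 1 ≠ 0) :
    ∃ Φ : ℂ → R → ℂ, AnalyticAt ℂ Φ 0 ∧ Φ 0 = (fun i => s.P i k) ∧
      EulerInf t (e • (1 : Matrix R R ℂ) + s.A) c (e + s.mu k) Φ := by
  have hBQ : (e • (1 : Matrix R R ℂ) + s.A) * s.P = s.P * diagonal fun l => e + s.mu l := by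
    have h1 : diagonal (fun l => e + s.mu l) = e • (1 : Matrix K K ℂ) + s.Q * s.A * s.P := by
      rw [s.QAP, smul_one_eq_diagonal, diagonal_add]
    rw [h1, Matrix.add_mul, Matrix.mul_add, ← Matrix.mul_assoc, ← Matrix.mul_assoc, s.PQ,
      Matrix.one_mul]
    simp
  have hv : (e • (1 : Matrix R R ℂ) + s.A) *ᵥ (fun i => s.P i k) =
      (e + s.mu k) • fun i => s.P i k := by
    have h1 : (fun i => s.P i k) = s.P *ᵥ Pi.single k 1 := by
      rw [mulVec_single_one]; rfl
    rw [h1, mulVec_mulVec, hBQ, ← mulVec_mulVec, diagonal_mulVec_single, ← mulVec_smul,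
      ← Pi.single_smul, smul_eq_mul]
  exact Okubo.exists_eulerInf s.PQ hBQ (fun l m h => hres l m (by linear_combination -h)) hv

lemma Data.rho_add_rho_rev (d : Data) (j : Fin 2) :
    d.ρ j + d.ρ (1 - j) = d.ρ 0 + d.ρ 1 := by
  fin_cases j
  · rfl
  · exact add_comm _ _

namespace Data.Generic

variable {d : Data} (hd : d.Generic)

include hd

lemma rho_sub_rho_rev (j : Fin 2) : NotInt (d.ρ j - d.ρ (1 - j)) := by
  fin_cases j
  · exact hd.rho_sub_rho
  · exact hd.rho_sub_rho.neg.congr (by simp)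

/-- The blocks of `A` that belong to one singular point are diagonal. -/
lemma A_block {i : Fin d.p} {a b : d.Row} (ha : a.1 = i) (hb : b.1 = i) :
    d.A a b = if a = b then d.lam a.1 a.2.1 else 0 := by
  obtain ⟨ia, a⟩ := a
  obtain ⟨ib, b⟩ := b
  change ia = i at ha
  change ib = i at hb
  subst ha hb
  rw [hd.A_diagonal_blocks]
  simp

lemma lam_nonres {i : Fin d.p} (k : Fin (d.r i)) {a : d.Row} (ha : a.1 = i) (m : ℕ) :
    d.lam i k + m + 1 ≠ d.lam a.1 a.2.1 := by
  obtain ⟨ia, l, _⟩ := a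
  change ia = i at ha
  subst ha
  intro h
  have h : d.lam _ k + m + 1 = d.lam _ l := h
  by_cases hkl : k = l
  · subst hkl
    have : ((m + 1 : ℕ) : ℂ) = 0 := by push_cast; linear_combination h
    exact absurd this (Nat.cast_ne_zero.2 m.succ_ne_zero)
  · refine hd.lam_sub_lam _ k l hkl (-(m + 1)) ?_
    push_cast; linear_combination h

lemma mu_nonres (k l : Fin d.q) (m : ℕ) : d.mu l - d.mu k + m + 1 ≠ 0 := by
  intro h
  by_cases hkl : k = l
  · subst hkl
    have : ((m + 1 : ℕ) : ℂ) = 0 := by push_cast; linear_combination h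
    exact absurd this (Nat.cast_ne_zero.2 m.succ_ne_zero)
  · refine hd.mu_sub_mu k l hkl (m + 1) ?_
    push_cast; linear_combination -h

lemma t'_injective : Function.Injective d.t' := by
  intro a b h
  have h1 : d.t a.castSucc - d.tLast = d.t b.castSucc - d.tLast := by
    simpa [Data.t'] using h
  exact Fin.castSucc_injective _ (hd.t_injective (sub_left_injective h1))

lemma t'_sub_ne_zero (b : Fin d.p) : d.t' b - d.η₀ ≠ 0 := by
  rw [Data.t', add_sub_cancel_left]
  exact one_div_ne_zero (hd.sub_ne_zero b)

/-- The rank `2n` system in the coordinate `X` with `x = t_{p+1} + ω X`, where `ρ_j` is taken as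
the first of the two exponents at infinity. -/
def raySys (j : Fin 2) {ω : ℂ} (hω : ω ≠ 0) : RaySys d.Row d.Col where
  A := d.A
  P := d.P
  Q := d.Pinv
  τ := fun a => (d.t a.1.castSucc - d.tLast) / ω
  mu := fun c => d.mu c.1
  ρ₁ := d.ρ j
  ρ₂ := d.ρ (1 - j)
  PQ := d.P_mul_Pinv
  QP := d.Pinv_mul_P
  QAP := hd.A'_diagonal
  τ_ne := fun a => div_ne_zero (hd.sub_ne_zero a.1) hω
  ρ₁_notInt := hd.rho_notInt _
  ρ₂_notInt := hd.rho_notInt _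
  ρ₁₂_notInt := hd.rho_sub_rho_rev j
  ρ₁_mu_notInt := fun _ => hd.rho_sub_mu _ _
  ρ₂_mu_notInt := fun _ => hd.rho_sub_mu _ _

/-- The coefficient matrix is symmetric in `ρ₁` and `ρ₂`, since `A'` is diagonal. Therefore either
exponent can play the part of the first one. -/
lemma raySys_B (j : Fin 2) {ω : ℂ} (hω : ω ≠ 0) : (hd.raySys j hω).B = d.bigA := by
  have h : ∀ c : ℂ, diagonal (fun b : d.Col => d.mu b.1) - c • (1 : Matrix d.Col d.Col ℂ) =
      diagonal fun b => d.mu b.1 - c := by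
    intro c; rw [smul_one_eq_diagonal, diagonal_sub]
  have h2 := d.rho_add_rho_rev j
  rw [RaySys.B, bigMat, bigA]
  change fromBlocks d.A d.P (-((d.A' - d.ρ j • (1 : Matrix d.Col d.Col ℂ)) *
    (d.A' - d.ρ (1 - j) • (1 : Matrix d.Col d.Col ℂ)) * d.Pinv))
    ((d.ρ j + d.ρ (1 - j)) • (1 : Matrix d.Col d.Col ℂ) - d.A') = _
  rw [h2]
  obtain rfl | rfl : j = 0 ∨ j = 1 := by omega
  · rfl
  · have h3 : (1 - 1 : Fin 2) = 0 := rfl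
    have h4 : (fun b : d.Col => (d.mu b.1 - d.ρ 1) * (d.mu b.1 - d.ρ 0)) =
        fun b => (d.mu b.1 - d.ρ 0) * (d.mu b.1 - d.ρ 1) := funext fun b => mul_comm _ _
    rw [h3, hd.A'_diagonal, h, h, diagonal_mul_diagonal, diagonal_mul_diagonal, h4]

lemma raySys_T (j : Fin 2) {ω : ℂ} (hω : ω ≠ 0) :
    (hd.raySys j hω).T = fun a => (d.tt a - d.tLast) / ω := by
  funext a
  rcases a with a | a
  · rfl
  · simp [RaySys.T, tt]

lemma raySys_leadVec (j : Fin 2) {ω : ℂ} (hω : ω ≠ 0) (c : d.Col) :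
    (hd.raySys j hω).leadVec c = Sum.elim (fun a => d.P a c)
      (fun b => (d.ρ j • (1 : Matrix d.Col d.Col ℂ) - d.A') b c) := by
  rw [RaySys.leadVec]
  congr 1
  funext b
  rw [hd.A'_diagonal, smul_one_eq_diagonal, diagonal_sub, diagonal_apply, Pi.single_apply]
  split_ifs with h
  · subst h; rfl
  · rfl

variable {δ : ℝ} (hδ : d.SmallAngle δ) (i : Fin d.p) (σ : Side)

include hδ

lemma exists_isUInf (j : Fin 2) (c : d.Col) : ∃ U, d.IsUInf δ i σ j c U := by
  obtain ⟨Φ, hΦ, hΦ0, h⟩ := (hd.raySys j one_ne_zero).exists_eulerInf d.tt d.tLast c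
  rw [raySys_B] at h
  rw [raySys_leadVec] at hΦ0
  obtain ⟨R, hR, hsol⟩ := okSol_locInf (φ := d.ang i) hΦ h
  obtain ⟨x₀, hx₀⟩ := sector_nonempty hδ i σ
  obtain ⟨x₁, hx₁, hx₁'⟩ := exists_mem_sector_norm hδ i σ (R + 1) (by positivity)
  have himg : {x | x ∈ d.sector δ i σ ∧ R < ‖x - d.tLast‖} =
      (fun z => z + d.tLast) '' {z | z ∈ wedge (d.lo δ i σ) (d.hi δ i σ) ∧ R < ‖z‖} := by
    ext x
    simp only [mem_image, mem_ofPred_eq, mem_sector]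
    constructor
    · exact fun h => ⟨x - d.tLast, h, sub_add_cancel _ _⟩
    · rintro ⟨z, h, rfl⟩
      rwa [add_sub_cancel_right]
  obtain ⟨V, hV, hVD⟩ := exists_okSol_extend (D := {x | x ∈ d.sector δ i σ ∧ R < ‖x - d.tLast‖})
    (isOpen_sector hδ i σ) ((convex_sector hδ i σ).starConvex hx₀) hx₀
    (fun x hx => hd.ne_tt_of_mem_sector hδ i σ hx)
    ((isOpen_sector hδ i σ).inter (isOpen_lt continuous_const (continuous_id.sub continuous_const).norm))
    (by
      rw [himg]
      exact (isPreconnected_wedge_diff (hδ.lo_lt_hi i σ) (hi_le_lo_add_pi i σ) hR).image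
        (fun z => z + d.tLast) (by fun_prop))
    (fun x hx => hx.1) ⟨x₁, hx₁, by rw [hx₁']; linarith⟩
    (hsol.mono fun x hx => ⟨hx.2, sector_slit i σ hx.1⟩)
  refine ⟨V, ?_, ?_⟩
  · rw [bigT_eq]; exact isSolutionOn_diagonal.2 hV
  · rw [← hΦ0]
    exact hasExpansionAtInfinity_of_eq hΦ hR fun x hx hxR => hVD x ⟨hx, hxR⟩

lemma exists_isULast (k : Fin d.q) (h : Fin (d.m k))
    (hk : ∀ N : ℕ, d.ρ 0 + d.ρ 1 - d.mu k ≠ -((N : ℂ) + 1)) : ∃ U, d.IsULast δ i σ k h U := by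
  obtain ⟨Ψ, hΨ, hΨ0, hE⟩ := exists_eulerFin (t := d.tt) (B := d.bigA) (c := d.tLast)
    (e := d.ρ 0 + d.ρ 1 - d.mu k) (a₀ := Sum.inr ⟨k, h⟩)
    (β := Sum.elim (fun _ => 0) fun c => d.ρ 0 + d.ρ 1 - d.mu c.1) rfl rfl
    (by
      rintro (a | a) (b | b) ha hb
      · exact absurd ha (_root_.sub_ne_zero.1 (hd.sub_ne_zero a.1))
      · exact absurd ha (_root_.sub_ne_zero.1 (hd.sub_ne_zero a.1))
      · exact absurd hb (_root_.sub_ne_zero.1 (hd.sub_ne_zero b.1))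
      · rw [bigA, fromBlocks_apply₂₂, hd.A'_diagonal, smul_one_eq_diagonal, diagonal_sub,
          diagonal_apply]
        simp)
    (fun m h => hk m (by linear_combination h))
    (by
      rintro (a | a) ha m
      · exact absurd ha (_root_.sub_ne_zero.1 (hd.sub_ne_zero a.1))
      · intro h
        simp only [Sum.elim_inr] at h
        exact hd.mu_nonres k a.1 m (by linear_combination h))
  obtain ⟨r, hr, hsol⟩ := okSol_locFin (φ := d.ang i) hΨ hE
  obtain ⟨x₀, hx₀⟩ := sector_nonempty hδ i σ
  obtain ⟨x₁, hx₁, hx₁'⟩ := exists_mem_sector_norm hδ i σ (r / 2) (by positivity)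
  have hball : ∀ x, x ∈ ball d.tLast r ↔ ‖x - d.tLast‖ < r := fun x => by
    rw [mem_ball, dist_eq_norm]
  obtain ⟨V, hV, hVD⟩ := exists_okSol_extend (D := d.sector δ i σ ∩ ball d.tLast r)
    (isOpen_sector hδ i σ) ((convex_sector hδ i σ).starConvex hx₀) hx₀
    (fun x hx => hd.ne_tt_of_mem_sector hδ i σ hx)
    ((isOpen_sector hδ i σ).inter isOpen_ball)
    ((convex_sector hδ i σ).inter (convex_ball _ _)).isPreconnected
    (fun x hx => hx.1) ⟨x₁, hx₁, by rw [hball, hx₁']; linarith⟩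
    (hsol.mono fun x hx => ⟨(hball x).1 hx.2, sector_slit i σ hx.1⟩)
  refine ⟨V, ?_, ?_⟩
  · rw [bigT_eq]; exact isSolutionOn_diagonal.2 hV
  · rw [← hΨ0]
    exact hasExpansionAt_of_eq hΨ hr fun x hx hxr => hVD x ⟨hx, (hball x).2 hxr⟩

omit hδ

/-- No singular point is the centre from which the cuts of the plane are directed away when the
solution at `t_i` is continued. The centre lies on the ray from `t_{p+1}` through `t_i`, behind
`t_i`. -/
lemma t_ne_base (b : Fin (d.p + 1)) :
    d.t b ≠ d.tLast + (2 : ℝ) * (d.t i.castSucc - d.tLast) := by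
  intro h
  refine Fin.lastCases (fun h => ?_) (fun b h => ?_) b h
  · refine hd.sub_ne_zero i ?_
    rw [tLast] at h ⊢
    push_cast at h
    linear_combination -h / 2
  · have h1 : d.t b.castSucc - d.tLast = (2 : ℝ) * (d.t i.castSucc - d.tLast) := by
      rw [h, add_sub_cancel_left]
    obtain rfl := hd.eq_of_smul h1
    refine hd.sub_ne_zero b ?_
    push_cast at h1
    linear_combination -h1

/-- The part of the ray from `t_{p+1}` through `t_i` that lies behind `t_i` avoids the cuts. -/
lemma ray_mem_starCut {X : ℝ} (hX : 1 < X) : d.tLast + (X : ℂ) * (d.t i.castSucc - d.tLast) ∈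
    starCut d.t (d.tLast + (2 : ℝ) * (d.t i.castSucc - d.tLast)) := by
  intro b s hs
  have hi := hd.sub_ne_zero i
  refine Fin.lastCases (fun h => ?_) (fun b h => ?_) b
  · have h1 : ((X - 2 + 2 * s : ℝ) : ℂ) * (d.t i.castSucc - d.tLast) = 0 := by
      rw [tLast] at h ⊢
      push_cast at h ⊢
      linear_combination h
    rw [mul_eq_zero, or_iff_left hi, Complex.ofReal_eq_zero] at h1
    linarith
  · have hs' : (s : ℂ) ≠ 0 := by exact_mod_cast (by linarith : s ≠ 0)
    have h1 : d.t b.castSucc - d.tLast =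
        (((X - 2) / s + 2 : ℝ) : ℂ) * (d.t i.castSucc - d.tLast) := by
      push_cast at h ⊢
      field_simp
      linear_combination -h
    obtain rfl := hd.eq_of_smul h1
    have h2 : ((X - 2 + s : ℝ) : ℂ) * (d.t b.castSucc - d.tLast) = 0 := by
      push_cast at h ⊢
      linear_combination h
    rw [mul_eq_zero, or_iff_left hi, Complex.ofReal_eq_zero] at h2
    linarith

/-- Of the cuts that start at the singular points, only the one that starts at `t_i` contains
`t_i`. -/
lemma t_avoids_cuts {b : Fin (d.p + 1)} (hb : d.t b ≠ d.t i.castSucc) (s : ℝ) (hs : 1 ≤ s) :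
    d.t i.castSucc ≠ d.tLast + (2 : ℝ) * (d.t i.castSucc - d.tLast) +
      s * (d.t b - (d.tLast + (2 : ℝ) * (d.t i.castSucc - d.tLast))) := by
  have hi := hd.sub_ne_zero i
  revert hb
  refine Fin.lastCases (fun _ h => ?_) (fun b hb h => ?_) b
  · have h1 : ((1 - 2 * s : ℝ) : ℂ) * (d.t i.castSucc - d.tLast) = 0 := by
      rw [tLast] at h ⊢
      push_cast at h ⊢
      linear_combination -h
    rw [mul_eq_zero, or_iff_left hi, Complex.ofReal_eq_zero] at h1
    linarith
  · have hs' : (s : ℂ) ≠ 0 := by exact_mod_cast (by linarith : s ≠ 0)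
    have h1 : d.t b.castSucc - d.tLast =
        ((2 - 1 / s : ℝ) : ℂ) * (d.t i.castSucc - d.tLast) := by
      push_cast at h ⊢
      field_simp
      linear_combination -h
    obtain rfl := hd.eq_of_smul h1
    exact hb rfl

include hδ

/-- The centre of the star lies on the boundary of the sectors adjacent to the ray through `t_i`,
so that these avoid the cuts. -/
lemma sector_subset_starCut : d.sector δ i σ ⊆
    starCut d.t (d.tLast + (2 : ℝ) * (d.t i.castSucc - d.tLast)) := by
  refine subset_starCut (isOpen_sector hδ i σ) (convex_sector hδ i σ)
    (fun x hx b => hd.ne_of_mem_sector hδ i σ hx b) ?_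
  rw [hd.θ_arg i, ← mul_assoc, ← Complex.ofReal_mul]
  exact ray_mem_closure_sector hδ i σ (by positivity)

omit hδ

/-- A local solution at `t_i` is continued to a plane with cuts that meets neither the sectors
adjacent to `t_i` nor the part of the ray from `t_{p+1}` through `t_i` that lies behind `t_i`. -/
lemma exists_okSol_fin {e : ℂ} {Ψ : ℂ → d.Row ⊕ d.Col → ℂ} (hΨ : AnalyticAt ℂ Ψ 0)
    (hE : EulerFin d.tt d.bigA (d.t i.castSucc) e Ψ) :
    ∃ V, OkSol d.tt d.bigA (starCut d.t (d.tLast + (2 : ℝ) * (d.t i.castSucc - d.tLast))) V ∧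
      ∃ r > 0, ∀ x ∈ starCut d.t (d.tLast + (2 : ℝ) * (d.t i.castSucc - d.tLast)),
        ‖x - d.t i.castSucc‖ < r → V x = locFin (d.ang i) (d.t i.castSucc) e Ψ x := by
  refine exists_okSol_starCut (hd.t_ne_base i) ?_ (norm_pos_iff.2 (hd.sub_ne_zero i)) ?_
    ⟨_, rfl⟩ (fun b hb => hd.t_avoids_cuts i hb) hΨ hE
  · rintro (a | a)
    · exact ⟨_, rfl⟩
    · exact ⟨_, rfl⟩
  · have := hd.θ_arg i
    rw [ang, ← this]
    push_cast
    ring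

include hδ

lemma exists_isUFin (k : Fin (d.r i)) (h : Fin (d.l i k)) : ∃ U, d.IsUFin δ i σ k h U := by
  have hinj : ∀ a : d.Row ⊕ d.Col, d.tt a = d.t i.castSucc → ∃ b : d.Row, a = Sum.inl b ∧
      b.1 = i := by
    rintro (a | a) ha
    · exact ⟨a, rfl, Fin.castSucc_injective _ (hd.t_injective ha)⟩
    · exact absurd ha.symm (_root_.sub_ne_zero.1 (hd.sub_ne_zero i))
  obtain ⟨Ψ, hΨ, hΨ0, hE⟩ := exists_eulerFin (t := d.tt) (B := d.bigA) (c := d.t i.castSucc)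
    (e := d.lam i k) (a₀ := Sum.inl ⟨i, k, h⟩)
    (β := Sum.elim (fun a => d.lam a.1 a.2.1) fun _ => 0) rfl rfl
    (by
      intro a b ha hb
      obtain ⟨a, rfl, ha'⟩ := hinj a ha
      obtain ⟨b, rfl, hb'⟩ := hinj b hb
      rw [bigA, fromBlocks_apply₁₁, hd.A_block ha' hb']
      simp)
    (fun m => (hd.lam_notInt i k).add_nat_ne_zero m)
    (by
      intro a ha m
      obtain ⟨a, rfl, ha'⟩ := hinj a ha
      exact hd.lam_nonres k ha' m)
  obtain ⟨V, hV, r, hr, hVr⟩ := hd.exists_okSol_fin i hΨ hE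
  have hsub := hd.sector_subset_starCut hδ i σ
  refine ⟨V, ?_, ?_⟩
  · rw [bigT_eq]; exact isSolutionOn_diagonal.2 (hV.mono hsub)
  · rw [← hΨ0]
    exact hasExpansionAt_of_eq hΨ hr fun x hx hxr => hVr x (hsub hx) hxr

omit hδ

/-- The point `η₀`, seen from `t'_i`, has the argument `θ'_i - π`, which is the middle of the
interval of arguments prescribed at `t'_i`. -/
lemma η₀_sub_t' : d.η₀ - d.t' i = (‖d.t i.castSucc - d.tLast‖⁻¹ : ℝ) *
    Complex.exp ((d.ang' i - Real.pi : ℝ) * I) := by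
  have h2 : ((‖d.t i.castSucc - d.tLast‖ : ℝ) : ℂ) ≠ 0 := by
    exact_mod_cast (norm_pos_iff.2 (hd.sub_ne_zero i)).ne'
  have h3 : Complex.exp (((d.ang' i - Real.pi : ℝ) : ℂ) * I) =
      -(Complex.exp (d.θ i.castSucc * I))⁻¹ := by
    rw [← Complex.exp_neg]
    have : ((d.ang' i - Real.pi : ℝ) : ℂ) * I = -(d.θ i.castSucc * I) - Real.pi * I := by
      rw [ang', ang]; push_cast; ring
    rw [this, Complex.exp_sub, Complex.exp_pi_mul_I, div_neg, div_one]
  have h1 : 1 / (d.t i.castSucc - d.tLast) =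
      (‖d.t i.castSucc - d.tLast‖ : ℂ)⁻¹ * (Complex.exp (d.θ i.castSucc * I))⁻¹ := by
    rw [one_div, ← mul_inv, ← hd.θ_arg i]
  rw [h3, Data.t', sub_add_cancel_left, h1]
  push_cast
  ring

/-- Of the rays removed from the plane, only the one that starts at `t'_i` lies on the line
through `η₀` and `t'_i`. -/
lemma t'_avoids_cuts {b : Fin d.p} (hb : d.t' b ≠ d.t' i) (s : ℝ) :
    d.t' i ≠ d.η₀ + s * (d.t' b - d.η₀) := by
  intro h1
  refine hb ?_
  have hb0 := hd.sub_ne_zero b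
  have hi0 := hd.sub_ne_zero i
  have h2 : d.t b.castSucc - d.tLast = (s : ℂ) * (d.t i.castSucc - d.tLast) := by
    simp only [Data.t', add_sub_cancel_left, add_right_inj] at h1
    generalize d.t b.castSucc - d.tLast = u at *
    generalize d.t i.castSucc - d.tLast = v at *
    field_simp at h1
    linear_combination h1
  rw [hd.eq_of_smul h2]

/-- A local solution of the underlying system at `t'_i` is continued to the cut plane. -/
lemma exists_okSol_underlying {B : Matrix d.Row d.Row ℂ} {e : ℂ} {Ψ : ℂ → d.Row → ℂ}
    (hΨ : AnalyticAt ℂ Ψ 0) (hE : EulerFin (fun a : d.Row => d.t' a.1) B (d.t' i) e Ψ) :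
    ∃ V, OkSol (fun a : d.Row => d.t' a.1) B d.cutPlane V ∧
      ∃ r > 0, ∀ x ∈ d.cutPlane, ‖x - d.t' i‖ < r →
        V x = locFin (d.ang' i - Real.pi) (d.t' i) e Ψ x := by
  refine exists_okSol_starCut (p := d.t') (fun b => _root_.sub_ne_zero.1 (hd.t'_sub_ne_zero b)) ?_
    (inv_pos.2 (norm_pos_iff.2 (hd.sub_ne_zero i))) (hd.η₀_sub_t' i) ⟨i, rfl⟩
    (fun b hb s _ => hd.t'_avoids_cuts i hb s) hΨ hE
  exact fun a => ⟨a.1, rfl⟩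

lemma exists_isWFin (j : Fin 2) (k : Fin (d.r i)) (h : Fin (d.l i k)) :
    ∃ w, d.IsWFin (-d.ρ j - 1) i k h w := by
  have hinj : ∀ a : d.Row, d.t' a.1 = d.t' i → a.1 = i := fun a ha => hd.t'_injective ha
  have hB : ∀ a b : d.Row, d.t' a.1 = d.t' i → d.t' b.1 = d.t' i →
      ((-d.ρ j - 1) • (1 : Matrix d.Row d.Row ℂ) + d.A) a b =
        if a = b then -d.ρ j - 1 + d.lam a.1 a.2.1 else 0 := by
    intro a b ha hb
    rw [smul_one_eq_diagonal, Matrix.add_apply, diagonal_apply,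
      hd.A_block (hinj a ha) (hinj b hb)]
    split_ifs <;> simp
  have he : ∀ m : ℕ, -d.ρ j - 1 + d.lam i k + m + 1 ≠ 0 := fun m =>
    NotInt.add_nat_ne_zero ((hd.rho_sub_lam j i k).neg.sub_one.congr (by ring)) m
  have hres : ∀ a : d.Row, d.t' a.1 = d.t' i → ∀ m : ℕ,
      -d.ρ j - 1 + d.lam i k + m + 1 ≠ -d.ρ j - 1 + d.lam a.1 a.2.1 :=
    fun a ha m h => hd.lam_nonres k (hinj a ha) m (by linear_combination h)
  obtain ⟨Ψ, hΨ, hΨ0, hE⟩ := exists_eulerFin (t := fun a : d.Row => d.t' a.1)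
    (a₀ := (⟨i, k, h⟩ : d.Row)) (β := fun a => -d.ρ j - 1 + d.lam a.1 a.2.1) rfl rfl hB he hres
  obtain ⟨V, hV, r, hr, hVr⟩ := hd.exists_okSol_underlying i hΨ hE
  refine ⟨V, ?_, ?_⟩
  · rw [T']; exact isSolutionOn_diagonal.2 hV
  · rw [← hΨ0]
    exact hasExpansionAt_of_eq hΨ hr fun x hx hxr => hVr x hx hxr

include hδ

/-- The union of the sector with vertex `η₀` and the disc contains none of the `t'_b`. -/
lemma ne_t'_of_mem {z : ℂ} (hz : z ∈ d.sector' δ i σ.opp ∪ d.regularDisc) (b : Fin d.p) :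
    z ≠ d.t' b := by
  rintro rfl
  rcases hz with hz | hz
  · rw [mem_sector'_opp, Data.t', add_sub_cancel_left, one_div] at hz
    have := inv_mem_wedge hz
    rw [inv_inv, neg_neg, neg_neg] at this
    exact hd.sub_notMem_wedge hδ i σ b this
  · exact lt_irrefl _ (hz b)

/-- The union of the sector and the disc around `η₀` is star-shaped with respect to `η₀`; so the
solution at infinity in the sector continues to `η₀`. -/
lemma exists_isWInf (j : Fin 2) (k : Fin d.q) (h : Fin (d.m k)) :
    ∃ w, d.IsWInf (-d.ρ j - 1) δ i σ.opp k h w := by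
  set s : ℂ := -d.ρ j - 1
  obtain ⟨Φ, hΦ, hΦ0, hE⟩ := (hd.raySys j one_ne_zero).exists_eulerInf_underlying
    (fun a : d.Row => d.t' a.1) d.η₀ s (⟨k, h⟩ : d.Col) fun l m => hd.mu_nonres k l.1 m
  have hφ : ∀ z, z ∈ d.sector' δ i σ.opp → (z - d.η₀) * Complex.exp (-(d.ang' i * I)) ∈ slitPlane := by
    intro z hz
    have h1 := sub_pi_le_lo (δ := δ) i σ
    have h2 := hi_le_add_pi (δ := δ) i σ
    exact wedge_slit (by rw [ang']; linarith) (by rw [ang']; linarith) ((mem_sector'_opp i σ).1 hz)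
  have hlt : -d.hi δ i σ < -d.lo δ i σ := neg_lt_neg (hδ.lo_lt_hi i σ)
  have hle : -d.lo δ i σ ≤ -d.hi δ i σ + Real.pi := by linarith [hi_le_lo_add_pi (δ := δ) i σ]
  have hopen : IsOpen (d.sector' δ i σ.opp) := by
    have : d.sector' δ i σ.opp = (fun z => z - d.η₀) ⁻¹' wedge (-d.hi δ i σ) (-d.lo δ i σ) :=
      Set.ext fun _ => mem_sector'_opp i σ
    rw [this]
    exact (isOpen_wedge hlt hle).preimage (by fun_prop)
  have hdisc : IsOpen d.regularDisc := by
    have : d.regularDisc = ⋂ b, {z | ‖z - d.η₀‖ < ‖d.t' b - d.η₀‖} := by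
      ext z; simp [regularDisc]
    rw [this]
    exact isOpen_iInter_of_finite fun b => isOpen_lt (by fun_prop) continuous_const
  have hη : d.η₀ ∈ d.regularDisc := fun b => by
    rw [sub_self, norm_zero]; exact norm_pos_iff.2 (hd.t'_sub_ne_zero b)
  have hstar : StarConvex ℝ d.η₀ (d.sector' δ i σ.opp ∪ d.regularDisc) := by
    intro z hz a u ha hu hau
    have h1 : (a : ℂ) + u = 1 := by exact_mod_cast hau
    have h2 : a • d.η₀ + u • z - d.η₀ = (z - d.η₀) * u := by
      simp only [Complex.real_smul]
      linear_combination d.η₀ * h1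
    rcases hz with hz | hz
    · rcases eq_or_lt_of_le hu with rfl | hu'
      · right
        have : a = 1 := by linarith
        rw [this, one_smul, zero_smul, add_zero]; exact hη
      · left
        rw [mem_sector'_opp] at hz ⊢
        rw [h2]
        exact mul_ofReal_mem_wedge hz hu'
    · right
      intro b
      rw [h2, norm_mul, Complex.norm_real, Real.norm_of_nonneg hu]
      exact (mul_le_of_le_one_right (norm_nonneg _) (by linarith)).trans_lt (hz b)
  obtain ⟨R, hR, hsol⟩ := okSol_locInf (φ := d.ang' i) hΦ hE
  obtain ⟨z₁, hz₁⟩ := wedge_nonempty hlt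
  have hz₁0 : 0 < ‖z₁‖ := norm_pos_iff.2 (wedge_ne_zero hz₁)
  have himg : {x | x ∈ d.sector' δ i σ.opp ∧ R < ‖x - d.η₀‖} =
      (fun z => z + d.η₀) '' {z | z ∈ wedge (-d.hi δ i σ) (-d.lo δ i σ) ∧ R < ‖z‖} := by
    ext x
    simp only [mem_image, mem_ofPred_eq, mem_sector'_opp]
    constructor
    · exact fun h => ⟨x - d.η₀, h, sub_add_cancel _ _⟩
    · rintro ⟨z, h, rfl⟩
      rwa [add_sub_cancel_right]
  obtain ⟨V, hV, hVD⟩ := exists_okSol_extend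
    (D := {x | x ∈ d.sector' δ i σ.opp ∧ R < ‖x - d.η₀‖})
    (hopen.union hdisc) hstar (Or.inr hη) (fun x hx a => hd.ne_t'_of_mem hδ i σ hx a.1)
    (hopen.inter (isOpen_lt continuous_const (continuous_id.sub continuous_const).norm))
    (by
      rw [himg]
      exact (isPreconnected_wedge_diff hlt hle hR).image (fun z => z + d.η₀) (by fun_prop))
    (fun x hx => Or.inl hx.1)
    (by
      rw [himg]
      refine ⟨_, z₁ * ((R + 1) / ‖z₁‖ : ℝ), ⟨mul_ofReal_mem_wedge hz₁ (by positivity), ?_⟩, rfl⟩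
      rw [norm_mul, Complex.norm_real, Real.norm_of_nonneg (by positivity)]
      field_simp
      linarith)
    (hsol.mono fun x hx => ⟨hx.2, hφ x hx.1⟩)
  refine ⟨V, ?_, ?_⟩
  · rw [T']; exact isSolutionOn_diagonal.2 hV
  · have := hasExpansionAtInfinity_of_eq (S := d.sector' δ i σ.opp) (U := V) hΦ hR
      fun x hx hxR => hVD x ⟨hx, hxR⟩
    rw [hΦ0] at this
    exact this

end Data.Generic

/-! ### The coefficients of a solution, read off along a ray -/

section

variable {J : Type} {c e : ℂ} {φ : ℝ}

lemma locInf_sum {ι : Type*} (s : Finset ι) (C : ι → ℂ) (Φ : ι → ℂ → J → ℂ) :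
    locInf φ c e (fun y => ∑ b ∈ s, C b • Φ b y) = ∑ b ∈ s, C b • locInf φ c e (Φ b) := by
  funext x
  simp only [locInf, Finset.sum_apply, Pi.smul_apply, Finset.smul_sum]
  exact Finset.sum_congr rfl fun b _ => smul_comm _ _ _

end

/-- Near infinity, a solution at infinity is given by its expansion also beyond the sector. -/
lemma Data.IsUInf.exists_locInf {d : Data} {δ : ℝ} (hδ : d.SmallAngle δ) {i : Fin d.p} {σ : Side}
    {j : Fin 2} {c : d.Col} {U : ℂ → d.Row ⊕ d.Col → ℂ}
    (hU : d.IsUInf δ i σ j c U) : ∃ Φ : ℂ → d.Row ⊕ d.Col → ℂ, AnalyticAt ℂ Φ 0 ∧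
      Φ 0 = Sum.elim (fun a => d.P a c)
        (fun b => (d.ρ j • (1 : Matrix d.Col d.Col ℂ) - d.A') b c) ∧ ∃ R > 0,
        OkSol d.tt d.bigA {x | R < ‖x - d.tLast‖ ∧
          (x - d.tLast) * Complex.exp (-(d.ang i * I)) ∈ slitPlane}
          (locInf (d.ang i) d.tLast (d.ρ j) Φ) ∧
        ∀ x ∈ d.sector δ i σ, R < ‖x - d.tLast‖ →
          U x = locInf (d.ang i) d.tLast (d.ρ j) Φ x := by
  obtain ⟨hsol, hexp⟩ := hU
  rw [bigT_eq, isSolutionOn_diagonal] at hsol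
  have hfar : ∀ R : ℝ, ∃ x ∈ d.sector δ i σ, R < ‖x - d.tLast‖ := fun R => by
    obtain ⟨x, hx, hxR⟩ := exists_mem_sector_norm hδ i σ (|R| + 1) (by positivity)
    exact ⟨x, hx, by rw [hxR]; linarith [le_abs_self R]⟩
  obtain ⟨Φ, hΦ, hΦ0, R, hR, hUR⟩ := hexp.exists_analyticAt hfar
  have hE := eulerInf_of_okSol (isOpen_sector hδ i σ) hsol hΦ hR hUR hfar
    fun x hx => sector_slit i σ hx
  obtain ⟨R', hR', hloc⟩ := okSol_locInf (φ := d.ang i) hΦ hE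
  refine ⟨Φ, hΦ, hΦ0, max R R', lt_max_of_lt_left hR,
    hloc.mono fun x hx => ⟨(le_max_right _ _).trans_lt hx.1, hx.2⟩,
    fun x hx hxR => hUR x hx ((le_max_left _ _).trans_lt hxR)⟩

namespace Data.Generic

variable {d : Data} (hd : d.Generic)

include hd

/-- In the coordinate inverse to its own, the underlying system is the one of the ray. -/
lemma gSol_of_okSol (j : Fin 2) {ω : ℂ} (hω : ω ≠ 0) {a : ℝ} (ha : 0 ≤ a) {D : Set ℂ}
    {w : ℂ → d.Row → ℂ}
    (hw : OkSol (fun a : d.Row => d.t' a.1)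
      ((-d.ρ (1 - j) - 1) • (1 : Matrix d.Row d.Row ℂ) + d.A) D w)
    (hray : ∀ ξ > a, d.η₀ + (ω * (ξ : ℂ))⁻¹ ∈ D) :
    (hd.raySys j hω).GSol a fun ξ => w (d.η₀ + (ω * (ξ : ℂ))⁻¹) := by
  intro ξ hξ
  have hξ0 : (ξ : ℂ) ≠ 0 := by exact_mod_cast (ha.trans_lt hξ).ne'
  obtain ⟨w', h1, h2⟩ := hw _ (hray ξ hξ)
  have d0 : HasDerivAt (fun ξ : ℝ => d.η₀ + (ω * (ξ : ℂ))⁻¹) (-ω / (ω * ξ) ^ 2) ξ := by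
    have h3 : HasDerivAt (fun z : ℂ => ω * z) ω (ξ : ℂ) := by
      simpa using (hasDerivAt_id (ξ : ℂ)).const_mul ω
    exact ((h3.inv (mul_ne_zero hω hξ0)).const_add d.η₀).comp_ofReal
  refine ⟨(-ω / (ω * ξ) ^ 2) • w', HasDerivAt.scomp ξ h1 d0, fun a => ?_⟩
  have h4 := h2 a
  have ht := hd.sub_ne_zero a.1
  rw [add_mulVec, Pi.add_apply, smul_mulVec, one_mulVec, Pi.smul_apply, smul_eq_mul] at h4
  change (ξ : ℂ) * (ξ - (d.t a.1.castSucc - d.tLast) / ω) * _ =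
    (d.t a.1.castSucc - d.tLast) / ω * ((d.A *ᵥ w _) a - (d.ρ (1 - j) + 1) * w _ a)
  have h5 : (d.A *ᵥ w (d.η₀ + (ω * (ξ : ℂ))⁻¹)) a -
      (d.ρ (1 - j) + 1) * w (d.η₀ + (ω * (ξ : ℂ))⁻¹) a =
      ((ω * (ξ : ℂ))⁻¹ - (d.t a.1.castSucc - d.tLast)⁻¹) * w' a := by
    have h6 : d.η₀ + (ω * (ξ : ℂ))⁻¹ - d.t' a.1 =
        (ω * (ξ : ℂ))⁻¹ - (d.t a.1.castSucc - d.tLast)⁻¹ := by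
      rw [Data.t']; ring
    rw [← h6, h4]; ring
  rw [h5, Pi.smul_apply, smul_eq_mul]
  generalize d.t a.1.castSucc - d.tLast = u at ht
  field_simp
  ring

/-- The passage from the relation along the ray to the quantities `γ`. The minus sign is the one in
`η₀ - t'_i = - 1 / (t_i - t_{p+1})`. -/
lemma gam_of_relation (j : Fin 2) {ω : ℂ} (hω : ω ≠ 0) {w : ℂ → d.Row → ℂ} {C : d.Col → ℂ}
    {x y : ℂ}
    (h : ∀ a, x * (d.P *ᵥ C) a = y * (w d.η₀ a / (hd.raySys j hω).τ a)) (b : d.Col) :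
    x * C b = -(y * ω * d.gam w b) := by
  set u := (d.η₀ • (1 : Matrix d.Row d.Row ℂ) - d.T') *ᵥ w d.η₀ with hu
  have h1 : ∀ a, u a = -(w d.η₀ a / (d.t a.1.castSucc - d.tLast)) := by
    intro a
    rw [hu, T', smul_one_eq_diagonal, diagonal_sub, mulVec_diagonal, Data.t']
    ring
  have h2 : x • (d.P *ᵥ C) = (-(y * ω)) • u := by
    funext a
    rw [Pi.smul_apply, Pi.smul_apply, h1, smul_eq_mul, smul_eq_mul, h]
    change y * (w d.η₀ a / ((d.t a.1.castSucc - d.tLast) / ω)) = _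
    have := hd.sub_ne_zero a.1
    field_simp
  have h3 : d.Pinv *ᵥ (d.P *ᵥ C) = C := (hd.raySys j hω).Q_P C
  have h4 := congrFun (congrArg (d.Pinv *ᵥ ·) h2) b
  simp only [mulVec_smul] at h4
  rw [h3, Pi.smul_apply, Pi.smul_apply, smul_eq_mul, smul_eq_mul] at h4
  rw [h4, gam]
  ring

variable {δ : ℝ} (hδ : d.SmallAngle δ) (i : Fin d.p) (σ : Side)

include hδ

/-- If a solution, continued to a neighbourhood of a ray in the closure of the sector, is a
combination of the solutions at infinity, then the coefficients of those with exponent `ρ_j` are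
given by the connection relation along the ray. -/
lemma coeff_of_ray {Uinf : Fin 2 → d.Col → ℂ → d.Row ⊕ d.Col → ℂ}
    (hUinf : ∀ j c, d.IsUInf δ i σ j c (Uinf j c)) {C : Fin 2 → d.Col → ℂ} {ω : ℂ} (hω : ω ≠ 0)
    (hslit : ω * Complex.exp (-(d.ang i * I)) ∈ slitPlane) {a : ℝ} (ha : 0 ≤ a) {D : Set ℂ}
    {V : ℂ → d.Row ⊕ d.Col → ℂ} (hV : OkSol d.tt d.bigA D V)
    (hVC : ∀ x ∈ d.sector δ i σ, V x = ∑ j : Fin 2, ∑ c : d.Col, C j c • Uinf j c x)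
    (hray : ∀ X : ℝ, a < X → d.tLast + ω * (X : ℂ) ∈ D)
    (hcl : ∀ X : ℝ, a < X → d.tLast + ω * (X : ℂ) ∈ closure (d.sector δ i σ))
    (j : Fin 2) {e γ κ c₀ c' : ℂ} {lead : d.Row ⊕ d.Col → ℂ} {glead : d.Row → ℂ}
    (hconn : (hd.raySys j hω).Connects a e γ lead glead κ)
    (hlead : LeadFin a e (c₀ • lead) fun X => V (d.tLast + ω * (X : ℂ)))
    {D' : Set ℂ} {w : ℂ → d.Row → ℂ}
    (hw : OkSol (fun a : d.Row => d.t' a.1)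
      ((-d.ρ (1 - j) - 1) • (1 : Matrix d.Row d.Row ℂ) + d.A) D' w)
    (hη : d.η₀ ∈ D') (hray' : ∀ ξ : ℝ, a < ξ → d.η₀ + (ω * (ξ : ℂ))⁻¹ ∈ D')
    (hwlead : LeadFin a γ (c' • glead) fun ξ => w (d.η₀ + (ω * (ξ : ℂ))⁻¹)) (b : d.Col) :
    c' * argPow (d.ang i) ω (d.ρ j) * C j b = -(c₀ * κ * ω * d.gam w b) := by
  choose Φ hΦ hΦ0 R hR hsol hUR using
    fun j c => (hUinf j c).exists_locInf hδ
  -- the part of the solution with exponent `ρ_l`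
  let Φs : Fin 2 → ℂ → d.Row ⊕ d.Col → ℂ := fun l y => ∑ c, C l c • Φ l c y
  let W : Fin 2 → ℂ → d.Row ⊕ d.Col → ℂ := fun l => locInf (d.ang i) d.tLast (d.ρ l) (Φs l)
  have hWs : ∀ l, W l = ∑ c, C l c • locInf (d.ang i) d.tLast (d.ρ l) (Φ l c) :=
    fun l => locInf_sum _ _ _
  have hΦs : ∀ l, AnalyticAt ℂ (Φs l) 0 := fun l =>
    Finset.analyticAt_fun_sum _ fun c _ => (analyticAt_const (v := C l c)).smul (hΦ l c)
  let D₂ : Set ℂ := {x | (∀ l c, R l c < ‖x - d.tLast‖) ∧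
    (x - d.tLast) * Complex.exp (-(d.ang i * I)) ∈ slitPlane}
  have hWsol : ∀ l, OkSol d.tt d.bigA D₂ (W l) := fun l => by
    rw [hWs]
    exact OkSol.sum _ fun c _ => ((hsol l c).mono fun x hx => ⟨hx.1 l c, hx.2⟩).smul _
  have hfar : ∀ᶠ X : ℝ in atTop, d.tLast + ω * (X : ℂ) ∈ D₂ := by
    have h1 : ∀ᶠ X : ℝ in atTop, ∀ l c, R l c < ‖ω * (X : ℂ)‖ :=
      eventually_all.2 fun l => eventually_all.2 fun c =>
        (tendsto_norm_mul_atTop hω).eventually_gt_atTop _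
    filter_upwards [h1, eventually_gt_atTop 0] with X hX hX0
    refine ⟨by simpa using hX, ?_⟩
    have h2 : (d.tLast + ω * (X : ℂ) - d.tLast) * Complex.exp (-(d.ang i * I)) =
        (X : ℂ) * (ω * Complex.exp (-(d.ang i * I))) := by ring
    rw [h2, Complex.mem_slitPlane_iff, Complex.re_ofReal_mul, Complex.im_ofReal_mul]
    rw [Complex.mem_slitPlane_iff] at hslit
    rcases hslit with h3 | h3
    · exact Or.inl (mul_pos hX0 h3)
    · exact Or.inr (mul_ne_zero hX0.ne' h3)
  obtain ⟨b₀, hb₀⟩ := eventually_atTop.1 hfar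
  have hraysol : ∀ l, RaySol (hd.raySys j hω).T (hd.raySys j hω).B (Ioi b₀)
      fun X => W l (d.tLast + ω * (X : ℂ)) := fun l => by
    rw [raySys_T, raySys_B]
    exact (hWsol l).raySol hω fun X hX => hb₀ X (le_of_lt hX)
  have hWlead : ∀ l, LeadInf (d.ρ l) (argPow (d.ang i) ω (d.ρ l) • Φs l 0)
      fun X => W l (d.tLast + ω * (X : ℂ)) := fun l =>
    leadInf_of_locInf hω (hΦs l) (Eventually.of_forall fun X => rfl)
  have hsum : ∀ᶠ X : ℝ in atTop, V (d.tLast + ω * (X : ℂ)) =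
      W j (d.tLast + ω * (X : ℂ)) + W (1 - j) (d.tLast + ω * (X : ℂ)) := by
    filter_upwards [hfar, eventually_gt_atTop a] with X hX hXa
    have h1 : ∀ x, W j x + W (1 - j) x = W 0 x + W 1 x := fun x => by
      fin_cases j
      · rfl
      · exact add_comm _ _
    rw [h1]
    -- both sides are continuous at the point and agree on the sector
    set x := d.tLast + ω * (X : ℂ)
    have : (𝓝[d.sector δ i σ] x).NeBot := mem_closure_iff_nhdsWithin_neBot.1 (hcl X hXa)
    have h2 : ContinuousAt V x := (hV.differentiableAt (hray X hXa)).continuousAt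
    have h3 : ∀ l, ContinuousAt (W l) x := fun l =>
      ((hWsol l).differentiableAt hX).continuousAt
    have h5 : 𝓝[d.sector δ i σ] x ≤ 𝓝 x := nhdsWithin_le_nhds
    refine tendsto_nhds_unique_of_eventuallyEq (h2.tendsto.mono_left h5)
      (((h3 0).add (h3 1)).tendsto.mono_left h5) ?_
    have h4 : ∀ᶠ y in 𝓝 x, ∀ l c, R l c < ‖y - d.tLast‖ :=
      eventually_all.2 fun l => eventually_all.2 fun c =>
        (continuous_id.sub continuous_const).norm.continuousAt.eventually
          (lt_mem_nhds (hX.1 l c))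
    filter_upwards [self_mem_nhdsWithin, nhdsWithin_le_nhds h4] with y hy hyR
    rw [hVC y hy, Fin.sum_univ_two, hWs, hWs]
    simp only [Finset.sum_apply, Pi.smul_apply, Pi.add_apply]
    congr 1 <;> refine Finset.sum_congr rfl fun c _ => ?_
    · rw [hUR 0 c y hy (hyR 0 c)]
    · rw [hUR 1 c y hy (hyR 1 c)]
  have hVray : RaySol (hd.raySys j hω).T (hd.raySys j hω).B (Ioi a)
      fun X => V (d.tLast + ω * (X : ℂ)) := by
    rw [raySys_T, raySys_B]
    exact hV.raySol hω fun X hX => hray X hX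
  have hlim : Tendsto (fun ξ : ℝ => w (d.η₀ + (ω * (ξ : ℂ))⁻¹)) atTop (𝓝 (w d.η₀)) := by
    have h1 : Tendsto (fun ξ : ℝ => d.η₀ + (ω * (ξ : ℂ))⁻¹) atTop (𝓝 (d.η₀ + 0)) :=
      (tendsto_inv₀_cobounded.comp
        (tendsto_norm_atTop_iff_cobounded.1 (tendsto_norm_mul_atTop hω))).const_add _
    rw [add_zero] at h1
    exact (hw.differentiableAt hη).continuousAt.tendsto.comp h1
  have hrel := hconn _ _ _ _ _ _ _ c₀ c' b₀ hVray hlead (hraysol j) (hraysol (1 - j)) hsum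
    (hWlead j) (hWlead (1 - j)) (hd.gSol_of_okSol j hω ha hw hray') hwlead hlim
  refine hd.gam_of_relation j hω (fun a => ?_) b
  rw [← hrel a]
  have : (Φs j 0) (Sum.inl a) = (d.P *ᵥ C j) a := by
    simp only [Φs, Finset.sum_apply, Pi.smul_apply, smul_eq_mul, hΦ0, Sum.elim_inl, mulVec,
      dotProduct]
    exact Finset.sum_congr rfl fun c _ => mul_comm _ _
  rw [Pi.smul_apply, smul_eq_mul, this, mul_assoc]

end Data.Generic

/-! ### The solutions of the underlying system along a ray -/

section

variable {J : Type} [Fintype J] {S : Set ℂ} {w : ℂ → J → ℂ} {c e ω : ℂ} {φ : ℝ}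

lemma inv_ofReal_cpow {x : ℝ} (hx : 0 < x) (e : ℂ) : ((x : ℂ)⁻¹) ^ e = (x : ℂ) ^ (-e) := by
  rw [Complex.inv_cpow _ _ (by rw [Complex.arg_ofReal_of_nonneg hx.le]; exact Real.pi_pos.ne),
    Complex.cpow_neg]

/-- The expansion at `c + 1 / ω` along the ray `c + 1 / (ω ξ)`, at `ξ = 1`. -/
lemma leadFin_inv_of_locFin (hω : ω ≠ 0) {Ψ : ℂ → J → ℂ} (hΨ : AnalyticAt ℂ Ψ 0) {r : ℝ}
    (hr : 0 < r) (hS : ∀ ξ : ℝ, 1 < ξ → c + (ω * (ξ : ℂ))⁻¹ ∈ S)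
    (hw : ∀ z ∈ S, ‖z - (c + ω⁻¹)‖ < r → w z = locFin φ (c + ω⁻¹) e Ψ z) :
    LeadFin 1 e (argPow φ (-ω⁻¹) e • Ψ 0) fun ξ => w (c + (ω * (ξ : ℂ))⁻¹) := by
  have hω' : -ω⁻¹ ≠ 0 := neg_ne_zero.2 (inv_ne_zero hω)
  refine ⟨fun y => (argPow φ (-ω⁻¹) e * (1 + y) ^ (-e)) • Ψ (-ω⁻¹ * (y / (1 + y))),
    ⟨?_, ?_⟩, by simp⟩
  · have h1 : AnalyticAt ℂ (fun y : ℂ => -ω⁻¹ * (y / (1 + y))) 0 := by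
      refine analyticAt_const.mul (analyticAt_id.div (analyticAt_const.add analyticAt_id) ?_)
      simp
    have h2 : AnalyticAt ℂ Ψ (-ω⁻¹ * (0 / (1 + 0))) := by simpa using hΨ
    have h3 : AnalyticAt ℂ (fun y : ℂ => Ψ (-ω⁻¹ * (y / (1 + y)))) 0 :=
      AnalyticAt.comp (f := fun y : ℂ => -ω⁻¹ * (y / (1 + y))) h2 h1
    have h4 : AnalyticAt ℂ (fun y : ℂ => (1 + y) ^ (-e)) 0 :=
      (analyticAt_const.add analyticAt_id).cpow analyticAt_const (by simp)
    exact ((analyticAt_const (v := argPow φ (-ω⁻¹) e)).mul h4).smul h3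
  · have h3 : Tendsto (fun ξ : ℝ => ‖-ω⁻¹ * (((ξ - 1) / ξ : ℝ) : ℂ)‖) (𝓝[>] 1) (𝓝 0) := by
      have h5 : ContinuousAt (fun ξ : ℝ => ‖-ω⁻¹ * (((ξ - 1) / ξ : ℝ) : ℂ)‖) 1 := by
        have : ContinuousAt (fun ξ : ℝ => (ξ - 1) / ξ) 1 :=
          (continuousAt_id.sub continuousAt_const).div continuousAt_id one_ne_zero
        exact (continuousAt_const.mul
          (Complex.continuous_ofReal.continuousAt.comp this)).norm
      have := h5.tendsto.mono_left (nhdsWithin_le_nhds (s := Ioi 1))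
      simpa using this
    filter_upwards [h3.eventually (gt_mem_nhds hr), self_mem_nhdsWithin] with ξ hξ hξ1
    have hξ1 : 1 < ξ := hξ1
    have hξ0 : 0 < ξ := by linarith
    have hξ0' : (ξ : ℂ) ≠ 0 := by exact_mod_cast hξ0.ne'
    have e1 : c + (ω * (ξ : ℂ))⁻¹ - (c + ω⁻¹) = -ω⁻¹ * (((ξ - 1) / ξ : ℝ) : ℂ) := by
      push_cast; field_simp; ring
    have e2 : 1 + ((ξ - 1 : ℝ) : ℂ) = ξ := by push_cast; ring
    have e3 : (((ξ - 1) / ξ : ℝ) : ℂ) ^ e = ((ξ - 1 : ℝ) : ℂ) ^ e * (ξ : ℂ) ^ (-e) := by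
      rw [← inv_ofReal_cpow hξ0, ← Complex.ofReal_inv,
        ← Complex.mul_cpow_ofReal_nonneg (by linarith) (by positivity), ← Complex.ofReal_mul,
        div_eq_mul_inv]
    rw [hw _ (hS ξ hξ1) (by rw [e1]; exact hξ), locFin, e1,
      argPow_mul_ofReal φ hω' (div_pos (by linarith) hξ0), e2, e3, smul_smul]
    congr 1
    · ring
    · congr 2
      push_cast; ring

/-- The expansion at infinity along the ray `c + 1 / (ω ξ)`, at `ξ = 0`. -/
lemma leadFin_inv_of_locInf (hω : ω ≠ 0) {Φ : ℂ → J → ℂ} (hΦ : AnalyticAt ℂ Φ 0) {R : ℝ}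
    (hS : ∀ ξ : ℝ, 0 < ξ → c + (ω * (ξ : ℂ))⁻¹ ∈ S)
    (hw : ∀ z ∈ S, R < ‖z - c‖ → w z = locInf φ c e Φ z) :
    LeadFin 0 (-e) (argPow φ ω⁻¹ e • Φ 0) fun ξ => w (c + (ω * (ξ : ℂ))⁻¹) := by
  refine ⟨fun y => argPow φ ω⁻¹ e • Φ (ω * y), ⟨?_, ?_⟩, by simp⟩
  · have h1 : AnalyticAt ℂ (fun y : ℂ => ω * y) 0 := by fun_prop
    have h2 : AnalyticAt ℂ Φ (ω * 0) := by simpa using hΦ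
    have h3 : AnalyticAt ℂ (fun y : ℂ => Φ (ω * y)) 0 :=
      AnalyticAt.comp (f := fun y : ℂ => ω * y) h2 h1
    exact (analyticAt_const (v := argPow φ ω⁻¹ e)).smul h3
  · have h3 : Tendsto (fun ξ : ℝ => ‖ω⁻¹ * ((ξ⁻¹ : ℝ) : ℂ)‖) (𝓝[>] 0) atTop :=
      (tendsto_norm_mul_atTop (inv_ne_zero hω)).comp tendsto_inv_nhdsGT_zero
    filter_upwards [h3.eventually_gt_atTop R, self_mem_nhdsWithin] with ξ hξ hξ0
    have hξ0 : 0 < ξ := hξ0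
    have e1 : c + (ω * (ξ : ℂ))⁻¹ - c = ω⁻¹ * ((ξ⁻¹ : ℝ) : ℂ) := by
      push_cast; rw [mul_inv]; ring
    rw [hw _ (hS ξ hξ0) (by rw [e1]; exact hξ), locInf, e1,
      argPow_mul_ofReal φ (inv_ne_zero hω) (inv_pos.2 hξ0), Complex.ofReal_inv,
      inv_ofReal_cpow hξ0, smul_smul, sub_zero, mul_inv, inv_inv, inv_inv]
    congr 1
    ring

end

/-! ### The ray through a singular point -/

namespace Data

variable {d : Data} {δ : ℝ}

/-- The line through `t_{p+1}` and `t_i` does not meet the adjacent sectors. -/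
lemma sector_im_ne_zero (hδ : d.SmallAngle δ) (i : Fin d.p) (σ : Side) {x : ℂ}
    (hx : x ∈ d.sector δ i σ) :
    ((x - d.tLast) * Complex.exp (-(d.ang i * I))).im ≠ 0 := by
  rw [mem_sector, mem_wedge_iff_im (hδ.lo_lt_hi i σ) (hi_le_lo_add_pi i σ)] at hx
  rcases ang_eq_lo_or_hi (δ := δ) i σ with h | h
  · rw [h]; exact hx.1.ne'
  · rw [h]; exact hx.2.ne

end Data

namespace Data.Generic

variable {d : Data} (hd : d.Generic)

include hd

lemma sub_mul_exp (i : Fin d.p) : (d.t i.castSucc - d.tLast) * Complex.exp (-(d.ang i * I)) =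
    (‖d.t i.castSucc - d.tLast‖ : ℝ) := by
  conv_lhs => rw [hd.θ_arg i]
  rw [mul_assoc, ang, ← Complex.exp_add, add_neg_cancel, Complex.exp_zero, mul_one]

lemma argLog_sub (i : Fin d.p) : argLog (d.ang i) (d.t i.castSucc - d.tLast) =
    Real.log ‖d.t i.castSucc - d.tLast‖ + d.ang i * I := by
  have hπ := Real.pi_pos
  conv_lhs => rw [hd.θ_arg i]
  exact argLog_polar (norm_pos_iff.2 (hd.sub_ne_zero i)) (by rw [ang]; linarith)
    (by rw [ang]; linarith)

/-- The ray from `t_{p+1}` through `t_i`, with the coordinate `X = 1` at `t_i`. -/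
lemma finCase (j : Fin 2) (i : Fin d.p) (k : Fin (d.r i)) (h : Fin (d.l i k)) :
    (hd.raySys j (hd.sub_ne_zero i)).FinCase (fun a => d.lam a.1 a.2.1) ⟨i, k, h⟩ := by
  have hτ : ∀ (a : d.Row) (X : ℂ), X = (hd.raySys j (hd.sub_ne_zero i)).τ a →
      d.t a.1.castSucc - d.tLast = X * (d.t i.castSucc - d.tLast) := by
    rintro a X rfl
    exact (div_mul_cancel₀ _ (hd.sub_ne_zero i)).symm
  have hone : ∀ a : d.Row, (hd.raySys j (hd.sub_ne_zero i)).τ a = 1 → a.1 = i := fun a ha =>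
    hd.eq_of_smul (s := 1) (by rw [Complex.ofReal_one]; exact hτ a 1 ha.symm)
  refine ⟨div_self (hd.sub_ne_zero i), fun a X hX h1 => ?_, fun a b ha hb =>
    hd.A_block (hone a ha) (hone b hb), hd.lam_notInt i k,
    fun a ha m => hd.lam_nonres k (hone a ha) m, (hd.rho_sub_lam (1 - j) i k).neg.congr ?_⟩
  · have h2 := hτ a X h1
    obtain ⟨ia, a⟩ := a
    change d.t ia.castSucc - d.tLast = _ at h2
    obtain rfl := hd.eq_of_smul h2
    have h3 : ((X - 1 : ℝ) : ℂ) * (d.t ia.castSucc - d.tLast) = 0 := by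
      push_cast; linear_combination -h2
    rw [mul_eq_zero, or_iff_left (hd.sub_ne_zero ia), Complex.ofReal_eq_zero] at h3
    linarith
  · exact (neg_sub _ _).symm

/-- In the coordinate `ζ`, the part of the ray behind `t_i` is the open segment from `η₀` to
`t'_i`, which avoids the cuts. -/
lemma inv_mem_cutPlane (i : Fin d.p) {ξ : ℝ} (hξ : 1 < ξ) :
    d.η₀ + ((d.t i.castSucc - d.tLast) * (ξ : ℂ))⁻¹ ∈ d.cutPlane := by
  intro b s hs h
  have hi := hd.sub_ne_zero i
  have hb := hd.sub_ne_zero b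
  have hξ' : (ξ : ℂ) ≠ 0 := by exact_mod_cast (by linarith : ξ ≠ 0)
  have h2 : d.t b.castSucc - d.tLast = ((s * ξ : ℝ) : ℂ) * (d.t i.castSucc - d.tLast) := by
    simp only [Data.t', add_sub_cancel_left, add_right_inj] at h
    generalize d.t b.castSucc - d.tLast = u at *
    generalize d.t i.castSucc - d.tLast = v at *
    push_cast
    field_simp at h
    linear_combination h
  obtain rfl := hd.eq_of_smul h2
  have h3 : ((s * ξ - 1 : ℝ) : ℂ) * (d.t b.castSucc - d.tLast) = 0 := by
    push_cast at h2 ⊢; linear_combination -h2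
  rw [mul_eq_zero, or_iff_left hi, Complex.ofReal_eq_zero] at h3
  nlinarith

/-- The solution of the underlying system at `t'_i`, along the ray. -/
lemma leadFin_of_isWFin {s : ℂ} {i : Fin d.p} {k : Fin (d.r i)} {h : Fin (d.l i k)}
    {w : ℂ → d.Row → ℂ} (hw : d.IsWFin s i k h w) :
    LeadFin 1 (s + d.lam i k)
      (argPow (d.ang' i - Real.pi) (-(d.t i.castSucc - d.tLast)⁻¹) (s + d.lam i k) •
        Pi.single ⟨i, k, h⟩ 1)
      fun ξ => w (d.η₀ + ((d.t i.castSucc - d.tLast) * (ξ : ℂ))⁻¹) := by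
  have hi := hd.sub_ne_zero i
  have ht : d.t' i = d.η₀ + (d.t i.castSucc - d.tLast)⁻¹ := by rw [Data.t', one_div]
  have hnear : ∀ ε > 0, ∃ z ∈ d.cutPlane, z ≠ d.t' i ∧ ‖z - d.t' i‖ < ε := by
    intro ε hε
    have h1 : ContinuousAt
        (fun ξ : ℝ => d.η₀ + ((d.t i.castSucc - d.tLast) * (ξ : ℂ))⁻¹ - d.t' i) 1 := by
      refine ContinuousAt.sub (continuousAt_const.add (ContinuousAt.inv₀
        (continuousAt_const.mul Complex.continuous_ofReal.continuousAt) ?_)) continuousAt_const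
      simpa using hi
    have h2 := (h1.norm.tendsto.mono_left (nhdsWithin_le_nhds (s := Ioi 1)))
    have h3 : ‖d.η₀ + ((d.t i.castSucc - d.tLast) * ((1 : ℝ) : ℂ))⁻¹ - d.t' i‖ = 0 := by
      rw [ht]; simp
    rw [h3] at h2
    obtain ⟨ξ, hξ, hξ1⟩ := ((h2.eventually (gt_mem_nhds hε)).and self_mem_nhdsWithin).exists
    have hmem := hd.inv_mem_cutPlane i hξ1
    refine ⟨_, hmem, fun h => hmem i 1 le_rfl ?_, hξ⟩
    rw [h]; simp
  obtain ⟨Ψ, hΨ, hΨ0, r, hr, hwr⟩ := hw.2.exists_analyticAt hnear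
  rw [← hΨ0]
  exact leadFin_inv_of_locFin hi hΨ hr (fun ξ hξ => hd.inv_mem_cutPlane i hξ)
    (by rw [← ht]; exact hwr)

end Data.Generic

/-! ### The connection coefficients -/

namespace Data.Generic

variable {d : Data} (hd : d.Generic) {δ : ℝ} (hδ : d.SmallAngle δ) {i : Fin d.p} {σ : Side}
  {Uinf : Fin 2 → d.Col → ℂ → d.Row ⊕ d.Col → ℂ}
  (hUinf : ∀ j c, d.IsUInf δ i σ j c (Uinf j c)) {C : Fin 2 → d.Col → ℂ}
  {U : ℂ → d.Row ⊕ d.Col → ℂ} (hU : IsSolutionOn d.bigT d.bigA (d.sector δ i σ) U)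
  (hC : ∀ x ∈ d.sector δ i σ, U x = ∑ j : Fin 2, ∑ c : d.Col, C j c • Uinf j c x)
  {w : Fin 2 → ℂ → d.Row → ℂ}

include hd hδ hUinf hU hC

/-- The coefficients of `U_{t_i,k,h}`: the connection relation along the ray from `t_{p+1}` through
`t_i`, on the boundary of the sector. -/
lemma coeff_fin {k : Fin (d.r i)} {h : Fin (d.l i k)}
    (hexp : HasExpansionAt (d.t i.castSucc) (d.ang i) (d.lam i k)
      (Pi.single (Sum.inl ⟨i, k, h⟩) 1) (d.sector δ i σ) U)
    (hw : ∀ j, d.IsWFin (-d.ρ j - 1) i k h (w j)) (j : Fin 2) (b : d.Col) :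
    C j b = Complex.exp (Real.pi * Complex.I * (d.lam i k - d.ρ (1 - j))) *
      argPow (d.ang i) (d.t i.castSucc - d.tLast) (2 * d.lam i k - d.ρ 0 - d.ρ 1) *
      RaySys.finFactor (d.ρ j) (d.ρ (1 - j)) (d.lam i k) * d.gam (w (1 - j)) b := by
  rw [bigT_eq, isSolutionOn_diagonal] at hU
  have hi := hd.sub_ne_zero i
  have hn : 0 < ‖d.t i.castSucc - d.tLast‖ := norm_pos_iff.2 hi
  have hcl : ∀ X : ℝ, 0 ≤ X →
      d.tLast + (d.t i.castSucc - d.tLast) * (X : ℂ) ∈ closure (d.sector δ i σ) := by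
    intro X hX
    have := ray_mem_closure_sector hδ i σ (r := X * ‖d.t i.castSucc - d.tLast‖) (by positivity)
    convert this using 2
    conv_lhs => rw [hd.θ_arg i]
    rw [ang]
    push_cast; ring
  have hnear : ∀ ε > 0, ∃ x ∈ d.sector δ i σ, ‖x - d.t i.castSucc‖ < ε := by
    intro ε hε
    have h1 := hcl 1 zero_le_one
    rw [Complex.ofReal_one, mul_one, add_sub_cancel] at h1
    obtain ⟨x, hx, hxε⟩ := Metric.mem_closure_iff.1 h1 ε hε
    exact ⟨x, hx, by rwa [← dist_eq_norm, dist_comm]⟩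
  obtain ⟨Ψ, hΨ, hΨ0, r, hr, hUr⟩ := hexp.exists_analyticAt fun ε hε => by
    obtain ⟨x, hx, hxε⟩ := hnear ε hε
    exact ⟨x, hx, hd.ne_of_mem_sector hδ i σ hx _, hxε⟩
  have hE := eulerFin_of_okSol (isOpen_sector hδ i σ) hU hΨ hr hUr hnear fun x hx => by
    rw [Complex.mem_slitPlane_iff]
    right
    have h1 : (x - d.t i.castSucc) * Complex.exp (-(d.ang i * I)) =
        (x - d.tLast) * Complex.exp (-(d.ang i * I)) - (‖d.t i.castSucc - d.tLast‖ : ℝ) := by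
      rw [← hd.sub_mul_exp i]; ring
    rw [h1, Complex.sub_im, Complex.ofReal_im, sub_zero]
    exact sector_im_ne_zero hδ i σ hx
  obtain ⟨V, hV, r', hr', hVr⟩ := hd.exists_okSol_fin i hΨ hE
  have hsub := hd.sector_subset_starCut hδ i σ
  have hVU : ∀ x ∈ d.sector δ i σ, V x = U x := by
    obtain ⟨x₁, hx₁, hx₁r⟩ := hnear (min r r') (lt_min hr hr')
    exact (hV.mono hsub).eqOn (isOpen_sector hδ i σ) (convex_sector hδ i σ).isPreconnected
      (fun x hx => hd.ne_tt_of_mem_sector hδ i σ hx) hU hx₁ (by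
        rw [hVr _ (hsub hx₁) (hx₁r.trans_le (min_le_right _ _)),
          hUr _ hx₁ (hx₁r.trans_le (min_le_left _ _))])
  have hray : ∀ X : ℝ, 1 < X → d.tLast + (d.t i.castSucc - d.tLast) * (X : ℂ) ∈
      starCut d.t (d.tLast + (2 : ℝ) * (d.t i.castSucc - d.tLast)) := fun X hX => by
    have := hd.ray_mem_starCut i hX
    rwa [mul_comm (X : ℂ)] at this
  have hlead : LeadFin 1 (d.lam i k)
      (argPow (d.ang i) (d.t i.castSucc - d.tLast) (d.lam i k) •
        Pi.single (Sum.inl ⟨i, k, h⟩) 1)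
      fun X => V (d.tLast + (d.t i.castSucc - d.tLast) * (X : ℂ)) := by
    have := leadFin_of_locFin (c := d.tLast) (a := 1) hi (by simp) hΨ hr' hray hVr
    rwa [hΨ0] at this
  have hw' := hw (1 - j)
  have hsol := hw'.1
  rw [T', isSolutionOn_diagonal] at hsol
  have hη : d.η₀ ∈ d.cutPlane :=
    mem_starCut_self (p := d.t') fun b => _root_.sub_ne_zero.1 (hd.t'_sub_ne_zero b)
  have hglead := (hd.leadFin_of_isWFin hw').cast (e' := d.lam i k - d.ρ (1 - j) - 1) (by ring)
    rfl fun _ => rfl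
  have key := hd.coeff_of_ray hδ i σ hUinf hi
    (by rw [hd.sub_mul_exp i, Complex.ofReal_mem_slitPlane]; exact hn) zero_le_one hV
    (fun x hx => (hVU x hx).trans (hC x hx)) hray (fun X hX => hcl X (by linarith)) j
    (hd.finCase j i k h).connects hlead hsol hη (fun ξ hξ => hd.inv_mem_cutPlane i hξ) hglead b
  -- all powers are exponentials of multiples of `L` and `π I`
  set L := argLog (d.ang i) (d.t i.castSucc - d.tLast) with hL
  have hLexp : Complex.exp L = d.t i.castSucc - d.tLast := exp_argLog _ hi
  have hL' : argLog (d.ang' i - Real.pi) (-(d.t i.castSucc - d.tLast)⁻¹) = -L - Real.pi * I := by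
    have him : (-L - Real.pi * I).im = d.ang' i - Real.pi := by
      rw [hL, hd.argLog_sub i, ang']; simp
    refine argLog_eq ?_ (by rw [him]; linarith [Real.pi_pos]) (by rw [him]; linarith [Real.pi_pos])
    rw [Complex.exp_sub, Complex.exp_neg, hLexp, Complex.exp_pi_mul_I, div_neg, div_one]
  have hexpId : Complex.exp (d.lam i k * L) * Complex.exp L =
      -(Complex.exp ((-d.ρ (1 - j) - 1 + d.lam i k) * (-L - Real.pi * I)) *
        Complex.exp (d.ρ j * L) * (Complex.exp (Real.pi * I * (d.lam i k - d.ρ (1 - j))) *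
          Complex.exp ((2 * d.lam i k - d.ρ 0 - d.ρ 1) * L))) := by
    have h1 : (-1 : ℂ) = Complex.exp (-(Real.pi * I)) := by
      rw [Complex.exp_neg, Complex.exp_pi_mul_I]; norm_num
    rw [neg_eq_neg_one_mul, h1, ← Complex.exp_add, ← Complex.exp_add, ← Complex.exp_add,
      ← Complex.exp_add, ← Complex.exp_add]
    congr 1
    linear_combination -L * d.rho_add_rho_rev j
  simp only [argPow, hL', ← hL] at key ⊢
  have hne : Complex.exp ((-d.ρ (1 - j) - 1 + d.lam i k) * (-L - Real.pi * I)) *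
      Complex.exp (d.ρ j * L) ≠ 0 := mul_ne_zero (Complex.exp_ne_zero _) (Complex.exp_ne_zero _)
  refine mul_left_cancel₀ hne ?_
  rw [key]
  change -(Complex.exp (d.lam i k * L) * RaySys.finFactor (d.ρ j) (d.ρ (1 - j)) (d.lam i k) *
    (d.t i.castSucc - d.tLast) * d.gam (w (1 - j)) b) = _
  rw [← hLexp]
  linear_combination (-RaySys.finFactor (d.ρ j) (d.ρ (1 - j)) (d.lam i k) *
    d.gam (w (1 - j)) b) * hexpId

/-- The coefficients of `U_{t_{p+1},k,h}`: the connection relation along a ray in the sector. -/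
lemma coeff_last {k : Fin d.q} {h : Fin (d.m k)}
    (hk : ∀ N : ℕ, d.ρ 0 + d.ρ 1 - d.mu k ≠ -((N : ℂ) + 1))
    (hexp : HasExpansionAt d.tLast (d.ang i) (d.ρ 0 + d.ρ 1 - d.mu k)
      (Pi.single (Sum.inr ⟨k, h⟩) 1) (d.sector δ i σ) U)
    (hw : ∀ j, d.IsWInf (-d.ρ j - 1) δ i σ.opp k h (w j)) (j : Fin 2) (b : d.Col) :
    C j b = -RaySys.lastFactor (d.ρ j) (d.ρ (1 - j)) (d.mu k) * d.gam (w (1 - j)) b := by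
  rw [bigT_eq, isSolutionOn_diagonal] at hU
  obtain ⟨ω, hωw⟩ := wedge_nonempty (hδ.lo_lt_hi i σ)
  have hω := wedge_ne_zero hωw
  have hlo := sub_pi_le_lo (δ := δ) i σ
  have hhi := hi_le_add_pi (δ := δ) i σ
  have hray : ∀ X : ℝ, 0 < X → d.tLast + ω * (X : ℂ) ∈ d.sector δ i σ := fun X hX =>
    add_mul_mem_sector i σ hωw hX
  have hray' : ∀ ξ : ℝ, 0 < ξ → d.η₀ + (ω * (ξ : ℂ))⁻¹ ∈ d.sector' δ i σ.opp := fun ξ hξ => by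
    rw [mem_sector'_opp, add_sub_cancel_left]
    exact inv_mem_wedge (mul_ofReal_mem_wedge hωw hξ)
  obtain ⟨Ψ, hΨ, hΨ0, r, hr, hUr⟩ := hexp.exists_analyticAt fun ε hε => by
    obtain ⟨x, hx, hxε⟩ := exists_mem_sector_norm hδ i σ (ε / 2) (by positivity)
    exact ⟨x, hx, hd.ne_of_mem_sector hδ i σ hx _, by rw [hxε]; linarith⟩
  have hlead : LeadFin 0 (d.ρ 0 + d.ρ 1 - d.mu k)
      (argPow (d.ang i) ω (d.ρ 0 + d.ρ 1 - d.mu k) • Pi.single (Sum.inr ⟨k, h⟩) 1)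
      fun X => U (d.tLast + ω * (X : ℂ)) := by
    have := leadFin_of_locFin (c := d.tLast) (a := 0) hω (by simp) hΨ hr hray hUr
    rwa [hΨ0] at this
  have hw' := hw (1 - j)
  have hsol := hw'.1
  rw [T', isSolutionOn_diagonal] at hsol
  have hη : d.η₀ ∈ d.sector' δ i σ.opp ∪ d.regularDisc := Or.inr fun b => by
    rw [sub_self, norm_zero]; exact norm_pos_iff.2 (hd.t'_sub_ne_zero b)
  have hglead : LeadFin 0 (d.ρ (1 - j) + 1 - d.mu k)
      (argPow (d.ang' i) ω⁻¹ (-d.ρ (1 - j) - 1 + d.mu k) • fun a => d.P a ⟨k, h⟩)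
      fun ξ => w (1 - j) (d.η₀ + (ω * (ξ : ℂ))⁻¹) := by
    obtain ⟨Φ, hΦ, hΦ0, R, hR, hwR⟩ := hw'.2.exists_analyticAt fun R => by
      have hpos : 0 < (|R| + 1) * ‖ω‖ := mul_pos (by positivity) (norm_pos_iff.2 hω)
      refine ⟨_, hray' _ (inv_pos.2 hpos), ?_⟩
      have := norm_pos_iff.2 hω
      rw [add_sub_cancel_left, norm_inv, norm_mul, Complex.norm_real,
        Real.norm_of_nonneg (inv_pos.2 hpos).le]
      field_simp
      linarith [le_abs_self R]
    rw [← hΦ0]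
    exact (leadFin_inv_of_locInf hω hΦ hray' hwR).cast (by ring) rfl fun _ => rfl
  have hlast : (hd.raySys j hω).LastCase (⟨k, h⟩ : d.Col) := by
    refine ⟨fun a X hX h1 => ?_, fun m h1 => ?_, fun c m => hd.mu_nonres k c.1 m⟩
    · have h1 : (X : ℂ) = (d.t a.1.castSucc - d.tLast) / ω := h1
      refine hd.sub_notMem_wedge hδ i σ a.1 ?_
      have := mul_ofReal_mem_wedge hωw hX
      rwa [h1, mul_div_cancel₀ _ hω] at this
    · have h1 : d.ρ j + d.ρ (1 - j) - d.mu k + m + 1 = 0 := h1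
      rw [d.rho_add_rho_rev] at h1
      exact hk m (by linear_combination h1)
  have hlead' := hlead.cast (e' := d.ρ j + d.ρ (1 - j) - d.mu k) (by rw [d.rho_add_rho_rev]) rfl
    fun _ => rfl
  -- the ray lies in the sector, and its inverse in the opposite sector at `η₀`
  have key := hd.coeff_of_ray hδ i σ hUinf hω (wedge_slit hlo hhi hωw) le_rfl hU hC hray
    (fun X hX => subset_closure (hray X hX)) j hlast.connects hlead' hsol hη
    (fun ξ hξ => Or.inl (hray' ξ hξ)) hglead b
  set L := argLog (d.ang i) ω with hL
  have hLexp : Complex.exp L = ω := exp_argLog _ hω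
  have hL' : argLog (d.ang' i) ω⁻¹ = -L := by
    have h1 := (mem_wedge_iff_argNear hlo hhi).1 hωw
    have h2 : L.im ∈ Ioo (d.lo δ i σ) (d.hi δ i σ) := h1.2
    refine argLog_eq (by rw [Complex.exp_neg, hLexp]) ?_ ?_
    · rw [Complex.neg_im, ang']; linarith [h2.2]
    · rw [Complex.neg_im, ang']; linarith [h2.1]
  have hexpId : Complex.exp ((d.ρ 0 + d.ρ 1 - d.mu k) * L) * Complex.exp L =
      Complex.exp ((-d.ρ (1 - j) - 1 + d.mu k) * -L) * Complex.exp (d.ρ j * L) := by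
    rw [← Complex.exp_add, ← Complex.exp_add]
    congr 1
    linear_combination -L * d.rho_add_rho_rev j
  simp only [argPow, hL', ← hL] at key
  have hne : Complex.exp ((-d.ρ (1 - j) - 1 + d.mu k) * -L) * Complex.exp (d.ρ j * L) ≠ 0 :=
    mul_ne_zero (Complex.exp_ne_zero _) (Complex.exp_ne_zero _)
  refine mul_left_cancel₀ hne ?_
  rw [key]
  change -(Complex.exp ((d.ρ 0 + d.ρ 1 - d.mu k) * L) *
    RaySys.lastFactor (d.ρ j) (d.ρ (1 - j)) (d.mu k) * ω * d.gam (w (1 - j)) b) = _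
  rw [hLexp] at hexpId
  linear_combination (-RaySys.lastFactor (d.ρ j) (d.ρ (1 - j)) (d.mu k) *
    d.gam (w (1 - j)) b) * hexpId

end Data.Generic

/-! ### The solutions at infinity form a basis -/

/-- Both index sets have `n` elements, since `P` is invertible. -/
lemma Data.card_row_eq_card_col (d : Data) : Fintype.card d.Row = Fintype.card d.Col :=
  Matrix.square_of_invertible d.P d.Pinv d.P_mul_Pinv d.Pinv_mul_P

namespace Data.Generic

variable {d : Data} (hd : d.Generic)

include hd

/-- The leading coefficients of the solutions at infinity are linearly independent. -/
lemma linearIndependent_lead : LinearIndependent ℂ fun p : Fin 2 × d.Col =>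
    (Sum.elim (fun a => d.P a p.2)
      (fun b => (d.ρ p.1 • (1 : Matrix d.Col d.Col ℂ) - d.A') b p.2) : d.Row ⊕ d.Col → ℂ) := by
  rw [Fintype.linearIndependent_iff]
  intro g hg
  rw [Fintype.sum_prod_type, Fin.sum_univ_two] at hg
  have h1 : ∀ b, g (0, b) + g (1, b) = 0 := by
    have h2 : d.P *ᵥ (fun b => g (0, b) + g (1, b)) = 0 := by
      funext a
      have := congrFun hg (Sum.inl a)
      simp only [Pi.add_apply, Finset.sum_apply, Pi.smul_apply, Sum.elim_inl, smul_eq_mul,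
        Pi.zero_apply] at this
      rw [← Finset.sum_add_distrib] at this
      refine Eq.trans ?_ this
      simp only [mulVec, dotProduct]
      exact Finset.sum_congr rfl fun b _ => by ring
    have h3 : d.Pinv *ᵥ (d.P *ᵥ fun b => g (0, b) + g (1, b)) = fun b => g (0, b) + g (1, b) :=
      (hd.raySys 0 one_ne_zero).Q_P _
    rw [h2, mulVec_zero] at h3
    exact fun b => (congrFun h3 b).symm
  have h2 : ∀ b, (d.ρ 0 - d.mu b.1) * g (0, b) + (d.ρ 1 - d.mu b.1) * g (1, b) = 0 := by
    intro b
    have := congrFun hg (Sum.inr b)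
    simp only [Pi.add_apply, Finset.sum_apply, Pi.smul_apply, Sum.elim_inr, smul_eq_mul,
      Pi.zero_apply, hd.A'_diagonal, smul_one_eq_diagonal, diagonal_sub, diagonal_apply,
      mul_ite, mul_zero, Finset.sum_ite_eq, Finset.mem_univ, if_true] at this
    linear_combination this
  have h3 : ∀ b, g (0, b) = 0 := fun b => by
    have : (d.ρ 0 - d.ρ 1) * g (0, b) = 0 := by
      linear_combination h2 b - (d.ρ 1 - d.mu b.1) * h1 b
    exact (mul_eq_zero.1 this).resolve_left hd.rho_sub_rho.ne_zero
  rintro ⟨j, b⟩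
  obtain rfl | rfl : j = 0 ∨ j = 1 := by omega
  · exact h3 b
  · have := h1 b
    rwa [h3, zero_add] at this

variable {δ : ℝ} (hδ : d.SmallAngle δ) {i : Fin d.p} {σ : Side}
  {Uinf : Fin 2 → d.Col → ℂ → d.Row ⊕ d.Col → ℂ}
  (hUinf : ∀ j c, d.IsUInf δ i σ j c (Uinf j c))

include hδ hUinf

/-- Every solution on the sector is a combination of the solutions at infinity. -/
lemma exists_coeff {U : ℂ → d.Row ⊕ d.Col → ℂ}
    (hU : IsSolutionOn d.bigT d.bigA (d.sector δ i σ) U) : ∃ C : Fin 2 → d.Col → ℂ,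
      ∀ x ∈ d.sector δ i σ, U x = ∑ j : Fin 2, ∑ c : d.Col, C j c • Uinf j c x := by
  choose Φ hΦ hΦ0 R hR hsol hUR using fun j c => (hUinf j c).exists_locInf hδ
  obtain ⟨ω, hωw⟩ := wedge_nonempty (hδ.lo_lt_hi i σ)
  have hω := wedge_ne_zero hωw
  -- linear independence is an open condition
  have hlim : Tendsto (fun (X : ℝ) (p : Fin 2 × d.Col) => Φ p.1 p.2 (ω * (X : ℂ))⁻¹) atTop
      (𝓝 fun p => Φ p.1 p.2 0) :=
    tendsto_pi_nhds.2 fun p => (hΦ p.1 p.2).continuousAt.tendsto.comp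
      (tendsto_inv₀_cobounded.comp
        (tendsto_norm_atTop_iff_cobounded.1 (tendsto_norm_mul_atTop hω)))
  have hLI : ∀ᶠ X : ℝ in atTop,
      LinearIndependent ℂ fun p : Fin 2 × d.Col => Φ p.1 p.2 (ω * (X : ℂ))⁻¹ :=
    hlim.eventually (isOpen_setOfPred_linearIndependent.mem_nhds (by
      simp only [hΦ0]; exact hd.linearIndependent_lead))
  have hfar : ∀ᶠ X : ℝ in atTop, ∀ l c, R l c < ‖ω * (X : ℂ)‖ :=
    eventually_all.2 fun l => eventually_all.2 fun c =>
      (tendsto_norm_mul_atTop hω).eventually_gt_atTop _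
  obtain ⟨X, hX, hXR, hX0⟩ := (hLI.and (hfar.and (eventually_gt_atTop 0))).exists
  have hx := add_mul_mem_sector i σ hωw hX0
  set x := d.tLast + ω * (X : ℂ) with hxdef
  have hval : ∀ p : Fin 2 × d.Col, Uinf p.1 p.2 x =
      Units.mk0 _ (argPow_ne_zero (d.ang i) (ω * (X : ℂ)) (d.ρ p.1)) •
        Φ p.1 p.2 (ω * (X : ℂ))⁻¹ := fun p => by
    rw [hUR p.1 p.2 x hx (by rw [hxdef, add_sub_cancel_left]; exact hXR p.1 p.2), locInf, hxdef,
      add_sub_cancel_left]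
    rfl
  have hLI' : LinearIndependent ℂ fun p : Fin 2 × d.Col => Uinf p.1 p.2 x := by
    simp only [hval]
    exact hX.units_smul fun p : Fin 2 × d.Col =>
      Units.mk0 _ (argPow_ne_zero (d.ang i) (ω * (X : ℂ)) (d.ρ p.1))
  have hspan := hLI'.span_eq_top_of_card_eq_finrank' (by
    rw [Module.finrank_fintype_fun_eq_card, Fintype.card_prod, Fintype.card_fin, Fintype.card_sum,
      d.card_row_eq_card_col, two_mul])
  have hmem : U x ∈ Submodule.span ℂ (Set.range fun p : Fin 2 × d.Col => Uinf p.1 p.2 x) := by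
    rw [hspan]; trivial
  obtain ⟨C, hC⟩ := (Submodule.mem_span_range_iff_exists_fun ℂ).1 hmem
  rw [Fintype.sum_prod_type] at hC
  refine ⟨fun j c => C (j, c), fun y hy => ?_⟩
  rw [bigT_eq, isSolutionOn_diagonal] at hU
  have hsum : OkSol d.tt d.bigA (d.sector δ i σ)
      (∑ j : Fin 2, ∑ c : d.Col, C (j, c) • Uinf j c) :=
    OkSol.sum _ fun j _ => OkSol.sum _ fun c _ => by
      have := (hUinf j c).1
      rw [bigT_eq, isSolutionOn_diagonal] at this
      exact this.smul _
  have := hU.eqOn (isOpen_sector hδ i σ) (convex_sector hδ i σ).isPreconnected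
    (fun x hx => hd.ne_tt_of_mem_sector hδ i σ hx) hsum hx (by
      rw [← hC]; simp only [Finset.sum_apply, Pi.smul_apply]) y hy
  rw [this]
  simp only [Finset.sum_apply, Pi.smul_apply]

/-- If the coefficients of a solution are determined, then the solution is the combination with
these coefficients. -/
lemma combination_iff {U : ℂ → d.Row ⊕ d.Col → ℂ}
    (hU : IsSolutionOn d.bigT d.bigA (d.sector δ i σ) U) {F : Fin 2 → d.Col → ℂ}
    (hF : ∀ C : Fin 2 → d.Col → ℂ,
      (∀ x ∈ d.sector δ i σ, U x = ∑ j : Fin 2, ∑ c : d.Col, C j c • Uinf j c x) →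
        ∀ j c, C j c = F j c) (C : Fin 2 → d.Col → ℂ) :
    (∀ x ∈ d.sector δ i σ, U x = ∑ j : Fin 2, ∑ c : d.Col, C j c • Uinf j c x) ↔
      ∀ j c, C j c = F j c := by
  refine ⟨hF C, fun h => ?_⟩
  obtain ⟨C', hC'⟩ := hd.exists_coeff hδ hUinf hU
  have : C = C' := funext fun j => funext fun c => (h j c).trans (hF C' hC' j c).symm
  rwa [this]

end Data.Generic

end Okubo

end

theorem mainTheorem1 (d : Okubo.Data) (hd : d.Generic) (δ : ℝ) (hδ : d.SmallAngle δ)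
    (i : Fin d.p) (σ : Okubo.Side) :
    -- the functions that occur below exist
    ((∀ (j : Fin 2) (c : d.Col), ∃ U, d.IsUInf δ i σ j c U) ∧
      (∀ (k : Fin (d.r i)) (h : Fin (d.l i k)), ∃ U, d.IsUFin δ i σ k h U) ∧
      (∀ (k : Fin d.q) (h : Fin (d.m k)),
        (∀ N : ℕ, d.ρ 0 + d.ρ 1 - d.mu k ≠ -((N : ℂ) + 1)) → ∃ U, d.IsULast δ i σ k h U) ∧
      (∀ (j : Fin 2) (k : Fin (d.r i)) (h : Fin (d.l i k)),
        ∃ w, d.IsWFin (-d.ρ j - 1) i k h w) ∧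
      (∀ (j : Fin 2) (k : Fin d.q) (h : Fin (d.m k)),
        ∃ w, d.IsWInf (-d.ρ j - 1) δ i σ.opp k h w)) ∧
    ∀ Uinf : Fin 2 → d.Col → ℂ → d.Row ⊕ d.Col → ℂ,
      (∀ j c, d.IsUInf δ i σ j c (Uinf j c)) →
      -- connection formula between `t_i` and infinity
      (∀ (k : Fin (d.r i)) (h : Fin (d.l i k)) (U : ℂ → d.Row ⊕ d.Col → ℂ)
          (w : Fin 2 → ℂ → d.Row → ℂ),
        d.IsUFin δ i σ k h U → (∀ j, d.IsWFin (-d.ρ j - 1) i k h (w j)) →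
        ∀ C : Fin 2 → d.Col → ℂ,
          (∀ x ∈ d.sector δ i σ, U x = ∑ j : Fin 2, ∑ c : d.Col, C j c • Uinf j c x) ↔
          ∀ (j : Fin 2) (c : d.Col), C j c =
            Complex.exp (Real.pi * Complex.I * (d.lam i k - d.ρ (1 - j))) *
            Okubo.argPow (d.ang i) (d.t i.castSucc - d.tLast)
              (2 * d.lam i k - d.ρ 0 - d.ρ 1) *
            (Complex.Gamma (d.ρ j - d.ρ (1 - j)) * Complex.Gamma (d.lam i k + 1) /
              (Complex.Gamma (d.ρ j + 1) * Complex.Gamma (d.lam i k - d.ρ (1 - j)))) *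
            d.gam (w (1 - j)) c) ∧
      -- connection formula between `t_{p+1}` and infinity
      (∀ (k : Fin d.q) (h : Fin (d.m k)) (U : ℂ → d.Row ⊕ d.Col → ℂ)
          (w : Fin 2 → ℂ → d.Row → ℂ),
        (∀ N : ℕ, d.ρ 0 + d.ρ 1 - d.mu k ≠ -((N : ℂ) + 1)) →
        d.IsULast δ i σ k h U → (∀ j, d.IsWInf (-d.ρ j - 1) δ i σ.opp k h (w j)) →
        ∀ C : Fin 2 → d.Col → ℂ,
          (∀ x ∈ d.sector δ i σ, U x = ∑ j : Fin 2, ∑ c : d.Col, C j c • Uinf j c x) ↔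
          ∀ (j : Fin 2) (c : d.Col), C j c =
            (Complex.Gamma (d.ρ j - d.ρ (1 - j)) *
                Complex.Gamma (d.ρ 0 + d.ρ 1 - d.mu k + 1) /
              (Complex.Gamma (d.ρ j + 1) * Complex.Gamma (d.ρ j - d.mu k + 1))) *
            d.gam (w (1 - j)) c) := by
  refine ⟨⟨hd.exists_isUInf hδ i σ, hd.exists_isUFin hδ i σ, hd.exists_isULast hδ i σ,
    hd.exists_isWFin i, hd.exists_isWInf hδ i σ⟩, fun Uinf hUinf =>
    ⟨fun k h U w hU hw => ?_, fun k h U w hk hU hw => ?_⟩⟩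
  · exact hd.combination_iff hδ hUinf hU.1 fun C hC => hd.coeff_fin hδ hUinf hU.1 hC hU.2 hw
  · refine hd.combination_iff hδ hUinf hU.1 fun C hC j c => ?_
    rw [hd.coeff_last hδ hUinf hU.1 hC hk hU.2 hw, Okubo.RaySys.lastFactor, neg_neg,
      d.rho_add_rho_rev]
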